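/- **Notation.** Let $0<|{\bf e}|<M$, $r_\pm=M\pm\sqrt{M^2-{\bf e}^2}$ and $\kappa_\pm=\frac{r_+-r_-}{2r_\pm^2}$. Let $$r^*(r)=r+\Big(M+\tfrac{2M^2-{\bf e}^2}{2\sqrt{M^2-{\bf e}^2}}\Big)\log(r_+-r)+\Big(M-\tfrac{2M^2-{\bf e}^2}{2\sqrt{M^2-{\bf e}^2}}\Big)\log(r-r_-),\qquad r\in(r_-,r_+),$$ which is a bijection onto $\mathbb R$. Let $r_{RN}(u,v)\in(r_-,r_+)$ be the solution of $r^*(r_{RN}(u,v))=u+v$, and let $\Omega_{RN}>0$ with $\Omega_{RN}^2=-4\big(1-\frac{2M}{r_{RN}}+\frac{{\bf e}^2}{r_{RN}^2}\big)$. Null coordinates $U,u$ and $v,V$ are related by $\frac{dU}{du}=e^{2\kappa_+u}$, $U\to0$ as $u\to-\infty$, and $\frac{dV}{dv}=e^{-2\kappa_-v}$, $V\to1$ as $v\to\infty$. The scalar field $\phi$ and the area radius $r$ do not depend on the choice of null coordinates, while the metric coefficient is denoted by $\Omega_{\mathcal H}$, $\Omega$, $\Omega_{\mathcal{CH}}>0$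 in the $(U,v)$, $(u,v)$, $(u,V)$ coordinates, so that $\Omega^2=\Omega_{\mathcal H}^2\frac{dU}{du}$ and $\Omega_{\mathcal{CH}}^2=\Omega^2\big(\frac{dV}{dv}\big)^{-1}$. The spherically symmetric Einstein–Maxwell–(real)–scalar field system with charge ${\bf e}$, for the metric $-\frac{\Omega^2}{2}(du\otimes dv+dv\otimes du)+r^2d\sigma_{\mathbb S^2}$ (and, with the respective coefficient, in any of the above null coordinates), consists of $$\partial_u\partial_v r=-\tfrac{\Omega^2}{4r}-\tfrac{\partial_ur\,\partial_vr}{r}+\tfrac{\Omega^2{\bf e}^2}{4r^3},\qquad \partial_u\partial_v\phi=-\tfrac{\partial_vr\,\partial_u\phi}{r}-\tfrac{\partial_ur\,\partial_v\phi}{r},$$ $$\partial_u\partial_v\log\Omega=-\partial_u\phi\,\partial_v\phi-\tfrac{\Omega^2{\bf e}^2}{2r^4}+\tfrac{\Omega^2}{4r^2}+\tfrac{\partial_ur\,\partial_vr}{r^2}$$ together with the Raychaudhuri equations $$\partial_v\Big(\tfrac{\partial_vr}{\Omega^2}\Big)=-\tfrac{r(\partial_v\phi)^2}{\Omega^2},\qquad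 \partial_u\Big(\tfrac{\partial_ur}{\Omega^2}\Big)=-\tfrac{r(\partial_u\phi)^2}{\Omega^2}.$$ Solutions are understood in the class $(r,\phi,\Omega)\in C^2\times C^1\times C^1$ with $r,\Omega>0$ (up to the initial curves). A *globally hyperbolic future development* of characteristic data is a solution of the three wave equations, attaining the data, on a relatively open subset of the quadrant spanned by the initial curves which contains the initial curves and, with each point, the whole of its causal past in the quadrant; it is *maximal* if every other development of the same data is a restriction of it. **Theorem 5.1.** Fix $M$, ${\bf e}$ and $s$ such that $0<|{\bf e}|<M$ and $s>1$, and let $E>0$, $U_0>0$. In the $(U,v)$ coordinates, consider characteristic initial data $(r,\phi,\Omega_{\mathcal H})\in C^2\times C^1\times C^1$, with $r,\Omega_{\mathcal H}>0$, on $$C_{-\infty}=\{U=0,\ v\ge1\}\quad\text{and}\quad \underline C_1=\{v=1,\ 0\le U\le U_0\},$$ matching at $(0,1)$ and satisfying the Raychaudhuri equations on each of the two curves, such that 1. on $C_{-\infty}$ one has $$\Omega_{\mathcal H}^2=\frac{4e^{-2\kappa_+r_+}(r_+-r_-)^{1+\frac{\kappa_+}{\kappa_-}}}{r_+^2}e^{2\kappa_+v},$$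 $r\to M+\sqrt{M^2-{\bf e}^2}$ as $v\to\infty$, and $|\phi|(0,v)+|\partial_v\phi|(0,v)\le Ev^{-s}$ for all $v\ge1$; 2. on $\underline C_1$ one has $\partial_Ur=-1$ and $|\partial_U\phi|\le E$. Then there is a $U_s\in(0,U_0]$, depending only on $M,{\bf e},s,E,U_0$, such that, with $\underline C_1'=\{v=1,\ 0\le U\le U_s\}$ and $u_s=u(U_s)$, the following hold. * The maximal globally hyperbolic future development of the data on $\underline C_1'\cup C_{-\infty}$ is defined on all of $\{0\le U\le U_s,\ v\ge1\}$, and it satisfies the Raychaudhuri equations. * In the $(u,V)$ coordinates one can attach the null boundary $\mathcal{CH}^+=\{V=1\}$: the functions $r$, $\phi$ and $\Omega_{\mathcal{CH}}$ extend continuously to $\{u\le u_s,\ V(1)\le V\le1\}$, and the extensions of $r$ and $\Omega_{\mathcal{CH}}$ are positive on $\{V=1\}$. * There is a constant $C>0$ depending only on $M,{\bf e},E,s$ such that, in the $(u,v)$ coordinates, for all $u<u_s$ and $v\ge1$, $$|\phi|+|r-r_{RN}|+|\log\Omega-\log\Omega_{RN}|\le C\big(v^{-s}+|u|^{-s+1}\big),$$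 $$|\partial_v\phi|+|\partial_v(r-r_{RN})|+|\partial_v(\log\Omega-\log\Omega_{RN})|\le Cv^{-s}.$$ * For every $A\in\mathbb R$ there is a constant $C>0$ depending only on $A,M,{\bf e},E,U_0,s$ such that, in the $(u,v)$ coordinates, for all $u<u_s$ and $v\ge1$, $$|\partial_u\phi|+|\partial_u(r-r_{RN})|+|\partial_u(\log\Omega-\log\Omega_{RN})|\le\begin{cases}C\,\Omega_{RN}^2v^{-s}&\text{if }u+v\le A,\\ C|u|^{-s}&\text{if }u+v\ge A.\end{cases}$$ -/

import Mathlib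

open Set Filter Topology

noncomputable section

namespace EMSF

/-! ### Reissner–Nordström interior with parameters `0 < |e| < M` -/

/-- The event horizon radius `r₊`. -/
def rPlus (M e : ℝ) : ℝ := M + √(M ^ 2 - e ^ 2)

/-- The Cauchy horizon radius `r₋`. -/
def rMinus (M e : ℝ) : ℝ := M - √(M ^ 2 - e ^ 2)

/-- The surface gravity `κ₊` of the event horizon. -/
def kappaPlus (M e : ℝ) : ℝ := (rPlus M e - rMinus M e) / (2 * rPlus M e ^ 2)

/-- The (positive) surface gravity `κ₋` of the Cauchy horizon. -/
def kappaMinus (M e : ℝ) : ℝ := (rPlus M e - rMinus M e) / (2 * rMinus M e ^ 2)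

/-- The coordinate `r*` as a function of `r ∈ (r₋, r₊)`. -/
def rStar (M e r : ℝ) : ℝ :=
  r + (M + (2 * M ^ 2 - e ^ 2) / (2 * √(M ^ 2 - e ^ 2))) * Real.log (rPlus M e - r)
    + (M - (2 * M ^ 2 - e ^ 2) / (2 * √(M ^ 2 - e ^ 2))) * Real.log (r - rMinus M e)

/-- The area radius `r_RN(u, v)`: since `v = (r* + t) / 2` and `u = (r* - t) / 2`, it is the
point `r` of `(r₋, r₊)` with `r*(r) = u + v` (see `rRN_spec`). -/
def rRN (M e u v : ℝ) : ℝ :=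
  Function.invFunOn (rStar M e) (Ioo (rMinus M e) (rPlus M e)) (u + v)

/-- The positive square root of `Ω_RN² = -4 (1 - 2M / r_RN + e² / r_RN²)`. -/
def OmegaRN (M e u v : ℝ) : ℝ :=
  √(-4 * (1 - 2 * M / rRN M e u v + e ^ 2 / rRN M e u v ^ 2))

/-- The coordinate `U(u)`, with `dU/du = exp (2 κ₊ u)` and `U → 0` as `u → -∞`. -/
def Ucoord (M e u : ℝ) : ℝ := Real.exp (2 * kappaPlus M e * u) / (2 * kappaPlus M e)

/-- The inverse `u(U)`, `U > 0`, of `Ucoord`. -/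
def ucoord (M e U : ℝ) : ℝ := Real.log (2 * kappaPlus M e * U) / (2 * kappaPlus M e)

/-- The coordinate `V(v)`, with `dV/dv = exp (-2 κ₋ v)` and `V → 1` as `v → ∞`. -/
def Vcoord (M e v : ℝ) : ℝ := 1 - Real.exp (-2 * kappaMinus M e * v) / (2 * kappaMinus M e)

/-- The value of `Ω_𝓗²` prescribed on the event horizon, which is that of Reissner–Nordström. -/
def horizonOmegaSq (M e v : ℝ) : ℝ :=
  4 * Real.exp (-2 * kappaPlus M e * rPlus M e)
      * (rPlus M e - rMinus M e) ^ (1 + kappaPlus M e / kappaMinus M e) / rPlus M e ^ 2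
    * Real.exp (2 * kappaPlus M e * v)

section facts

variable {M e : ℝ}

lemma sqrt_pos' (h1 : |e| < M) : 0 < √(M ^ 2 - e ^ 2) := by
  apply Real.sqrt_pos.mpr
  have : e ^ 2 < M ^ 2 := sq_lt_sq.mpr (lt_of_lt_of_le h1 (le_abs_self M))
  linarith

lemma rMinus_pos (h0 : 0 < |e|) (h1 : |e| < M) : 0 < rMinus M e := by
  have hM : 0 < M := h0.trans h1
  have : √(M ^ 2 - e ^ 2) < M := by
    rw [Real.sqrt_lt' hM]
    have : 0 < e ^ 2 := by rw [← sq_abs]; positivity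
    linarith
  unfold rMinus; linarith

lemma rMinus_lt_rPlus (h1 : |e| < M) : rMinus M e < rPlus M e := by
  have := sqrt_pos' h1
  unfold rMinus rPlus; linarith

lemma kappaPlus_pos (h0 : 0 < |e|) (h1 : |e| < M) : 0 < kappaPlus M e := by
  have h2 := rMinus_pos h0 h1
  have h3 := rMinus_lt_rPlus h1
  have h4 : 0 < rPlus M e := h2.trans h3
  have h5 := sub_pos.mpr h3
  unfold kappaPlus; positivity

lemma kappaMinus_pos (h0 : 0 < |e|) (h1 : |e| < M) : 0 < kappaMinus M e := by
  have h2 := rMinus_pos h0 h1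
  have h5 := sub_pos.mpr (rMinus_lt_rPlus h1)
  unfold kappaMinus; positivity

lemma coeff_plus (h1 : |e| < M) :
    M + (2 * M ^ 2 - e ^ 2) / (2 * √(M ^ 2 - e ^ 2))
      = rPlus M e ^ 2 / (rPlus M e - rMinus M e) := by
  have h := sqrt_pos' h1
  have hs : √(M ^ 2 - e ^ 2) ^ 2 = M ^ 2 - e ^ 2 := Real.sq_sqrt (Real.sqrt_pos.mp h).le
  have hd : rPlus M e - rMinus M e = 2 * √(M ^ 2 - e ^ 2) := by unfold rPlus rMinus; ring
  rw [hd]; unfold rPlus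
  field_simp
  linear_combination -hs

lemma coeff_minus (h1 : |e| < M) :
    M - (2 * M ^ 2 - e ^ 2) / (2 * √(M ^ 2 - e ^ 2))
      = -(rMinus M e ^ 2 / (rPlus M e - rMinus M e)) := by
  have h := sqrt_pos' h1
  have hs : √(M ^ 2 - e ^ 2) ^ 2 = M ^ 2 - e ^ 2 := Real.sq_sqrt (Real.sqrt_pos.mp h).le
  have hd : rPlus M e - rMinus M e = 2 * √(M ^ 2 - e ^ 2) := by unfold rPlus rMinus; ring
  rw [hd]; unfold rMinus
  field_simp
  linear_combination hs

lemma hasDerivAt_rStar (h1 : |e| < M) {r : ℝ} (hr : r ∈ Ioo (rMinus M e) (rPlus M e)) :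
    HasDerivAt (rStar M e) (-(r ^ 2 / ((rPlus M e - r) * (r - rMinus M e)))) r := by
  have hp : rPlus M e - r ≠ 0 := (sub_pos.mpr hr.2).ne'
  have hm : r - rMinus M e ≠ 0 := (sub_pos.mpr hr.1).ne'
  have hd : rPlus M e - rMinus M e ≠ 0 := (sub_pos.mpr (rMinus_lt_rPlus h1)).ne'
  have hlp : HasDerivAt (fun x => Real.log (rPlus M e - x)) (-1 / (rPlus M e - r)) r :=
    ((hasDerivAt_id r).const_sub _).log hp
  have hlm : HasDerivAt (fun x => Real.log (x - rMinus M e)) (1 / (r - rMinus M e)) r :=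
    ((hasDerivAt_id r).sub_const _).log hm
  have hmain := ((hasDerivAt_id r).add
    (hlp.const_mul (M + (2 * M ^ 2 - e ^ 2) / (2 * √(M ^ 2 - e ^ 2))))).add
    (hlm.const_mul (M - (2 * M ^ 2 - e ^ 2) / (2 * √(M ^ 2 - e ^ 2))))
  refine HasDerivAt.congr_deriv (hmain.congr_of_eventuallyEq ?_) ?_
  · exact Eventually.of_forall fun x => rfl
  · rw [coeff_plus h1, coeff_minus h1]
    field_simp
    ring

lemma rStar_bijOn (h0 : 0 < |e|) (h1 : |e| < M) :
    BijOn (rStar M e) (Ioo (rMinus M e) (rPlus M e)) univ := by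
  have hlt := rMinus_lt_rPlus h1
  have hmp := rMinus_pos h0 h1
  have hd : 0 < rPlus M e - rMinus M e := sub_pos.mpr hlt
  have hcont : ContinuousOn (rStar M e) (Ioo (rMinus M e) (rPlus M e)) :=
    fun r hr => (hasDerivAt_rStar h1 hr).continuousAt.continuousWithinAt
  refine ⟨fun _ _ => mem_univ _, ?_, ?_⟩
  · apply StrictAntiOn.injOn
    refine strictAntiOn_of_deriv_neg (convex_Ioo _ _) hcont ?_
    intro r hr
    rw [interior_Ioo] at hr
    rw [(hasDerivAt_rStar h1 hr).deriv]
    have a1 := sub_pos.mpr hr.1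
    have a2 := sub_pos.mpr hr.2
    have a3 : 0 < r := hmp.trans hr.1
    have : 0 < r ^ 2 / ((rPlus M e - r) * (r - rMinus M e)) := by positivity
    linarith
  · intro y _
    have hcp : 0 < M + (2 * M ^ 2 - e ^ 2) / (2 * √(M ^ 2 - e ^ 2)) := by
      rw [coeff_plus h1]; have := hmp.trans hlt; positivity
    have hcm : M - (2 * M ^ 2 - e ^ 2) / (2 * √(M ^ 2 - e ^ 2)) < 0 := by
      rw [coeff_minus h1]
      have : 0 < rMinus M e ^ 2 / (rPlus M e - rMinus M e) := by positivity
      linarith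
    have t1 : Tendsto (fun x => rPlus M e - x) (𝓝[<] rPlus M e) (𝓝[>] 0) := by
      refine tendsto_nhdsWithin_iff.mpr ⟨?_, ?_⟩
      · have : Tendsto (fun x => rPlus M e - x) (𝓝 (rPlus M e)) (𝓝 (rPlus M e - rPlus M e)) :=
          (continuous_const.sub continuous_id).tendsto _
        rw [sub_self] at this
        exact this.mono_left nhdsWithin_le_nhds
      · filter_upwards [self_mem_nhdsWithin] with x hx
        exact sub_pos.mpr (by simpa using hx)
    have t2 : Tendsto (fun x => x - rMinus M e) (𝓝[>] rMinus M e) (𝓝[>] 0) := by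
      refine tendsto_nhdsWithin_iff.mpr ⟨?_, ?_⟩
      · have : Tendsto (fun x => x - rMinus M e) (𝓝 (rMinus M e))
            (𝓝 (rMinus M e - rMinus M e)) :=
          (continuous_id.sub continuous_const).tendsto _
        rw [sub_self] at this
        exact this.mono_left nhdsWithin_le_nhds
      · filter_upwards [self_mem_nhdsWithin] with x hx
        exact sub_pos.mpr (by simpa using hx)
    have b1 : Tendsto (rStar M e) (𝓝[<] rPlus M e) atBot := by
      have l1 := (Real.tendsto_log_nhdsGT_zero.comp t1).const_mul_atBot hcp
      have c1 : ContinuousAt (fun r => r + (M - (2 * M ^ 2 - e ^ 2) / (2 * √(M ^ 2 - e ^ 2)))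
          * Real.log (r - rMinus M e)) (rPlus M e) := by
        refine continuousAt_id.add (continuousAt_const.mul ?_)
        exact ContinuousAt.log (continuousAt_id.sub continuousAt_const) hd.ne'
      have := (c1.tendsto.mono_left (nhdsWithin_le_nhds (s := Iio (rPlus M e)))).add_atBot l1
      refine this.congr fun x => ?_
      simp only [rStar, Function.comp]; ring
    have b2 : Tendsto (rStar M e) (𝓝[>] rMinus M e) atTop := by
      have l1 := (Real.tendsto_log_nhdsGT_zero.comp t2).const_mul_atBot_of_neg hcm
      have c1 : ContinuousAt (fun r => r + (M + (2 * M ^ 2 - e ^ 2) / (2 * √(M ^ 2 - e ^ 2)))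
          * Real.log (rPlus M e - r)) (rMinus M e) := by
        refine continuousAt_id.add (continuousAt_const.mul ?_)
        exact ContinuousAt.log (continuousAt_const.sub continuousAt_id) hd.ne'
      have := (c1.tendsto.mono_left (nhdsWithin_le_nhds (s := Ioi (rMinus M e)))).add_atTop l1
      refine this.congr fun x => ?_
      simp only [rStar, Function.comp]
    obtain ⟨a, ha, ha'⟩ := ((b1.eventually (eventually_le_atBot y)).and
      (Ioo_mem_nhdsLT hlt)).exists
    obtain ⟨b, hb, hb'⟩ := ((b2.eventually (eventually_ge_atTop y)).and
      (Ioo_mem_nhdsGT hlt)).exists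
    exact isPreconnected_Ioo.intermediate_value ha' hb' hcont ⟨ha, hb⟩

lemma rRN_spec (h0 : 0 < |e|) (h1 : |e| < M) (u v : ℝ) :
    rRN M e u v ∈ Ioo (rMinus M e) (rPlus M e) ∧ rStar M e (rRN M e u v) = u + v := by
  have hex : ∃ r ∈ Ioo (rMinus M e) (rPlus M e), rStar M e r = u + v :=
    (rStar_bijOn h0 h1).surjOn (mem_univ (u + v))
  exact ⟨Function.invFunOn_mem hex, Function.invFunOn_eq hex⟩

lemma Ucoord_spec (h0 : 0 < |e|) (h1 : |e| < M) :
    (∀ u, HasDerivAt (Ucoord M e) (Real.exp (2 * kappaPlus M e * u)) u)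
      ∧ Tendsto (Ucoord M e) atBot (𝓝 0) := by
  have hk := kappaPlus_pos h0 h1
  constructor
  · intro u
    have h : HasDerivAt (fun u => 2 * kappaPlus M e * u) (2 * kappaPlus M e) u := by
      simpa using (hasDerivAt_id u).const_mul (2 * kappaPlus M e)
    refine (h.exp.div_const (2 * kappaPlus M e)).congr_deriv ?_
    field_simp
  · have h : Tendsto (fun u => 2 * kappaPlus M e * u) atBot atBot :=
      tendsto_id.const_mul_atBot (by positivity)
    have := (Real.tendsto_exp_atBot.comp h).div_const (2 * kappaPlus M e)
    rw [zero_div] at this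
    exact this

lemma Ucoord_ucoord (h0 : 0 < |e|) (h1 : |e| < M) {U : ℝ} (hU : 0 < U) :
    Ucoord M e (ucoord M e U) = U := by
  have hk := kappaPlus_pos h0 h1
  unfold Ucoord ucoord
  rw [mul_div_cancel₀ _ (by positivity), Real.exp_log (by positivity)]
  field_simp

lemma Vcoord_spec (h0 : 0 < |e|) (h1 : |e| < M) :
    (∀ v, HasDerivAt (Vcoord M e) (Real.exp (-2 * kappaMinus M e * v)) v)
      ∧ Tendsto (Vcoord M e) atTop (𝓝 1) := by
  have hk := kappaMinus_pos h0 h1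
  constructor
  · intro v
    have h : HasDerivAt (fun v => -2 * kappaMinus M e * v) (-2 * kappaMinus M e) v := by
      simpa using (hasDerivAt_id v).const_mul (-2 * kappaMinus M e)
    refine ((h.exp.div_const (2 * kappaMinus M e)).const_sub 1).congr_deriv ?_
    field_simp
  · have h : Tendsto (fun v => -2 * kappaMinus M e * v) atTop atBot :=
      tendsto_id.const_mul_atTop_of_neg (by linarith)
    have := ((Real.tendsto_exp_atBot.comp h).div_const (2 * kappaMinus M e)).const_sub 1
    rw [zero_div, sub_zero] at this
    exact this

end facts

/-! ### The reduced Einstein–Maxwell–scalar field system -/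

/-- The unknowns `(r, φ, Ω)` as functions of two null coordinates; the metric is
`-(Ω² / 2) (du ⊗ dv + dv ⊗ du) + r² dσ`. -/
structure Fields where
  r : ℝ → ℝ → ℝ
  φ : ℝ → ℝ → ℝ
  Ω : ℝ → ℝ → ℝ

/-- `∂_u f`, one-sided at the end points of the range `I` of `u`. -/
def pu (I : Set ℝ) (f : ℝ → ℝ → ℝ) (u v : ℝ) : ℝ := derivWithin (fun x => f x v) I u

/-- `∂_v f`, one-sided at the end points of the range `J` of `v`. -/
def pv (J : Set ℝ) (f : ℝ → ℝ → ℝ) (u v : ℝ) : ℝ := derivWithin (fun y => f u y) J v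

/-- `(r, φ, Ω)` has regularity `C² × C¹ × C¹` on `D ⊆ I × J`, with `r, Ω > 0`, and solves there
the system of wave equations with charge `e`. Each equation includes the existence of the
mixed derivative on its left-hand side. -/
structure SolvesWave (e : ℝ) (I J : Set ℝ) (D : Set (ℝ × ℝ)) (S : Fields) : Prop where
  r_reg : ContDiffOn ℝ 2 (fun p : ℝ × ℝ => S.r p.1 p.2) D
  φ_reg : ContDiffOn ℝ 1 (fun p : ℝ × ℝ => S.φ p.1 p.2) D
  Ω_reg : ContDiffOn ℝ 1 (fun p : ℝ × ℝ => S.Ω p.1 p.2) D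
  r_pos : ∀ u v, (u, v) ∈ D → 0 < S.r u v
  Ω_pos : ∀ u v, (u, v) ∈ D → 0 < S.Ω u v
  r_eq : ∀ u v, (u, v) ∈ D →
    HasDerivWithinAt (fun x => pv J S.r x v)
      (-(S.Ω u v ^ 2 / (4 * S.r u v)) - pu I S.r u v * pv J S.r u v / S.r u v
        + S.Ω u v ^ 2 * e ^ 2 / (4 * S.r u v ^ 3)) I u
  φ_eq : ∀ u v, (u, v) ∈ D →
    HasDerivWithinAt (fun x => pv J S.φ x v)
      (-(pv J S.r u v * pu I S.φ u v / S.r u v)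
        - pu I S.r u v * pv J S.φ u v / S.r u v) I u
  Ω_eq : ∀ u v, (u, v) ∈ D →
    HasDerivWithinAt (fun x => pv J (fun a b => Real.log (S.Ω a b)) x v)
      (-(pu I S.φ u v * pv J S.φ u v) - S.Ω u v ^ 2 * e ^ 2 / (2 * S.r u v ^ 4)
        + S.Ω u v ^ 2 / (4 * S.r u v ^ 2) + pu I S.r u v * pv J S.r u v / S.r u v ^ 2) I u

/-- The Raychaudhuri equations on `D ⊆ I × J`. -/
structure SolvesRaychaudhuri (I J : Set ℝ) (D : Set (ℝ × ℝ)) (S : Fields) : Prop where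
  v_eq : ∀ u v, (u, v) ∈ D →
    HasDerivWithinAt (fun y => pv J S.r u y / S.Ω u y ^ 2)
      (-(S.r u v * pv J S.φ u v ^ 2 / S.Ω u v ^ 2)) J v
  u_eq : ∀ u v, (u, v) ∈ D →
    HasDerivWithinAt (fun x => pu I S.r x v / S.Ω x v ^ 2)
      (-(S.r u v * pu I S.φ u v ^ 2 / S.Ω u v ^ 2)) I u

/-! ### The characteristic initial value problem -/

/-- Values of `(r, φ, Ω)` on an outgoing null curve `{u = u₁}` (functions of `v`) and on an
incoming null curve `{v = v₁}` (functions of `u`). -/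
structure CharData where
  rOut : ℝ → ℝ
  φOut : ℝ → ℝ
  ΩOut : ℝ → ℝ
  rIn : ℝ → ℝ
  φIn : ℝ → ℝ
  ΩIn : ℝ → ℝ

/-- Characteristic initial data on `({u₁} × J) ∪ (I × {v₁})`: regular, positive `r` and `Ω`,
matching at `(u₁, v₁)`, and satisfying the constraint (Raychaudhuri) equations. -/
structure CharData.IsInitialData (d : CharData) (I J : Set ℝ) (u₁ v₁ : ℝ) : Prop where
  rOut_reg : ContDiffOn ℝ 2 d.rOut J
  φOut_reg : ContDiffOn ℝ 1 d.φOut J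
  ΩOut_reg : ContDiffOn ℝ 1 d.ΩOut J
  rIn_reg : ContDiffOn ℝ 2 d.rIn I
  φIn_reg : ContDiffOn ℝ 1 d.φIn I
  ΩIn_reg : ContDiffOn ℝ 1 d.ΩIn I
  rOut_pos : ∀ v ∈ J, 0 < d.rOut v
  ΩOut_pos : ∀ v ∈ J, 0 < d.ΩOut v
  rIn_pos : ∀ u ∈ I, 0 < d.rIn u
  ΩIn_pos : ∀ u ∈ I, 0 < d.ΩIn u
  r_match : d.rOut v₁ = d.rIn u₁
  φ_match : d.φOut v₁ = d.φIn u₁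
  Ω_match : d.ΩOut v₁ = d.ΩIn u₁
  constraint_out : ∀ v ∈ J,
    HasDerivWithinAt (fun y => derivWithin d.rOut J y / d.ΩOut y ^ 2)
      (-(d.rOut v * derivWithin d.φOut J v ^ 2 / d.ΩOut v ^ 2)) J v
  constraint_in : ∀ u ∈ I,
    HasDerivWithinAt (fun x => derivWithin d.rIn I x / d.ΩIn x ^ 2)
      (-(d.rIn u * derivWithin d.φIn I u ^ 2 / d.ΩIn u ^ 2)) I u

/-- A globally hyperbolic future development, with domain `D`, of the data `d` given on
`({u₁} × J) ∪ (I × {v₁})`. Here `I` and `J` are intervals with least elements `u₁` and `v₁`.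
`D` is a relatively open neighbourhood of the initial curves in `I × J` that contains, with
every point, all of the causal past of the point in `I × J`. -/
structure IsDevelopment (e : ℝ) (d : CharData) (I J : Set ℝ) (u₁ v₁ : ℝ)
    (D : Set (ℝ × ℝ)) (S : Fields) : Prop where
  subset : D ⊆ I ×ˢ J
  rel_open : ∃ O : Set (ℝ × ℝ), IsOpen O ∧ D = O ∩ I ×ˢ J
  out_mem : ∀ v ∈ J, (u₁, v) ∈ D
  in_mem : ∀ u ∈ I, (u, v₁) ∈ D
  past : ∀ u v, (u, v) ∈ D → Icc u₁ u ×ˢ Icc v₁ v ⊆ D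
  solves : SolvesWave e I J D S
  out_data : ∀ v ∈ J, S.r u₁ v = d.rOut v ∧ S.φ u₁ v = d.φOut v ∧ S.Ω u₁ v = d.ΩOut v
  in_data : ∀ u ∈ I, S.r u v₁ = d.rIn u ∧ S.φ u v₁ = d.φIn u ∧ S.Ω u v₁ = d.ΩIn u

/-- The maximal globally hyperbolic future development: a development of which every other
development of the same data is a restriction. -/
def IsMaximalDevelopment (e : ℝ) (d : CharData) (I J : Set ℝ) (u₁ v₁ : ℝ)
    (D : Set (ℝ × ℝ)) (S : Fields) : Prop :=
  IsDevelopment e d I J u₁ v₁ D S ∧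
    ∀ (D' : Set (ℝ × ℝ)) (S' : Fields), IsDevelopment e d I J u₁ v₁ D' S' →
      D' ⊆ D ∧ ∀ u v, (u, v) ∈ D' →
        S'.r u v = S.r u v ∧ S'.φ u v = S.φ u v ∧ S'.Ω u v = S.Ω u v

/-- The class of data considered, in the `(U, v)` coordinates, on the event horizon
`{U = 0, v ≥ 1}` and on the incoming curve `{v = 1, 0 ≤ U ≤ U₀}`. -/
structure IsEventHorizonData (M e s E U₀ : ℝ) (d : CharData) : Prop where
  initial : d.IsInitialData (Icc 0 U₀) (Ici 1) 0 1
  gauge_out : ∀ v ∈ Ici (1 : ℝ), d.ΩOut v ^ 2 = horizonOmegaSq M e v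
  r_lim : Tendsto d.rOut atTop (𝓝 (M + √(M ^ 2 - e ^ 2)))
  φ_decay : ∀ v ∈ Ici (1 : ℝ), |d.φOut v| + |derivWithin d.φOut (Ici 1) v| ≤ E * v ^ (-s)
  gauge_in : ∀ U ∈ Icc 0 U₀, derivWithin d.rIn (Icc 0 U₀) U = -1
  φ_bound : ∀ U ∈ Icc 0 U₀, |derivWithin d.φIn (Icc 0 U₀) U| ≤ E

/-! ### Changes of null coordinates -/

/-- The fields in the `(u, v)` coordinates, from those in the `(U, v)` coordinates:
`Ω² = Ω_𝓗² dU/du`. -/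
def Fields.toUV (M e : ℝ) (S : Fields) : Fields where
  r u v := S.r (Ucoord M e u) v
  φ u v := S.φ (Ucoord M e u) v
  Ω u v := Real.exp (kappaPlus M e * u) * S.Ω (Ucoord M e u) v

/-- The coefficient `Ω_𝓒𝓗` of the `(u, V)` coordinates at the point `(u, V(v))`, from that of the
`(u, v)` coordinates: `Ω_𝓒𝓗² = Ω² (dV/dv)⁻¹`. -/
def OmegaCH (M e : ℝ) (Ω : ℝ → ℝ → ℝ) (u v : ℝ) : ℝ := Real.exp (kappaMinus M e * v) * Ω u v

/-- `F`, a function of `(u, V)`, is a continuous extension to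
`{u ≤ us, V(1) ≤ V ≤ 1}`, hence to the Cauchy horizon `{V = 1}`, of the function `f` of `(u, v)`
given on `{u ≤ us, v ≥ 1}`. -/
def IsContExtension (M e us : ℝ) (f F : ℝ → ℝ → ℝ) : Prop :=
  ContinuousOn (fun p : ℝ × ℝ => F p.1 p.2) (Iic us ×ˢ Icc (Vcoord M e 1) 1) ∧
    ∀ u ≤ us, ∀ v, 1 ≤ v → F u (Vcoord M e v) = f u v

/-- In the `(u, V)` coordinates, the metric and the scalar field of `T` (given in the `(u, v)`
coordinates) extend continuously to the Cauchy horizon `{V = 1}`, the metric as a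
nondegenerate one. -/
def ExtendsToCauchyHorizon (M e us : ℝ) (T : Fields) : Prop :=
  ∃ rX φX ΩX : ℝ → ℝ → ℝ,
    IsContExtension M e us T.r rX ∧ IsContExtension M e us T.φ φX ∧
    IsContExtension M e us (OmegaCH M e T.Ω) ΩX ∧
    ∀ u ≤ us, 0 < rX u 1 ∧ 0 < ΩX u 1

/-! ### Differences from Reissner–Nordström in the `(u, v)` coordinates -/

/-- `r - r_RN`. -/
def rDiff (M e : ℝ) (T : Fields) (u v : ℝ) : ℝ := T.r u v - rRN M e u v

/-- `log Ω - log Ω_RN`. -/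
def logOmegaDiff (M e : ℝ) (T : Fields) (u v : ℝ) : ℝ :=
  Real.log (T.Ω u v) - Real.log (OmegaRN M e u v)

end EMSF

end

noncomputable section

namespace EMSF

open MeasureTheory intervalIntegral

/-! ### Calculus on rectangles -/

section calculus

/-! The argument takes place in the (U, v) coordinates, with c = 2κ₊ and ξ = cU e^{cv} = e^{c(u+v)}.
Reissner–Nordström is superposed with the data on the event horizon: the background has radius
r(0,v) + r_RN − r₊, scalar field φ(0,v) and the Reissner–Nordström value of log Ω. The deviation ψ
of (r, φ, log Ω) from this background vanishes on U = 0, has a bounded U-derivative on v = 1, and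
satisfies ∂_U∂_vψ = rhs(`jS`) − rhs(`jB`), the difference of the right-hand sides of the wave
equations at the solution and at Reissner–Nordström.

There is no continuity argument. The mixed derivative n = ∂_U∂_vψ is the fixed point of a
contraction in a sup norm weighted by an explicit function w, on the whole region 0 ≤ U ≤ Us, v ≥ 1
at once (`exists_goursat`). Global existence and all decay estimates therefore come together. What
is needed are majorants A, Bv, Ψ of ∂_Uψ, ∂_vψ, ψ that dominate the integrals of w, such that the
nonlinearity, evaluated within the majorants, is at most w, and Lipschitz with constant 1/2 relative
to them.

By `Jet.norm_rhs_sub_le` and `main_terms_le` the nonlinearity is bounded by a constant times the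
linear terms δ (v^{-s} + Ψ + Bv + cU A), where δ is Ω_𝓗² of Reissner–Nordström, plus the terms A Bv
+ v^{-s} A. The two groups are absorbed differently. (i) Linear terms. Since κ₊ < κ₋, δ (1 +
log(1+ξ)/c)^{s+1} is at most a multiple of g = e^{cv}/(1+ξ)² (`exists_dB_le`). The growth in v of
the factor 1/τ of A, which is the redshift, produces a positive multiple of g. The factor e^{ly},
with y = ξ/(1+ξ), increases in both directions across the transition region while staying between 1
and e^l; its derivatives absorb the remaining linear terms (`dterms_le_A`, `dterms_le_B`). (ii) The
other terms. As s > 1, v^{-s} is integrable, so the bounded factor G = exp(−L v^{1−s}) of A gains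
L(s−1)v^{-s}; in Bv the same is done by L P, with P the U-primitive of the profile p of A
(`qterms_le_A`, `qterms_le_B`). For small U one has L P ≤ 1, so L is not seen in the final bounds.

The order in which the constants are chosen matters (`Weight.exists_weight`). For large v, r is at
least r₋/2, so the constant of the nonlinearity there depends on M, e, s, E alone, and so do a, l
and v₀, from which the bounds on ψ and ∂_vψ follow. For bounded v the lower bound on r involves U₀;
there the linear terms are dominated by means of a large additive constant cB in p and of small U.
L, B and Us may thus depend on U₀, and only the constant for the u-derivatives contains B.

The horizon bounds |r − r₊|, |∂_v r| ≲ v^{-s} come from Raychaudhuri integrated back from infinity: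
if ∂_v r had the wrong sign or were too large at one point, the exponential growth of Ω_𝓗² would
contradict r > 0 or r ≤ r₊. The Raychaudhuri equations propagate from the data because r times their
defect is constant along the other null direction (`SolvesJet.exists_ruu`). Uniqueness on compact
rectangles (`SolvesJet.eq_of_eq_initial`) yields maximality, the domain being the entire quadrant.
Finally |∂_vψ| ≤ e^l v^{-s} is integrable, so ψ has a limit at the Cauchy horizon that is uniform in
u, while e^{κ₋(u+v)} Ω_RN has a positive limit; this gives the continuous extension. -/

lemma continuous_left {X : Type*} [TopologicalSpace X] {n : ℝ → ℝ → X} (hn : Continuous (Function.uncurry n)) (v : ℝ) :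
    Continuous fun x => n x v := hn.comp (by fun_prop : Continuous fun x : ℝ => (x, v))

lemma continuous_right {X : Type*} [TopologicalSpace X] {n : ℝ → ℝ → X} (hn : Continuous (Function.uncurry n)) (u : ℝ) :
    Continuous fun y => n u y := hn.comp (by fun_prop : Continuous fun y : ℝ => (u, y))

variable {V : Type*} [NormedAddCommGroup V] [NormedSpace ℝ V]

lemma continuous_integral_fst {n : ℝ → ℝ → V} (hn : Continuous (Function.uncurry n)) (a : ℝ) :
    Continuous (Function.uncurry fun u v => ∫ x in a..u, n x v) := by
  have h : Continuous (Function.uncurry fun (p : ℝ × ℝ) x => n x p.2) :=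
    hn.comp (by fun_prop : Continuous fun q : (ℝ × ℝ) × ℝ => (q.2, q.1.2))
  exact continuous_parametric_intervalIntegral_of_continuous h continuous_fst

lemma continuous_integral_snd {n : ℝ → ℝ → V} (hn : Continuous (Function.uncurry n)) (a : ℝ) :
    Continuous (Function.uncurry fun u v => ∫ y in a..v, n u y) := by
  have h : Continuous (Function.uncurry fun (p : ℝ × ℝ) y => n p.1 y) :=
    hn.comp (by fun_prop : Continuous fun q : (ℝ × ℝ) × ℝ => (q.1.1, q.2))
  exact continuous_parametric_intervalIntegral_of_continuous h continuous_snd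

lemma hasDerivAt_integral [CompleteSpace V] {n : ℝ → V} (hn : Continuous n) (a u : ℝ) :
    HasDerivAt (fun x => ∫ t in a..x, n t) (n u) u :=
  (hn.integral_hasStrictDerivAt a u).hasDerivAt

lemma integral_integral_comm {n : ℝ → ℝ → V} (hn : Continuous (Function.uncurry n))
    (a b c d : ℝ) :
    ∫ x in a..b, ∫ y in c..d, n x y = ∫ y in c..d, ∫ x in a..b, n x y := by
  refine intervalIntegral_intervalIntegral_swap ?_
  have := (hn.continuousOn (s := uIcc a b ×ˢ uIcc c d)).integrableOn_compact
    (μ := volume) (isCompact_uIcc.prod isCompact_uIcc)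
  refine IntegrableOn.mono_set ?_ (prod_mono uIoc_subset_uIcc uIoc_subset_uIcc)
  exact this

/-- A function with continuous partial derivatives on a rectangle is differentiable there. -/
lemma hasFDerivWithinAt_of_partials {I J : Set ℝ} (hI : Convex ℝ I) (hJ : Convex ℝ J)
    {f fu fv : ℝ → ℝ → ℝ}
    (h1 : ∀ u ∈ I, ∀ v ∈ J, HasDerivWithinAt (fun x => f x v) (fu u v) I u)
    (h2 : ∀ u ∈ I, ∀ v ∈ J, HasDerivWithinAt (fun y => f u y) (fv u v) J v)
    (c1 : ContinuousOn (fun p : ℝ × ℝ => fu p.1 p.2) (I ×ˢ J))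
    (c2 : ContinuousOn (fun p : ℝ × ℝ => fv p.1 p.2) (I ×ˢ J))
    {p : ℝ × ℝ} (hp : p ∈ I ×ˢ J) :
    HasFDerivWithinAt (fun p : ℝ × ℝ => f p.1 p.2)
      (fu p.1 p.2 • ContinuousLinearMap.fst ℝ ℝ ℝ + fv p.1 p.2 • ContinuousLinearMap.snd ℝ ℝ ℝ)
      (I ×ˢ J) p := by
  rw [hasFDerivWithinAt_iff_isLittleO, Asymptotics.isLittleO_iff]
  intro ε hε
  have e1 := Metric.continuousWithinAt_iff.mp (c1 p hp) (ε / 2) (by positivity)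
  have e2 := Metric.continuousWithinAt_iff.mp (c2 p hp) (ε / 2) (by positivity)
  obtain ⟨d1, hd1, k1⟩ := e1
  obtain ⟨d2, hd2, k2⟩ := e2
  have hb : ∀ᶠ q in 𝓝[I ×ˢ J] p, q ∈ I ×ˢ J ∧ dist q p < min d1 d2 :=
    (eventually_mem_nhdsWithin).and
      (mem_nhdsWithin_of_mem_nhds (Metric.ball_mem_nhds p (lt_min hd1 hd2)))
  filter_upwards [hb] with q hq
  obtain ⟨hq, hqd⟩ := hq
  obtain ⟨u, v⟩ := p
  obtain ⟨x, y⟩ := q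
  simp only [mem_prod] at hp hq
  have hxd : dist x u < min d1 d2 := lt_of_le_of_lt (by simp [Prod.dist_eq]) hqd
  have hyd : dist y v < min d1 d2 := lt_of_le_of_lt (by simp [Prod.dist_eq]) hqd
  have hseg : ∀ {a b t : ℝ}, t ∈ segment ℝ a b → dist t a ≤ dist b a := by
    intro a b t ht
    rw [segment_eq_uIcc] at ht
    rw [Real.dist_eq, Real.dist_eq, abs_sub_comm t, abs_sub_comm b]
    rw [abs_sub_comm a t, abs_sub_comm a b]
    exact abs_sub_left_of_mem_uIcc ht
  -- The increment is taken along the two sides of the rectangle, from (u,v) to (u,y) to (x,y); on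
  -- each side the mean value inequality is applied to f minus its linear part, using the continuity
  -- of one partial derivative.
  have s1 : ‖(f x y - fu u v * x) - (f u y - fu u v * u)‖ ≤ ε / 2 * ‖x - u‖ := by
    have hsub : segment ℝ u x ⊆ I := hI.segment_subset hp.1 hq.1
    refine Convex.norm_image_sub_le_of_norm_hasDerivWithin_le (s := segment ℝ u x)
      (f := fun t => f t y - fu u v * t) (f' := fun t => fu t y - fu u v)
      (fun t ht => ?_) (fun t ht => ?_) (convex_segment u x) (left_mem_segment ℝ u x)
      (right_mem_segment ℝ u x)
    · have := ((h1 t (hsub ht) y hq.2).mono hsub).sub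
        (((hasDerivAt_id t).const_mul (fu u v)).hasDerivWithinAt (s := segment ℝ u x))
      exact this.congr_deriv (by simp)
    · have h := k1 (x := (t, y)) ⟨hsub ht, hq.2⟩ (by
        rw [Prod.dist_eq]
        exact max_lt (((hseg ht).trans_lt hxd).trans_le (min_le_left _ _))
          (hyd.trans_le (min_le_left _ _)))
      rw [Real.dist_eq] at h
      exact h.le
  have s2 : ‖(f u y - fv u v * y) - (f u v - fv u v * v)‖ ≤ ε / 2 * ‖y - v‖ := by
    have hsub : segment ℝ v y ⊆ J := hJ.segment_subset hp.2 hq.2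
    refine Convex.norm_image_sub_le_of_norm_hasDerivWithin_le (s := segment ℝ v y)
      (f := fun t => f u t - fv u v * t) (f' := fun t => fv u t - fv u v)
      (fun t ht => ?_) (fun t ht => ?_) (convex_segment v y) (left_mem_segment ℝ v y)
      (right_mem_segment ℝ v y)
    · have := ((h2 u hp.1 t (hsub ht)).mono hsub).sub
        (((hasDerivAt_id t).const_mul (fv u v)).hasDerivWithinAt (s := segment ℝ v y))
      exact this.congr_deriv (by simp)
    · have h := k2 (x := (u, t)) ⟨hp.1, hsub ht⟩ (by
        rw [Prod.dist_eq]
        exact max_lt (by simpa using hd2)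
          (((hseg ht).trans_lt hyd).trans_le (min_le_right _ _)))
      rw [Real.dist_eq] at h
      exact h.le
  have n1 : ‖x - u‖ ≤ ‖(x, y) - (u, v)‖ := by simp [Prod.norm_def]
  have n2 : ‖y - v‖ ≤ ‖(x, y) - (u, v)‖ := by simp [Prod.norm_def]
  have key : f x y - f u v - (fu u v * (x - u) + fv u v * (y - v))
      = ((f x y - fu u v * x) - (f u y - fu u v * u))
        + ((f u y - fv u v * y) - (f u v - fv u v * v)) := by ring
  calc _ = ‖f x y - f u v - (fu u v * (x - u) + fv u v * (y - v))‖ := by simp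
    _ ≤ ε / 2 * ‖x - u‖ + ε / 2 * ‖y - v‖ := by
      rw [key]; exact (norm_add_le _ _).trans (add_le_add s1 s2)
    _ ≤ ε / 2 * ‖(x, y) - (u, v)‖ + ε / 2 * ‖(x, y) - (u, v)‖ := by gcongr
    _ = _ := by ring

lemma continuousOn_of_partials {I J : Set ℝ} (hI : Convex ℝ I) (hJ : Convex ℝ J)
    {f fu fv : ℝ → ℝ → ℝ}
    (h1 : ∀ u ∈ I, ∀ v ∈ J, HasDerivWithinAt (fun x => f x v) (fu u v) I u)
    (h2 : ∀ u ∈ I, ∀ v ∈ J, HasDerivWithinAt (fun y => f u y) (fv u v) J v)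
    (c1 : ContinuousOn (fun p : ℝ × ℝ => fu p.1 p.2) (I ×ˢ J))
    (c2 : ContinuousOn (fun p : ℝ × ℝ => fv p.1 p.2) (I ×ˢ J)) :
    ContinuousOn (fun p : ℝ × ℝ => f p.1 p.2) (I ×ˢ J) := fun _ hp =>
  (hasFDerivWithinAt_of_partials hI hJ h1 h2 c1 c2 hp).continuousWithinAt

lemma contDiffOn_succ_of_partials {I J : Set ℝ} (hI : Convex ℝ I) (hJ : Convex ℝ J)
    (n : ℕ) {f fu fv : ℝ → ℝ → ℝ}
    (h1 : ∀ u ∈ I, ∀ v ∈ J, HasDerivWithinAt (fun x => f x v) (fu u v) I u)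
    (h2 : ∀ u ∈ I, ∀ v ∈ J, HasDerivWithinAt (fun y => f u y) (fv u v) J v)
    (c1 : ContDiffOn ℝ n (fun p : ℝ × ℝ => fu p.1 p.2) (I ×ˢ J))
    (c2 : ContDiffOn ℝ n (fun p : ℝ × ℝ => fv p.1 p.2) (I ×ˢ J)) :
    ContDiffOn ℝ (n + 1) (fun p : ℝ × ℝ => f p.1 p.2) (I ×ˢ J) := by
  rw [contDiffOn_succ_iff_hasFDerivWithinAt (by simp)]
  intro p hp
  refine ⟨I ×ˢ J, by rw [insert_eq_of_mem hp]; exact self_mem_nhdsWithin, by simp,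
    fun p => fu p.1 p.2 • ContinuousLinearMap.fst ℝ ℝ ℝ
      + fv p.1 p.2 • ContinuousLinearMap.snd ℝ ℝ ℝ, fun q hq => ?_, ?_⟩
  · exact hasFDerivWithinAt_of_partials hI hJ h1 h2 c1.continuousOn c2.continuousOn hq
  · exact (c1.smul contDiffOn_const).add (c2.smul contDiffOn_const)

end calculus

/-! ### The Goursat problem with majorants -/

section goursat

variable {V : Type*} [NormedAddCommGroup V] [NormedSpace ℝ V]

/-- Retraction of the plane onto `[0, Us] × [1, ∞)`. -/
def clamp (Us : ℝ) (p : ℝ × ℝ) : ℝ × ℝ := (max 0 (min Us p.1), max 1 p.2)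

lemma clamp_mem {Us : ℝ} (h : 0 ≤ Us) (p : ℝ × ℝ) : clamp Us p ∈ Icc 0 Us ×ˢ Ici 1 := by
  simp [clamp, h]

lemma clamp_eq {Us u v : ℝ} (hu : u ∈ Icc 0 Us) (hv : v ∈ Ici 1) :
    clamp Us (u, v) = (u, v) := by
  simp only [clamp]
  rw [min_eq_right hu.2, max_eq_right hu.1, max_eq_right hv]

lemma continuous_clamp (Us : ℝ) : Continuous (clamp Us) := by
  unfold clamp; fun_prop

/-- `a₀(u) + ∫₁ᵛ n`. -/
def primA (a₀ : ℝ → V) (n : ℝ → ℝ → V) (u v : ℝ) : V := a₀ u + ∫ y in (1 : ℝ)..v, n u y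

/-- `∫₀ᵘ n`. -/
def primB (n : ℝ → ℝ → V) (u v : ℝ) : V := ∫ x in (0 : ℝ)..u, n x v

lemma continuous_primA {a₀ : ℝ → V} (ha : Continuous a₀) {n : ℝ → ℝ → V}
    (hn : Continuous (Function.uncurry n)) : Continuous (Function.uncurry (primA a₀ n)) :=
  (ha.comp continuous_fst).add (continuous_integral_snd hn 1)

lemma continuous_primB {n : ℝ → ℝ → V}
    (hn : Continuous (Function.uncurry n)) : Continuous (Function.uncurry (primB n)) :=
  continuous_integral_fst hn 0

lemma hasDerivAt_primA [CompleteSpace V] {a₀ : ℝ → V} {n : ℝ → ℝ → V}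
    (hn : Continuous (Function.uncurry n)) (u v : ℝ) :
    HasDerivAt (fun y => primA a₀ n u y) (n u v) v :=
  (hasDerivAt_integral (continuous_right hn u) 1 v).const_add _

lemma hasDerivAt_primB [CompleteSpace V] {n : ℝ → ℝ → V}
    (hn : Continuous (Function.uncurry n)) (u v : ℝ) :
    HasDerivAt (fun x => primB n x v) (n u v) u :=
  hasDerivAt_integral (continuous_left hn v) 0 u

/-- By Fubini the double integral may be taken in the other order. If n is the mixed derivative and
`primB (primA a₀ n)` is ψ, then ∂_Uψ and ∂_vψ are `primA a₀ n` and `primB n`. -/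
lemma hasDerivAt_primB_primA [CompleteSpace V] {a₀ : ℝ → V} (ha : Continuous a₀) {n : ℝ → ℝ → V}
    (hn : Continuous (Function.uncurry n)) (u v : ℝ) :
    HasDerivAt (fun y => primB (primA a₀ n) u y) (primB n u v) v := by
  have h : ∀ y, primB (primA a₀ n) u y
      = (∫ x in (0 : ℝ)..u, a₀ x) + ∫ t in (1 : ℝ)..y, primB n u t := by
    intro y
    simp only [primB, primA]
    rw [intervalIntegral.integral_add (ha.intervalIntegrable _ _)
      ((continuous_left (continuous_integral_snd hn 1) y).intervalIntegrable _ _),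
      integral_integral_comm hn]
  simp only [h]
  exact (hasDerivAt_integral (continuous_right (continuous_primB hn) u) 1 v).const_add _

variable {Us : ℝ} {w A B P : ℝ → ℝ → ℝ}

lemma norm_primA_sub_le {a₀ : ℝ → V} {n m : ℝ → ℝ → V} {d : ℝ}
    (hn : Continuous (Function.uncurry n)) (hm : Continuous (Function.uncurry m))
    (hwc : ContinuousOn (fun p : ℝ × ℝ => w p.1 p.2) (Icc 0 Us ×ˢ Ici 1))
    (hle : ∀ u ∈ Icc 0 Us, ∀ v ∈ Ici (1 : ℝ), ‖n u v - m u v‖ ≤ d * w u v)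
    {u v : ℝ} (hu : u ∈ Icc 0 Us) (hv : v ∈ Ici (1 : ℝ)) :
    ‖primA a₀ n u v - primA a₀ m u v‖ ≤ d * ∫ y in (1 : ℝ)..v, w u y := by
  have e : primA a₀ n u v - primA a₀ m u v = ∫ y in (1 : ℝ)..v, (n u y - m u y) := by
    rw [intervalIntegral.integral_sub ((continuous_right hn u).intervalIntegrable _ _)
      ((continuous_right hm u).intervalIntegrable _ _)]
    simp [primA]
  rw [e, ← intervalIntegral.integral_const_mul]
  refine intervalIntegral.norm_integral_le_of_norm_le hv
    (Eventually.of_forall fun t ht => hle u hu t (le_of_lt ht.1)) ?_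
  refine ContinuousOn.intervalIntegrable ?_
  rw [uIcc_of_le hv]
  exact continuousOn_const.mul (hwc.comp (by fun_prop : Continuous fun y : ℝ => (u, y)).continuousOn
    fun y hy => ⟨hu, hy.1⟩)

lemma norm_primB_sub_le {n m : ℝ → ℝ → V} {d : ℝ}
    (hn : Continuous (Function.uncurry n)) (hm : Continuous (Function.uncurry m))
    (hwc : ContinuousOn (fun p : ℝ × ℝ => w p.1 p.2) (Icc 0 Us ×ˢ Ici 1))
    (hle : ∀ u ∈ Icc 0 Us, ∀ v ∈ Ici (1 : ℝ), ‖n u v - m u v‖ ≤ d * w u v)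
    {u v : ℝ} (hu : u ∈ Icc 0 Us) (hv : v ∈ Ici (1 : ℝ)) :
    ‖primB n u v - primB m u v‖ ≤ d * ∫ x in (0 : ℝ)..u, w x v := by
  have e : primB n u v - primB m u v = ∫ x in (0 : ℝ)..u, (n x v - m x v) := by
    rw [intervalIntegral.integral_sub ((continuous_left hn v).intervalIntegrable _ _)
      ((continuous_left hm v).intervalIntegrable _ _)]
    simp [primB]
  rw [e, ← intervalIntegral.integral_const_mul]
  refine intervalIntegral.norm_integral_le_of_norm_le hu.1
    (Eventually.of_forall fun t ht => hle t ⟨ht.1.le, ht.2.trans hu.2⟩ v hv) ?_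
  refine ContinuousOn.intervalIntegrable ?_
  rw [uIcc_of_le hu.1]
  exact continuousOn_const.mul (hwc.comp (by fun_prop : Continuous fun x : ℝ => (x, v)).continuousOn
    fun y hy => ⟨⟨hy.1, hy.2.trans hu.2⟩, hv⟩)

/-- The bounds on `(ψ, ∂_uψ, ∂_vψ)` at a point given by the majorants `P`, `A`, `B`, up to a
factor `d`. -/
def Within (P A B : ℝ → ℝ → ℝ) (d u v : ℝ) (ψ a b : V) : Prop :=
  ‖ψ‖ ≤ d * P u v ∧ ‖a‖ ≤ d * A u v ∧ ‖b‖ ≤ d * B u v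

/-- Solution of the Goursat problem `∂_u∂_vψ = F(u, v, ψ, ∂_uψ, ∂_vψ)`, `ψ(0, v) = 0`,
`∂_uψ(u, 1) = a₀(u)`, given a system of majorants. -/
theorem exists_goursat [CompleteSpace V] (hUs : 0 ≤ Us) (F : ℝ → ℝ → V → V → V → V) {a₀ : ℝ → V}
    (ha₀ : Continuous a₀)
    (hwc : ContinuousOn (fun p : ℝ × ℝ => w p.1 p.2) (Icc 0 Us ×ˢ Ici 1))
    (hw : ∀ u ∈ Icc 0 Us, ∀ v ∈ Ici (1 : ℝ), 0 < w u v)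
    (hAc : ContinuousOn (fun p : ℝ × ℝ => A p.1 p.2) (Icc 0 Us ×ˢ Ici 1))
    (hA : ∀ u ∈ Icc 0 Us, ∀ v ∈ Ici (1 : ℝ), ‖a₀ u‖ + ∫ y in (1 : ℝ)..v, w u y ≤ A u v)
    (hB : ∀ u ∈ Icc 0 Us, ∀ v ∈ Ici (1 : ℝ), ∫ x in (0 : ℝ)..u, w x v ≤ B u v)
    (hP : ∀ u ∈ Icc 0 Us, ∀ v ∈ Ici (1 : ℝ), ∫ x in (0 : ℝ)..u, A x v ≤ P u v)
    (hFc : ∀ ψ a b : ℝ → ℝ → V, Continuous (Function.uncurry ψ) → Continuous (Function.uncurry a) →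
      Continuous (Function.uncurry b) →
      (∀ u ∈ Icc 0 Us, ∀ v ∈ Ici (1 : ℝ), Within P A B 1 u v (ψ u v) (a u v) (b u v)) →
      ContinuousOn (fun p : ℝ × ℝ => F p.1 p.2 (ψ p.1 p.2) (a p.1 p.2) (b p.1 p.2))
        (Icc 0 Us ×ˢ Ici 1))
    (hF : ∀ u ∈ Icc 0 Us, ∀ v ∈ Ici (1 : ℝ), ∀ ψ a b : V, Within P A B 1 u v ψ a b →
      ‖F u v ψ a b‖ ≤ w u v)
    (hL : ∀ u ∈ Icc 0 Us, ∀ v ∈ Ici (1 : ℝ), ∀ ψ a b ψ' a' b' : V, ∀ d ≥ 0,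
      Within P A B 1 u v ψ a b → Within P A B 1 u v ψ' a' b' →
      Within P A B d u v (ψ - ψ') (a - a') (b - b') →
      ‖F u v ψ a b - F u v ψ' a' b'‖ ≤ d / 2 * w u v) :
    ∃ n : ℝ → ℝ → V, Continuous (Function.uncurry n) ∧
      ∀ u ∈ Icc 0 Us, ∀ v ∈ Ici (1 : ℝ),
        n u v = F u v (primB (primA a₀ n) u v) (primA a₀ n u v) (primB n u v) ∧
        Within P A B 1 u v (primB (primA a₀ n) u v) (primA a₀ n u v) (primB n u v) := by
  set R : Set (ℝ × ℝ) := Icc 0 Us ×ˢ Ici 1 with hR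
  -- the candidate for the mixed derivative determined by a bounded function
  let m : BoundedContinuousFunction (ℝ × ℝ) V → ℝ → ℝ → V := fun f u v =>
    w (clamp Us (u, v)).1 (clamp Us (u, v)).2 • f (clamp Us (u, v))
  have hwcl : Continuous fun p => w (clamp Us p).1 (clamp Us p).2 :=
    hwc.comp_continuous (continuous_clamp Us) fun p => clamp_mem hUs p
  have hwcl_pos : ∀ p, 0 < w (clamp Us p).1 (clamp Us p).2 := fun p =>
    hw _ (clamp_mem hUs p).1 _ (clamp_mem hUs p).2
  have hmc : ∀ f, Continuous (Function.uncurry (m f)) := fun f =>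
    hwcl.smul (f.continuous.comp (continuous_clamp Us))
  have hm_eq : ∀ f, ∀ u ∈ Icc 0 Us, ∀ v ∈ Ici (1 : ℝ), m f u v = w u v • f (u, v) := by
    intro f u hu v hv
    simp only [m, clamp_eq hu hv]
  have hm_sub : ∀ f g : BoundedContinuousFunction (ℝ × ℝ) V, ∀ u ∈ Icc 0 Us, ∀ v ∈ Ici (1 : ℝ),
      ‖m f u v - m g u v‖ ≤ dist f g * w u v := by
    intro f g u hu v hv
    rw [hm_eq f u hu v hv, hm_eq g u hu v hv, ← smul_sub, norm_smul, Real.norm_eq_abs,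
      abs_of_pos (hw u hu v hv), mul_comm, ← dist_eq_norm]
    exact mul_le_mul_of_nonneg_right (BoundedContinuousFunction.dist_coe_le_dist _) (hw u hu v hv).le
  have hAi : ∀ u ∈ Icc 0 Us, ∀ v ∈ Ici (1 : ℝ), ∫ y in (1 : ℝ)..v, w u y ≤ A u v :=
    fun u hu v hv => (le_add_of_nonneg_left (norm_nonneg _)).trans (hA u hu v hv)
  have hdiff : ∀ f g : BoundedContinuousFunction (ℝ × ℝ) V, ∀ u ∈ Icc 0 Us, ∀ v ∈ Ici (1 : ℝ),
      Within P A B (dist f g) u v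
        (primB (primA a₀ (m f)) u v - primB (primA a₀ (m g)) u v)
        (primA a₀ (m f) u v - primA a₀ (m g) u v) (primB (m f) u v - primB (m g) u v) := by
    intro f g u hu v hv
    have h1 : ∀ u ∈ Icc 0 Us, ∀ v ∈ Ici (1 : ℝ),
        ‖primA a₀ (m f) u v - primA a₀ (m g) u v‖ ≤ dist f g * A u v := fun u hu v hv =>
      (norm_primA_sub_le (hmc f) (hmc g) hwc (hm_sub f g) hu hv).trans
        (mul_le_mul_of_nonneg_left (hAi u hu v hv) dist_nonneg)
    refine ⟨?_, h1 u hu v hv, ?_⟩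
    · exact (norm_primB_sub_le (continuous_primA ha₀ (hmc f)) (continuous_primA ha₀ (hmc g)) hAc
        h1 hu hv).trans (mul_le_mul_of_nonneg_left (hP u hu v hv) dist_nonneg)
    · exact (norm_primB_sub_le (hmc f) (hmc g) hwc (hm_sub f g) hu hv).trans
        (mul_le_mul_of_nonneg_left (hB u hu v hv) dist_nonneg)
  have hball : ∀ f : BoundedContinuousFunction (ℝ × ℝ) V, ‖f‖ ≤ 1 →
      ∀ u ∈ Icc 0 Us, ∀ v ∈ Ici (1 : ℝ),
      Within P A B 1 u v (primB (primA a₀ (m f)) u v) (primA a₀ (m f) u v) (primB (m f) u v) := by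
    intro f hf u hu v hv
    -- The bounds on the ball are the difference bounds with the zero function as second argument,
    -- for which the first derivative reduces to a₀.
    have c0 : Continuous (Function.uncurry fun _ _ : ℝ => (0 : V)) := continuous_const
    have hle : ∀ u ∈ Icc 0 Us, ∀ v ∈ Ici (1 : ℝ), ‖m f u v - (fun _ _ : ℝ => (0 : V)) u v‖
        ≤ 1 * w u v := by
      intro u hu v hv
      rw [hm_eq f u hu v hv, sub_zero, norm_smul, Real.norm_eq_abs,
        abs_of_pos (hw u hu v hv), mul_comm]
      exact mul_le_mul_of_nonneg_right ((f.norm_coe_le_norm _).trans hf) (hw u hu v hv).le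
    have h1 : ∀ u ∈ Icc 0 Us, ∀ v ∈ Ici (1 : ℝ), ‖primA a₀ (m f) u v - (0 : V)‖
        ≤ 1 * A u v := by
      intro u hu v hv
      have h := norm_primA_sub_le (a₀ := a₀) (hmc f) c0 hwc hle hu hv
      have e : primA a₀ (fun _ _ : ℝ => (0 : V)) u v = a₀ u := by simp [primA]
      rw [e] at h
      have := norm_sub_norm_le (primA a₀ (m f) u v) (a₀ u)
      have := hA u hu v hv
      rw [sub_zero]
      linarith
    refine ⟨?_, by simpa using h1 u hu v hv, ?_⟩
    · have h := norm_primB_sub_le (continuous_primA ha₀ (hmc f)) c0 hAc h1 hu hv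
      have e : primB (fun _ _ : ℝ => (0 : V)) u v = 0 := by simp [primB]
      rw [e, sub_zero] at h
      have := hP u hu v hv
      linarith
    · have h := norm_primB_sub_le (hmc f) c0 hwc hle hu hv
      have e : primB (fun _ _ : ℝ => (0 : V)) u v = 0 := by simp [primB]
      rw [e, sub_zero] at h
      have := hB u hu v hv
      linarith
  let Φ : BoundedContinuousFunction (ℝ × ℝ) V → ℝ × ℝ → V := fun f p =>
    F p.1 p.2 (primB (primA a₀ (m f)) p.1 p.2) (primA a₀ (m f) p.1 p.2) (primB (m f) p.1 p.2)
  have hΦc : ∀ f : BoundedContinuousFunction (ℝ × ℝ) V, ‖f‖ ≤ 1 → ContinuousOn (Φ f) R :=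
    fun f hf => hFc _ _ _ (continuous_primB (continuous_primA ha₀ (hmc f)))
      (continuous_primA ha₀ (hmc f)) (continuous_primB (hmc f)) (hball f hf)
  -- The unknown is f = n / w in the closed unit ball of the bounded continuous functions on the
  -- plane, a complete space. Composition with `clamp` makes functions of the quadrant into
  -- functions of the plane.
  let S := {f : BoundedContinuousFunction (ℝ × ℝ) V // f ∈ Metric.closedBall 0 1}
  have hS : ∀ f : S, ‖f.1‖ ≤ 1 := fun f => mem_closedBall_zero_iff.mp f.2
  let q : S → ℝ × ℝ → V := fun f p =>
    (w (clamp Us p).1 (clamp Us p).2)⁻¹ • Φ f.1 (clamp Us p)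
  have hqc : ∀ f, Continuous (q f) := fun f =>
    (hwcl.inv₀ fun p => (hwcl_pos p).ne').smul
      ((hΦc f.1 (hS f)).comp_continuous (continuous_clamp Us) fun p => clamp_mem hUs p)
  have hqb : ∀ f p, ‖q f p‖ ≤ 1 := by
    intro f p
    have hp := clamp_mem hUs p
    rw [norm_smul, norm_inv, Real.norm_eq_abs, abs_of_pos (hwcl_pos p),
      inv_mul_le_iff₀ (hwcl_pos p), mul_one]
    exact hF _ hp.1 _ hp.2 _ _ _ (hball f.1 (hS f) _ hp.1 _ hp.2)
  let T : S → S := fun f => ⟨BoundedContinuousFunction.ofNormedAddCommGroup (q f) (hqc f) 1 (hqb f),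
    mem_closedBall_zero_iff.mpr
      (BoundedContinuousFunction.norm_ofNormedAddCommGroup_le (hqc f) zero_le_one (hqb f))⟩
  -- The factor d / 2 in `hL` is the contraction constant, since division by w turns it into half of
  -- the sup distance.
  have hT : ContractingWith (1 / 2) T := by
    refine ⟨by rw [← NNReal.coe_lt_coe]; norm_num, LipschitzWith.of_dist_le_mul fun f g => ?_⟩
    rw [Subtype.dist_eq, BoundedContinuousFunction.dist_le (by positivity)]
    intro p
    have hp := clamp_mem hUs p
    change dist (q f p) (q g p) ≤ _
    rw [dist_eq_norm, ← smul_sub, norm_smul, norm_inv, Real.norm_eq_abs, abs_of_pos (hwcl_pos p),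
      inv_mul_le_iff₀ (hwcl_pos p)]
    have := hL _ hp.1 _ hp.2 _ _ _ _ _ _ (dist f.1 g.1) dist_nonneg
      (hball f.1 (hS f) _ hp.1 _ hp.2) (hball g.1 (hS g) _ hp.1 _ hp.2)
      (hdiff f.1 g.1 _ hp.1 _ hp.2)
    refine this.trans (le_of_eq ?_)
    rw [Subtype.dist_eq]
    push_cast
    ring
  have : CompleteSpace S := Metric.isClosed_closedBall.completeSpace_coe
  let f₀ : S := ⟨0, by simp⟩
  obtain ⟨f, hf, -⟩ := hT.exists_fixedPoint f₀ (edist_ne_top _ _)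
  refine ⟨m f.1, hmc f.1, fun u hu v hv => ⟨?_, hball f.1 (hS f) u hu v hv⟩⟩
  have e : f.1 (u, v) = q f (u, v) := by
    have h : (T f).1 (u, v) = q f (u, v) := rfl
    rw [← h, hf]
  rw [hm_eq f.1 u hu v hv, e]
  simp only [q, clamp_eq hu hv]
  rw [smul_smul, mul_inv_cancel₀ (hw u hu v hv).ne', one_smul]

end goursat

/-! ### Weights -/

/-- Parameters of the weight functions. -/
structure Weight where
  c : ℝ
  s : ℝ
  v₀ : ℝ
  a : ℝ
  l : ℝ
  L : ℝ
  B : ℝ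

namespace Weight

variable (W : Weight)

/-- `exp (-c v) + c U`. -/
def τ (U v : ℝ) : ℝ := Real.exp (-(W.c * v)) + W.c * U

/-- A smooth version of `v₀ + min v |u|`. -/
def Z (U v : ℝ) : ℝ := W.v₀ - Real.log (W.τ U v) / W.c

/-- A smooth version of the positive part of `u + v`. -/
def ell (U v : ℝ) : ℝ := v + Real.log (W.τ U v) / W.c

/-- A logistic function of `u + v`. -/
def y (U v : ℝ) : ℝ := W.c * U / W.τ U v

/-- Up to the factor c this is ∂_U y. With ξ = cU e^{cv} it equals e^{cv} / (1 + ξ)², the profile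
that dominates Ω_𝓗² of Reissner–Nordström. -/
def g (U v : ℝ) : ℝ := (1 - W.y U v) / W.τ U v

/-- Profile of ∂_Uψ. The factor 1/τ grows like e^{cv} up to u + v ≈ 0 and then saturates at 1/(cU).
The constant cB takes care of the data at v = 1 and of the strip of bounded v. -/
def p (U v : ℝ) : ℝ := W.Z U v ^ (-W.s) / W.τ U v + W.c * W.B

/-- The U-primitive of `p` that vanishes at U = 0, where Z = v + v₀. -/
def P (U v : ℝ) : ℝ :=
  (W.Z U v ^ (1 - W.s) - (v + W.v₀) ^ (1 - W.s)) / (W.s - 1) + W.c * W.B * U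

/-- A factor between 1 and e^l, increasing in both variables, whose logarithmic derivatives are l
times those of y; a large l absorbs linear terms at the price of a bounded factor only. -/
def ey (U v : ℝ) : ℝ := Real.exp (W.l * W.y U v)

/-- Increasing in v, with values between e^{-L} and 1 for v ≥ 1. The logarithmic derivative
L(s−1)v^{-s} absorbs terms of the form v^{-s}∂_Uψ. -/
def G (v : ℝ) : ℝ := Real.exp (-(W.L * v ^ (1 - W.s)))

/-- The majorant of `∂_U ψ`. -/
def A (U v : ℝ) : ℝ := W.a * W.G v * W.ey U v * W.p U v

/-- The majorant of `ψ`. -/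
def Ψ (U v : ℝ) : ℝ := W.a * W.G v * W.ey U v * W.P U v

/-- The majorant of `∂_v ψ`. -/
def Bv (U v : ℝ) : ℝ := (v + W.v₀) ^ (-W.s) * (W.ey U v - 1 + W.L * W.P U v)

/-- A lower bound for `∂_v A`. -/
def wA (U v : ℝ) : ℝ := W.a * W.G v * W.ey U v * (W.c / 2 * W.g U v * W.Z U v ^ (-W.s)
  + W.l * W.c * (W.y U v * (1 - W.y U v)) * W.p U v + W.L * (W.s - 1) * v ^ (-W.s) * W.p U v)

/-- `∂_U Bv`. -/
def wB (U v : ℝ) : ℝ :=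
  (v + W.v₀) ^ (-W.s) * (W.l * W.c * W.g U v * W.ey U v + W.L * W.p U v)

/-- The majorant of `∂_U∂_v ψ`. -/
def w (U v : ℝ) : ℝ := min (W.wA U v) (W.wB U v)

/-- Standing assumptions on the parameters. -/
structure Good : Prop where
  c_pos : 0 < W.c
  s_gt : 1 < W.s
  v₀_ge : 1 ≤ W.v₀
  v₀_ge' : 2 * W.s / W.c ≤ W.v₀
  a_pos : 0 < W.a
  l_pos : 0 < W.l
  L_pos : 0 < W.L
  B_pos : 0 < W.B

variable {W} (hW : W.Good) {U v : ℝ} (hU : 0 ≤ U) (hv : 1 ≤ v)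

include hW hU

lemma Good.τ_pos : 0 < W.τ U v := by
  have := hW.c_pos
  unfold τ; positivity

lemma Good.exp_le_τ : Real.exp (-(W.c * v)) ≤ W.τ U v := by
  have := hW.c_pos
  unfold τ
  have : 0 ≤ W.c * U := by positivity
  linarith

lemma Good.ell_nonneg : 0 ≤ W.ell U v := by
  have hc := hW.c_pos
  have h := Real.log_le_log (Real.exp_pos _) (hW.exp_le_τ hU (v := v))
  rw [Real.log_exp] at h
  have : -v ≤ Real.log (W.τ U v) / W.c := by
    rw [le_div_iff₀ hc]; linarith
  unfold ell; linarith

omit hW hU in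
lemma Z_add_ell : W.Z U v + W.ell U v = v + W.v₀ := by unfold Z ell; ring

lemma Good.y_nonneg : 0 ≤ W.y U v := by
  have := hW.c_pos
  have := hW.τ_pos hU (v := v)
  unfold y; positivity

lemma Good.one_sub_y : 1 - W.y U v = Real.exp (-(W.c * v)) / W.τ U v := by
  have := (hW.τ_pos hU (v := v)).ne'
  unfold y; field_simp; unfold τ; ring

lemma Good.one_sub_y_pos : 0 < 1 - W.y U v := by
  rw [hW.one_sub_y hU]
  have := hW.τ_pos hU (v := v)
  positivity

lemma Good.g_pos : 0 < W.g U v :=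
  div_pos (hW.one_sub_y_pos hU) (hW.τ_pos hU)

lemma Good.cU_g : W.c * U * W.g U v = W.y U v * (1 - W.y U v) := by
  have := (hW.τ_pos hU (v := v)).ne'
  unfold g y; field_simp

lemma Good.ey_ge : 1 ≤ W.ey U v := by
  have := hW.l_pos
  have := hW.y_nonneg hU (v := v)
  exact Real.one_le_exp (by positivity)

lemma Good.ey_le : W.ey U v ≤ Real.exp W.l := by
  have := hW.l_pos
  have := hW.one_sub_y_pos hU (v := v)
  apply Real.exp_le_exp.mpr
  nlinarith

omit hU in
lemma Good.G_le (hv : 0 ≤ v) : W.G v ≤ 1 := by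
  have := hW.L_pos
  have : 0 ≤ W.L * v ^ (1 - W.s) := by positivity
  unfold G
  rw [Real.exp_le_one_iff]; linarith

omit hW hU in
lemma G_pos : 0 < W.G v := Real.exp_pos _

omit hU in
include hv in
lemma Good.G_ge : Real.exp (-W.L) ≤ W.G v := by
  have := hW.L_pos
  have h : v ^ (1 - W.s) ≤ 1 := Real.rpow_le_one_of_one_le_of_nonpos hv (by linarith [hW.s_gt])
  apply Real.exp_le_exp.mpr
  nlinarith

/-! #### Derivatives -/

omit hW hU in
lemma hasDerivAt_τ_U : HasDerivAt (fun x => W.τ x v) W.c U := by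
  unfold τ
  simpa using ((hasDerivAt_id U).const_mul W.c).const_add (Real.exp (-(W.c * v)))

omit hW hU in
lemma hasDerivAt_τ_v :
    HasDerivAt (fun x => W.τ U x) (-W.c * Real.exp (-(W.c * v))) v := by
  unfold τ
  have h : HasDerivAt (fun x => -(W.c * x)) (-W.c) v := by
    exact ((hasDerivAt_id v).const_mul W.c).neg.congr_deriv (by ring)
  refine (h.exp.add_const _).congr_deriv (by ring)

lemma Good.hasDerivAt_y_U : HasDerivAt (fun x => W.y x v) (W.c * W.g U v) U := by
  have h0 := (hW.τ_pos hU (v := v)).ne'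
  have h : HasDerivAt (fun x => W.c * x) W.c U := by
    simpa using (hasDerivAt_id U).const_mul W.c
  refine (h.div hasDerivAt_τ_U h0).congr_deriv ?_
  unfold g y; field_simp

lemma Good.hasDerivAt_y_v :
    HasDerivAt (fun x => W.y U x) (W.c * (W.y U v * (1 - W.y U v))) v := by
  have h0 := (hW.τ_pos hU (v := v)).ne'
  refine ((hasDerivAt_const v (W.c * U)).div hasDerivAt_τ_v h0).congr_deriv ?_
  rw [hW.one_sub_y hU]; unfold y; field_simp; ring

lemma Good.hasDerivAt_Z_U : HasDerivAt (fun x => W.Z x v) (-(1 / W.τ U v)) U := by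
  have h0 := (hW.τ_pos hU (v := v)).ne'
  have hc := hW.c_pos.ne'
  refine (((hasDerivAt_τ_U.log h0).div_const W.c).const_sub W.v₀).congr_deriv ?_
  field_simp

lemma Good.hasDerivAt_Z_v : HasDerivAt (fun x => W.Z U x) (1 - W.y U v) v := by
  have h0 := (hW.τ_pos hU (v := v)).ne'
  have hc := hW.c_pos.ne'
  refine (((hasDerivAt_τ_v.log h0).div_const W.c).const_sub W.v₀).congr_deriv ?_
  rw [hW.one_sub_y hU]
  field_simp

/-- The redshift: c comes from the growth of 1/τ, and s / Z is the loss caused by the decay of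
Z^{-s}. -/
lemma Good.hasDerivAt_p_v (hZ : 0 < W.Z U v) : HasDerivAt (fun x => W.p U x)
    (W.Z U v ^ (-W.s) * W.g U v * (W.c - W.s / W.Z U v)) v := by
  have h0 := (hW.τ_pos hU (v := v)).ne'
  have h1 := (hW.hasDerivAt_Z_v hU (v := v)).rpow_const (p := -W.s) (Or.inl hZ.ne')
  refine ((h1.div hasDerivAt_τ_v h0).add_const _).congr_deriv ?_
  rw [Real.rpow_sub_one hZ.ne']
  unfold g
  rw [hW.one_sub_y hU]
  have := hZ.ne'
  field_simp
  ring

lemma Good.hasDerivAt_P_U (hZ : 0 < W.Z U v) : HasDerivAt (fun x => W.P x v) (W.p U v) U := by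
  have h0 := (hW.τ_pos hU (v := v)).ne'
  have hs : W.s - 1 ≠ 0 := by linarith [hW.s_gt]
  have h1 := (hW.hasDerivAt_Z_U hU (v := v)).rpow_const (p := 1 - W.s) (Or.inl hZ.ne')
  refine (((h1.sub_const _).div_const (W.s - 1)).add
    ((hasDerivAt_id U).const_mul (W.c * W.B))).congr_deriv ?_
  unfold p
  rw [show 1 - W.s - 1 = -W.s by ring]
  field_simp
  ring

lemma Good.hasDerivAt_ey_U :
    HasDerivAt (fun x => W.ey x v) (W.l * W.c * W.g U v * W.ey U v) U := by
  refine ((hW.hasDerivAt_y_U hU).const_mul W.l).exp.congr_deriv ?_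
  unfold ey; ring

lemma Good.hasDerivAt_ey_v : HasDerivAt (fun x => W.ey U x)
    (W.l * W.c * (W.y U v * (1 - W.y U v)) * W.ey U v) v := by
  refine ((hW.hasDerivAt_y_v hU).const_mul W.l).exp.congr_deriv ?_
  unfold ey; ring

omit hW hU in
include hv in
lemma Good.hasDerivAt_G : HasDerivAt W.G (W.L * (W.s - 1) * v ^ (-W.s) * W.G v) v := by
  have hv0 : v ≠ 0 := by linarith
  have h1 := (hasDerivAt_id v).rpow_const (p := 1 - W.s) (Or.inl hv0)
  refine ((h1.const_mul W.L).neg.exp).congr_deriv ?_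
  simp only [id, Pi.neg_apply]
  unfold G
  rw [show 1 - W.s - 1 = -W.s by ring]
  ring

/-- The derivative of `A` with respect to `v`. -/
def dA (W : Weight) (U v : ℝ) : ℝ := W.a * W.G v * W.ey U v *
  (W.Z U v ^ (-W.s) * W.g U v * (W.c - W.s / W.Z U v)
  + W.l * W.c * (W.y U v * (1 - W.y U v)) * W.p U v + W.L * (W.s - 1) * v ^ (-W.s) * W.p U v)

include hv in
lemma Good.hasDerivAt_A (hZ : 0 < W.Z U v) : HasDerivAt (fun x => W.A U x) (W.dA U v) v := by
  refine ((((Good.hasDerivAt_G hv).const_mul W.a).mul (hW.hasDerivAt_ey_v hU)).mul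
    (hW.hasDerivAt_p_v hU hZ)).congr_deriv ?_
  simp only [Pi.mul_apply]
  unfold dA; ring

lemma Good.hasDerivAt_Bv (hZ : 0 < W.Z U v) :
    HasDerivAt (fun x => W.Bv x v) (W.wB U v) U := by
  refine ((((hW.hasDerivAt_ey_U hU).sub_const 1).add
    ((hW.hasDerivAt_P_U hU hZ).const_mul W.L)).const_mul _).congr_deriv ?_
  unfold wB; ring

lemma Good.hasDerivAt_Ψ (hZ : 0 < W.Z U v) : HasDerivAt (fun x => W.Ψ x v)
    (W.A U v + W.a * W.G v * (W.l * W.c * W.g U v * W.ey U v) * W.P U v) U := by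
  refine (((hW.hasDerivAt_ey_U hU).const_mul (W.a * W.G v)).mul
    (hW.hasDerivAt_P_U hU hZ)).congr_deriv ?_
  unfold A; ring

/-! #### Elementary inequalities -/

variable (hτ : W.τ U v ≤ 1)

include hτ

lemma Good.Z_ge : W.v₀ ≤ W.Z U v := by
  have h := Real.log_nonpos (hW.τ_pos hU).le hτ
  have := div_nonpos_of_nonpos_of_nonneg h hW.c_pos.le
  unfold Z; linarith

lemma Good.Z_ge_one : 1 ≤ W.Z U v := hW.v₀_ge.trans (hW.Z_ge hU hτ)

lemma Good.Z_pos : 0 < W.Z U v := zero_lt_one.trans_le (hW.Z_ge_one hU hτ)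

lemma Good.p_pos : 0 < W.p U v := by
  have := hW.Z_pos hU hτ
  have := hW.τ_pos hU (v := v)
  have := hW.c_pos
  have := hW.B_pos
  unfold p; positivity

lemma Good.p_ge : W.c * W.B ≤ W.p U v := by
  have := hW.Z_pos hU hτ
  have := hW.τ_pos hU (v := v)
  have : 0 ≤ W.Z U v ^ (-W.s) / W.τ U v := by positivity
  unfold p; linarith

lemma Good.rpow_Z_ge : (v + W.v₀) ^ (-W.s) ≤ W.Z U v ^ (-W.s) :=
  Real.rpow_le_rpow_of_nonpos (hW.Z_pos hU hτ)
    (by have := Z_add_ell (W := W) (U := U) (v := v); linarith [hW.ell_nonneg hU (v := v)])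
    (by linarith [hW.s_gt])

lemma Good.add_le : v + W.v₀ ≤ W.Z U v * (1 + W.ell U v) := by
  have h1 := hW.Z_ge_one hU hτ
  have h2 := hW.ell_nonneg hU (v := v)
  rw [← Z_add_ell (W := W) (U := U)]
  nlinarith

-- Z and ell add up to v + v₀ and Z ≥ 1, so v + v₀ ≤ Z (1 + ell): trading Z for v + v₀ costs a power
-- of 1 + ell, which the decay of δ will pay for.
include hv in
lemma Good.rpow_Z_le :
    W.Z U v ^ (-W.s) ≤ (1 + W.ell U v) ^ W.s * (v + W.v₀) ^ (-W.s) := by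
  have h1 := hW.Z_pos hU hτ
  have h2 := hW.ell_nonneg hU (v := v)
  have h3 : 0 < v + W.v₀ := by linarith [hW.v₀_ge]
  have h4 : (v + W.v₀) ^ W.s ≤ W.Z U v ^ W.s * (1 + W.ell U v) ^ W.s := by
    rw [← Real.mul_rpow h1.le (by linarith)]
    exact Real.rpow_le_rpow h3.le (hW.add_le hU hτ) (by linarith [hW.s_gt])
  rw [Real.rpow_neg h1.le, Real.rpow_neg h3.le, ← div_eq_mul_inv, le_div_iff₀ (by positivity),
    inv_mul_le_iff₀ (by positivity)]
  exact h4

/-- The part of `P` that does not involve `B`. -/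
def P₁ (W : Weight) (U v : ℝ) : ℝ :=
  (W.Z U v ^ (1 - W.s) - (v + W.v₀) ^ (1 - W.s)) / (W.s - 1)

lemma Good.P₁_nonneg : 0 ≤ W.P₁ U v := by
  have h1 := hW.Z_pos hU hτ
  have h2 : (v + W.v₀) ^ (1 - W.s) ≤ W.Z U v ^ (1 - W.s) :=
    Real.rpow_le_rpow_of_nonpos h1
    (by have := Z_add_ell (W := W) (U := U) (v := v); linarith [hW.ell_nonneg hU (v := v)])
    (by linarith [hW.s_gt])
  exact div_nonneg (by linarith) (by linarith [hW.s_gt])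

/-- Bernoulli's inequality (1 + t)^{1−s} ≥ 1 − (s−1)t with t = ell / Z, since v + v₀ = Z (1 + t). -/
lemma Good.P₁_le : W.P₁ U v ≤ W.ell U v * W.Z U v ^ (-W.s) := by
  have h1 := hW.Z_pos hU hτ
  have h2 := hW.ell_nonneg hU (v := v)
  have hs : 0 < W.s - 1 := by linarith [hW.s_gt]
  unfold P₁
  rw [div_le_iff₀ hs, ← Z_add_ell (W := W) (U := U)]
  have e : W.Z U v + W.ell U v = W.Z U v * (1 + W.ell U v / W.Z U v) := by field_simp
  have ht : 0 ≤ W.ell U v / W.Z U v := by positivity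
  have k : 1 - (W.s - 1) * (W.ell U v / W.Z U v)
      ≤ (1 + W.ell U v / W.Z U v) ^ (1 - W.s) := by
    rw [Real.rpow_def_of_pos (by linarith)]
    have k1 := Real.add_one_le_exp (Real.log (1 + W.ell U v / W.Z U v) * (1 - W.s))
    have k2 := Real.log_le_sub_one_of_pos (x := 1 + W.ell U v / W.Z U v) (by linarith)
    nlinarith
  rw [e, Real.mul_rpow h1.le (by linarith)]
  have e2 : W.Z U v ^ (-W.s) = W.Z U v ^ (1 - W.s) / W.Z U v := by
    rw [← Real.rpow_sub_one h1.ne']; congr 1; ring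
  rw [e2]
  have h3 : 0 < W.Z U v ^ (1 - W.s) := by positivity
  have k3 := mul_le_mul_of_nonneg_left k h3.le
  have e3 : W.ell U v * (W.Z U v ^ (1 - W.s) / W.Z U v) * (W.s - 1)
    = W.Z U v ^ (1 - W.s) * ((W.s - 1) * (W.ell U v / W.Z U v)) := by ring
  rw [e3]; linarith

lemma Good.P_nonneg : 0 ≤ W.P U v := by
  have := hW.P₁_nonneg hU hτ
  have := hW.c_pos
  have := hW.B_pos
  change 0 ≤ W.P₁ U v + _
  positivity

omit hτ in
/-- `ell ≤ C y (1 + ell)`. -/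
lemma Good.ell_le : W.ell U v ≤ (2 / W.c + 2) * W.y U v * (1 + W.ell U v) := by
  have hc := hW.c_pos
  have hτ0 := hW.τ_pos hU (v := v)
  have h2 := hW.ell_nonneg hU (v := v)
  have hy := hW.y_nonneg hU (v := v)
  have hE := Real.exp_pos (-(W.c * v))
  -- In the first case log(1+x) ≤ x with x = cU e^{cv}, and τ ≤ 2e^{-cv} turns x into at most 2y. In
  -- the second case y ≥ 1/2 and nothing is needed.
  by_cases h : W.c * U ≤ Real.exp (-(W.c * v))
  · have k1 : W.ell U v ≤ W.c * U / Real.exp (-(W.c * v)) / W.c := by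
      have e : W.ell U v = Real.log (W.τ U v / Real.exp (-(W.c * v))) / W.c := by
        rw [Real.log_div hτ0.ne' hE.ne', Real.log_exp]; unfold ell; field_simp; ring
      rw [e]
      gcongr
      refine (Real.log_le_sub_one_of_pos (by positivity)).trans (le_of_eq ?_)
      unfold τ; field_simp; ring
    have k2 : W.c * U / Real.exp (-(W.c * v)) ≤ 2 * W.y U v := by
      unfold y
      rw [← mul_div_assoc, div_le_div_iff₀ hE hτ0]
      have : 0 ≤ W.c * U := by positivity
      unfold τ; nlinarith
    calc W.ell U v ≤ 2 * W.y U v / W.c := k1.trans (by gcongr)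
      _ = 2 / W.c * W.y U v * 1 := by ring
      _ ≤ (2 / W.c + 2) * W.y U v * (1 + W.ell U v) := by gcongr <;> linarith
  · push Not at h
    have k2 : 1 ≤ 2 * W.y U v := by
      unfold y
      rw [← mul_div_assoc, le_div_iff₀ hτ0]; unfold τ; linarith
    calc W.ell U v ≤ 2 * W.y U v * W.ell U v := by nlinarith
      _ ≤ (2 / W.c + 2) * W.y U v * (1 + W.ell U v) := by
        gcongr
        · have : 0 < 2 / W.c := by positivity
          linarith
        · linarith

/-- Z ≥ v₀ ≥ 2s/c, so the decay of Z^{-s} consumes at most half of the redshift. -/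
lemma Good.wA_le : W.a * W.G v * W.ey U v * (W.c / 2 * W.g U v * W.Z U v ^ (-W.s)) ≤
    W.a * W.G v * W.ey U v * (W.Z U v ^ (-W.s) * W.g U v * (W.c - W.s / W.Z U v)) := by
  have h1 := hW.Z_pos hU hτ
  have := hW.a_pos
  have := G_pos (W := W) (v := v)
  have := hW.ey_ge hU (v := v)
  have hg := hW.g_pos hU (v := v)
  have hz : 0 < W.Z U v ^ (-W.s) := by positivity
  have k : W.s / W.Z U v ≤ W.c / 2 := by
    rw [div_le_iff₀ h1]
    have k1 := hW.v₀_ge'.trans (hW.Z_ge hU hτ)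
    rw [div_le_iff₀ hW.c_pos] at k1
    linarith
  have e : W.c / 2 * W.g U v * W.Z U v ^ (-W.s) = W.Z U v ^ (-W.s) * W.g U v * (W.c / 2) := by ring
  rw [e]
  gcongr
  linarith

lemma Good.wA_le_dA : W.wA U v ≤ W.dA U v := by
  have := hW.wA_le hU hτ
  unfold wA dA
  rw [mul_add, mul_add, mul_add, mul_add]
  linarith

end Weight

/-! ### The majorant inequalities at a point. -/

namespace Weight

variable {W : Weight}

/-- The part of the nonlinearity that has the coefficient `δ = Ω_𝓗²` of Reissner–Nordström. -/
def dterms (W : Weight) (δ U v : ℝ) : ℝ :=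
  δ * v ^ (-W.s) + δ * W.Ψ U v + δ * W.Bv U v + W.c * U * δ * W.A U v

/-- The terms without the coefficient δ: ∂_Uψ against the v-derivatives of the deviation and of the
horizon data. -/
def qterms (W : Weight) (U v : ℝ) : ℝ := W.A U v * W.Bv U v + v ^ (-W.s) * W.A U v

/-- A point of the domain, at which `B` is not too large. -/
structure Point (W : Weight) (U v : ℝ) : Prop where
  good : W.Good
  hU : 0 ≤ U
  hv : 1 ≤ v
  hτ : W.τ U v ≤ 1
  hLP : W.L * W.P U v ≤ 1
  hB : W.c * W.B * U ≤ W.Z U v ^ (-W.s)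

section point

variable {U v δ C : ℝ} (h : W.Point U v)

include h

lemma Point.vs_le : (v + W.v₀) ^ (-W.s) ≤ v ^ (-W.s) :=
  Real.rpow_le_rpow_of_nonpos (by linarith [h.hv]) (by linarith [h.good.v₀_ge])
    (by linarith [h.good.s_gt])

lemma Point.le_vs : v ^ (-W.s) ≤ (1 + W.v₀) ^ W.s * (v + W.v₀) ^ (-W.s) := by
  have hv := h.hv
  have h0 := h.good.v₀_ge
  have h4 : (v + W.v₀) ^ W.s ≤ (1 + W.v₀) ^ W.s * v ^ W.s := by
    rw [← Real.mul_rpow (by linarith) (by linarith)]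
    exact Real.rpow_le_rpow (by linarith) (by nlinarith) (by linarith [h.good.s_gt])
  have hv0 : 0 < v ^ W.s := Real.rpow_pos_of_pos (by linarith) _
  have hv1 : 0 < (v + W.v₀) ^ W.s := Real.rpow_pos_of_pos (by linarith) _
  rw [Real.rpow_neg (by linarith), Real.rpow_neg (by linarith), ← div_eq_mul_inv,
    le_div_iff₀ hv1, inv_mul_le_iff₀ hv0]
  linarith

lemma Point.vv_pos : 0 < (v + W.v₀) ^ (-W.s) :=
  Real.rpow_pos_of_pos (by linarith [h.hv, h.good.v₀_ge]) _

lemma Point.vs_pos : 0 < v ^ (-W.s) := Real.rpow_pos_of_pos (by linarith [h.hv]) _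

lemma Point.zs_pos : 0 < W.Z U v ^ (-W.s) :=
  Real.rpow_pos_of_pos (h.good.Z_pos h.hU h.hτ) _

lemma Point.vs_le_one : v ^ (-W.s) ≤ 1 :=
  Real.rpow_le_one_of_one_le_of_nonpos h.hv (by linarith [h.good.s_gt])

lemma Point.vv_le_one : (v + W.v₀) ^ (-W.s) ≤ 1 := h.vs_le.trans h.vs_le_one

lemma Point.Bv_nonneg : 0 ≤ W.Bv U v := by
  have h1 := h.good.ey_ge h.hU (v := v)
  have h2 := h.good.P_nonneg h.hU h.hτ
  have h3 := h.good.L_pos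
  have h4 := h.vv_pos
  unfold Bv
  have : 0 ≤ W.ey U v - 1 := by linarith
  positivity

/-- L P ≤ 1 is compensated by the −1 in `Bv`, so the bound does not involve L. -/
lemma Point.Bv_le : W.Bv U v ≤ (v + W.v₀) ^ (-W.s) * W.ey U v := by
  have h4 := h.vv_pos
  have := h.hLP
  unfold Bv
  gcongr
  linarith

lemma Point.A_pos : 0 < W.A U v := by
  have h1 := h.good.ey_ge h.hU (v := v)
  have h2 := h.good.p_pos h.hU h.hτ
  have h3 := h.good.a_pos
  have h4 := G_pos (W := W) (v := v)
  unfold A; positivity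

lemma Point.A_le : W.A U v ≤ W.a * Real.exp W.l * W.p U v := by
  have h1 := h.good.ey_ge h.hU (v := v)
  have h2 := h.good.p_pos h.hU h.hτ
  have h3 := h.good.a_pos
  have h4 := G_pos (W := W) (v := v)
  have h5 := h.good.ey_le h.hU (v := v)
  have h6 := h.good.G_le (by linarith [h.hv] : 0 ≤ v)
  unfold A
  gcongr
  calc W.a * W.G v ≤ W.a * 1 := by gcongr
    _ = W.a := mul_one _

lemma Point.Ψ_nonneg : 0 ≤ W.Ψ U v := by
  have h1 := h.good.ey_ge h.hU (v := v)
  have h2 := h.good.P_nonneg h.hU h.hτ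
  have h3 := h.good.a_pos
  have h4 := G_pos (W := W) (v := v)
  unfold Ψ; positivity

lemma Point.Ψ_le : W.Ψ U v ≤ W.a * Real.exp W.l * W.P U v := by
  have h1 := h.good.ey_ge h.hU (v := v)
  have h2 := h.good.P_nonneg h.hU h.hτ
  have h3 := h.good.a_pos
  have h4 := G_pos (W := W) (v := v)
  have h5 := h.good.ey_le h.hU (v := v)
  have h6 := h.good.G_le (by linarith [h.hv] : 0 ≤ v)
  unfold Ψ
  gcongr
  calc W.a * W.G v ≤ W.a * 1 := by gcongr
    _ = W.a := mul_one _

/-- P₁ is at most ell Z^{-s}, and the term with B is at most one more Z^{-s}. -/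
lemma Point.P_le : W.P U v ≤ (1 + W.ell U v) * W.Z U v ^ (-W.s) := by
  have h1 := h.good.P₁_le h.hU h.hτ
  have h2 := h.hB
  change W.P₁ U v + _ ≤ _
  linarith

lemma Point.w_pos : 0 < W.w U v := by
  have h1 := h.good.ey_ge h.hU (v := v)
  have h2 := h.good.p_pos h.hU h.hτ
  have h3 := h.good.a_pos
  have h4 := G_pos (W := W) (v := v)
  have h5 := h.good.g_pos h.hU (v := v)
  have h6 := h.zs_pos
  have h7 := h.vv_pos
  have h8 := h.vs_pos
  have h9 := h.good.c_pos
  have h10 := h.good.l_pos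
  have h11 := h.good.L_pos
  have h12 := h.good.y_nonneg h.hU (v := v)
  have h13 := h.good.one_sub_y_pos h.hU (v := v)
  have h14 : 0 < W.s - 1 := by linarith [h.good.s_gt]
  have h15 : 0 < W.ey U v := by linarith
  refine lt_min ?_ ?_
  · unfold wA; positivity
  · unfold wB; positivity

variable (hδ0 : 0 ≤ δ) (hC : 0 ≤ C) (hδ : δ * (1 + W.ell U v) ^ (W.s + 1) ≤ C * W.g U v)
include hδ0 hδ

lemma Point.δ_ell_le : δ * (1 + W.ell U v) ≤ C * W.g U v := by
  have h1 := h.good.ell_nonneg h.hU (v := v)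
  refine le_trans ?_ hδ
  gcongr
  exact Real.self_le_rpow_of_one_le (by linarith) (by linarith [h.good.s_gt])

lemma Point.δ_le : δ ≤ C * W.g U v := by
  refine le_trans ?_ (h.δ_ell_le hδ0 hδ)
  have h1 := h.good.ell_nonneg h.hU (v := v)
  nlinarith

/-- This is why δ is required to beat the power s + 1 of 1 + ell: one power comes from the bound on
P, the other s from trading Z for v + v₀. -/
lemma Point.δ_ell_zs_le :
    δ * ((1 + W.ell U v) * W.Z U v ^ (-W.s)) ≤ C * W.g U v * (v + W.v₀) ^ (-W.s) := by
  have h1 := h.good.ell_nonneg h.hU (v := v)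
  have h2 := h.good.rpow_Z_le h.hU h.hv h.hτ
  have h3 := h.vv_pos
  calc δ * ((1 + W.ell U v) * W.Z U v ^ (-W.s))
      ≤ δ * ((1 + W.ell U v) * ((1 + W.ell U v) ^ W.s * (v + W.v₀) ^ (-W.s))) := by gcongr
    _ = δ * (1 + W.ell U v) ^ (W.s + 1) * (v + W.v₀) ^ (-W.s) := by
      rw [Real.rpow_add_one (by positivity)]; ring
    _ ≤ _ := by gcongr

lemma Point.δ_zs_le : δ * W.Z U v ^ (-W.s) ≤ C * W.g U v * (v + W.v₀) ^ (-W.s) := by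
  refine le_trans ?_ (h.δ_ell_zs_le hδ0 hδ)
  have h1 := h.good.ell_nonneg h.hU (v := v)
  have := h.zs_pos
  gcongr
  nlinarith

lemma Point.δ_P_le : δ * W.P U v ≤ C * W.g U v * (v + W.v₀) ^ (-W.s) :=
  (mul_le_mul_of_nonneg_left h.P_le hδ0).trans (h.δ_ell_zs_le hδ0 hδ)

lemma Point.cU_δ_le : W.c * U * δ ≤ C * (W.y U v * (1 - W.y U v)) := by
  have h1 := h.δ_le hδ0 hδ
  have h2 := h.good.c_pos
  have h3 := h.hU
  calc W.c * U * δ ≤ W.c * U * (C * W.g U v) := by gcongr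
    _ = C * (W.c * U * W.g U v) := by ring
    _ = _ := by rw [h.good.cU_g h.hU]

-- The derivative of e^{ly} in the direction v offers only y(1−y)p, so a factor y has to be found in
-- δP. In the part with Z it comes from ell ≲ y(1 + ell), in the part with B from cU g = y(1−y).
include hC in
lemma Point.δ_P_le' : δ * W.P U v
    ≤ C * (2 / W.c + 2 + 1 / W.c) * (W.y U v * (1 - W.y U v) * W.p U v) := by
  have hc := h.good.c_pos
  have hB := h.good.B_pos
  have hy := h.good.y_nonneg h.hU (v := v)
  have hy1 := h.good.one_sub_y_pos h.hU (v := v)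
  have hz := h.zs_pos
  have hτ := h.good.τ_pos h.hU (v := v)
  have hl := h.good.ell_nonneg h.hU (v := v)
  have k1 : δ * (W.ell U v * W.Z U v ^ (-W.s)) ≤
      C * (2 / W.c + 2) * (W.y U v * (1 - W.y U v) * (W.Z U v ^ (-W.s) / W.τ U v)) := by
    calc δ * (W.ell U v * W.Z U v ^ (-W.s))
        ≤ δ * (((2 / W.c + 2) * W.y U v * (1 + W.ell U v)) * W.Z U v ^ (-W.s)) := by
          gcongr; exact h.good.ell_le h.hU
      _ = (δ * (1 + W.ell U v)) * ((2 / W.c + 2) * W.y U v * W.Z U v ^ (-W.s)) := by ring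
      _ ≤ (C * W.g U v) * ((2 / W.c + 2) * W.y U v * W.Z U v ^ (-W.s)) := by
          exact mul_le_mul_of_nonneg_right (h.δ_ell_le hδ0 hδ) (by positivity)
      _ = _ := by unfold g; ring
  have k2 : δ * (W.c * W.B * U) ≤
      C * (1 / W.c) * (W.y U v * (1 - W.y U v) * (W.c * W.B)) := by
    calc δ * (W.c * W.B * U) = (W.c * U * δ) * W.B := by ring
      _ ≤ (C * (W.y U v * (1 - W.y U v))) * W.B := 
          mul_le_mul_of_nonneg_right (h.cU_δ_le hδ0 hδ) hB.le
      _ = _ := by field_simp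
  have k3 : W.P U v ≤ W.ell U v * W.Z U v ^ (-W.s) + W.c * W.B * U := by
    have h1 := h.good.P₁_le h.hU h.hτ
    change W.P₁ U v + _ ≤ _
    linarith
  have k4 := mul_le_mul_of_nonneg_left k3 hδ0
  have m1 : 0 ≤ C * (W.y U v * (1 - W.y U v) * (W.c * W.B)) := by positivity
  have m2 : 0 ≤ C * (W.y U v * (1 - W.y U v) * (W.Z U v ^ (-W.s) / W.τ U v)) := by positivity
  have m3 : 0 ≤ 1 / W.c := by positivity
  have m4 : 0 ≤ 2 / W.c + 2 := by positivity
  have e : C * (2 / W.c + 2 + 1 / W.c) * (W.y U v * (1 - W.y U v) * W.p U v)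
      = C * (2 / W.c + 2) * (W.y U v * (1 - W.y U v) * (W.Z U v ^ (-W.s) / W.τ U v))
        + C * (1 / W.c) * (W.y U v * (1 - W.y U v) * (W.c * W.B))
        + (2 / W.c + 2) * (C * (W.y U v * (1 - W.y U v) * (W.c * W.B)))
        + 1 / W.c * (C * (W.y U v * (1 - W.y U v) * (W.Z U v ^ (-W.s) / W.τ U v))) := by
    unfold p; ring
  have m5 := mul_nonneg m4 m1
  have m6 := mul_nonneg m3 m2
  rw [e]
  linarith

/-- cU / τ = y ≤ 1 removes the large factor 1/τ from p, and cU·cB ≤ c Z^{-s}. -/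
lemma Point.cU_δ_p_le : W.c * U * δ * W.p U v
    ≤ C * (1 + W.c) * (W.g U v * (v + W.v₀) ^ (-W.s)) := by
  have hc := h.good.c_pos
  have hB := h.hB
  have hy := h.good.y_nonneg h.hU (v := v)
  have hy1 := h.good.one_sub_y_pos h.hU (v := v)
  have hz := h.zs_pos
  have hτ := h.good.τ_pos h.hU (v := v)
  have k := h.δ_zs_le hδ0 hδ
  have k1 : W.y U v * (δ * W.Z U v ^ (-W.s)) ≤ 1 * (C * W.g U v * (v + W.v₀) ^ (-W.s)) := by
    gcongr
    · linarith
  have k2 : W.c * (δ * (W.c * W.B * U)) ≤ W.c * (C * W.g U v * (v + W.v₀) ^ (-W.s)) := by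
    refine mul_le_mul_of_nonneg_left (le_trans ?_ k) hc.le
    gcongr
  have e : W.c * U * δ * W.p U v
      = W.y U v * (δ * W.Z U v ^ (-W.s)) + W.c * (δ * (W.c * W.B * U)) := by
    unfold p y; field_simp
  rw [e]; linarith

variable {S K : ℝ} (hK : 0 ≤ K) (hS : S = (1 + W.v₀) ^ W.s)

include hC hK hS

/-- δ v^{-s} and δ Bv are charged to the redshift term, which requires a to be large; δΨ and cUδA
carry the factor y(1−y)p and are charged to the derivative of e^{ly}, which requires l to be large.
The latter two contain a on both sides, so l need not grow with a here. The bound G ≥ 1/3 makes the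
condition on a independent of L. -/
lemma Point.dterms_le_A (hG : 1 / 3 ≤ W.G v) (h1 : 6 * K * C * (S + 1) ≤ W.a * W.c)
    (h2 : K * (C * (2 / W.c + 2 + 1 / W.c) + C) ≤ W.l * W.c) :
    K * W.dterms δ U v ≤ W.a * W.G v * W.ey U v * (W.c / 2 * W.g U v * W.Z U v ^ (-W.s)
      + W.l * W.c * (W.y U v * (1 - W.y U v)) * W.p U v) := by
  have ha := h.good.a_pos
  have hc := h.good.c_pos
  have he := h.good.ey_ge h.hU (v := v)
  have hg := h.good.g_pos h.hU (v := v)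
  have hy := h.good.y_nonneg h.hU (v := v)
  have hy1 := h.good.one_sub_y_pos h.hU (v := v)
  have hz := h.zs_pos
  have hp := h.good.p_pos h.hU h.hτ
  have hzv := h.good.rpow_Z_ge h.hU h.hτ (v := v)
  have hvv := h.vv_pos
  have hS0 : 0 ≤ S := by rw [hS]; exact Real.rpow_nonneg (by linarith [h.good.v₀_ge]) _
  have hδC := h.δ_le hδ0 hδ
  have hGp := G_pos (W := W) (v := v)
  have i1 : δ * v ^ (-W.s) ≤ C * S * (W.g U v * W.Z U v ^ (-W.s) * W.ey U v) := by
    calc δ * v ^ (-W.s) ≤ (C * W.g U v) * (S * W.Z U v ^ (-W.s)) := by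
          have := h.vs_pos
          have k := h.le_vs
          rw [← hS] at k
          gcongr
          exact k.trans (by gcongr)
      _ = C * S * (W.g U v * W.Z U v ^ (-W.s) * 1) := by ring
      _ ≤ _ := by gcongr
  have i2 : δ * W.Bv U v ≤ C * (W.g U v * W.Z U v ^ (-W.s) * W.ey U v) := by
    calc δ * W.Bv U v ≤ (C * W.g U v) * (W.Z U v ^ (-W.s) * W.ey U v) := by
          have := h.Bv_nonneg
          gcongr
          exact h.Bv_le.trans (by gcongr)
      _ = _ := by ring
  have i3 : δ * W.Ψ U v ≤ W.a * W.G v * W.ey U v *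
      (C * (2 / W.c + 2 + 1 / W.c) * (W.y U v * (1 - W.y U v) * W.p U v)) := by
    have := h.δ_P_le' hδ0 hC hδ
    calc δ * W.Ψ U v = W.a * W.G v * W.ey U v * (δ * W.P U v) := by unfold Ψ; ring
      _ ≤ _ := by gcongr
  have i4 : W.c * U * δ * W.A U v ≤ W.a * W.G v * W.ey U v *
      (C * (W.y U v * (1 - W.y U v)) * W.p U v) := by
    have := h.cU_δ_le hδ0 hδ
    calc W.c * U * δ * W.A U v = W.a * W.G v * W.ey U v * ((W.c * U * δ) * W.p U v) := by
          unfold A; ring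
      _ ≤ _ := by gcongr
  have j1 : K * (C * S + C) * (W.g U v * W.Z U v ^ (-W.s) * W.ey U v)
      ≤ W.a * W.G v * W.ey U v * (W.c / 2 * W.g U v * W.Z U v ^ (-W.s)) := by
    have : K * (C * S + C) ≤ W.a * W.G v * (W.c / 2) := by
      have : W.a * W.c * (1 / 3) ≤ W.a * W.c * W.G v := by gcongr
      linarith
    calc _ ≤ (W.a * W.G v * (W.c / 2)) * (W.g U v * W.Z U v ^ (-W.s) * W.ey U v) := by gcongr
      _ = _ := by ring
  have j2 : K * (C * (2 / W.c + 2 + 1 / W.c) + C)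
        * (W.a * W.G v * W.ey U v * (W.y U v * (1 - W.y U v) * W.p U v))
      ≤ W.l * W.c * (W.a * W.G v * W.ey U v * (W.y U v * (1 - W.y U v) * W.p U v)) := by
    gcongr
  have := mul_le_mul_of_nonneg_left (add_le_add (add_le_add (add_le_add i1 i3) i2) i4) hK
  unfold dterms
  refine this.trans ?_
  rw [mul_add (W.a * W.G v * W.ey U v)]
  refine le_trans (le_of_eq ?_) (add_le_add j1 (j2.trans (le_of_eq ?_))) <;> ring

/-- In the direction U all four terms are multiples of g (v+v₀)^{-s} e^{ly}, which is what the
U-derivative of e^{ly} supplies. Here l has to be large in terms of a. -/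
lemma Point.dterms_le_B
    (h1 : K * (C * S + W.a * C + C + W.a * (C * (1 + W.c))) ≤ W.l * W.c) :
    K * W.dterms δ U v ≤ (v + W.v₀) ^ (-W.s) * (W.l * W.c * W.g U v * W.ey U v) := by
  have ha := h.good.a_pos
  have hc := h.good.c_pos
  have he := h.good.ey_ge h.hU (v := v)
  have hg := h.good.g_pos h.hU (v := v)
  have hz := h.zs_pos
  have hp := h.good.p_pos h.hU h.hτ
  have hvv := h.vv_pos
  have hS0 : 0 ≤ S := by rw [hS]; exact Real.rpow_nonneg (by linarith [h.good.v₀_ge]) _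
  have hδC := h.δ_le hδ0 hδ
  have hGp := G_pos (W := W) (v := v)
  have hG1 := h.good.G_le (by linarith [h.hv] : 0 ≤ v)
  have hU := h.hU
  set X := W.g U v * (v + W.v₀) ^ (-W.s) with hX
  have i1 : δ * v ^ (-W.s) ≤ C * S * (X * W.ey U v) := by
    calc δ * v ^ (-W.s) ≤ (C * W.g U v) * (S * (v + W.v₀) ^ (-W.s)) := by
          have := h.vs_pos
          have k := h.le_vs
          rw [← hS] at k
          gcongr
      _ = C * S * (X * 1) := by rw [hX]; ring
      _ ≤ _ := by gcongr
  have i2 : δ * W.Bv U v ≤ C * (X * W.ey U v) := by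
    calc δ * W.Bv U v ≤ (C * W.g U v) * ((v + W.v₀) ^ (-W.s) * W.ey U v) := by
          have := h.Bv_nonneg
          gcongr
          exact h.Bv_le
      _ = _ := by rw [hX]; ring
  have i3 : δ * W.Ψ U v ≤ W.a * C * (X * W.ey U v) := by
    have := h.δ_P_le hδ0 hδ
    have hP := h.good.P_nonneg h.hU h.hτ
    calc δ * W.Ψ U v = W.a * W.G v * W.ey U v * (δ * W.P U v) := by unfold Ψ; ring
      _ ≤ W.a * 1 * W.ey U v * (C * W.g U v * (v + W.v₀) ^ (-W.s)) := by gcongr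
      _ = _ := by rw [hX]; ring
  have i4 : W.c * U * δ * W.A U v ≤ W.a * (C * (1 + W.c)) * (X * W.ey U v) := by
    have := h.cU_δ_p_le hδ0 hδ
    calc W.c * U * δ * W.A U v = W.a * W.G v * W.ey U v * ((W.c * U * δ) * W.p U v) := by
          unfold A; ring
      _ ≤ W.a * 1 * W.ey U v * (C * (1 + W.c) * X) := by gcongr
      _ = _ := by ring
  have j2 : K * (C * S + W.a * C + C + W.a * (C * (1 + W.c))) * (X * W.ey U v)
      ≤ W.l * W.c * (X * W.ey U v) := by
    gcongr
  have := mul_le_mul_of_nonneg_left (add_le_add (add_le_add (add_le_add i1 i3) i2) i4) hK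
  unfold dterms
  refine this.trans ?_
  refine le_trans (le_of_eq ?_) (j2.trans (le_of_eq ?_))
  · ring
  · rw [hX]; ring

-- A is multiplied by at most (e^l + 1) v^{-s}, and the derivative of G supplies L(s−1)v^{-s} A.
omit hδ0 hδ hC hS in
lemma Point.qterms_le_A (h1 : 2 * (K * (Real.exp W.l + 1)) ≤ W.L * (W.s - 1)) :
    K * W.qterms U v
      ≤ 1 / 2 * (W.a * W.G v * W.ey U v * (W.L * (W.s - 1) * v ^ (-W.s) * W.p U v)) := by
  have hA := h.A_pos
  have hvs := h.vs_pos
  have hB : W.Bv U v ≤ v ^ (-W.s) * Real.exp W.l := by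
    refine h.Bv_le.trans ?_
    have := h.vs_le
    have := h.good.ey_le h.hU (v := v)
    have he := h.good.ey_ge h.hU (v := v)
    gcongr
  have e : W.a * W.G v * W.ey U v * (W.L * (W.s - 1) * v ^ (-W.s) * W.p U v)
      = W.L * (W.s - 1) * (v ^ (-W.s) * W.A U v) := by unfold A; ring
  rw [e]
  have k : W.qterms U v ≤ (Real.exp W.l + 1) * (v ^ (-W.s) * W.A U v) := by
    unfold qterms
    have := mul_le_mul_of_nonneg_left hB hA.le
    linarith
  have k2 := mul_le_mul_of_nonneg_left k hK
  have k3 := mul_le_mul_of_nonneg_right h1 (mul_pos hvs hA).le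
  linarith

-- A is at most a e^l p, and the U-derivative of L P supplies L p.
omit hδ0 hδ hC in
lemma Point.qterms_le_B
    (h1 : 2 * (K * (W.a * Real.exp W.l * (Real.exp W.l + S))) ≤ W.L) :
    K * W.qterms U v ≤ 1 / 2 * ((v + W.v₀) ^ (-W.s) * (W.L * W.p U v)) := by
  have hA := h.A_pos
  have hvv := h.vv_pos
  have hp := h.good.p_pos h.hU h.hτ
  have hB : W.Bv U v ≤ (v + W.v₀) ^ (-W.s) * Real.exp W.l := by
    refine h.Bv_le.trans ?_
    have := h.good.ey_le h.hU (v := v)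
    gcongr
  have hS0 : 0 ≤ S := by rw [hS]; exact Real.rpow_nonneg (by linarith [h.good.v₀_ge]) _
  have k := h.le_vs
  rw [← hS] at k
  have k1 : W.qterms U v
      ≤ (W.a * Real.exp W.l * (Real.exp W.l + S)) * ((v + W.v₀) ^ (-W.s) * W.p U v) := by
    calc W.qterms U v = W.A U v * (W.Bv U v + v ^ (-W.s)) := by unfold qterms; ring
      _ ≤ (W.a * Real.exp W.l * W.p U v) *
          ((v + W.v₀) ^ (-W.s) * Real.exp W.l + S * (v + W.v₀) ^ (-W.s)) := by
          have := h.Bv_nonneg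
          have := h.vs_pos
          have := h.good.a_pos
          gcongr
          exact h.A_le
      _ = _ := by ring
  have k2 := mul_le_mul_of_nonneg_left k1 hK
  have k3 := mul_le_mul_of_nonneg_right h1 (mul_pos hvv hp).le
  linarith

omit hδ0 hδ hC hS hK in
/-- The majorant inequality, given separate bounds on the linear and the quadratic part. -/
lemma Point.le_w_of_large
    (hdA : K * W.dterms δ U v ≤ W.a * W.G v * W.ey U v * (W.c / 2 * W.g U v * W.Z U v ^ (-W.s)
      + W.l * W.c * (W.y U v * (1 - W.y U v)) * W.p U v))
    (hdB : K * W.dterms δ U v ≤ (v + W.v₀) ^ (-W.s) * (W.l * W.c * W.g U v * W.ey U v))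
    (hqA : K * W.qterms U v
      ≤ 1 / 2 * (W.a * W.G v * W.ey U v * (W.L * (W.s - 1) * v ^ (-W.s) * W.p U v)))
    (hqB : K * W.qterms U v ≤ 1 / 2 * ((v + W.v₀) ^ (-W.s) * (W.L * W.p U v))) :
    K * (W.dterms δ U v + W.qterms U v) ≤ W.w U v := by
  have h1 := h.good.ey_ge h.hU (v := v)
  have hp := h.good.p_pos h.hU h.hτ
  have ha := h.good.a_pos
  have hG := G_pos (W := W) (v := v)
  have hvv := h.vv_pos
  have hvs := h.vs_pos
  have hL := h.good.L_pos
  have hs : 0 < W.s - 1 := by linarith [h.good.s_gt]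
  have m1 : 0 ≤ W.a * W.G v * W.ey U v * (W.L * (W.s - 1) * v ^ (-W.s) * W.p U v) := by positivity
  have m2 : 0 ≤ (v + W.v₀) ^ (-W.s) * (W.L * W.p U v) := by positivity
  refine le_min ?_ ?_
  · unfold wA; rw [mul_add (W.a * W.G v * W.ey U v)]; linarith
  · unfold wB; rw [mul_add ((v + W.v₀) ^ (-W.s))]; linarith

-- Where a and l are not adapted to K, both groups of terms are charged to the terms with L, one
-- half each.
omit hδ0 hδ hC hS hK in
lemma Point.le_w_of_small
    (hdA : K * W.dterms δ U v
      ≤ 1 / 2 * (W.a * W.G v * W.ey U v * (W.L * (W.s - 1) * v ^ (-W.s) * W.p U v)))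
    (hdB : K * W.dterms δ U v ≤ 1 / 2 * ((v + W.v₀) ^ (-W.s) * (W.L * W.p U v)))
    (hqA : K * W.qterms U v
      ≤ 1 / 2 * (W.a * W.G v * W.ey U v * (W.L * (W.s - 1) * v ^ (-W.s) * W.p U v)))
    (hqB : K * W.qterms U v ≤ 1 / 2 * ((v + W.v₀) ^ (-W.s) * (W.L * W.p U v))) :
    K * (W.dterms δ U v + W.qterms U v) ≤ W.w U v := by
  have h1 := h.good.ey_ge h.hU (v := v)
  have hp := h.good.p_pos h.hU h.hτ
  have ha := h.good.a_pos
  have hG := G_pos (W := W) (v := v)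
  have hvv := h.vv_pos
  have hg := h.good.g_pos h.hU (v := v)
  have hz := h.zs_pos
  have hc := h.good.c_pos
  have hl := h.good.l_pos
  have hy := h.good.y_nonneg h.hU (v := v)
  have hy1 := h.good.one_sub_y_pos h.hU (v := v)
  have m1 : 0 ≤ W.a * W.G v * W.ey U v * (W.c / 2 * W.g U v * W.Z U v ^ (-W.s)
      + W.l * W.c * (W.y U v * (1 - W.y U v)) * W.p U v) := by positivity
  have m2 : 0 ≤ (v + W.v₀) ^ (-W.s) * (W.l * W.c * W.g U v * W.ey U v) := by positivity
  refine le_min ?_ ?_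
  · unfold wA; rw [mul_add (W.a * W.G v * W.ey U v)]; linarith
  · unfold wB; rw [mul_add ((v + W.v₀) ^ (-W.s))]; linarith

omit hS in
/-- In a strip `v ≤ V` the terms with coefficient `δ` are controlled by `B`, for small `U`. -/
lemma Point.dterms_le_small {V m b : ℝ} (hV : v ≤ V) (hΨ : W.Ψ U v ≤ 1)
    (hm : m ≤ 1 / 2 * (W.a * Real.exp (-W.L) * (W.L * (W.s - 1) * V ^ (-W.s))))
    (hm' : m ≤ 1 / 2 * ((V + W.v₀) ^ (-W.s) * W.L))
    (hb : K * (C * Real.exp (W.c * V) * (2 + Real.exp W.l)) ≤ m / 2 * (W.c * W.B))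
    (hUb : U ≤ b) (hb' : K * (W.c * b * (C * Real.exp (W.c * V)) * (W.a * Real.exp W.l)) ≤ m / 2)
    (hm0 : 0 ≤ m) :
    K * W.dterms δ U v
        ≤ 1 / 2 * (W.a * W.G v * W.ey U v * (W.L * (W.s - 1) * v ^ (-W.s) * W.p U v)) ∧
      K * W.dterms δ U v ≤ 1 / 2 * ((v + W.v₀) ^ (-W.s) * (W.L * W.p U v)) := by
  have he := h.good.ey_ge h.hU (v := v)
  have he' := h.good.ey_le h.hU (v := v)
  have hp := h.good.p_pos h.hU h.hτ
  have hpB := h.good.p_ge h.hU h.hτ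
  have ha := h.good.a_pos
  have hL := h.good.L_pos
  have hs : 0 < W.s - 1 := by linarith [h.good.s_gt]
  have hG := h.good.G_ge h.hv
  have hvv := h.vv_pos
  have hvs := h.vs_pos
  have hc := h.good.c_pos
  have hv := h.hv
  have hU := h.hU
  have hA := h.A_le
  have hA0 := h.A_pos
  have hτ := h.good.τ_pos h.hU (v := v)
  have hv0 := h.good.v₀_ge
  -- In the strip v ≤ V the profile g, and with it δ, is merely bounded.
  have hg : W.g U v ≤ Real.exp (W.c * V) := by
    have k1 := h.good.exp_le_τ h.hU (v := v)
    have k2 := h.good.y_nonneg h.hU (v := v)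
    calc W.g U v ≤ 1 / W.τ U v := by unfold g; gcongr; linarith
      _ ≤ 1 / Real.exp (-(W.c * v)) := by gcongr
      _ = Real.exp (W.c * v) := by rw [Real.exp_neg]; simp
      _ ≤ _ := by gcongr
  have hδC : δ ≤ C * Real.exp (W.c * V) := (h.δ_le hδ0 hδ).trans (by gcongr)
  have hBv : W.Bv U v ≤ Real.exp W.l := by
    refine h.Bv_le.trans ?_
    have := h.vv_le_one
    calc _ ≤ 1 * Real.exp W.l := by gcongr
      _ = _ := one_mul _
  have hvs1 := h.vs_le_one
  have hE := Real.exp_pos (W.c * V)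
  have hl := Real.exp_pos W.l
  have k1 : W.dterms δ U v ≤ C * Real.exp (W.c * V) * (2 + Real.exp W.l)
      + W.c * b * (C * Real.exp (W.c * V)) * (W.a * Real.exp W.l) * W.p U v := by
    have hBv0 := h.Bv_nonneg
    have hΨ0 := h.Ψ_nonneg
    have t1 : δ * (v ^ (-W.s) + W.Ψ U v + W.Bv U v)
        ≤ C * Real.exp (W.c * V) * (2 + Real.exp W.l) := by
      gcongr; linarith
    have t2 : W.c * U * δ * W.A U v
        ≤ W.c * b * (C * Real.exp (W.c * V)) * (W.a * Real.exp W.l * W.p U v) := by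
      have : 0 ≤ b := hU.trans hUb
      gcongr
    unfold dterms
    linarith
  -- The terms without A are bounded, hence below (m/2)cB ≤ (m/2)p for large B; the term with A
  -- carries a factor U ≤ b and takes the other half.
  have k2 : K * W.dterms δ U v ≤ m * W.p U v := by
    have t := mul_le_mul_of_nonneg_left k1 hK
    have t1 := mul_le_mul_of_nonneg_right hb' hp.le
    have t2 := mul_le_mul_of_nonneg_left hpB (by positivity : 0 ≤ m / 2)
    linarith
  refine ⟨k2.trans ?_, k2.trans ?_⟩
  · calc m * W.p U v
        ≤ 1 / 2 * (W.a * Real.exp (-W.L) * (W.L * (W.s - 1) * V ^ (-W.s))) * W.p U v := by gcongr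
      _ ≤ 1 / 2 * (W.a * (W.G v * W.ey U v) * (W.L * (W.s - 1) * v ^ (-W.s))) * W.p U v := by
          have : V ^ (-W.s) ≤ v ^ (-W.s) :=
            Real.rpow_le_rpow_of_nonpos (by linarith) hV (by linarith)
          have : Real.exp (-W.L) ≤ W.G v * W.ey U v := by
            have := Real.exp_pos (-W.L)
            nlinarith
          have hVp : 0 ≤ V ^ (-W.s) := Real.rpow_nonneg (by linarith) _
          have hex := Real.exp_pos (-W.L)
          have hGe : 0 ≤ W.G v * W.ey U v := hex.le.trans this
          gcongr
      _ = _ := by ring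
  · calc m * W.p U v ≤ 1 / 2 * ((V + W.v₀) ^ (-W.s) * W.L) * W.p U v := by gcongr
      _ ≤ 1 / 2 * ((v + W.v₀) ^ (-W.s) * W.L) * W.p U v := by
          have : (V + W.v₀) ^ (-W.s) ≤ (v + W.v₀) ^ (-W.s) :=
            Real.rpow_le_rpow_of_nonpos (by linarith) (by linarith) (by linarith)
          gcongr
      _ = _ := by ring

end point

end Weight

/-! ### Choice of the parameters of the weights. -/

namespace Weight

variable {W : Weight}

lemma log_two_div_le (hW : W.Good) : Real.log 2 / W.c ≤ W.v₀ := by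
  have hc := hW.c_pos
  refine le_trans ?_ hW.v₀_ge'
  gcongr
  have := Real.log_two_lt_d9
  linarith [hW.s_gt]

lemma ell_le_mul_exp (hW : W.Good) {U v : ℝ} (hU : 0 ≤ U) :
    W.ell U v ≤ U * Real.exp (W.c * v) := by
  have hc := hW.c_pos
  have hτ := hW.τ_pos hU (v := v)
  have hE := Real.exp_pos (-(W.c * v))
  have e : W.ell U v = Real.log (W.τ U v / Real.exp (-(W.c * v))) / W.c := by
    rw [Real.log_div hτ.ne' hE.ne', Real.log_exp]; unfold ell; field_simp; ring
  rw [e, div_le_iff₀ hc]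
  refine (Real.log_le_sub_one_of_pos (by positivity)).trans (le_of_eq ?_)
  unfold τ
  rw [Real.exp_neg]
  field_simp
  ring

/-- Smallness uniform in v. For v ≤ V, ell ≤ U e^{cv} is small with U; for v ≥ V, τ ≤ 2e^{-cV}
forces Z ≥ V, and V is such that V^{1−s} < ε(s−1). The first entry of the minimum gives τ ≤ 1. -/
lemma exists_P₁_le (hW : W.Good) {ε : ℝ} (hε : 0 < ε) : ∃ U₁ > 0, ∀ U, 0 ≤ U → U ≤ U₁ →
    ∀ v, 1 ≤ v → W.τ U v ≤ 1 ∧ W.P₁ U v ≤ ε := by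
  have hc := hW.c_pos
  have hs : 0 < W.s - 1 := by linarith [hW.s_gt]
  have ht : Tendsto (fun v : ℝ => v ^ (1 - W.s)) atTop (𝓝 0) := by
    have := tendsto_rpow_neg_atTop hs
    simpa using this
  obtain ⟨V, hV, hV1⟩ := ((ht.eventually (gt_mem_nhds (by positivity : 0 < ε * (W.s - 1)))).and
    (eventually_ge_atTop 1)).exists
  have hec : 0 < 1 - Real.exp (-W.c) := by
    have : Real.exp (-W.c) < 1 := by rw [Real.exp_lt_one_iff]; linarith
    linarith
  have hE := Real.exp_pos (-(W.c * V))
  refine ⟨min ((1 - Real.exp (-W.c)) / W.c) (min (Real.exp (-(W.c * V)) / W.c)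
    (ε * Real.exp (-(W.c * V)))), by positivity, fun U hU hU1 v hv => ?_⟩
  have h1 := hU1.trans (min_le_left _ _)
  have h2 := (hU1.trans (min_le_right _ _)).trans (min_le_left _ _)
  have h3 := (hU1.trans (min_le_right _ _)).trans (min_le_right _ _)
  rw [le_div_iff₀ hc] at h1 h2
  have hτ : W.τ U v ≤ 1 := by
    have : Real.exp (-(W.c * v)) ≤ Real.exp (-W.c) := Real.exp_le_exp.mpr (by nlinarith)
    unfold τ; linarith
  refine ⟨hτ, ?_⟩
  have hZ := hW.Z_pos hU hτ
  rcases le_total v V with hvV | hvV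
  · have k1 := hW.P₁_le hU hτ
    have k2 : W.Z U v ^ (-W.s) ≤ 1 :=
      Real.rpow_le_one_of_one_le_of_nonpos (hW.Z_ge_one hU hτ) (by linarith)
    have k3 := hW.ell_nonneg hU (v := v)
    have k4 := ell_le_mul_exp hW hU (v := v)
    calc W.P₁ U v ≤ W.ell U v * W.Z U v ^ (-W.s) := k1
      _ ≤ W.ell U v * 1 := by gcongr
      _ ≤ U * Real.exp (W.c * v) := by linarith
      _ ≤ (ε * Real.exp (-(W.c * V))) * Real.exp (W.c * V) := by gcongr
      _ = ε := by rw [mul_assoc, ← Real.exp_add]; simp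
  · have k1 : W.τ U v ≤ 2 * Real.exp (-(W.c * V)) := by
      have : Real.exp (-(W.c * v)) ≤ Real.exp (-(W.c * V)) := Real.exp_le_exp.mpr (by nlinarith)
      unfold τ; linarith
    have k2 : V ≤ W.Z U v := by
      have := Real.log_le_log (hW.τ_pos hU) k1
      rw [Real.log_mul (by norm_num) hE.ne', Real.log_exp] at this
      -- v₀ compensates the logarithm of the factor 2 in the bound on τ.
      have h4 := log_two_div_le hW
      have h5 : Real.log (W.τ U v) / W.c ≤ Real.log 2 / W.c - V := by
        rw [div_le_iff₀ hc, sub_mul, div_mul_cancel₀ _ hc.ne']; linarith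
      unfold Z; linarith
    have k3 : W.Z U v ^ (1 - W.s) ≤ V ^ (1 - W.s) :=
      Real.rpow_le_rpow_of_nonpos (by linarith) k2 (by linarith)
    have k4 : 0 ≤ (v + W.v₀) ^ (1 - W.s) := Real.rpow_nonneg (by linarith [hW.v₀_ge]) _
    unfold P₁
    rw [div_le_iff₀ hs]
    linarith

/-- As U → 0, Z grows at most logarithmically in 1/U, uniformly in v. Bounding the logarithm of x⁻¹,
x = cU, by its power 1/(2s) gives Z^s ≲ x^{-1/2}, so that U Z^s ≲ √U. -/
lemma exists_B_le (hW : W.Good) : ∃ U₁ > 0, ∀ U, 0 ≤ U → U ≤ U₁ →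
    ∀ v, 1 ≤ v → W.τ U v ≤ 1 → W.c * W.B * U ≤ W.Z U v ^ (-W.s) := by
  have hc := hW.c_pos
  have hB := hW.B_pos
  have hs : 1 < W.s := hW.s_gt
  have hv0 := hW.v₀_ge
  set D : ℝ := W.v₀ + 2 * W.s / W.c with hD
  have hDp : 0 < D := by
    have : 0 < 2 * W.s / W.c := div_pos (by linarith) hc
    linarith
  set M : ℝ := W.B * D ^ W.s with hM
  have hMp : 0 < M := mul_pos hB (Real.rpow_pos_of_pos hDp _)
  refine ⟨min (1 / W.c) ((1 / M) ^ 2 / W.c), by positivity, fun U hU hU1 v hv hτ => ?_⟩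
  have hZ := hW.Z_pos hU hτ
  rcases hU.eq_or_lt with h0 | hU0
  · rw [show W.c * W.B * U = 0 by rw [← h0]; ring]
    exact (Real.rpow_pos_of_pos hZ _).le
  have h1 := hU1.trans (min_le_left _ _)
  have h2 := hU1.trans (min_le_right _ _)
  rw [le_div_iff₀ hc] at h1 h2
  set x := W.c * U with hx
  have hx0 : 0 < x := by positivity
  have hx1 : x ≤ 1 := by rw [hx]; linarith
  have hZle : W.Z U v ≤ D * x⁻¹ ^ (1 / (2 * W.s)) := by
    have k1 : Real.log x ≤ Real.log (W.τ U v) :=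
      Real.log_le_log hx0 (by unfold τ; have := Real.exp_pos (-(W.c * v)); linarith)
    have k2 := Real.log_le_rpow_div (x := x⁻¹) (by positivity)
      (by rw [one_div]; exact inv_pos.mpr (by linarith) : 0 < 1 / (2 * W.s))
    rw [Real.log_inv] at k2
    have k3 : 1 ≤ x⁻¹ ^ (1 / (2 * W.s)) :=
      Real.one_le_rpow ((one_le_inv₀ hx0).mpr hx1) (by positivity)
    have k4 : -(Real.log (W.τ U v)) / W.c ≤ x⁻¹ ^ (1 / (2 * W.s)) / (1 / (2 * W.s)) / W.c := by
      gcongr; linarith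
    have k5 : x⁻¹ ^ (1 / (2 * W.s)) / (1 / (2 * W.s)) / W.c
      = 2 * W.s / W.c * x⁻¹ ^ (1 / (2 * W.s)) := by field_simp
    have k6 : W.Z U v = W.v₀ + -(Real.log (W.τ U v)) / W.c := by unfold Z; ring
    rw [k6, hD, add_mul]
    have : W.v₀ * 1 ≤ W.v₀ * x⁻¹ ^ (1 / (2 * W.s)) := by gcongr
    linarith
  have hZs : W.Z U v ^ W.s ≤ D ^ W.s * x⁻¹ ^ (1 / 2 : ℝ) := by
    calc W.Z U v ^ W.s ≤ (D * x⁻¹ ^ (1 / (2 * W.s))) ^ W.s :=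
          Real.rpow_le_rpow hZ.le hZle (by linarith)
      _ = _ := by
        rw [Real.mul_rpow hDp.le (by positivity), ← Real.rpow_mul (by positivity)]
        congr 2; field_simp
  rw [Real.rpow_neg hZ.le, ← one_div, le_div_iff₀ (by positivity)]
  have hsq : x * x⁻¹ ^ (1 / 2 : ℝ) = √x := by
    rw [← Real.sqrt_eq_rpow, Real.sqrt_inv, ← div_eq_mul_inv, Real.div_sqrt]
  calc W.c * W.B * U * W.Z U v ^ W.s = W.B * x * W.Z U v ^ W.s := by rw [hx]; ring
    _ ≤ W.B * x * (D ^ W.s * x⁻¹ ^ (1 / 2 : ℝ)) := by gcongr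
    _ = M * √x := by rw [hM, ← hsq]; ring
    _ ≤ M * √((1 / M) ^ 2) := by
      gcongr; rw [hx]; linarith
    _ = 1 := by rw [Real.sqrt_sq (by positivity)]; field_simp

/-- Choice of the parameters of the weights: `a`, `l` and `v₀` depend only on the constant `K₀` of
the nonlinearity in the region `v ≥ V₀`. -/
theorem exists_weight {c s C K₀ : ℝ} (hc : 0 < c) (hs : 1 < s) (hC : 0 < C) (hK₀ : 0 < K₀) :
    ∃ v₀ a l : ℝ, ∀ K₁ V₀ Ka η U₀ : ℝ, 0 < K₁ → 0 < Ka → 0 < η → 0 < U₀ →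
      ∃ L B Us : ℝ, (⟨c, s, v₀, a, l, L, B⟩ : Weight).Good ∧ 0 < Us ∧ Us ≤ U₀ ∧
      ∀ U v : ℝ, 0 ≤ U → U ≤ Us → 1 ≤ v →
        (⟨c, s, v₀, a, l, L, B⟩ : Weight).Point U v ∧
        (⟨c, s, v₀, a, l, L, B⟩ : Weight).Ψ U v ≤ η ∧
        (⟨c, s, v₀, a, l, L, B⟩ : Weight).P U v ≤ η ∧
        Ka ≤ (⟨c, s, v₀, a, l, L, B⟩ : Weight).A U 1 ∧
        ∀ δ K : ℝ, 0 ≤ δ → δ * (1 + (⟨c, s, v₀, a, l, L, B⟩ : Weight).ell U v) ^ (s + 1)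
            ≤ C * (⟨c, s, v₀, a, l, L, B⟩ : Weight).g U v →
          0 ≤ K → K ≤ K₁ → (V₀ ≤ v → K ≤ K₀) →
          K * ((⟨c, s, v₀, a, l, L, B⟩ : Weight).dterms δ U v
            + (⟨c, s, v₀, a, l, L, B⟩ : Weight).qterms U v)
              ≤ (⟨c, s, v₀, a, l, L, B⟩ : Weight).w U v := by
  obtain ⟨v₀, hv₀⟩ : ∃ x, x = max 1 (2 * s / c) := ⟨_, rfl⟩
  have hv1 : 1 ≤ v₀ := hv₀ ▸ le_max_left _ _
  have hv2 : 2 * s / c ≤ v₀ := hv₀ ▸ le_max_right _ _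
  obtain ⟨S, hS⟩ : ∃ x, x = (1 + v₀) ^ s := ⟨_, rfl⟩
  have hS0 : 0 < S := hS ▸ Real.rpow_pos_of_pos (by linarith) _
  -- The factor 6 combines the 1/2 in the redshift term with G ≥ 1/3. The size of l is fixed only
  -- afterwards, as one of its two conditions involves a.
  obtain ⟨a, ha⟩ : ∃ x, x = 6 * K₀ * C * (S + 1) / c + 1 := ⟨_, rfl⟩
  have ha0 : 0 < a := by rw [ha]; positivity
  have ha1 : 6 * K₀ * C * (S + 1) ≤ a * c := by
    rw [ha, add_mul, div_mul_cancel₀ _ hc.ne']; linarith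
  have hx1 : 0 < C * (2 / c + 2 + 1 / c) + C := by positivity
  have hx2 : 0 < C * S + a * C + C + a * (C * (1 + c)) := by positivity
  obtain ⟨l, hl⟩ : ∃ x, x = (K₀ * (C * (2 / c + 2 + 1 / c) + C)
    + K₀ * (C * S + a * C + C + a * (C * (1 + c)))) / c := ⟨_, rfl⟩
  have hl0 : 0 < l := by rw [hl]; positivity
  have hl1 : K₀ * (C * (2 / c + 2 + 1 / c) + C) ≤ l * c := by
    rw [hl, div_mul_cancel₀ _ hc.ne']
    have : 0 < K₀ * (C * S + a * C + C + a * (C * (1 + c))) := by positivity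
    linarith
  have hl2 : K₀ * (C * S + a * C + C + a * (C * (1 + c))) ≤ l * c := by
    rw [hl, div_mul_cancel₀ _ hc.ne']
    have : 0 < K₀ * (C * (2 / c + 2 + 1 / c) + C) := by positivity
    linarith
  refine ⟨v₀, a, l, fun K₁ V₀ Ka η U₀ hK₁ hKa hη hU₀ => ?_⟩
  have hs1 : 0 < s - 1 := by linarith
  have hel := Real.exp_pos l
  -- The quadratic terms are present for all v, so L is adapted to K₁; a, l and v₀ are already fixed
  -- and do not change.
  obtain ⟨L, hL⟩ : ∃ x, x = 2 * (K₁ * (Real.exp l + 1)) / (s - 1)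
    + 2 * (K₁ * (a * Real.exp l * (Real.exp l + S))) := ⟨_, rfl⟩
  have hL0 : 0 < L := by rw [hL]; positivity
  have hL1 : 2 * (K₁ * (Real.exp l + 1)) ≤ L * (s - 1) := by
    rw [hL, add_mul, div_mul_cancel₀ _ hs1.ne']
    have : 0 < 2 * (K₁ * (a * Real.exp l * (Real.exp l + S))) * (s - 1) := by positivity
    linarith
  have hL2 : 2 * (K₁ * (a * Real.exp l * (Real.exp l + S))) ≤ L := by
    rw [hL]
    have : 0 < 2 * (K₁ * (Real.exp l + 1)) / (s - 1) := by positivity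
    linarith
  have ht : Tendsto (fun v : ℝ => v ^ (1 - s)) atTop (𝓝 0) := by
    have := tendsto_rpow_neg_atTop hs1
    simpa using this
  -- For v ≥ V one has L v^{1−s} ≤ 1, hence G ≥ e^{-1} ≥ 1/3, and K ≤ K₀; the strip v ≤ V is left to
  -- B.
  obtain ⟨V, ⟨hV1, hVV⟩, hV0⟩ := ((ht.eventually (gt_mem_nhds (by positivity : 0 < 1 / L))).and
    (eventually_ge_atTop 1)|>.and (eventually_ge_atTop V₀)).exists
  obtain ⟨m, hm⟩ : ∃ x, x = min (1 / 2 * (a * Real.exp (-L) * (L * (s - 1) * V ^ (-s))))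
    (1 / 2 * ((V + v₀) ^ (-s) * L)) := ⟨_, rfl⟩
  have hVp : 0 < V ^ (-s) := Real.rpow_pos_of_pos (by linarith) _
  have hVp' : 0 < (V + v₀) ^ (-s) := Real.rpow_pos_of_pos (by linarith) _
  have hm0 : 0 < m := by rw [hm]; positivity
  have hcV := Real.exp_pos (c * V)
  -- The first summand dominates the linear terms in the strip v ≤ V; the second makes A(U, 1) at
  -- least Ka.
  obtain ⟨B, hB⟩ : ∃ x, x = K₁ * (C * Real.exp (c * V) * (2 + Real.exp l)) / (m / 2 * c)
    + Ka / (a * Real.exp (-L) * c) := ⟨_, rfl⟩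
  have hB0 : 0 < B := by rw [hB]; positivity
  have hB1 : K₁ * (C * Real.exp (c * V) * (2 + Real.exp l)) ≤ m / 2 * (c * B) := by
    have e : m / 2 * (c * B) = K₁ * (C * Real.exp (c * V) * (2 + Real.exp l))
      + m / 2 * (c * (Ka / (a * Real.exp (-L) * c))) := by rw [hB]; field_simp
    have : 0 < m / 2 * (c * (Ka / (a * Real.exp (-L) * c))) := by positivity
    linarith
  have hB2 : Ka ≤ a * Real.exp (-L) * (c * B) := by
    have e : a * Real.exp (-L) * (c * B) = Ka + a * Real.exp (-L) * (c *
      (K₁ * (C * Real.exp (c * V) * (2 + Real.exp l)) / (m / 2 * c))) := by rw [hB]; field_simp; ring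
    have : 0 < a * Real.exp (-L) * (c *
      (K₁ * (C * Real.exp (c * V) * (2 + Real.exp l)) / (m / 2 * c))) := by positivity
    linarith
  set W : Weight := ⟨c, s, v₀, a, l, L, B⟩ with hWdef
  have hW : W.Good := ⟨hc, hs, hv1, hv2, ha0, hl0, hL0, hB0⟩
  obtain ⟨b, hb⟩ : ∃ x, x = m / 2 / (K₁ * (c * (C * Real.exp (c * V)) * (a * Real.exp l))) :=
    ⟨_, rfl⟩
  have hb0 : 0 < b := by rw [hb]; positivity
  have hb1 : K₁ * (c * b * (C * Real.exp (c * V)) * (a * Real.exp l)) ≤ m / 2 := by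
    rw [hb]; apply le_of_eq; field_simp
  -- The four entries give L P ≤ 1, P ≤ η, Ψ ≤ 1 and Ψ ≤ η. One half of ε is spent on P₁, the other
  -- on the term with B.
  obtain ⟨ε, hε⟩ : ∃ x, x = min (min (1 / L) η) (min (1 / (a * Real.exp l)) (η / (a * Real.exp l))) :=
    ⟨_, rfl⟩
  have hε0 : 0 < ε := by rw [hε]; positivity
  have he1 : ε ≤ 1 / L := by rw [hε]; exact (min_le_left _ _).trans (min_le_left _ _)
  have he2 : ε ≤ η := by rw [hε]; exact (min_le_left _ _).trans (min_le_right _ _)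
  have he3 : ε ≤ 1 / (a * Real.exp l) := by
    rw [hε]; exact (min_le_right _ _).trans (min_le_left _ _)
  have he4 : ε ≤ η / (a * Real.exp l) := by
    rw [hε]; exact (min_le_right _ _).trans (min_le_right _ _)
  obtain ⟨U₁, hU₁, h₁⟩ := exists_P₁_le hW (half_pos hε0)
  obtain ⟨U₂, hU₂, h₂⟩ := exists_B_le hW
  refine ⟨L, B, min (min U₀ U₁) (min (min U₂ b) (ε / 2 / (c * B))), hW, by positivity,
    (min_le_left _ _).trans (min_le_left _ _), fun U v hU hUs hv => ?_⟩
  have g1 : U ≤ U₁ := hUs.trans ((min_le_left _ _).trans (min_le_right _ _))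
  have g2 : U ≤ U₂ := hUs.trans ((min_le_right _ _).trans ((min_le_left _ _).trans (min_le_left _ _)))
  have g3 : U ≤ b := hUs.trans ((min_le_right _ _).trans ((min_le_left _ _).trans (min_le_right _ _)))
  have g4 : U ≤ ε / 2 / (c * B) := hUs.trans ((min_le_right _ _).trans (min_le_right _ _))
  obtain ⟨hτ, hP1⟩ := h₁ U hU g1 v hv
  have hP : W.P U v ≤ ε := by
    rw [le_div_iff₀ (by positivity)] at g4
    change W.P₁ U v + c * B * U ≤ ε
    linarith
  have hpt : W.Point U v := ⟨hW, hU, hv, hτ, by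
    have : L * W.P U v ≤ L * (1 / L) := by gcongr; exact hP.trans he1
    rwa [mul_one_div_cancel hL0.ne'] at this, h₂ U hU g2 v hv hτ⟩
  have hael : 0 < a * Real.exp l := by positivity
  have hΨ : ∀ x, ε ≤ x / (a * Real.exp l) → W.Ψ U v ≤ x := by
    intro x hx
    refine hpt.Ψ_le.trans ?_
    have := hP.trans hx
    rw [le_div_iff₀ hael] at this
    change a * Real.exp l * _ ≤ _
    linarith
  refine ⟨hpt, hΨ η he4, hP.trans he2, ?_, ?_⟩
  · have hτ1 := (h₁ U hU g1 1 le_rfl).1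
    have k1 := hW.p_ge hU hτ1
    have k2 := hW.ey_ge hU (v := 1)
    have k3 := hW.G_ge (le_refl (1 : ℝ))
    change Ka ≤ a * W.G 1 * W.ey U 1 * W.p U 1
    calc Ka ≤ a * Real.exp (-L) * (c * B) := hB2
      _ = a * Real.exp (-L) * 1 * (c * B) := by ring
      _ ≤ _ := by
        have : 0 < c * B := by positivity
        have := Real.exp_pos (-L)
        have : Real.exp (-L) ≤ W.G 1 := k3
        have hey : 0 ≤ W.ey U 1 := by linarith
        have hG := (G_pos (W := W) (v := 1)).le
        gcongr
  · intro δ K hδ0 hδ hK hKK₁ hKK₀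
    have hqA : K * W.qterms U v
        ≤ 1 / 2 * (W.a * W.G v * W.ey U v * (W.L * (W.s - 1) * v ^ (-W.s) * W.p U v)) := by
      refine hpt.qterms_le_A hK (le_trans ?_ hL1)
      gcongr
    have hqB : K * W.qterms U v ≤ 1 / 2 * ((v + W.v₀) ^ (-W.s) * (W.L * W.p U v)) := by
      refine hpt.qterms_le_B hK hS (le_trans ?_ hL2)
      change 2 * (K * (a * Real.exp l * (Real.exp l + S))) ≤ _
      gcongr
    rcases le_total V v with hVv | hvV
    · have hK0 := hKK₀ (hV0.trans hVv)
      refine hpt.le_w_of_large ?_ ?_ hqA hqB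
      · refine hpt.dterms_le_A hδ0 hC.le hδ hK hS ?_ ?_ ?_
        · have : L * v ^ (1 - s) ≤ 1 := by
            have h5 : v ^ (1 - s) ≤ V ^ (1 - s) :=
              Real.rpow_le_rpow_of_nonpos (by linarith) hVv (by linarith)
            have h6 : L * v ^ (1 - s) ≤ L * (1 / L) := by gcongr; linarith
            rwa [mul_one_div_cancel hL0.ne'] at h6
          have h7 : Real.exp (-1) ≤ W.G v := Real.exp_le_exp.mpr (by
            change -1 ≤ -(L * v ^ (1 - s)); linarith)
          have h8 : 1 / 3 ≤ Real.exp (-1) := by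
            rw [Real.exp_neg, ← one_div]
            apply one_div_le_one_div_of_le (Real.exp_pos 1)
            have := Real.exp_one_lt_d9; linarith
          linarith
        · refine le_trans ?_ ha1
          gcongr
        · refine le_trans ?_ hl1
          change K * (C * (2 / c + 2 + 1 / c) + C) ≤ _
          gcongr
      · refine hpt.dterms_le_B hδ0 hC.le hδ hK hS (le_trans ?_ hl2)
        change K * (C * S + a * C + C + a * (C * (1 + c))) ≤ _
        gcongr
    · have hd := hpt.dterms_le_small hδ0 hC.le hδ hK (V := V) (m := m) (b := b) hvV
        (hΨ 1 he3) (by rw [hm]; exact min_le_left _ _) (by rw [hm]; exact min_le_right _ _)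
        (le_trans (by change K * (C * Real.exp (c * V) * (2 + Real.exp l)) ≤ _; gcongr) hB1)
        g3 (le_trans (by
          change K * (c * b * (C * Real.exp (c * V)) * (a * Real.exp l)) ≤ _; gcongr) hb1) hm0.le
      exact hpt.le_w_of_small hd.1 hd.2 hqA hqB

/-! #### The weights in the coordinates `(u, v)` -/

section uv

variable {u v : ℝ}

lemma rpow_le_exp {c s x : ℝ} (hc : 0 < c) (hs : 0 < s) (hx : 0 < x) :
    Real.exp (-(c * x)) ≤ (s / c) ^ s * x ^ (-s) := by
  have k : x ≤ s / c * Real.exp (c / s * x) := by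
    have := Real.add_one_le_exp (c / s * x)
    calc x = s / c * (c / s * x) := by field_simp
      _ ≤ _ := by gcongr; linarith
  have k2 : x ^ s ≤ (s / c) ^ s * Real.exp (c * x) := by
    calc x ^ s ≤ (s / c * Real.exp (c / s * x)) ^ s := Real.rpow_le_rpow hx.le k hs.le
      _ = _ := by
        rw [Real.mul_rpow (by positivity) (by positivity), ← Real.exp_mul]
        congr 2; field_simp
  rw [Real.exp_neg, Real.rpow_neg hx.le, ← div_eq_mul_inv, ← one_div,
    div_le_div_iff₀ (Real.exp_pos _) (by positivity)]
  linarith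

variable (h : W.Point (Real.exp (W.c * u) / W.c) v)

include h

lemma Point.cU_eq : W.c * (Real.exp (W.c * u) / W.c) = Real.exp (W.c * u) :=
  mul_div_cancel₀ _ h.good.c_pos.ne'

/-- For cU = e^{cu} one has exactly ell = log(1 + e^{c(u+v)}) / c. -/
lemma Point.ell_le_of_le {A : ℝ} (hA : u + v ≤ A) :
    W.ell (Real.exp (W.c * u) / W.c) v ≤ Real.log (1 + Real.exp (W.c * A)) / W.c := by
  have hc := h.good.c_pos
  have hτ := h.good.τ_pos h.hU (v := v)
  have e : W.ell (Real.exp (W.c * u) / W.c) v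
      = Real.log (W.τ (Real.exp (W.c * u) / W.c) v * Real.exp (W.c * v)) / W.c := by
    rw [Real.log_mul hτ.ne' (Real.exp_pos _).ne', Real.log_exp]; unfold ell; field_simp; ring
  rw [e]
  gcongr
  have : W.τ (Real.exp (W.c * u) / W.c) v * Real.exp (W.c * v)
      = 1 + Real.exp (W.c * (u + v)) := by
    unfold τ
    rw [h.cU_eq, add_mul, ← Real.exp_add, ← Real.exp_add]
    congr 1
    · simp
    · ring_nf
  rw [this]
  gcongr

lemma Point.Z_ge_of_ge {A : ℝ} (hA : A ≤ u + v) :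
    W.v₀ - u - Real.log (1 + Real.exp (-(W.c * A))) / W.c
      ≤ W.Z (Real.exp (W.c * u) / W.c) v := by
  have hc := h.good.c_pos
  have hτ := h.good.τ_pos h.hU (v := v)
  have k : W.τ (Real.exp (W.c * u) / W.c) v
      ≤ Real.exp (W.c * u) * (1 + Real.exp (-(W.c * A))) := by
    unfold τ
    rw [h.cU_eq, mul_add, ← Real.exp_add, mul_one, add_comm]
    gcongr
    nlinarith
  have k2 := Real.log_le_log hτ k
  rw [Real.log_mul (Real.exp_pos _).ne' (by positivity), Real.log_exp] at k2
  have k3 : Real.log (W.τ (Real.exp (W.c * u) / W.c) v) / W.c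
      ≤ u + Real.log (1 + Real.exp (-(W.c * A))) / W.c := by
    rw [div_le_iff₀ hc, add_mul, div_mul_cancel₀ _ hc.ne']; linarith
  unfold Z; linarith

/-- Split at u + v = 0. Below, ell is bounded and Z ≥ v, which gives v^{-s}; above, Z ≥ |u| and P is
controlled by Z^{1−s}. The power lost in |u|^{1−s} is the one lost by integrating p in U. In both
cases v₀ ≥ log 2 / c removes an error from the logarithm. -/
lemma Point.P_uv_le (hu : u < 0) : W.P (Real.exp (W.c * u) / W.c) v
    ≤ (1 + 1 / W.c + 1 / (W.s - 1)) * (v ^ (-W.s) + |u| ^ (-W.s + 1)) := by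
  have hc := h.good.c_pos
  have hs : 0 < W.s - 1 := by linarith [h.good.s_gt]
  have hv := h.hv
  have h0 := log_two_div_le h.good
  have hZ1 := h.good.Z_ge_one h.hU h.hτ
  have hvs := h.vs_pos
  have hup : 0 < |u| ^ (-W.s + 1) := Real.rpow_pos_of_pos (abs_pos.mpr hu.ne) _
  have hzs := h.zs_pos
  rcases le_total (u + v) 0 with hx | hx
  · have k1 := h.ell_le_of_le hx
    rw [mul_zero, Real.exp_zero, one_add_one_eq_two] at k1
    have k2 : v ≤ W.Z (Real.exp (W.c * u) / W.c) v := by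
      have := Z_add_ell (W := W) (U := Real.exp (W.c * u) / W.c) (v := v); linarith
    have k3 : W.Z (Real.exp (W.c * u) / W.c) v ^ (-W.s) ≤ v ^ (-W.s) :=
      Real.rpow_le_rpow_of_nonpos (by linarith) k2 (by linarith)
    have k4 : Real.log 2 / W.c ≤ 1 / W.c := by
      gcongr; linarith [Real.log_two_lt_d9]
    have k5 := h.good.ell_nonneg h.hU (v := v)
    calc _ ≤ _ := h.P_le
      _ ≤ (1 + 1 / W.c) * v ^ (-W.s) := by gcongr; linarith
      _ ≤ _ := by
        have : 0 < 1 / (W.s - 1) := by positivity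
        refine mul_le_mul (by linarith) (by linarith) hvs.le (by positivity)
  · have k1 := h.Z_ge_of_ge hx
    rw [mul_zero, neg_zero, Real.exp_zero, one_add_one_eq_two] at k1
    have k2 : |u| ≤ W.Z (Real.exp (W.c * u) / W.c) v := by rw [abs_of_neg hu]; linarith
    have k3 : W.Z (Real.exp (W.c * u) / W.c) v ^ (1 - W.s) ≤ |u| ^ (-W.s + 1) := by
      rw [show -W.s + 1 = 1 - W.s by ring]
      exact Real.rpow_le_rpow_of_nonpos (abs_pos.mpr hu.ne) k2 (by linarith)
    have k4 : W.Z (Real.exp (W.c * u) / W.c) v ^ (-W.s)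
        ≤ W.Z (Real.exp (W.c * u) / W.c) v ^ (1 - W.s) :=
      Real.rpow_le_rpow_of_exponent_le hZ1 (by linarith)
    have k5 : 0 ≤ (v + W.v₀) ^ (1 - W.s) := Real.rpow_nonneg (by linarith [h.good.v₀_ge]) _
    have k6 := h.hB
    calc _ ≤ W.Z (Real.exp (W.c * u) / W.c) v ^ (1 - W.s) / (W.s - 1)
          + W.Z (Real.exp (W.c * u) / W.c) v ^ (-W.s) := by
          unfold P; gcongr; linarith
      _ ≤ |u| ^ (-W.s + 1) / (W.s - 1) + |u| ^ (-W.s + 1) := by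
          gcongr; exact k4.trans k3
      _ = (1 + 1 / (W.s - 1)) * |u| ^ (-W.s + 1) := by ring
      _ ≤ _ := by
        have : 0 < 1 / W.c := by positivity
        refine mul_le_mul (by linarith) (by linarith) hup.le (by positivity)

/-- e^{cu}/τ ≤ e^{c(u+v)}, which in this region is the size of Ω_RN². As ell is bounded, Z^{-s} ≲
v^{-s}; in the term with B, e^{cu} = e^{c(u+v)}e^{-cv} and e^{-cv} ≲ v^{-s}. -/
lemma Point.cU_p_le_of_le {A : ℝ} (hA : u + v ≤ A) :
    Real.exp (W.c * u) * W.p (Real.exp (W.c * u) / W.c) v ≤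
      ((1 + Real.log (1 + Real.exp (W.c * A)) / W.c) ^ W.s + W.c * W.B * (W.s / W.c) ^ W.s)
        * (Real.exp (W.c * (u + v)) * v ^ (-W.s)) := by
  have hc := h.good.c_pos
  have hB := h.good.B_pos
  have hv := h.hv
  have hs : 0 < W.s := by linarith [h.good.s_gt]
  have hl := h.ell_le_of_le hA
  have hl0 := h.good.ell_nonneg h.hU (v := v)
  have hτ := h.good.τ_pos h.hU (v := v)
  have hzs := h.zs_pos
  have hpw : 0 ≤ (1 + Real.log (1 + Real.exp (W.c * A)) / W.c) ^ W.s :=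
    Real.rpow_nonneg (by linarith) _
  have hvs := h.vs_pos
  have k1 : Real.exp (W.c * u) * (W.Z (Real.exp (W.c * u) / W.c) v ^ (-W.s)
      / W.τ (Real.exp (W.c * u) / W.c) v)
      ≤ (1 + Real.log (1 + Real.exp (W.c * A)) / W.c) ^ W.s
        * (Real.exp (W.c * (u + v)) * v ^ (-W.s)) := by
    have e1 : 1 / W.τ (Real.exp (W.c * u) / W.c) v ≤ Real.exp (W.c * v) := by
      have := h.good.exp_le_τ h.hU (v := v)
      calc _ ≤ 1 / Real.exp (-(W.c * v)) := by gcongr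
        _ = _ := by rw [Real.exp_neg]; simp
    have e2 : W.Z (Real.exp (W.c * u) / W.c) v ^ (-W.s)
        ≤ (1 + Real.log (1 + Real.exp (W.c * A)) / W.c) ^ W.s * v ^ (-W.s) := by
      refine (h.good.rpow_Z_le h.hU hv h.hτ).trans ?_
      have := h.vs_le
      have := h.vv_pos
      gcongr
    calc _ = Real.exp (W.c * u) * (W.Z (Real.exp (W.c * u) / W.c) v ^ (-W.s)
        * (1 / W.τ (Real.exp (W.c * u) / W.c) v)) := by ring
      _ ≤ Real.exp (W.c * u) * (((1 + Real.log (1 + Real.exp (W.c * A)) / W.c) ^ W.s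
          * v ^ (-W.s)) * Real.exp (W.c * v)) := by gcongr
      _ = _ := by rw [mul_add W.c, Real.exp_add]; ring
  have k2 : Real.exp (W.c * u) * (W.c * W.B) ≤ W.c * W.B * (W.s / W.c) ^ W.s
      * (Real.exp (W.c * (u + v)) * v ^ (-W.s)) := by
    have e := rpow_le_exp hc hs (by linarith : 0 < v)
    calc Real.exp (W.c * u) * (W.c * W.B)
        = W.c * W.B * (Real.exp (W.c * (u + v)) * Real.exp (-(W.c * v))) := by
          rw [← Real.exp_add]; ring_nf
      _ ≤ W.c * W.B * (Real.exp (W.c * (u + v)) * ((W.s / W.c) ^ W.s * v ^ (-W.s))) := by gcongr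
      _ = _ := by ring
  unfold p
  rw [mul_add, add_mul]
  exact add_le_add k1 k2

/-- cU ≤ τ removes the factor 1/τ, Z is comparable to |u| from below, and the term with B is
exponentially small in |u|. -/
lemma Point.cU_p_le_of_ge {A : ℝ} (hA : A ≤ u + v) (hu : u < 0) :
    Real.exp (W.c * u) * W.p (Real.exp (W.c * u) / W.c) v ≤
      ((1 + Real.log (1 + Real.exp (-(W.c * A))) / W.c) ^ W.s + W.c * W.B * (W.s / W.c) ^ W.s)
        * |u| ^ (-W.s) := by
  have hc := h.good.c_pos
  have hB := h.good.B_pos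
  have hv := h.hv
  have hs : 0 < W.s := by linarith [h.good.s_gt]
  have hτ := h.good.τ_pos h.hU (v := v)
  have hzs := h.zs_pos
  have hZ1 := h.good.Z_ge_one h.hU h.hτ
  have hup : 0 < |u| := abs_pos.mpr hu.ne
  have hZ := h.Z_ge_of_ge hA
  have hL0 : 0 ≤ Real.log (1 + Real.exp (-(W.c * A))) / W.c := by
    have := Real.exp_pos (-(W.c * A))
    have := Real.log_nonneg (by linarith : 1 ≤ 1 + Real.exp (-(W.c * A)))
    positivity
  set q := Real.log (1 + Real.exp (-(W.c * A))) / W.c with hq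
  have k1 : Real.exp (W.c * u) * (W.Z (Real.exp (W.c * u) / W.c) v ^ (-W.s)
      / W.τ (Real.exp (W.c * u) / W.c) v) ≤ (1 + q) ^ W.s * |u| ^ (-W.s) := by
    have e1 : Real.exp (W.c * u) / W.τ (Real.exp (W.c * u) / W.c) v ≤ 1 := by
      rw [div_le_one hτ]
      unfold τ; rw [h.cU_eq]; have := Real.exp_pos (-(W.c * v)); linarith
    have e2 : |u| ≤ W.Z (Real.exp (W.c * u) / W.c) v * (1 + q) := by
      rw [abs_of_neg hu]; nlinarith [h.good.v₀_ge]
    have e3 : W.Z (Real.exp (W.c * u) / W.c) v ^ (-W.s) ≤ (1 + q) ^ W.s * |u| ^ (-W.s) := by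
      have := Real.rpow_le_rpow hup.le e2 hs.le
      rw [Real.mul_rpow (by linarith) (by linarith)] at this
      rw [Real.rpow_neg (by linarith), Real.rpow_neg hup.le, ← div_eq_mul_inv,
        le_div_iff₀ (by positivity), inv_mul_le_iff₀ (by positivity)]
      exact this
    calc _ = (Real.exp (W.c * u) / W.τ (Real.exp (W.c * u) / W.c) v)
          * W.Z (Real.exp (W.c * u) / W.c) v ^ (-W.s) := by ring
      _ ≤ 1 * W.Z (Real.exp (W.c * u) / W.c) v ^ (-W.s) := by gcongr
      _ ≤ _ := by rw [one_mul]; exact e3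
  have k2 : Real.exp (W.c * u) * (W.c * W.B) ≤ W.c * W.B * (W.s / W.c) ^ W.s * |u| ^ (-W.s) := by
    have e := rpow_le_exp hc hs hup
    have e2 : Real.exp (W.c * u) = Real.exp (-(W.c * |u|)) := by rw [abs_of_neg hu]; ring_nf
    calc Real.exp (W.c * u) * (W.c * W.B) = W.c * W.B * Real.exp (-(W.c * |u|)) := by
          rw [e2]; ring
      _ ≤ W.c * W.B * ((W.s / W.c) ^ W.s * |u| ^ (-W.s)) := by gcongr
      _ = _ := by ring
  unfold p
  rw [mul_add, add_mul]
  exact add_le_add k1 k2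

end uv

end Weight

/-! ### Continuity of the weights and the integral inequalities for the majorants. -/

namespace Weight

variable {W : Weight} {Us : ℝ} (h : ∀ U ∈ Icc 0 Us, ∀ v ∈ Ici (1 : ℝ), W.Point U v)

include h

omit h in
lemma continuousOn_τ : ContinuousOn (fun p : ℝ × ℝ => W.τ p.1 p.2) (Icc 0 Us ×ˢ Ici 1) := by
  unfold τ; fun_prop

lemma continuousOn_y : ContinuousOn (fun p : ℝ × ℝ => W.y p.1 p.2) (Icc 0 Us ×ˢ Ici 1) := by
  have := continuousOn_τ (W := W) (Us := Us)
  unfold y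
  exact (by fun_prop : Continuous fun p : ℝ × ℝ => W.c * p.1).continuousOn.div this fun p hp =>
    ((h _ hp.1 _ hp.2).good.τ_pos hp.1.1).ne'

lemma continuousOn_Z : ContinuousOn (fun p : ℝ × ℝ => W.Z p.1 p.2) (Icc 0 Us ×ˢ Ici 1) := by
  have := continuousOn_τ.log fun p hp => ((h _ hp.1 _ hp.2).good.τ_pos hp.1.1).ne'
  unfold Z
  exact continuousOn_const.sub (this.div_const _)

lemma continuousOn_Z_rpow (q : ℝ) :
    ContinuousOn (fun p : ℝ × ℝ => W.Z p.1 p.2 ^ q) (Icc 0 Us ×ˢ Ici 1) :=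
  (continuousOn_Z h).rpow_const fun _ hp =>
    Or.inl ((h _ hp.1 _ hp.2).good.Z_pos hp.1.1 (h _ hp.1 _ hp.2).hτ).ne'

lemma continuousOn_ey : ContinuousOn (fun p : ℝ × ℝ => W.ey p.1 p.2) (Icc 0 Us ×ˢ Ici 1) :=
  ((continuousOn_y h).const_mul W.l).rexp

lemma continuousOn_p : ContinuousOn (fun p : ℝ × ℝ => W.p p.1 p.2) (Icc 0 Us ×ˢ Ici 1) :=
  ((continuousOn_Z_rpow h _).div continuousOn_τ fun _ hp =>
    ((h _ hp.1 _ hp.2).good.τ_pos hp.1.1).ne').add continuousOn_const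

omit h in
lemma continuousOn_snd_rpow (a q : ℝ) (ha : 0 ≤ a) :
    ContinuousOn (fun p : ℝ × ℝ => (p.2 + a) ^ q) (Icc 0 Us ×ˢ Ici 1) :=
  (by fun_prop : Continuous fun p : ℝ × ℝ => p.2 + a).continuousOn.rpow_const fun p hp =>
    Or.inl (by have : (1 : ℝ) ≤ p.2 := hp.2; linarith : p.2 + a ≠ 0)

omit h in
lemma continuousOn_snd_rpow' (q : ℝ) :
    ContinuousOn (fun p : ℝ × ℝ => p.2 ^ q) (Icc 0 Us ×ˢ Ici 1) := by
  simpa using continuousOn_snd_rpow (Us := Us) 0 q le_rfl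

omit h in
lemma continuousOn_G : ContinuousOn (fun p : ℝ × ℝ => W.G p.2) (Icc 0 Us ×ˢ Ici 1) :=
  (((continuousOn_snd_rpow' _).const_mul W.L).neg).rexp

lemma continuousOn_A : ContinuousOn (fun p : ℝ × ℝ => W.A p.1 p.2) (Icc 0 Us ×ˢ Ici 1) :=
  ((continuousOn_G.const_mul W.a).mul (continuousOn_ey h)).mul (continuousOn_p h)

lemma continuousOn_w : ContinuousOn (fun p : ℝ × ℝ => W.w p.1 p.2) (Icc 0 Us ×ˢ Ici 1) := by
  have hy := continuousOn_y h
  have hy1 : ContinuousOn (fun p : ℝ × ℝ => 1 - W.y p.1 p.2) (Icc 0 Us ×ˢ Ici 1) :=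
    continuousOn_const.sub hy
  have hp := continuousOn_p h
  have he := continuousOn_ey h
  have hg : ContinuousOn (fun p : ℝ × ℝ => W.g p.1 p.2) (Icc 0 Us ×ˢ Ici 1) :=
    hy1.div continuousOn_τ fun p hp => ((h _ hp.1 _ hp.2).good.τ_pos hp.1.1).ne'
  have hvs := continuousOn_snd_rpow' (Us := Us) (-W.s)
  refine ContinuousOn.inf (f := fun p : ℝ × ℝ => W.wA p.1 p.2) (g := fun p : ℝ × ℝ => W.wB p.1 p.2)
    ?_ ?_
  · refine ((continuousOn_G.const_mul W.a).mul he).mul (((((hg.const_mul (W.c / 2))).mul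
      (continuousOn_Z_rpow h _)).add (((hy.mul hy1).const_mul (W.l * W.c)).mul hp)).add
      ((hvs.const_mul (W.L * (W.s - 1))).mul hp))
  · by_cases h0 : (Icc 0 Us ×ˢ Ici (1 : ℝ) : Set (ℝ × ℝ)).Nonempty
    · obtain ⟨p, hp0⟩ := h0
      have hv0 : 0 ≤ W.v₀ := by linarith [(h _ hp0.1 _ hp0.2).good.v₀_ge]
      exact (continuousOn_snd_rpow W.v₀ (-W.s) hv0).mul
        (((hg.const_mul (W.l * W.c)).mul he).add (hp.const_mul W.L))
    · rw [not_nonempty_iff_eq_empty.mp h0]; exact continuousOn_empty _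

variable {U v : ℝ} (hU : U ∈ Icc 0 Us) (hv : v ∈ Ici (1 : ℝ))

include hU hv

lemma integral_w_right_le : ∫ y in (1 : ℝ)..v, W.w U y ≤ W.A U v - W.A U 1 := by
  have hd : ∀ x ∈ Icc 1 v, HasDerivAt (fun x => W.A U x) (W.dA U x) x := fun x hx =>
    (h U hU x hx.1).good.hasDerivAt_A hU.1 hx.1
      ((h U hU x hx.1).good.Z_pos hU.1 (h U hU x hx.1).hτ)
  refine intervalIntegral.integral_le_sub_of_hasDeriv_right_of_le hv
    (fun x hx => (hd x hx).continuousAt.continuousWithinAt)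
    (fun x hx => (hd x ⟨hx.1.le, hx.2.le⟩).hasDerivWithinAt) ?_
    fun x hx => (min_le_left _ _).trans
      ((h U hU x hx.1.le).good.wA_le_dA hU.1 (h U hU x hx.1.le).hτ)
  exact ((continuousOn_w h).comp (by fun_prop : Continuous fun y : ℝ => (U, y)).continuousOn
    fun y hy => ⟨hU, hy.1⟩).integrableOn_Icc

lemma integral_w_left_le : ∫ x in (0 : ℝ)..U, W.w x v ≤ W.Bv U v := by
  have hx' : ∀ x ∈ Icc 0 U, x ∈ Icc 0 Us := fun x hx => ⟨hx.1, hx.2.trans hU.2⟩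
  have hd : ∀ x ∈ Icc 0 U, HasDerivAt (fun x => W.Bv x v) (W.wB x v) x := fun x hx =>
    (h x (hx' x hx) v hv).good.hasDerivAt_Bv hx.1
      ((h x (hx' x hx) v hv).good.Z_pos hx.1 (h x (hx' x hx) v hv).hτ)
  have h0 := (h 0 ⟨le_rfl, hU.1.trans hU.2⟩ v hv).Bv_nonneg
  have : ∫ x in (0 : ℝ)..U, W.w x v ≤ W.Bv U v - W.Bv 0 v := by
    refine intervalIntegral.integral_le_sub_of_hasDeriv_right_of_le hU.1
      (fun x hx => (hd x hx).continuousAt.continuousWithinAt)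
      (fun x hx => (hd x ⟨hx.1.le, hx.2.le⟩).hasDerivWithinAt) ?_
      fun x hx => min_le_right _ _
    exact ((continuousOn_w h).comp (by fun_prop : Continuous fun x : ℝ => (x, v)).continuousOn
      fun y hy => ⟨hx' y hy, hv⟩).integrableOn_Icc
  linarith

/-- ∂_UΨ is A plus the derivative of e^{ly}, which has a favourable sign. -/
lemma integral_A_left_le : ∫ x in (0 : ℝ)..U, W.A x v ≤ W.Ψ U v := by
  have hx' : ∀ x ∈ Icc 0 U, x ∈ Icc 0 Us := fun x hx => ⟨hx.1, hx.2.trans hU.2⟩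
  have hd : ∀ x ∈ Icc 0 U, HasDerivAt (fun x => W.Ψ x v)
      (W.A x v + W.a * W.G v * (W.l * W.c * W.g x v * W.ey x v) * W.P x v) x := fun x hx =>
    (h x (hx' x hx) v hv).good.hasDerivAt_Ψ hx.1
      ((h x (hx' x hx) v hv).good.Z_pos hx.1 (h x (hx' x hx) v hv).hτ)
  have h0 := (h 0 ⟨le_rfl, hU.1.trans hU.2⟩ v hv).Ψ_nonneg
  have : ∫ x in (0 : ℝ)..U, W.A x v ≤ W.Ψ U v - W.Ψ 0 v := by
    refine intervalIntegral.integral_le_sub_of_hasDeriv_right_of_le hU.1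
      (fun x hx => (hd x hx).continuousAt.continuousWithinAt)
      (fun x hx => (hd x ⟨hx.1.le, hx.2.le⟩).hasDerivWithinAt) ?_
      fun x hx => ?_
    · exact ((continuousOn_A h).comp (by fun_prop : Continuous fun x : ℝ => (x, v)).continuousOn
        fun y hy => ⟨hx' y hy, hv⟩).integrableOn_Icc
    · have hpt := h x (hx' x ⟨hx.1.le, hx.2.le⟩) v hv
      have hW := hpt.good
      have k1 := hW.a_pos
      have k2 := G_pos (W := W) (v := v)
      have k3 := hW.ey_ge hpt.hU (v := v)
      have k4 := hW.g_pos hpt.hU (v := v)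
      have k5 := hW.P_nonneg hpt.hU hpt.hτ
      have k6 := hW.c_pos
      have k7 := hW.l_pos
      have : 0 ≤ W.a * W.G v * (W.l * W.c * W.g x v * W.ey x v) * W.P x v := by positivity
      linarith
  linarith

end Weight

/-! ### Lipschitz bounds for the nonlinearity -/

/-- The quantities of which the right-hand sides of the wave equations are functions: `Ω²`, `r`,
and the first derivatives of `r` and `φ`. -/
structure Jet where
  o : ℝ
  r : ℝ
  ru : ℝ
  rv : ℝ
  fu : ℝ
  fv : ℝ

namespace Jet

/-- The right-hand side of the wave equation for `r`. -/
def rhs₁ (e : ℝ) (j : Jet) : ℝ :=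
  -(j.o / (4 * j.r)) - j.ru * j.rv / j.r + j.o * e ^ 2 / (4 * j.r ^ 3)

/-- The right-hand side of the wave equation for `φ`. -/
def rhs₂ (j : Jet) : ℝ := -(j.rv * j.fu / j.r) - j.ru * j.fv / j.r

/-- The right-hand side of the wave equation for `log Ω`. -/
def rhs₃ (e : ℝ) (j : Jet) : ℝ :=
  -(j.fu * j.fv) - j.o * e ^ 2 / (2 * j.r ^ 4) + j.o / (4 * j.r ^ 2) + j.ru * j.rv / j.r ^ 2

def rhs (e : ℝ) (j : Jet) : ℝ × ℝ × ℝ := (j.rhs₁ e, j.rhs₂, j.rhs₃ e)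

/-- Bounds on a jet. -/
structure Bdd (m δ α β : ℝ) (j : Jet) : Prop where
  r_pos : 0 < j.r
  inv_r : j.r⁻¹ ≤ m
  o : |j.o| ≤ 16 * δ
  ru : |j.ru| ≤ α
  fu : |j.fu| ≤ α
  rv : |j.rv| ≤ β
  fv : |j.fv| ≤ β

/-- Bounds on the difference of two jets. -/
structure Near (δ d da db : ℝ) (i j : Jet) : Prop where
  r : |i.r - j.r| ≤ d
  o : |i.o - j.o| ≤ 16 * δ * d
  ru : |i.ru - j.ru| ≤ da
  fu : |i.fu - j.fu| ≤ da
  rv : |i.rv - j.rv| ≤ db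
  fv : |i.fv - j.fv| ≤ db

lemma abs_mul_sub_le {x y x' y' X Y dx dy : ℝ} (hx : |x| ≤ X) (hy : |y'| ≤ Y)
    (hdx : |x - x'| ≤ dx) (hdy : |y - y'| ≤ dy) : |x * y - x' * y'| ≤ X * dy + Y * dx := by
  have e : x * y - x' * y' = x * (y - y') + y' * (x - x') := by ring
  rw [e]
  refine (abs_add_le _ _).trans ?_
  rw [abs_mul, abs_mul]
  have := abs_nonneg x
  have := abs_nonneg y'
  gcongr
  · linarith
  · linarith

lemma abs_pow_inv_sub_le {m d x y : ℝ} (hx : 0 < x) (hy : 0 < y) (hxm : x⁻¹ ≤ m)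
    (hym : y⁻¹ ≤ m) (hd : |x - y| ≤ d) (n : ℕ) :
    |x⁻¹ ^ n - y⁻¹ ^ n| ≤ n * m ^ (n + 1) * d := by
  have hx' := inv_pos.mpr hx
  have hy' := inv_pos.mpr hy
  have hm : 0 < m := hx'.trans_le hxm
  have hd0 := (abs_nonneg _).trans hd
  have h1 : |x⁻¹ - y⁻¹| ≤ m ^ 2 * d := by
    have e : x⁻¹ - y⁻¹ = x⁻¹ * y⁻¹ * (y - x) := by field_simp
    rw [e, abs_mul, abs_of_pos (by positivity), abs_sub_comm, sq]
    gcongr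
  induction n with
  | zero => simp
  | succ n ih =>
    rw [pow_succ, pow_succ]
    have := abs_mul_sub_le (X := m ^ n) (Y := m) (by rw [abs_of_pos (by positivity)]; gcongr)
      (by rw [abs_of_pos hy']; exact hym) ih h1
    refine this.trans (le_of_eq ?_)
    push_cast; ring

variable {m δ α β d da db : ℝ} {i j : Jet}

lemma abs_pow_inv_le (hi : Bdd m δ α β i) (n : ℕ) : |i.r⁻¹ ^ n| ≤ m ^ n := by
  have := inv_pos.mpr hi.r_pos
  rw [abs_of_pos (by positivity)]
  gcongr
  exact hi.inv_r

lemma o_mul_le (hm : 1 ≤ m) (hδ : 0 ≤ δ) (hi : Bdd m δ α β i) (hj : Bdd m δ α β j)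
    (h : Near δ d da db i j) (n : ℕ) (hn : n ≤ 4) :
    |i.o * i.r⁻¹ ^ n - j.o * j.r⁻¹ ^ n| ≤ 80 * m ^ 5 * (δ * d) := by
  have hd := (abs_nonneg _).trans h.r
  have := abs_mul_sub_le hi.o (abs_pow_inv_le hj n) h.o
    (abs_pow_inv_sub_le hi.r_pos hj.r_pos hi.inv_r hj.inv_r h.r n)
  have k1 : m ^ (n + 1) ≤ m ^ 5 := pow_le_pow_right₀ hm (by omega)
  have k2 : m ^ n ≤ m ^ 5 := pow_le_pow_right₀ hm (by omega)
  have k3 : (n : ℝ) ≤ 4 := by exact_mod_cast hn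
  have k4 : (n : ℝ) * m ^ (n + 1) ≤ 4 * m ^ 5 := by gcongr
  calc _ ≤ 16 * δ * (n * m ^ (n + 1) * d) + m ^ n * (16 * δ * d) := this
    _ ≤ 16 * δ * (4 * m ^ 5 * d) + m ^ 5 * (16 * δ * d) := by gcongr
    _ = _ := by ring

lemma quad_le {x y x' y' : ℝ} (hm : 1 ≤ m) (hi : Bdd m δ α β i) (hj : Bdd m δ α β j)
    (h : Near δ d da db i j) (hx : |x| ≤ α) (hy' : |y'| ≤ β) (hy : |y| ≤ β)
    (hdx : |x - x'| ≤ da) (hdy : |y - y'| ≤ db) (n : ℕ) (hn : n ≤ 2) :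
    |x * y * i.r⁻¹ ^ n - x' * y' * j.r⁻¹ ^ n|
      ≤ 2 * m ^ 5 * (α * β * d + α * db + β * da) := by
  have hd := (abs_nonneg _).trans h.r
  have hα := (abs_nonneg _).trans hx
  have hβ := (abs_nonneg _).trans hy
  have hda := (abs_nonneg _).trans hdx
  have hdb := (abs_nonneg _).trans hdy
  have h1 := abs_mul_sub_le hx hy' hdx hdy
  have h2 : |x * y| ≤ α * β := by rw [abs_mul]; gcongr
  have := abs_mul_sub_le h2 (abs_pow_inv_le hj n) h1
    (abs_pow_inv_sub_le hi.r_pos hj.r_pos hi.inv_r hj.inv_r h.r n)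
  have k1 : m ^ (n + 1) ≤ m ^ 5 := pow_le_pow_right₀ hm (by omega)
  have k2 : m ^ n ≤ m ^ 5 := pow_le_pow_right₀ hm (by omega)
  have k3 : (n : ℝ) ≤ 2 := by exact_mod_cast hn
  have k4 : (n : ℝ) * m ^ (n + 1) ≤ 2 * m ^ 5 := by gcongr
  have k5 : 0 ≤ m ^ 5 * (α * db + β * da) := by positivity
  calc _ ≤ α * β * (n * m ^ (n + 1) * d) + m ^ n * (α * db + β * da) := this
    _ ≤ α * β * (2 * m ^ 5 * d) + m ^ 5 * (α * db + β * da) := by gcongr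
    _ ≤ _ := by linarith

/-- The constant in the Lipschitz bound for the nonlinearity. -/
def lipConst (e m : ℝ) : ℝ := 80 * (1 + e ^ 2) * m ^ 5

/-- The right-hand sides are combinations of Ω² r^{-n}, n ≤ 4, and of products of one u-derivative
with one v-derivative and r^{-n}, n ≤ 2. Hence the bound has a part with coefficient δ and a part in
which α and β enter bilinearly. -/
lemma norm_rhs_sub_le (e : ℝ) (hm : 1 ≤ m) (hδ : 0 ≤ δ) (hi : Bdd m δ α β i)
    (hj : Bdd m δ α β j) (h : Near δ d da db i j) :
    ‖i.rhs e - j.rhs e‖ ≤ lipConst e m * ((δ + α * β) * d + α * db + β * da) := by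
  have hd := (abs_nonneg _).trans h.r
  have hα := (abs_nonneg _).trans hi.ru
  have hβ := (abs_nonneg _).trans hi.rv
  have hda := (abs_nonneg _).trans h.ru
  have hdb := (abs_nonneg _).trans h.rv
  have hir := hi.r_pos.ne'
  have hjr := hj.r_pos.ne'
  set Q := α * β * d + α * db + β * da with hQ
  have hQ0 : 0 ≤ Q := by positivity
  have hδd : 0 ≤ δ * d := by positivity
  have hm5 : 0 < m ^ 5 := by positivity
  set X := m ^ 5 * (δ * d) with hX
  set Y := m ^ 5 * Q with hY
  have hX0 : 0 ≤ X := by positivity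
  have hY0 : 0 ≤ Y := by positivity
  have he : 0 ≤ e ^ 2 := sq_nonneg e
  have heX := mul_nonneg he hX0
  have heY := mul_nonneg he hY0
  have key : lipConst e m * ((δ + α * β) * d + α * db + β * da)
      = 80 * (1 + e ^ 2) * X + 80 * (1 + e ^ 2) * Y := by
    unfold lipConst; rw [hX, hY, hQ]; ring
  have o1 := abs_le.mp (o_mul_le hm hδ hi hj h 1 (by norm_num))
  have o2 := abs_le.mp (o_mul_le hm hδ hi hj h 2 (by norm_num))
  have o3 := abs_le.mp (o_mul_le hm hδ hi hj h 3 (by norm_num))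
  have o4 := abs_le.mp (o_mul_le hm hδ hi hj h 4 (by norm_num))
  have q1 := abs_le.mp (quad_le hm hi hj h hi.ru hj.rv hi.rv h.ru h.rv 1 (by norm_num))
  have q2 := abs_le.mp (quad_le hm hi hj h hi.ru hj.rv hi.rv h.ru h.rv 2 (by norm_num))
  have q3 := abs_le.mp (quad_le hm hi hj h hi.ru hj.fv hi.fv h.ru h.fv 1 (by norm_num))
  have q4 := abs_le.mp (quad_le hm hi hj h hi.fu hj.rv hi.rv h.fu h.rv 1 (by norm_num))
  have q5 := abs_le.mp (quad_le hm hi hj h hi.fu hj.fv hi.fv h.fu h.fv 0 (by norm_num))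
  rw [mul_assoc 80, ← hX] at o1 o2 o3 o4
  rw [mul_assoc 2, ← hQ, ← hY] at q1 q2 q3 q4 q5
  rw [key]
  simp only [rhs, Prod.mk_sub_mk]
  refine norm_prod_le_iff.mpr ⟨?_, norm_prod_le_iff.mpr ⟨?_, ?_⟩⟩
  · have e1 : i.rhs₁ e - j.rhs₁ e = -(1 / 4) * (i.o * i.r⁻¹ ^ 1 - j.o * j.r⁻¹ ^ 1)
        - (i.ru * i.rv * i.r⁻¹ ^ 1 - j.ru * j.rv * j.r⁻¹ ^ 1)
        + e ^ 2 / 4 * (i.o * i.r⁻¹ ^ 3 - j.o * j.r⁻¹ ^ 3) := by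
      unfold rhs₁; field_simp; ring
    simp only
    rw [e1, Real.norm_eq_abs, abs_le]
    have t1 := mul_le_mul_of_nonneg_left o3.1 he
    have t2 := mul_le_mul_of_nonneg_left o3.2 he
    constructor <;> linarith
  · have e2 : i.rhs₂ - j.rhs₂ = -(i.fu * i.rv * i.r⁻¹ ^ 1 - j.fu * j.rv * j.r⁻¹ ^ 1)
        - (i.ru * i.fv * i.r⁻¹ ^ 1 - j.ru * j.fv * j.r⁻¹ ^ 1) := by
      unfold rhs₂; field_simp; ring
    simp only
    rw [e2, Real.norm_eq_abs, abs_le]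
    constructor <;> linarith
  · have e3 : i.rhs₃ e - j.rhs₃ e = -(i.fu * i.fv * i.r⁻¹ ^ 0 - j.fu * j.fv * j.r⁻¹ ^ 0)
        - e ^ 2 / 2 * (i.o * i.r⁻¹ ^ 4 - j.o * j.r⁻¹ ^ 4)
        + 1 / 4 * (i.o * i.r⁻¹ ^ 2 - j.o * j.r⁻¹ ^ 2)
        + (i.ru * i.rv * i.r⁻¹ ^ 2 - j.ru * j.rv * j.r⁻¹ ^ 2) := by
      unfold rhs₃; field_simp; ring
    simp only
    rw [e3, Real.norm_eq_abs, abs_le]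
    have t1 := mul_le_mul_of_nonneg_left o4.1 he
    have t2 := mul_le_mul_of_nonneg_left o4.2 he
    constructor <;> linarith

end Jet

/-! ### Reissner–Nordström in the `(U, v)` coordinates -/

section RN

/-- `2 κ₊`. -/
def cc (M e : ℝ) : ℝ := 2 * kappaPlus M e

/-- `κ₊ / κ₋`. -/
def qq (M e : ℝ) : ℝ := kappaPlus M e / kappaMinus M e

/-- The derivative of `-r_RN` with respect to `ξ = exp (2 κ₊ (u + v))`, as a function of `r_RN`. -/
def hRN (M e r : ℝ) : ℝ :=
  Real.exp (-(cc M e * r)) * (r - rMinus M e) ^ (1 + qq M e) / (cc M e * r ^ 2)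

/-- `-(1 - 2M / r + e² / r²)`. -/
def fRN (M e r : ℝ) : ℝ := -1 + 2 * M / r - e ^ 2 / r ^ 2

/-- The logarithmic derivative of `hRN`. -/
def hLog (M e r : ℝ) : ℝ := -cc M e + (1 + qq M e) / (r - rMinus M e) - 2 / r

/-- `r_RN` as a function of `ξ = exp (2 κ₊ (u + v))`, with an affine continuation to `ξ < 0`. -/
def rho (M e ξ : ℝ) : ℝ :=
  if ξ ≤ 0 then rPlus M e - hRN M e (rPlus M e) * ξ else rRN M e (Real.log ξ / cc M e) 0

variable {M e : ℝ}

lemma rPlus_add_rMinus : rPlus M e + rMinus M e = 2 * M := by unfold rPlus rMinus; ring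

lemma rPlus_mul_rMinus (h1 : |e| < M) : rPlus M e * rMinus M e = e ^ 2 := by
  have hs : √(M ^ 2 - e ^ 2) ^ 2 = M ^ 2 - e ^ 2 :=
    Real.sq_sqrt (Real.sqrt_pos.mp (sqrt_pos' h1)).le
  unfold rPlus rMinus
  linear_combination -hs

lemma fRN_eq (h1 : |e| < M) {r : ℝ} (hr : r ≠ 0) :
    fRN M e r = (rPlus M e - r) * (r - rMinus M e) / r ^ 2 := by
  unfold fRN
  rw [← rPlus_mul_rMinus h1, ← rPlus_add_rMinus (e := e)]
  field_simp
  ring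

variable (h0 : 0 < |e|) (h1 : |e| < M)
include h0 h1

lemma rPlus_pos : 0 < rPlus M e := (rMinus_pos h0 h1).trans (rMinus_lt_rPlus h1)

lemma cc_pos : 0 < cc M e := by
  have := kappaPlus_pos h0 h1
  unfold cc; positivity

lemma cc_eq : cc M e = (rPlus M e - rMinus M e) / rPlus M e ^ 2 := by
  have := rPlus_pos h0 h1
  unfold cc kappaPlus; field_simp

lemma qq_pos : 0 < qq M e := div_pos (kappaPlus_pos h0 h1) (kappaMinus_pos h0 h1)

lemma qq_eq : qq M e = rMinus M e ^ 2 / rPlus M e ^ 2 := by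
  have := rPlus_pos h0 h1
  have := rMinus_pos h0 h1
  have := sub_pos.mpr (rMinus_lt_rPlus h1)
  unfold qq kappaPlus kappaMinus; field_simp

lemma qq_lt_one : qq M e < 1 := by
  have := rPlus_pos h0 h1
  have := rMinus_pos h0 h1
  have := rMinus_lt_rPlus h1
  rw [qq_eq h0 h1, div_lt_one (by positivity)]
  gcongr

lemma rStar_eq (r : ℝ) : rStar M e r
    = r + 1 / cc M e * Real.log (rPlus M e - r)
      - qq M e / cc M e * Real.log (r - rMinus M e) := by
  have h2 := rPlus_pos h0 h1
  have h3 := rMinus_pos h0 h1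
  have h4 := sub_pos.mpr (rMinus_lt_rPlus h1)
  unfold rStar
  rw [coeff_plus h1, coeff_minus h1, cc_eq h0 h1, qq_eq h0 h1]
  field_simp
  ring

lemma rStar_strictAntiOn : StrictAntiOn (rStar M e) (Ioo (rMinus M e) (rPlus M e)) := by
  refine strictAntiOn_of_deriv_neg (convex_Ioo _ _)
    (fun r hr => (hasDerivAt_rStar h1 hr).continuousAt.continuousWithinAt) ?_
  intro r hr
  rw [interior_Ioo] at hr
  rw [(hasDerivAt_rStar h1 hr).deriv]
  have a1 := sub_pos.mpr hr.1
  have a2 := sub_pos.mpr hr.2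
  have a3 : 0 < r := (rMinus_pos h0 h1).trans hr.1
  have : 0 < r ^ 2 / ((rPlus M e - r) * (r - rMinus M e)) := by positivity
  linarith

lemma rRN_mem (x : ℝ) : rRN M e x 0 ∈ Ioo (rMinus M e) (rPlus M e) := (rRN_spec h0 h1 x 0).1

lemma rStar_rRN (x : ℝ) : rStar M e (rRN M e x 0) = x := by
  have := (rRN_spec h0 h1 x 0).2
  rwa [add_zero] at this

lemma rRN_surj {r : ℝ} (hr : r ∈ Ioo (rMinus M e) (rPlus M e)) :
    rRN M e (rStar M e r) 0 = r :=
  (rStar_strictAntiOn h0 h1).injOn (rRN_mem h0 h1 _) hr (rStar_rRN h0 h1 _)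

lemma rRN_antitone : Antitone fun x => rRN M e x 0 := by
  intro x y hxy
  by_contra! hlt
  have := rStar_strictAntiOn h0 h1 (rRN_mem h0 h1 x) (rRN_mem h0 h1 y) hlt
  rw [rStar_rRN h0 h1, rStar_rRN h0 h1] at this
  linarith

lemma continuous_rRN : Continuous fun x => rRN M e x 0 := by
  rw [continuous_iff_continuousAt]
  intro x
  have hm : Monotone fun x => -rRN M e x 0 := fun a b hab => neg_le_neg (rRN_antitone h0 h1 hab)
  have : ContinuousAt (fun x => -rRN M e x 0) x := by
    refine continuousAt_of_monotoneOn_of_image_mem_nhds (hm.monotoneOn univ) univ_mem ?_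
    refine mem_of_superset (Ioo_mem_nhds (a := -rPlus M e) (b := -rMinus M e) ?_ ?_) ?_
    · exact neg_lt_neg (rRN_mem h0 h1 x).2
    · exact neg_lt_neg (rRN_mem h0 h1 x).1
    · intro y hy
      refine ⟨rStar M e (-y), mem_univ _, ?_⟩
      change -rRN M e (rStar M e (-y)) 0 = y
      rw [rRN_surj h0 h1 ⟨by linarith [hy.2], by linarith [hy.1]⟩, neg_neg]
  have h2 : ContinuousAt (fun x => -(-rRN M e x 0)) x := this.neg
  simpa only [neg_neg] using h2

lemma hasDerivAt_rRN (x : ℝ) :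
    HasDerivAt (fun x => rRN M e x 0) (-fRN M e (rRN M e x 0)) x := by
  have hr := rRN_mem h0 h1 x
  have a1 := sub_pos.mpr hr.1
  have a2 := sub_pos.mpr hr.2
  have a3 : 0 < rRN M e x 0 := (rMinus_pos h0 h1).trans hr.1
  have := HasDerivAt.of_local_left_inverse (continuous_rRN h0 h1).continuousAt
    (hasDerivAt_rStar h1 hr) (by
      have : 0 < rRN M e x 0 ^ 2 / ((rPlus M e - rRN M e x 0) * (rRN M e x 0 - rMinus M e)) := by
        positivity
      linarith) (Eventually.of_forall fun y => rStar_rRN h0 h1 y)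
  refine this.congr_deriv ?_
  rw [fRN_eq h1 a3.ne', inv_neg, inv_div]

/-- The relation r*(r) = x, exponentiated and solved for the factor that vanishes at the event
horizon; it shows that ξ = e^{cx} is a regular parameter there. -/
lemma rPlus_sub_rRN (x : ℝ) : rPlus M e - rRN M e x 0
    = Real.exp (cc M e * x) * Real.exp (-(cc M e * rRN M e x 0))
      * (rRN M e x 0 - rMinus M e) ^ qq M e := by
  have hr := rRN_mem h0 h1 x
  have a1 := sub_pos.mpr hr.1
  have a2 := sub_pos.mpr hr.2
  have hc := cc_pos h0 h1
  have k := rStar_rRN h0 h1 x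
  rw [rStar_eq h0 h1] at k
  have k2 : Real.log (rPlus M e - rRN M e x 0)
      = cc M e * x + -(cc M e * rRN M e x 0)
        + Real.log (rRN M e x 0 - rMinus M e) * qq M e := by
    have := congrArg (fun t => cc M e * t) k
    field_simp at this
    linarith
  rw [← Real.exp_log a2, k2, Real.exp_add, Real.exp_add, Real.rpow_def_of_pos a1]

lemma fRN_rRN (x : ℝ) : fRN M e (rRN M e x 0)
    = cc M e * Real.exp (cc M e * x) * hRN M e (rRN M e x 0) := by
  have hr := rRN_mem h0 h1 x
  have a1 := sub_pos.mpr hr.1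
  have a3 : 0 < rRN M e x 0 := (rMinus_pos h0 h1).trans hr.1
  have hc := cc_pos h0 h1
  rw [fRN_eq h1 a3.ne', rPlus_sub_rRN h0 h1 x]
  unfold hRN
  rw [add_comm 1 (qq M e), Real.rpow_add_one a1.ne']
  field_simp

lemma hRN_pos {r : ℝ} (hr : rMinus M e < r) : 0 < hRN M e r := by
  have a1 := sub_pos.mpr hr
  have a3 : 0 < r := (rMinus_pos h0 h1).trans hr
  have hc := cc_pos h0 h1
  unfold hRN; positivity

lemma hasDerivAt_hRN {r : ℝ} (hr : rMinus M e < r) :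
    HasDerivAt (hRN M e) (hRN M e r * hLog M e r) r := by
  have a1 := sub_pos.mpr hr
  have a3 : 0 < r := (rMinus_pos h0 h1).trans hr
  have hc := cc_pos h0 h1
  have d1 : HasDerivAt (fun r => Real.exp (-(cc M e * r)))
      (Real.exp (-(cc M e * r)) * (-cc M e)) r := by
    have : HasDerivAt (fun x => -(cc M e * x)) (-cc M e) r :=
      ((hasDerivAt_id r).const_mul (cc M e)).neg.congr_deriv (by ring)
    exact this.exp
  have d2 : HasDerivAt (fun r => (r - rMinus M e) ^ (1 + qq M e))
      (1 * (1 + qq M e) * (r - rMinus M e) ^ (1 + qq M e - 1)) r :=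
    ((hasDerivAt_id r).sub_const _).rpow_const (Or.inl a1.ne')
  have d3 : HasDerivAt (fun r => cc M e * r ^ 2) (cc M e * (2 * r)) r := by
    simpa using (hasDerivAt_pow 2 r).const_mul (cc M e)
  refine ((d1.mul d2).div d3 (by positivity)).congr_deriv ?_
  simp only [Pi.mul_apply]
  unfold hRN hLog
  rw [Real.rpow_sub_one a1.ne']
  field_simp

/-! #### The function `rho` -/

omit h0 h1 in
lemma rho_of_pos {ξ : ℝ} (hξ : 0 < ξ) : rho M e ξ = rRN M e (Real.log ξ / cc M e) 0 :=
  if_neg hξ.not_ge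

omit h0 h1 in
lemma rho_zero : rho M e 0 = rPlus M e := by simp [rho]

lemma rho_exp (x : ℝ) : rho M e (Real.exp (cc M e * x)) = rRN M e x 0 := by
  rw [rho_of_pos (Real.exp_pos _), Real.log_exp, mul_div_cancel_left₀ _ (cc_pos h0 h1).ne']

lemma rho_mem {ξ : ℝ} (hξ : 0 ≤ ξ) : rho M e ξ ∈ Ioc (rMinus M e) (rPlus M e) := by
  rcases hξ.eq_or_lt with h | h
  · rw [← h, rho_zero]; exact ⟨rMinus_lt_rPlus h1, le_rfl⟩
  · rw [rho_of_pos h]; exact Ioo_subset_Ioc_self (rRN_mem h0 h1 _)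

lemma rPlus_sub_rho {ξ : ℝ} (hξ : 0 ≤ ξ) : rPlus M e - rho M e ξ
    = ξ * Real.exp (-(cc M e * rho M e ξ)) * (rho M e ξ - rMinus M e) ^ qq M e := by
  rcases hξ.eq_or_lt with h | h
  · rw [← h, rho_zero]; simp
  · have := rPlus_sub_rRN h0 h1 (Real.log ξ / cc M e)
    rw [mul_div_cancel₀ _ (cc_pos h0 h1).ne', Real.exp_log h] at this
    rw [rho_of_pos h]; exact this

lemma fRN_rho {ξ : ℝ} (hξ : 0 ≤ ξ) : fRN M e (rho M e ξ) = cc M e * ξ * hRN M e (rho M e ξ) := by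
  rcases hξ.eq_or_lt with h | h
  · rw [← h, rho_zero, fRN_eq h1 (rPlus_pos h0 h1).ne']; simp
  · have := fRN_rRN h0 h1 (Real.log ξ / cc M e)
    rw [mul_div_cancel₀ _ (cc_pos h0 h1).ne', Real.exp_log h] at this
    rw [rho_of_pos h]; exact this

/-- For ξ > 0 this is the chain rule. At ξ = 0 the right derivative is the limit of the derivatives,
and the affine continuation to ξ < 0 is made to have the same slope, so that two-sided derivatives
are available on the horizon. -/
lemma hasDerivAt_rho {ξ : ℝ} (hξ : 0 ≤ ξ) :
    HasDerivAt (rho M e) (-hRN M e (rho M e ξ)) ξ := by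
  have hc := cc_pos h0 h1
  have hpos : ∀ ξ > 0, HasDerivAt (rho M e) (-hRN M e (rho M e ξ)) ξ := by
    intro ξ h
    have d1 : HasDerivAt (fun x => Real.log x / cc M e) (ξ⁻¹ / cc M e) ξ :=
      (Real.hasDerivAt_log h.ne').div_const _
    have d2 := (hasDerivAt_rRN h0 h1 (Real.log ξ / cc M e)).comp ξ d1
    refine (d2.congr_of_eventuallyEq ?_).congr_deriv ?_
    · filter_upwards [lt_mem_nhds h] with x hx
      exact rho_of_pos hx
    · have := fRN_rho h0 h1 h.le
      rw [← rho_of_pos h, this]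
      field_simp
  rcases hξ.eq_or_lt with h | h
  swap
  · exact hpos ξ h
  rw [← h]
  have hcont : Tendsto (rho M e) (𝓝[>] 0) (𝓝 (rPlus M e)) := by
    have t1 : Tendsto (fun ξ : ℝ => rPlus M e - ξ * (rPlus M e - rMinus M e) ^ qq M e) (𝓝[>] 0)
        (𝓝 (rPlus M e)) := by
      have : Continuous fun ξ : ℝ => rPlus M e - ξ * (rPlus M e - rMinus M e) ^ qq M e := by
        fun_prop
      have := (this.tendsto 0).mono_left (nhdsWithin_le_nhds (s := Ioi 0))
      simpa using this
    refine tendsto_of_tendsto_of_tendsto_of_le_of_le' t1 tendsto_const_nhds ?_ ?_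
    · filter_upwards [self_mem_nhdsWithin] with ξ hξ
      have hξ : 0 < ξ := hξ
      have k := rPlus_sub_rho h0 h1 hξ.le
      have hm := rho_mem h0 h1 hξ.le
      have a1 := sub_pos.mpr hm.1
      have a3 : 0 < rho M e ξ := (rMinus_pos h0 h1).trans hm.1
      have k1 : Real.exp (-(cc M e * rho M e ξ)) ≤ 1 := by
        rw [Real.exp_le_one_iff]; have := mul_pos hc a3; linarith
      have k2 : (rho M e ξ - rMinus M e) ^ qq M e ≤ (rPlus M e - rMinus M e) ^ qq M e :=
        Real.rpow_le_rpow a1.le (by linarith [hm.2]) (qq_pos h0 h1).le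
      have : ξ * Real.exp (-(cc M e * rho M e ξ)) * (rho M e ξ - rMinus M e) ^ qq M e
          ≤ ξ * 1 * (rPlus M e - rMinus M e) ^ qq M e := by gcongr
      linarith
    · filter_upwards [self_mem_nhdsWithin] with ξ hξ
      exact (rho_mem h0 h1 (le_of_lt hξ)).2
  have hr : HasDerivWithinAt (rho M e) (-hRN M e (rPlus M e)) (Ici 0) 0 := by
    refine hasDerivWithinAt_Ici_of_tendsto_deriv (s := Ioi 0)
      (fun x hx => (hpos x hx).differentiableAt.differentiableWithinAt) ?_
      self_mem_nhdsWithin ?_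
    · unfold ContinuousWithinAt; rw [rho_zero]; exact hcont
    · have k := ((hasDerivAt_hRN h0 h1 (rMinus_lt_rPlus h1)).continuousAt.tendsto.comp hcont).neg
      refine k.congr' ?_
      filter_upwards [self_mem_nhdsWithin] with x hx
      exact (hpos x hx).deriv.symm
  have hl : HasDerivWithinAt (rho M e) (-hRN M e (rPlus M e)) (Iic 0) 0 := by
    have : HasDerivAt (fun ξ => rPlus M e - hRN M e (rPlus M e) * ξ)
        (-hRN M e (rPlus M e)) 0 :=
      (((hasDerivAt_id (0 : ℝ)).const_mul (hRN M e (rPlus M e))).const_sub _).congr_deriv (by ring)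
    refine this.hasDerivWithinAt.congr (fun x hx => if_pos hx) (if_pos le_rfl)
  have := hl.union hr
  rw [Iic_union_Ici, hasDerivWithinAt_univ] at this
  rwa [rho_zero]

lemma exists_le_hRN (Ξ : ℝ) : ∃ m > 0, ∀ ξ, 0 ≤ ξ → ξ ≤ Ξ → m ≤ hRN M e (rho M e ξ) := by
  rcases lt_or_ge Ξ 0 with h | h
  · exact ⟨1, one_pos, fun ξ h2 h3 => by linarith⟩
  have hcont : ContinuousOn (fun ξ => hRN M e (rho M e ξ)) (Icc 0 Ξ) := fun ξ hξ =>
    ((hasDerivAt_hRN h0 h1 (rho_mem h0 h1 hξ.1).1).continuousAt.comp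
      (hasDerivAt_rho h0 h1 hξ.1).continuousAt).continuousWithinAt
  obtain ⟨x, hx, hmin⟩ := isCompact_Icc.exists_isMinOn (nonempty_Icc.mpr h) hcont
  exact ⟨_, hRN_pos h0 h1 (rho_mem h0 h1 hx.1).1, fun ξ h2 h3 => hmin ⟨h2, h3⟩⟩

/-- Here κ₊ < κ₋ enters. The relation for r₊ − ρ bounds (1+ξ)(ρ − r₋)^q, so `hRN` decays like
(1+ξ)^{-p} with p = 1 + 1/q. Since q < 1, p exceeds 2, and the excess p − 2 absorbs any power of the
logarithm. -/
lemma exists_hRN_le {s : ℝ} (hs : 0 < s + 1) : ∃ C > 0, ∀ ξ, 0 ≤ ξ →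
    hRN M e (rho M e ξ) * (1 + Real.log (1 + ξ) / cc M e) ^ (s + 1) * (1 + ξ) ^ 2 ≤ C := by
  have hc := cc_pos h0 h1
  have hq := qq_pos h0 h1
  have hq1 := qq_lt_one h0 h1
  have hm := rMinus_pos h0 h1
  have hd := sub_pos.mpr (rMinus_lt_rPlus h1)
  set c := cc M e with hcdef
  set q := qq M e with hqdef
  set C₁ := (rPlus M e - rMinus M e) * Real.exp (c * rPlus M e) with hC₁
  set C₃ := C₁ + (rPlus M e - rMinus M e) ^ q with hC₃
  have hC₃p : 0 < C₃ := by positivity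
  set p := 1 + 1 / q with hp
  have hp2 : 0 < p - 2 := by
    have : 1 < 1 / q := by rw [lt_div_iff₀ hq]; linarith
    rw [hp]; linarith
  set δ := (p - 2) / (s + 1) with hδ
  have hδp : 0 < δ := by positivity
  refine ⟨C₃ ^ p / (c * rMinus M e ^ 2) * (1 + 1 / (c * δ)) ^ (s + 1), by positivity,
    fun ξ hξ => ?_⟩
  have hr := rho_mem h0 h1 hξ
  set r := rho M e ξ with hrdef
  have a1 := sub_pos.mpr hr.1
  have a3 : 0 < r := hm.trans hr.1
  have hξ1 : 0 < 1 + ξ := by linarith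
  have k1 : (1 + ξ) * (r - rMinus M e) ^ q ≤ C₃ := by
    have e1 : ξ * (r - rMinus M e) ^ q = (rPlus M e - r) * Real.exp (c * r) := by
      rw [rPlus_sub_rho h0 h1 hξ, Real.exp_neg, ← hrdef, ← hcdef, ← hqdef]
      field_simp
    have e2 : (rPlus M e - r) * Real.exp (c * r) ≤ C₁ := by
      rw [hC₁]
      have := hr.1
      have := hr.2
      gcongr
    have e3 : (r - rMinus M e) ^ q ≤ (rPlus M e - rMinus M e) ^ q :=
      Real.rpow_le_rpow a1.le (by linarith [hr.2]) hq.le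
    rw [add_mul, one_mul, e1, hC₃]; linarith
  have k2 : (r - rMinus M e) ^ (1 + q) ≤ C₃ ^ p / (1 + ξ) ^ p := by
    rw [← Real.div_rpow hC₃p.le hξ1.le]
    have e : (r - rMinus M e) ^ (1 + q) = ((r - rMinus M e) ^ q) ^ p := by
      rw [← Real.rpow_mul a1.le]; congr 1; rw [hp]; field_simp; ring
    rw [e]
    refine Real.rpow_le_rpow (by positivity) ?_ (by positivity)
    rw [le_div_iff₀ hξ1]; linarith
  have k3 : hRN M e r ≤ C₃ ^ p / (1 + ξ) ^ p / (c * rMinus M e ^ 2) := by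
    unfold hRN
    have e1 : Real.exp (-(c * r)) ≤ 1 := by
      rw [Real.exp_le_one_iff]; have := mul_pos hc a3; linarith
    have := hr.1
    calc Real.exp (-(c * r)) * (r - rMinus M e) ^ (1 + q) / (c * r ^ 2)
        ≤ 1 * (C₃ ^ p / (1 + ξ) ^ p) / (c * rMinus M e ^ 2) := by gcongr
      _ = _ := by rw [one_mul]
  have k4 : (1 + Real.log (1 + ξ) / c) ^ (s + 1)
      ≤ (1 + 1 / (c * δ)) ^ (s + 1) * (1 + ξ) ^ (p - 2) := by
    have e1 := Real.log_le_rpow_div hξ1.le hδp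
    have e2 : 1 ≤ (1 + ξ) ^ δ := Real.one_le_rpow (by linarith) hδp.le
    have e3 := Real.log_nonneg (by linarith : 1 ≤ 1 + ξ)
    have e4 : 1 + Real.log (1 + ξ) / c ≤ (1 + 1 / (c * δ)) * (1 + ξ) ^ δ := by
      have : Real.log (1 + ξ) / c ≤ (1 + ξ) ^ δ / δ / c := by gcongr
      have e5 : (1 + ξ) ^ δ / δ / c = 1 / (c * δ) * (1 + ξ) ^ δ := by field_simp
      rw [add_mul, one_mul]; linarith
    have e6 : (1 + ξ) ^ (p - 2) = ((1 + ξ) ^ δ) ^ (s + 1) := by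
      rw [← Real.rpow_mul hξ1.le]; congr 1; rw [hδ]; field_simp
    rw [e6, ← Real.mul_rpow (by positivity) (by positivity)]
    exact Real.rpow_le_rpow (by positivity) e4 hs.le
  have e3 := Real.log_nonneg (by linarith : 1 ≤ 1 + ξ)
  have hh := hRN_pos h0 h1 hr.1
  have e7 : (1 + ξ) ^ p = (1 + ξ) ^ (p - 2) * (1 + ξ) ^ 2 := by
    rw [← Real.rpow_natCast, ← Real.rpow_add hξ1]; congr 1; push_cast; ring
  calc _ ≤ (C₃ ^ p / (1 + ξ) ^ p / (c * rMinus M e ^ 2))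
        * ((1 + 1 / (c * δ)) ^ (s + 1) * (1 + ξ) ^ (p - 2)) * (1 + ξ) ^ 2 := by gcongr
    _ = _ := by rw [e7]; field_simp

/-! #### The metric coefficients in the `(U, v)` coordinates -/

omit h0 h1

/-- `exp (2 κ₊ (u + v))`. -/
def xi (M e U v : ℝ) : ℝ := cc M e * U * Real.exp (cc M e * v)

/-- `r_RN` in the `(U, v)` coordinates. -/
def rB (M e U v : ℝ) : ℝ := rho M e (xi M e U v)

/-- `Ω_𝓗²` of Reissner–Nordström in the `(U, v)` coordinates. -/
def dB (M e U v : ℝ) : ℝ := 4 * cc M e * Real.exp (cc M e * v) * hRN M e (rB M e U v)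

/-- `log Ω_𝓗` of Reissner–Nordström in the `(U, v)` coordinates. -/
def lB (M e U v : ℝ) : ℝ := Real.log (dB M e U v) / 2

/-- `∂_U log Ω_𝓗` of Reissner–Nordström. -/
def lBU (M e U v : ℝ) : ℝ := -(hLog M e (rB M e U v) * dB M e U v / 8)

include h0 h1

variable {U v : ℝ} (hU : 0 ≤ U)

omit h0 h1 in
lemma hasDerivAt_xi_U (U v : ℝ) :
    HasDerivAt (fun x => xi M e x v) (cc M e * Real.exp (cc M e * v)) U :=
  (((hasDerivAt_id U).const_mul (cc M e)).mul_const _).congr_deriv (by ring)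

omit h0 h1 in
lemma hasDerivAt_xi_v (U v : ℝ) : HasDerivAt (fun y => xi M e U y) (cc M e * xi M e U v) v := by
  have : HasDerivAt (fun x => cc M e * x) (cc M e) v :=
    ((hasDerivAt_id v).const_mul (cc M e)).congr_deriv (by ring)
  exact (this.exp.const_mul (cc M e * U)).congr_deriv (by unfold xi; ring)

include hU

lemma xi_nonneg : 0 ≤ xi M e U v := by
  have := cc_pos h0 h1
  unfold xi; positivity

lemma rB_mem : rB M e U v ∈ Ioc (rMinus M e) (rPlus M e) := rho_mem h0 h1 (xi_nonneg h0 h1 hU)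

lemma rB_pos : 0 < rB M e U v := (rMinus_pos h0 h1).trans (rB_mem h0 h1 hU).1

lemma dB_pos : 0 < dB M e U v := by
  have := cc_pos h0 h1
  have := hRN_pos h0 h1 (rB_mem h0 h1 hU (v := v)).1
  unfold dB; positivity

lemma hasDerivAt_rB_U : HasDerivAt (fun x => rB M e x v) (-(dB M e U v / 4)) U := by
  refine (HasDerivAt.comp (h := fun x => xi M e x v) (h₂ := rho M e) U
    (hasDerivAt_rho h0 h1 (xi_nonneg h0 h1 hU)) (hasDerivAt_xi_U U v)).congr_deriv ?_
  unfold dB rB; ring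

lemma hasDerivAt_rB_v : HasDerivAt (fun y => rB M e U y) (-(cc M e * U * dB M e U v / 4)) v := by
  refine (HasDerivAt.comp (h := fun y => xi M e U y) (h₂ := rho M e) v
    (hasDerivAt_rho h0 h1 (xi_nonneg h0 h1 hU)) (hasDerivAt_xi_v U v)).congr_deriv ?_
  unfold dB rB xi; ring

lemma fRN_rB : fRN M e (rB M e U v) = cc M e * U * dB M e U v / 4 := by
  unfold rB
  rw [fRN_rho h0 h1 (xi_nonneg h0 h1 hU)]
  unfold dB rB xi; ring

omit hU in
lemma hasDerivAt_log_hRN {r : ℝ} (hr : rMinus M e < r) :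
    HasDerivAt (fun x => Real.log (hRN M e x)) (hLog M e r) r := by
  have := (hRN_pos h0 h1 hr).ne'
  refine ((hasDerivAt_hRN h0 h1 hr).log this).congr_deriv ?_
  field_simp

lemma lB_eq : lB M e U v
    = (Real.log (4 * cc M e) + cc M e * v + Real.log (hRN M e (rB M e U v))) / 2 := by
  have hc := cc_pos h0 h1
  have := hRN_pos h0 h1 (rB_mem h0 h1 hU (v := v)).1
  unfold lB dB
  rw [Real.log_mul (by positivity) this.ne', Real.log_mul (by positivity) (by positivity),
    Real.log_exp]

/-- The right-hand side is what differentiation of log Ω_𝓗 along v yields; partial fractions with r₊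
+ r₋ = 2M and r₊r₋ = e² reduce it to the explicit expression on the left. -/
lemma lBv_eq : M / rB M e U v ^ 2 - e ^ 2 / rB M e U v ^ 3
    = (cc M e - hLog M e (rB M e U v) * fRN M e (rB M e U v)) / 2 := by
  have hm := rB_mem h0 h1 hU (v := v)
  rw [fRN_eq h1 (rB_pos h0 h1 hU).ne']
  unfold hLog
  have a1 := (sub_pos.mpr hm.1).ne'
  have a2 := (rB_pos h0 h1 hU (v := v)).ne'
  have a3 := (rPlus_pos h0 h1).ne'
  have eM : M = (rPlus M e + rMinus M e) / 2 := by rw [rPlus_add_rMinus]; ring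
  rw [cc_eq h0 h1, qq_eq h0 h1, ← rPlus_mul_rMinus h1]
  generalize rB M e U v = r at *
  have : M / r ^ 2 = (rPlus M e + rMinus M e) / 2 / r ^ 2 := by rw [← eM]
  rw [this]
  field_simp
  ring

lemma hasDerivAt_lB_v :
    HasDerivAt (fun y => lB M e U y) (M / rB M e U v ^ 2 - e ^ 2 / rB M e U v ^ 3) v := by
  have hm := rB_mem h0 h1 hU (v := v)
  have d1 : HasDerivAt (fun y => cc M e * y) (cc M e) v :=
    ((hasDerivAt_id v).const_mul (cc M e)).congr_deriv (by ring)
  have d2 := (hasDerivAt_log_hRN h0 h1 hm.1).comp v (hasDerivAt_rB_v h0 h1 hU)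
  have d3 := (((d1.const_add (Real.log (4 * cc M e))).add d2).div_const 2)
  refine (d3.congr_of_eventuallyEq ?_).congr_deriv ?_
  · exact Eventually.of_forall fun y => lB_eq h0 h1 hU
  · rw [← fRN_rB h0 h1 hU, lBv_eq h0 h1 hU]
    ring

lemma hasDerivAt_dB_U :
    HasDerivAt (fun x => dB M e x v) (2 * dB M e U v * lBU M e U v) U := by
  have d1 := (HasDerivAt.comp (h := fun x => rB M e x v) (h₂ := hRN M e) U
    (hasDerivAt_hRN h0 h1 (rB_mem h0 h1 hU (v := v)).1) (hasDerivAt_rB_U h0 h1 hU)).const_mul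
      (4 * cc M e * Real.exp (cc M e * v))
  refine d1.congr_deriv ?_
  unfold lBU
  have : dB M e U v = 4 * cc M e * Real.exp (cc M e * v) * hRN M e (rB M e U v) := rfl
  generalize dB M e U v = d at *
  rw [show 4 * cc M e * Real.exp (cc M e * v)
    * (hRN M e (rB M e U v) * hLog M e (rB M e U v) * -(d / 4))
    = (4 * cc M e * Real.exp (cc M e * v) * hRN M e (rB M e U v))
      * (hLog M e (rB M e U v) * -(d / 4)) by ring, ← this]
  ring

lemma hasDerivAt_lB_U : HasDerivAt (fun x => lB M e x v) (lBU M e U v) U := by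
  have hd := (dB_pos h0 h1 hU (v := v)).ne'
  refine (((hasDerivAt_dB_U h0 h1 hU).log hd).div_const 2).congr_deriv ?_
  field_simp

omit h0 h1 hU in
/-- The Reissner–Nordström solution in the `(U, v)` coordinates. -/
def jB (M e U v : ℝ) : Jet :=
  ⟨dB M e U v, rB M e U v, -(dB M e U v / 4), -(cc M e * U * dB M e U v / 4), 0, 0⟩

/-- ∂_v r_RN is replaced by −`fRN` of r_RN, a function of the radius alone. The identity is known
for U ≥ 0 only, hence the one-sided derivative. -/
lemma hasDerivWithinAt_rBv_U : HasDerivWithinAt (fun x => -(cc M e * x * dB M e x v / 4))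
    ((jB M e U v).rhs₁ e) (Ici 0) U := by
  have hr := (rB_pos h0 h1 hU (v := v)).ne'
  have d1 : HasDerivAt (fun r => -fRN M e r)
      (2 * M / rB M e U v ^ 2 - 2 * e ^ 2 / rB M e U v ^ 3) (rB M e U v) := by
    unfold fRN
    have k1 := (hasDerivAt_inv hr).const_mul (2 * M)
    have k2 := ((hasDerivAt_pow 2 (rB M e U v)).inv (pow_ne_zero 2 hr)).const_mul (e ^ 2)
    refine (((k1.const_add (-1)).sub k2).neg).congr_deriv ?_
    push_cast
    field_simp
    ring
  have d2 := HasDerivAt.comp (h := fun x => rB M e x v) (h₂ := fun r => -fRN M e r) U d1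
    (hasDerivAt_rB_U h0 h1 hU)
  refine (d2.hasDerivWithinAt.congr (fun x hx => ?_) ?_).congr_deriv ?_
  · simp only [Function.comp]
    rw [fRN_rB h0 h1 hx]
  · simp only [Function.comp]
    rw [fRN_rB h0 h1 hU]
  · have k := fRN_rB h0 h1 hU (v := v)
    simp only [jB, Jet.rhs₁]
    rw [← k]
    unfold fRN
    field_simp
    ring

lemma hasDerivAt_lBv_U :
    HasDerivAt (fun x => M / rB M e x v ^ 2 - e ^ 2 / rB M e x v ^ 3) ((jB M e U v).rhs₃ e) U := by
  have hr := (rB_pos h0 h1 hU (v := v)).ne'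
  have d0 := hasDerivAt_rB_U h0 h1 hU (v := v)
  have k1 := ((d0.pow 2).inv (pow_ne_zero 2 hr)).const_mul M
  have k2 := ((d0.pow 3).inv (pow_ne_zero 3 hr)).const_mul (e ^ 2)
  refine (k1.sub k2).congr_deriv ?_
  have k := fRN_rB h0 h1 hU (v := v)
  simp only [jB, Jet.rhs₃, Pi.pow_apply]
  rw [← k]
  unfold fRN
  push_cast
  field_simp
  ring

lemma hasDerivAt_dB_v : HasDerivAt (fun y => dB M e U y)
    (2 * dB M e U v * (M / rB M e U v ^ 2 - e ^ 2 / rB M e U v ^ 3)) v := by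
  have k := ((hasDerivAt_lB_v h0 h1 hU (v := v)).const_mul 2).exp
  have e1 : ∀ y, Real.exp (2 * lB M e U y) = dB M e U y := fun y => by
    unfold lB
    rw [mul_div_cancel₀ _ two_ne_zero, Real.exp_log (dB_pos h0 h1 hU)]
  simp only [e1] at k
  exact k.congr_deriv (by ring)

lemma hasDerivAt_lBU_v :
    HasDerivAt (fun y => lBU M e U y) ((jB M e U v).rhs₃ e) v := by
  have hm := rB_mem h0 h1 hU (v := v)
  have a1 := (sub_pos.mpr hm.1).ne'
  have a2 := (rB_pos h0 h1 hU (v := v)).ne'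
  have a3 := (rPlus_pos h0 h1).ne'
  have d0 := hasDerivAt_rB_v h0 h1 hU (v := v)
  rw [← fRN_rB h0 h1 hU] at d0
  have d1 : HasDerivAt (fun y => hLog M e (rB M e U y))
      ((-((1 + qq M e) / (rB M e U v - rMinus M e) ^ 2) + 2 / rB M e U v ^ 2)
        * -fRN M e (rB M e U v)) v := by
    have k1 := ((d0.sub_const (rMinus M e)).inv a1).const_mul (1 + qq M e)
    have k2 := (d0.inv a2).const_mul 2
    refine ((k1.const_add (-cc M e)).sub k2).congr_deriv ?_
    field_simp
    ring
  refine ((d1.mul (hasDerivAt_dB_v h0 h1 hU)).div_const 8).neg.congr_deriv ?_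
  simp only [jB, Jet.rhs₃]
  rw [lBv_eq h0 h1 hU, ← fRN_rB h0 h1 hU, fRN_eq h1 a2]
  unfold hLog
  rw [cc_eq h0 h1, qq_eq h0 h1, ← rPlus_mul_rMinus h1]
  generalize rB M e U v = r at *
  generalize dB M e U v = δ at *
  field_simp
  ring

omit hU

lemma continuousAt_rB (hU : 0 ≤ U) (v : ℝ) :
    ContinuousAt (fun p : ℝ × ℝ => rB M e p.1 p.2) (U, v) := by
  refine ContinuousAt.comp (f := fun p : ℝ × ℝ => xi M e p.1 p.2) (g := rho M e)
    (hasDerivAt_rho h0 h1 (xi_nonneg h0 h1 hU)).continuousAt ?_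
  unfold xi; fun_prop

lemma continuousAt_dB (hU : 0 ≤ U) (v : ℝ) :
    ContinuousAt (fun p : ℝ × ℝ => dB M e p.1 p.2) (U, v) := by
  have h := ContinuousAt.comp (f := fun p : ℝ × ℝ => rB M e p.1 p.2) (g := hRN M e) (x := (U, v))
    (hasDerivAt_hRN h0 h1 (rB_mem h0 h1 hU (v := v)).1).continuousAt (continuousAt_rB h0 h1 hU v)
  have h2 : ContinuousAt (fun p : ℝ × ℝ => 4 * cc M e * Real.exp (cc M e * p.2)) (U, v) := by
    fun_prop
  exact h2.mul h

lemma continuousAt_lBU (hU : 0 ≤ U) (v : ℝ) :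
    ContinuousAt (fun p : ℝ × ℝ => lBU M e p.1 p.2) (U, v) := by
  have hm := rB_mem h0 h1 hU (v := v)
  have hr := continuousAt_rB h0 h1 hU v
  have k1 : rB M e U v - rMinus M e ≠ 0 := (sub_pos.mpr hm.1).ne'
  have k2 : rB M e U v ≠ 0 := (rB_pos h0 h1 hU).ne'
  have hl : ContinuousAt (fun p : ℝ × ℝ => hLog M e (rB M e p.1 p.2)) (U, v) :=
    (continuousAt_const.add (continuousAt_const.div (hr.sub continuousAt_const) k1)).sub
      (continuousAt_const.div hr k2)
  exact ((hl.mul (continuousAt_dB h0 h1 hU v)).div_const 8).neg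

/-- τ = e^{-cv}(1+ξ), so ell = log(1+ξ)/c and g = e^{cv}/(1+ξ)²; after cancelling e^{cv} the claim
is the decay of `hRN`. -/
lemma exists_dB_le {s : ℝ} (hs : 0 < s + 1) : ∃ C > 0, ∀ W : Weight, W.c = cc M e → W.s = s →
    ∀ U v, 0 ≤ U → dB M e U v * (1 + W.ell U v) ^ (s + 1) ≤ C * W.g U v := by
  have hc := cc_pos h0 h1
  obtain ⟨C, hC, h⟩ := exists_hRN_le h0 h1 hs
  refine ⟨4 * cc M e * C, by positivity, fun W hW _ U v hU => ?_⟩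
  have hξ := xi_nonneg h0 h1 hU (v := v)
  have hξ1 : 0 < 1 + xi M e U v := by linarith
  have e1 : W.τ U v = Real.exp (-(cc M e * v)) * (1 + xi M e U v) := by
    unfold Weight.τ xi
    rw [hW, mul_add, mul_one, mul_comm (Real.exp _) (_ * _), mul_assoc, ← Real.exp_add]
    simp
  have e2 : W.ell U v = Real.log (1 + xi M e U v) / cc M e := by
    unfold Weight.ell
    rw [e1, hW, Real.log_mul (Real.exp_pos _).ne' hξ1.ne', Real.log_exp]
    field_simp
    ring
  have e3 : W.g U v = Real.exp (cc M e * v) / (1 + xi M e U v) ^ 2 := by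
    have : W.c * U = W.τ U v - Real.exp (-(cc M e * v)) := by
      unfold Weight.τ; rw [hW]; ring
    unfold Weight.g Weight.y
    rw [this, e1, Real.exp_neg]
    have := (Real.exp_pos (cc M e * v)).ne'
    field_simp
    ring
  have := h _ hξ
  rw [e2, e3]
  have hh : dB M e U v = 4 * cc M e * Real.exp (cc M e * v) * hRN M e (rho M e (xi M e U v)) := rfl
  rw [hh, ← mul_div_assoc, le_div_iff₀ (by positivity)]
  calc _ = 4 * cc M e * Real.exp (cc M e * v) * (hRN M e (rho M e (xi M e U v))
      * (1 + Real.log (1 + xi M e U v) / cc M e) ^ (s + 1) * (1 + xi M e U v) ^ 2) := by ring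
    _ ≤ 4 * cc M e * Real.exp (cc M e * v) * C := by gcongr
    _ = _ := by ring

lemma cU_dB_le (hU : 0 ≤ U) : cc M e * U * dB M e U v ≤ 8 * M / rMinus M e := by
  have hm := rMinus_pos h0 h1
  have hM : 0 < M := h0.trans h1
  have hr := rB_mem h0 h1 hU (v := v)
  have h := fRN_rB h0 h1 hU (v := v)
  have h2 : fRN M e (rB M e U v) ≤ 2 * M / rMinus M e := by
    unfold fRN
    have : 2 * M / rB M e U v ≤ 2 * M / rMinus M e := by
      have := hr.1.le
      gcongr
    have : 0 ≤ e ^ 2 / rB M e U v ^ 2 := by positivity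
    linarith
  have : 8 * M / rMinus M e = 4 * (2 * M / rMinus M e) := by ring
  linarith

omit h0 h1 in
lemma rB_horizon (v : ℝ) : rB M e 0 v = rPlus M e := by simp [rB, xi, rho_zero]

lemma dB_horizon (v : ℝ) : dB M e 0 v = horizonOmegaSq M e v := by
  have := (cc_pos h0 h1).ne'
  unfold dB
  rw [rB_horizon]
  unfold hRN horizonOmegaSq qq
  rw [show -2 * kappaPlus M e * rPlus M e = -(cc M e * rPlus M e) by unfold cc; ring,
    show 2 * kappaPlus M e * v = cc M e * v by unfold cc; ring]
  field_simp

omit h0 h1 in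
lemma rRN_add (u v : ℝ) : rRN M e u v = rRN M e (u + v) 0 := by simp [rRN]

omit h0 h1 in
lemma Ucoord_eq (u : ℝ) : Ucoord M e u = Real.exp (cc M e * u) / cc M e := rfl

lemma cc_mul_Ucoord (u : ℝ) : cc M e * Ucoord M e u = Real.exp (cc M e * u) := by
  rw [Ucoord_eq, mul_div_cancel₀ _ (cc_pos h0 h1).ne']

lemma Ucoord_pos (u : ℝ) : 0 < Ucoord M e u := by
  rw [Ucoord_eq]; exact div_pos (Real.exp_pos _) (cc_pos h0 h1)

lemma xi_Ucoord (u v : ℝ) : xi M e (Ucoord M e u) v = Real.exp (cc M e * (u + v)) := by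
  unfold xi
  rw [cc_mul_Ucoord h0 h1, ← Real.exp_add]; ring_nf

lemma rB_Ucoord (u v : ℝ) : rB M e (Ucoord M e u) v = rRN M e u v := by
  unfold rB
  rw [xi_Ucoord h0 h1, rho_exp h0 h1, ← rRN_add]

lemma OmegaRN_sq_eq (u v : ℝ) :
    OmegaRN M e u v ^ 2 = Real.exp (cc M e * u) * dB M e (Ucoord M e u) v := by
  have hU := Ucoord_pos h0 h1 u
  have h := fRN_rB h0 h1 hU.le (v := v)
  have hd := dB_pos h0 h1 hU.le (v := v)
  rw [cc_mul_Ucoord h0 h1, rB_Ucoord h0 h1] at h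
  have e1 : -4 * (1 - 2 * M / rRN M e u v + e ^ 2 / rRN M e u v ^ 2)
      = Real.exp (cc M e * u) * dB M e (Ucoord M e u) v := by
    have : -4 * (1 - 2 * M / rRN M e u v + e ^ 2 / rRN M e u v ^ 2) = 4 * fRN M e (rRN M e u v) := by
      unfold fRN; ring
    rw [this, h]; ring
  unfold OmegaRN
  rw [e1, Real.sq_sqrt (by positivity)]

lemma OmegaRN_pos (u v : ℝ) : 0 < OmegaRN M e u v := by
  have h : 0 < OmegaRN M e u v ^ 2 := by
    rw [OmegaRN_sq_eq h0 h1]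
    exact mul_pos (Real.exp_pos _) (dB_pos h0 h1 (Ucoord_pos h0 h1 u).le)
  exact lt_of_le_of_ne (Real.sqrt_nonneg _) fun h2 => by rw [← h2] at h; simp at h

lemma log_OmegaRN (u v : ℝ) :
    Real.log (OmegaRN M e u v) = kappaPlus M e * u + lB M e (Ucoord M e u) v := by
  have h := congrArg Real.log (OmegaRN_sq_eq h0 h1 u v)
  rw [Real.log_pow, Real.log_mul (Real.exp_pos _).ne'
    (dB_pos h0 h1 (Ucoord_pos h0 h1 u).le).ne', Real.log_exp] at h
  unfold lB
  push_cast at h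
  have : cc M e = 2 * kappaPlus M e := rfl
  rw [this] at h
  linarith

/-- Ω_RN² is 4c e^{c(u+v)} times `hRN`, which is bounded below for bounded ξ. This converts
exponentials in u + v into Ω_RN². -/
lemma exists_le_OmegaRN_sq (A : ℝ) : ∃ m > 0, ∀ u v, u + v ≤ A →
    m * Real.exp (cc M e * (u + v)) ≤ OmegaRN M e u v ^ 2 := by
  have hc := cc_pos h0 h1
  obtain ⟨m, hm, h⟩ := exists_le_hRN h0 h1 (Real.exp (cc M e * A))
  refine ⟨4 * cc M e * m, by positivity, fun u v huv => ?_⟩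
  have k := h (xi M e (Ucoord M e u) v) (xi_nonneg h0 h1 (Ucoord_pos h0 h1 u).le)
    (by rw [xi_Ucoord h0 h1]; gcongr)
  rw [OmegaRN_sq_eq h0 h1]
  have : Real.exp (cc M e * u) * dB M e (Ucoord M e u) v = 4 * cc M e
      * Real.exp (cc M e * (u + v)) * hRN M e (rho M e (xi M e (Ucoord M e u) v)) := by
    unfold dB rB; rw [mul_add, Real.exp_add]; ring
  rw [this]
  calc _ = 4 * cc M e * Real.exp (cc M e * (u + v)) * m := by ring
    _ ≤ _ := by gcongr

end RN

/-! ### The data -/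

section Data

/-- A function on `[1, ∞)` with positive lower bound for its derivative is unbounded. -/
lemma not_bddAbove_of_deriv_ge {f f' : ℝ → ℝ} {v₁ η K : ℝ} (hv₁ : 1 ≤ v₁) (hη : 0 < η)
    (hd : ∀ v ∈ Ici (1 : ℝ), HasDerivWithinAt f (f' v) (Ici 1) v)
    (h : ∀ v ≥ v₁, η ≤ f' v) (hK : ∀ v ≥ (1 : ℝ), f v ≤ K) : False := by
  have hm : MonotoneOn (fun v => f v - η * v) (Ici v₁) := by
    refine monotoneOn_of_hasDerivWithinAt_nonneg (f' := fun v => f' v - η * 1) (convex_Ici _) ?_ ?_ ?_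
    · intro v hv
      exact ((hd v (hv₁.trans hv)).continuousWithinAt.mono (Ici_subset_Ici.mpr hv₁)).sub
        (by fun_prop)
    · intro v hv
      rw [interior_Ici] at hv ⊢
      exact (((hd v (hv₁.trans hv.le)).mono (Ioi_subset_Ici_self.trans (Ici_subset_Ici.mpr hv₁)))).sub
        ((hasDerivWithinAt_id _ _).const_mul η)
    · intro v hv
      rw [interior_Ici] at hv
      have := h v hv.le
      linarith
  set v := v₁ + (|K - f v₁| + 1) / η with hv
  have hvv : v₁ ≤ v := by rw [hv]; have : 0 ≤ (|K - f v₁| + 1) / η := by positivity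
                          linarith
  have k := hm self_mem_Ici hvv hvv
  simp only at k
  have k2 := hK v (hv₁.trans hvv)
  have k3 : η * v = η * v₁ + (|K - f v₁| + 1) := by rw [hv]; field_simp
  have := le_abs_self (K - f v₁)
  linarith

/-- `∂_v r` on the outgoing initial curve. -/
def CharData.rOutV (d : CharData) (v : ℝ) : ℝ := derivWithin d.rOut (Ici 1) v

/-- `∂_v φ` on the outgoing initial curve. -/
def CharData.φOutV (d : CharData) (v : ℝ) : ℝ := derivWithin d.φOut (Ici 1) v

/-- `∂_U φ` on the incoming initial curve. -/
def CharData.φInU (d : CharData) (U₀ U : ℝ) : ℝ := derivWithin d.φIn (Icc 0 U₀) U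

/-- A bound for the decay on the event horizon. -/
def horizonConst (M e E : ℝ) : ℝ := 1 + E + rPlus M e * E ^ 2 / cc M e

variable {M e s E U₀ : ℝ} {d : CharData}

namespace IsEventHorizonData

variable (h0 : 0 < |e|) (h1 : |e| < M) (hs : 1 < s) (hE : 0 < E) (hU₀ : 0 < U₀)
  (h : IsEventHorizonData M e s E U₀ d)
include h

lemma hasDerivWithinAt_rOut {v : ℝ} (hv : v ∈ Ici (1 : ℝ)) :
    HasDerivWithinAt d.rOut (d.rOutV v) (Ici 1) v :=
  ((h.initial.rOut_reg.differentiableOn (by norm_num)) v hv).hasDerivWithinAt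

lemma hasDerivWithinAt_φOut {v : ℝ} (hv : v ∈ Ici (1 : ℝ)) :
    HasDerivWithinAt d.φOut (d.φOutV v) (Ici 1) v :=
  ((h.initial.φOut_reg.differentiableOn (by norm_num)) v hv).hasDerivWithinAt

lemma continuousOn_rOutV : ContinuousOn d.rOutV (Ici 1) :=
  h.initial.rOut_reg.continuousOn_derivWithin (uniqueDiffOn_Ici 1) (by norm_num)

lemma continuousOn_φOutV : ContinuousOn d.φOutV (Ici 1) :=
  h.initial.φOut_reg.continuousOn_derivWithin (uniqueDiffOn_Ici 1) (by norm_num)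

lemma abs_φOut_le {v : ℝ} (hv : v ∈ Ici (1 : ℝ)) : |d.φOut v| ≤ E * v ^ (-s) := by
  have := h.φ_decay v hv
  have := abs_nonneg (derivWithin d.φOut (Ici 1) v)
  linarith

lemma abs_φOutV_le {v : ℝ} (hv : v ∈ Ici (1 : ℝ)) : |d.φOutV v| ≤ E * v ^ (-s) := by
  have := h.φ_decay v hv
  have := abs_nonneg (d.φOut v)
  unfold CharData.φOutV
  linarith

include h0 h1

lemma ΩOut_sq {v : ℝ} (hv : v ∈ Ici (1 : ℝ)) : d.ΩOut v ^ 2 = dB M e 0 v := by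
  rw [h.gauge_out v hv, dB_horizon h0 h1]

omit h h0 h1 in
lemma dB_zero (v : ℝ) : dB M e 0 v = dB M e 0 0 * Real.exp (cc M e * v) := by
  unfold dB; rw [rB_horizon, rB_horizon]; simp; ring

lemma hasDerivWithinAt_quot {v : ℝ} (hv : v ∈ Ici (1 : ℝ)) :
    HasDerivWithinAt (fun y => d.rOutV y / dB M e 0 y)
      (-(d.rOut v * d.φOutV v ^ 2 / dB M e 0 v)) (Ici 1) v := by
  have k := h.initial.constraint_out v hv
  rw [h.ΩOut_sq h0 h1 hv] at k
  refine k.congr (fun y hy => ?_) ?_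
  · rw [h.ΩOut_sq h0 h1 hy]; rfl
  · rw [h.ΩOut_sq h0 h1 hv]; rfl

/-- By Raychaudhuri ∂_v r / Ω² does not increase, while Ω² grows exponentially. A negative value of
∂_v r would stay below a negative constant from then on and contradict r > 0. -/
lemma rOutV_nonneg {v : ℝ} (hv : v ∈ Ici (1 : ℝ)) : 0 ≤ d.rOutV v := by
  by_contra! hlt
  have hc := cc_pos h0 h1
  have hp := fun y => dB_pos h0 h1 (le_refl (0 : ℝ)) (v := y)
  have anti : AntitoneOn (fun y => d.rOutV y / dB M e 0 y) (Ici 1) := by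
    refine antitoneOn_of_hasDerivWithinAt_nonpos
      (f' := fun y => -(d.rOut y * d.φOutV y ^ 2 / dB M e 0 y)) (convex_Ici _) ?_ ?_ ?_
    · exact fun y hy => (h.hasDerivWithinAt_quot h0 h1 hy).continuousWithinAt
    · intro y hy
      exact (h.hasDerivWithinAt_quot h0 h1 (interior_subset hy)).mono interior_subset
    · intro y hy
      have := h.initial.rOut_pos y (interior_subset hy)
      have := hp y
      have : 0 ≤ d.rOut y * d.φOutV y ^ 2 / dB M e 0 y := by positivity
      linarith
  set η := -d.rOutV v with hη
  refine not_bddAbove_of_deriv_ge (f := fun y => -d.rOut y) (f' := fun y => -d.rOutV y) (η := η)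
    (K := 0) hv (by linarith) (fun y hy => (h.hasDerivWithinAt_rOut hy).neg) ?_ ?_
  · intro y hy
    have hy1 : (1 : ℝ) ≤ y := le_trans hv hy
    have k := anti hv hy1 hy
    simp only at k
    rw [div_le_iff₀ (hp y)] at k
    have k2 : dB M e 0 v ≤ dB M e 0 y := by
      rw [dB_zero v, dB_zero y]
      have := (hp 0).le
      have hy : v ≤ y := hy
      gcongr
    have k3 : η ≤ η / dB M e 0 v * dB M e 0 y := by
      rw [div_mul_eq_mul_div, le_div_iff₀ (hp v)]
      have : 0 ≤ η := by linarith
      gcongr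
    have k4 : d.rOutV v / dB M e 0 v * dB M e 0 y = -(η / dB M e 0 v * dB M e 0 y) := by
      rw [hη]; ring
    linarith
  · intro y hy
    have := h.initial.rOut_pos y hy
    linarith

lemma monotoneOn_rOut : MonotoneOn d.rOut (Ici 1) := by
  refine monotoneOn_of_hasDerivWithinAt_nonneg (f' := d.rOutV) (convex_Ici _)
    (fun y hy => (h.hasDerivWithinAt_rOut hy).continuousWithinAt) ?_ ?_
  · intro y hy
    exact (h.hasDerivWithinAt_rOut (interior_subset hy)).mono interior_subset
  · exact fun y hy => h.rOutV_nonneg h0 h1 (interior_subset hy)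

lemma rOut_le {v : ℝ} (hv : v ∈ Ici (1 : ℝ)) : d.rOut v ≤ rPlus M e := by
  refine ge_of_tendsto h.r_lim ?_
  filter_upwards [eventually_ge_atTop v] with y hy
  exact h.monotoneOn_rOut h0 h1 hv (le_trans hv hy) hy

include hs hE

/-- The same argument from infinity, for ∂_v r − Q v^{-2s}: with cQ = r₊E² its quotient by Ω² does
not decrease, so a positive value would make r grow linearly, contrary to r ≤ r₊. -/
lemma rOutV_le_aux {v : ℝ} (hv : v ∈ Ici (1 : ℝ)) :
    d.rOutV v ≤ rPlus M e * E ^ 2 / cc M e * v ^ (-(2 * s)) := by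
  have hc := cc_pos h0 h1
  have hrp := rPlus_pos h0 h1
  have hp := fun y => dB_pos h0 h1 (le_refl (0 : ℝ)) (v := y)
  set Q := rPlus M e * E ^ 2 / cc M e with hQ
  set H := dB M e 0 0 with hH
  have hHp : 0 < H := hp 0
  have dg : ∀ y ∈ Ici (1 : ℝ), HasDerivAt (fun y => Q * y ^ (-(2 * s)) / dB M e 0 y)
      (Q * (-(2 * s) * y ^ (-(2 * s) - 1)) / dB M e 0 y
        - cc M e * (Q * y ^ (-(2 * s)) / dB M e 0 y)) y := by
    intro y hy
    have hy0 : (0 : ℝ) < y := lt_of_lt_of_le one_pos hy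
    have e1 : HasDerivAt (fun y => dB M e 0 y) (cc M e * dB M e 0 y) y := by
      have : HasDerivAt (fun x => cc M e * x) (cc M e) y :=
        ((hasDerivAt_id y).const_mul (cc M e)).congr_deriv (by ring)
      have := (this.exp.const_mul H).congr_of_eventuallyEq
        (Eventually.of_forall fun y => dB_zero y)
      refine this.congr_deriv ?_
      rw [dB_zero y]; ring
    have e2 := (Real.hasDerivAt_rpow_const (p := -(2 * s)) (Or.inl hy0.ne')).const_mul Q
    refine (e2.div e1 (hp y).ne').congr_deriv ?_
    have := (hp y).ne'
    field_simp
  have mono : MonotoneOn (fun y => d.rOutV y / dB M e 0 y - Q * y ^ (-(2 * s)) / dB M e 0 y)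
      (Ici 1) := by
    have hd : ∀ y ∈ Ici (1 : ℝ), HasDerivWithinAt
        (fun y => d.rOutV y / dB M e 0 y - Q * y ^ (-(2 * s)) / dB M e 0 y)
        (-(d.rOut y * d.φOutV y ^ 2 / dB M e 0 y)
          - (Q * (-(2 * s) * y ^ (-(2 * s) - 1)) / dB M e 0 y
          - cc M e * (Q * y ^ (-(2 * s)) / dB M e 0 y))) (Ici 1) y :=
      fun y hy => (h.hasDerivWithinAt_quot h0 h1 hy).sub (dg y hy).hasDerivWithinAt
    refine monotoneOn_of_hasDerivWithinAt_nonneg (convex_Ici _)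
      (fun y hy => (hd y hy).continuousWithinAt)
      (fun y hy => (hd y (interior_subset hy)).mono interior_subset) ?_
    intro y hy
    have hy : y ∈ Ici (1 : ℝ) := interior_subset hy
    have hy0 : (0 : ℝ) < y := lt_of_lt_of_le one_pos hy
    have k1 : d.φOutV y ^ 2 ≤ E ^ 2 * y ^ (-(2 * s)) := by
      have := h.abs_φOutV_le hy
      have e1 : y ^ (-(2 * s)) = (y ^ (-s)) ^ 2 := by
        rw [← Real.rpow_natCast, ← Real.rpow_mul hy0.le]; congr 1; push_cast; ring
      rw [e1, ← mul_pow, ← sq_abs]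
      gcongr
    have k2 : d.rOut y * d.φOutV y ^ 2 ≤ rPlus M e * (E ^ 2 * y ^ (-(2 * s))) := by
      have := h.rOut_le h0 h1 hy
      gcongr
    have k3 : d.rOut y * d.φOutV y ^ 2 / dB M e 0 y
        ≤ cc M e * (Q * y ^ (-(2 * s)) / dB M e 0 y) := by
      have : cc M e * (Q * y ^ (-(2 * s)) / dB M e 0 y)
          = rPlus M e * (E ^ 2 * y ^ (-(2 * s))) / dB M e 0 y := by
        rw [hQ]; field_simp
      rw [this]
      have := hp y
      gcongr
    have k4 : 0 ≤ Q * (2 * s * y ^ (-(2 * s) - 1)) / dB M e 0 y := by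
      have := hp y
      positivity
    have k5 : Q * (-(2 * s) * y ^ (-(2 * s) - 1)) / dB M e 0 y
      = -(Q * (2 * s * y ^ (-(2 * s) - 1)) / dB M e 0 y) := by ring
    linarith
  by_contra! hlt
  set η := d.rOutV v - Q * v ^ (-(2 * s)) with hη
  refine not_bddAbove_of_deriv_ge (f := d.rOut) (f' := d.rOutV) (η := η)
    (K := rPlus M e) hv (by linarith) (fun y hy => h.hasDerivWithinAt_rOut hy) ?_
    (fun y hy => h.rOut_le h0 h1 hy)
  intro y hy
  have hy1 : (1 : ℝ) ≤ y := le_trans hv hy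
  have hy0 : (0 : ℝ) < y := lt_of_lt_of_le one_pos hy1
  have k := mono hv hy1 hy
  simp only at k
  rw [← sub_div, ← sub_div, ← hη, le_div_iff₀ (hp y)] at k
  have k2 : dB M e 0 v ≤ dB M e 0 y := by
    rw [dB_zero v, dB_zero y]
    have := (hp 0).le
    have hy : v ≤ y := hy
    gcongr
  have k3 : η ≤ η / dB M e 0 v * dB M e 0 y := by
    rw [div_mul_eq_mul_div, le_div_iff₀ (hp v)]
    have : 0 ≤ η := by linarith
    gcongr
  have k4 : 0 ≤ Q * y ^ (-(2 * s)) := by positivity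
  linarith

/-- The bound Q v^{-2s} on ∂_v r is integrated from infinity, where r tends to r₊; v^{1−2s} ≤ v^{-s}
and Q/(2s−1) ≤ Q because s > 1. -/
lemma rPlus_sub_rOut_le {v : ℝ} (hv : v ∈ Ici (1 : ℝ)) :
    rPlus M e - d.rOut v ≤ horizonConst M e E * v ^ (-s) := by
  have hc := cc_pos h0 h1
  have hrp := rPlus_pos h0 h1
  set Q := rPlus M e * E ^ 2 / cc M e with hQ
  have hQ0 : 0 < Q := by positivity
  have hs1 : 0 < 2 * s - 1 := by linarith
  have hd : ∀ y ∈ Ici (1 : ℝ), HasDerivWithinAt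
      (fun y => d.rOut y + Q / (2 * s - 1) * y ^ (1 - 2 * s))
      (d.rOutV y + Q / (2 * s - 1) * ((1 - 2 * s) * y ^ (1 - 2 * s - 1))) (Ici 1) y := by
    intro y hy
    have hy0 : (0 : ℝ) < y := lt_of_lt_of_le one_pos hy
    exact (h.hasDerivWithinAt_rOut hy).add
      (((Real.hasDerivAt_rpow_const (Or.inl hy0.ne')).const_mul _).hasDerivWithinAt)
  have anti : AntitoneOn (fun y => d.rOut y + Q / (2 * s - 1) * y ^ (1 - 2 * s)) (Ici 1) := by
    refine antitoneOn_of_hasDerivWithinAt_nonpos (convex_Ici _)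
      (fun y hy => (hd y hy).continuousWithinAt)
      (fun y hy => (hd y (interior_subset hy)).mono interior_subset) ?_
    intro y hy
    have hy : y ∈ Ici (1 : ℝ) := interior_subset hy
    have k := h.rOutV_le_aux h0 h1 hs hE hy
    rw [← hQ] at k
    have e1 : Q / (2 * s - 1) * ((1 - 2 * s) * y ^ (1 - 2 * s - 1)) = -(Q * y ^ (-(2 * s))) := by
      rw [show 1 - 2 * s - 1 = -(2 * s) by ring, show 1 - 2 * s = -(2 * s - 1) by ring]
      field_simp
    rw [e1]; linarith
  have lim : Tendsto (fun y => d.rOut y + Q / (2 * s - 1) * y ^ (1 - 2 * s)) atTop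
      (𝓝 (rPlus M e)) := by
    have k := tendsto_rpow_neg_atTop hs1
    rw [show -(2 * s - 1) = 1 - 2 * s by ring] at k
    have := h.r_lim.add (k.const_mul (Q / (2 * s - 1)))
    rwa [mul_zero, add_zero] at this
  have key : rPlus M e ≤ d.rOut v + Q / (2 * s - 1) * v ^ (1 - 2 * s) := by
    refine le_of_tendsto lim ?_
    filter_upwards [eventually_ge_atTop v] with y hy
    exact anti hv (le_trans hv hy) hy
  have k1 : v ^ (1 - 2 * s) ≤ v ^ (-s) := Real.rpow_le_rpow_of_exponent_le hv (by linarith)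
  have k2 : Q / (2 * s - 1) ≤ Q := div_le_self hQ0.le (by linarith)
  have k3 : 0 ≤ v ^ (1 - 2 * s) := Real.rpow_nonneg (zero_le_one.trans hv) _
  have k4 : Q ≤ horizonConst M e E := by unfold horizonConst; linarith
  have : Q / (2 * s - 1) * v ^ (1 - 2 * s) ≤ horizonConst M e E * v ^ (-s) := by
    have : 0 ≤ horizonConst M e E := by linarith
    gcongr
    linarith
  linarith

lemma abs_rOut_sub_le {v : ℝ} (hv : v ∈ Ici (1 : ℝ)) :
    |d.rOut v - rPlus M e| ≤ horizonConst M e E * v ^ (-s) := by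
  rw [abs_sub_comm, abs_of_nonneg (sub_nonneg.mpr (h.rOut_le h0 h1 hv))]
  exact h.rPlus_sub_rOut_le h0 h1 hs hE hv

lemma abs_rOutV_le {v : ℝ} (hv : v ∈ Ici (1 : ℝ)) :
    |d.rOutV v| ≤ horizonConst M e E * v ^ (-s) := by
  have hc := cc_pos h0 h1
  have hrp := rPlus_pos h0 h1
  rw [abs_of_nonneg (h.rOutV_nonneg h0 h1 hv)]
  refine (h.rOutV_le_aux h0 h1 hs hE hv).trans ?_
  have k1 : v ^ (-(2 * s)) ≤ v ^ (-s) := Real.rpow_le_rpow_of_exponent_le hv (by linarith)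
  have k4 : rPlus M e * E ^ 2 / cc M e ≤ horizonConst M e E := by unfold horizonConst; linarith
  have : 0 ≤ v ^ (-(2 * s)) := Real.rpow_nonneg (zero_le_one.trans hv) _
  gcongr
  exact le_trans (by positivity) k4

omit h in
omit hs in
lemma E_le_horizonConst : E ≤ horizonConst M e E := by
  have hc := cc_pos h0 h1
  have hrp := rPlus_pos h0 h1
  have : 0 ≤ rPlus M e * E ^ 2 / cc M e := by positivity
  unfold horizonConst; linarith

omit h0 h1 hs hE
include hU₀

omit hU₀ in
lemma hasDerivWithinAt_rIn {U : ℝ} (hU : U ∈ Icc 0 U₀) :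
    HasDerivWithinAt d.rIn (-1) (Icc 0 U₀) U := by
  rw [← h.gauge_in U hU]
  exact ((h.initial.rIn_reg.differentiableOn (by norm_num)) U hU).hasDerivWithinAt

lemma rIn_eq {U : ℝ} (hU : U ∈ Icc 0 U₀) : d.rIn U = d.rOut 1 - U := by
  have k : ∀ x ∈ Icc 0 U₀, HasDerivWithinAt (fun x => d.rIn x + x) (-1 + 1) (Icc 0 U₀) x :=
    fun x hx => (h.hasDerivWithinAt_rIn hx).add (hasDerivWithinAt_id _ _)
  have := (convex_Icc 0 U₀).is_const_of_fderivWithin_eq_zero (𝕜 := ℝ) (f := fun x => d.rIn x + x)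
    (fun x hx => (k x hx).differentiableWithinAt) (fun x hx => by
      have := (k x hx).hasFDerivWithinAt.fderivWithin (uniqueDiffOn_Icc hU₀ x hx)
      rw [this]; ext; simp) hU (left_mem_Icc.mpr hU₀.le)
  simp only [add_zero] at this
  rw [h.initial.r_match]
  linarith

include h0 h1

/-- On v = 1 the radius decreases at unit rate and is still positive at U = U₀; on the horizon it
does not decrease in v. This is how U₀ enters the lower bound for r. -/
lemma le_rOut {v : ℝ} (hv : v ∈ Ici (1 : ℝ)) : U₀ ≤ d.rOut v := by
  have k := h.initial.rIn_pos U₀ (right_mem_Icc.mpr hU₀.le)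
  rw [h.rIn_eq hU₀ (right_mem_Icc.mpr hU₀.le)] at k
  have := h.monotoneOn_rOut h0 h1 self_mem_Ici hv hv
  linarith

omit h0 h1
omit hU₀ in
lemma hasDerivWithinAt_φIn {U : ℝ} (hU : U ∈ Icc 0 U₀) :
    HasDerivWithinAt d.φIn (d.φInU U₀ U) (Icc 0 U₀) U :=
  ((h.initial.φIn_reg.differentiableOn (by norm_num)) U hU).hasDerivWithinAt

lemma continuousOn_φInU : ContinuousOn (d.φInU U₀) (Icc 0 U₀) :=
  h.initial.φIn_reg.continuousOn_derivWithin (uniqueDiffOn_Icc hU₀) (by norm_num)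

/-- In the gauge ∂_U r = −1 the constraint is a first order equation for Ω. -/
lemma hasDerivWithinAt_log_ΩIn {U : ℝ} (hU : U ∈ Icc 0 U₀) :
    HasDerivWithinAt (fun x => Real.log (d.ΩIn x)) (-(d.rIn U * d.φInU U₀ U ^ 2 / 2))
      (Icc 0 U₀) U := by
  have hp := h.initial.ΩIn_pos U hU
  have k := h.initial.constraint_in U hU
  rw [← CharData.φInU] at k
  have hd := ((h.initial.ΩIn_reg.differentiableOn (by norm_num)) U hU).hasDerivWithinAt
  set Ω' := derivWithin d.ΩIn (Icc 0 U₀) U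
  have k2 : HasDerivWithinAt (fun x => derivWithin d.rIn (Icc 0 U₀) x / d.ΩIn x ^ 2)
      (2 * Ω' / d.ΩIn U ^ 3) (Icc 0 U₀) U := by
    have k3 := ((hd.pow 2).inv (pow_ne_zero 2 hp.ne')).neg
    refine (k3.congr (fun x hx => ?_) ?_).congr_deriv ?_
    · rw [h.gauge_in x hx]; simp [neg_div]
    · rw [h.gauge_in U hU]; simp [neg_div]
    · simp only [Pi.pow_apply]; push_cast; field_simp
  have k4 := (k.derivWithin (uniqueDiffOn_Icc hU₀ U hU)).symm.trans
    (k2.derivWithin (uniqueDiffOn_Icc hU₀ U hU))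
  refine (hd.log hp.ne').congr_deriv ?_
  field_simp at k4 ⊢
  linarith

include h0 h1

lemma rIn_le {U : ℝ} (hU : U ∈ Icc 0 U₀) : d.rIn U ≤ rPlus M e := by
  rw [h.rIn_eq hU₀ hU]
  have := h.rOut_le h0 h1 (self_mem_Ici (a := (1 : ℝ)))
  linarith [hU.1]

end IsEventHorizonData

end Data

/-! ### Existence of the solution -/

section Existence

/-- The jet of the solution with the deviation `ψ = (ψ₁, ψ₂, ψ₃)` of `(r, φ, log Ω)` from the
superposition of Reissner–Nordström and the data on the event horizon, where `∂_U ψ = a` and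
`∂_v ψ = b`. -/
def jS (M e : ℝ) (d : CharData) (U v : ℝ) (ψ a b : ℝ × ℝ × ℝ) : Jet where
  o := dB M e U v * Real.exp (2 * ψ.2.2)
  r := d.rOut v + rB M e U v - rPlus M e + ψ.1
  ru := -(dB M e U v / 4) + a.1
  rv := d.rOutV v - cc M e * U * dB M e U v / 4 + b.1
  fu := a.2.1
  fv := d.φOutV v + b.2.1

lemma abs_fst_le (x : ℝ × ℝ × ℝ) : |x.1| ≤ ‖x‖ := norm_fst_le x

lemma abs_snd_fst_le (x : ℝ × ℝ × ℝ) : |x.2.1| ≤ ‖x‖ := (norm_fst_le x.2).trans (norm_snd_le x)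

lemma abs_snd_snd_le (x : ℝ × ℝ × ℝ) : |x.2.2| ≤ ‖x‖ := (norm_snd_le x.2).trans (norm_snd_le x)

lemma exp_two_mul_le {x : ℝ} (hx : |x| ≤ 1) : Real.exp (2 * x) ≤ 8 := by
  have h1 := (abs_le.mp hx).2
  have : Real.exp (2 * x) ≤ Real.exp 1 * Real.exp 1 := by
    rw [← Real.exp_add]; gcongr; linarith
  have h2 := Real.exp_one_lt_d9
  have h3 := Real.exp_pos 1
  nlinarith

lemma abs_exp_two_mul_sub_le {x y : ℝ} (hx : |x| ≤ 1) (hy : |y| ≤ 1) :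
    |Real.exp (2 * x) - Real.exp (2 * y)| ≤ 16 * |x - y| := by
  have key : ∀ a b : ℝ, |a| ≤ 1 → b ≤ a →
      Real.exp (2 * a) - Real.exp (2 * b) ≤ 16 * (a - b) := by
    intro a b ha hab
    have h1 := Real.add_one_le_exp (2 * b - 2 * a)
    have h2 := exp_two_mul_le ha
    have h3 : Real.exp (2 * b) = Real.exp (2 * a) * Real.exp (2 * b - 2 * a) := by
      rw [← Real.exp_add]; ring_nf
    have h4 := Real.exp_pos (2 * a)
    have h5 : Real.exp (2 * a) * (2 * b - 2 * a + 1) ≤ Real.exp (2 * b) := by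
      rw [h3]; gcongr
    have h6 : Real.exp (2 * a) * (2 * (a - b)) ≤ 8 * (2 * (a - b)) :=
      mul_le_mul_of_nonneg_right h2 (by linarith)
    linarith
  rcases le_total y x with h | h
  · have : Real.exp (2 * y) ≤ Real.exp (2 * x) := by gcongr
    rw [abs_of_nonneg (by linarith), abs_of_nonneg (by linarith)]
    exact key x y hx h
  · have : Real.exp (2 * x) ≤ Real.exp (2 * y) := by gcongr
    rw [abs_sub_comm, abs_sub_comm x, abs_of_nonneg (by linarith), abs_of_nonneg (by linarith)]
    exact key y x hy h

lemma continuousOn_rhs {X : Type*} [TopologicalSpace X] {S : Set X} (e : ℝ) {j : X → Jet}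
    (ho : ContinuousOn (fun x => (j x).o) S) (hr : ContinuousOn (fun x => (j x).r) S)
    (hru : ContinuousOn (fun x => (j x).ru) S) (hrv : ContinuousOn (fun x => (j x).rv) S)
    (hfu : ContinuousOn (fun x => (j x).fu) S) (hfv : ContinuousOn (fun x => (j x).fv) S)
    (hr0 : ∀ x ∈ S, (j x).r ≠ 0) : ContinuousOn (fun x => (j x).rhs e) S := by
  have k : ∀ c : ℝ, c ≠ 0 → ∀ n : ℕ, ∀ x ∈ S, c * (j x).r ^ n ≠ 0 := fun c hc n x hx =>
    mul_ne_zero hc (pow_ne_zero n (hr0 x hx))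
  have h1 : ContinuousOn (fun x => (j x).rhs₁ e) S := by
    unfold Jet.rhs₁
    refine ((ho.div (hr.const_mul 4) fun x hx => ?_).neg.sub ((hru.mul hrv).div hr hr0)).add
      ((ho.mul_const _).div ((hr.pow 3).const_mul 4) (k 4 (by norm_num) 3))
    exact mul_ne_zero (by norm_num) (hr0 x hx)
  have h2 : ContinuousOn (fun x => (j x).rhs₂) S := by
    unfold Jet.rhs₂
    exact ((hrv.mul hfu).div hr hr0).neg.sub ((hru.mul hfv).div hr hr0)
  have h3 : ContinuousOn (fun x => (j x).rhs₃ e) S := by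
    unfold Jet.rhs₃
    exact (((hfu.mul hfv).neg.sub ((ho.mul_const _).div ((hr.pow 4).const_mul 2)
      (k 2 (by norm_num) 4))).add (ho.div ((hr.pow 2).const_mul 4) (k 4 (by norm_num) 2))).add
      ((hru.mul hrv).div (hr.pow 2) fun x hx => pow_ne_zero 2 (hr0 x hx))
  exact h1.prodMk (h2.prodMk h3)

/-- The constant in `main_terms_le`. -/
def termConst (C D : ℝ) : ℝ := 4 * (C + 1) ^ 2 * (1 + D)

/-- The left side is the Lipschitz bound of `Jet.norm_rhs_sub_le` with x = v^{-s}, y = cU, α = δ +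
A, β = Cx + yδ + B and increments d = Cx + Ψ, db = Cx + B, da = A. Each product on expansion is a
term of the right side times factors bounded through x, Ψ ≤ 1 and yδ ≤ D. -/
lemma main_terms_le {C D δ x y A Ψ B : ℝ} (hC : 1 ≤ C) (hδ : 0 ≤ δ) (hx : 0 ≤ x)
    (hx1 : x ≤ 1) (hy : 0 ≤ y) (hyδ : y * δ ≤ D) (hA : 0 ≤ A) (hΨ : 0 ≤ Ψ) (hΨ1 : Ψ ≤ 1)
    (hB : 0 ≤ B) :
    (δ + (δ + A) * (C * x + y * δ + B)) * (C * x + Ψ) + (δ + A) * (C * x + B)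
      + (C * x + y * δ + B) * A
    ≤ termConst C D * (δ * x + δ * Ψ + δ * B + y * δ * A + (A * B + x * A)) := by
  have hyδ0 : 0 ≤ y * δ := by positivity
  have hD : 0 ≤ D := hyδ0.trans hyδ
  set X := C * x + Ψ with hX
  have hX0 : 0 ≤ X := by positivity
  have hX1 : X ≤ C + 1 := by
    have : C * x ≤ C * 1 := by gcongr
    linarith
  set T := δ * x + δ * Ψ + δ * B + y * δ * A + (A * B + x * A) with hT
  have t1 : 0 ≤ δ * x := by positivity
  have t2 : 0 ≤ δ * Ψ := by positivity
  have t3 : 0 ≤ δ * B := by positivity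
  have t4 : 0 ≤ y * δ * A := by positivity
  have t5 : 0 ≤ A * B := by positivity
  have t6 : 0 ≤ x * A := by positivity
  have hC0 : 0 ≤ C := by linarith
  have hδX : δ * X ≤ C * (δ * x + δ * Ψ) := by
    have : δ * X = C * (δ * x) + δ * Ψ := by rw [hX]; ring
    have : δ * Ψ ≤ C * (δ * Ψ) := le_mul_of_one_le_left t2 hC
    linarith
  have hδX0 : 0 ≤ δ * X := by positivity
  have s1 : δ * X * (y * δ) ≤ D * (C * (δ * x + δ * Ψ)) := by
    rw [mul_comm]; gcongr
  have s2 : δ * (C * x) * X ≤ (C + 1) * (C * (δ * x)) := by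
    have : δ * (C * x) * X ≤ δ * (C * x) * (C + 1) := by gcongr
    linarith
  have s3 : δ * B * X ≤ (C + 1) * (δ * B) := by
    rw [mul_comm]; gcongr
  have s4 : A * (C * x) * X ≤ (C + 1) * (C * (x * A)) := by
    have : A * (C * x) * X ≤ A * (C * x) * (C + 1) := by gcongr
    linarith
  have s5 : y * δ * A * X ≤ (C + 1) * (y * δ * A) := by
    rw [mul_comm]; gcongr
  have s6 : A * B * X ≤ (C + 1) * (A * B) := by
    rw [mul_comm]; gcongr
  have k1 : C ≤ (C + 1) ^ 2 := by nlinarith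
  have k2 : (C + 1) * C ≤ (C + 1) ^ 2 := by nlinarith
  have k3 : C + 1 ≤ (C + 1) ^ 2 := by nlinarith
  have k4 : 1 ≤ (C + 1) ^ 2 := by nlinarith
  set Q := (C + 1) ^ 2 with hQ
  have hQ0 : 0 ≤ Q := by positivity
  have r1 : C * (δ * x) ≤ Q * (δ * x) := by gcongr
  have r2 : C * (δ * Ψ) ≤ Q * (δ * Ψ) := by gcongr
  have r3 : (C + 1) * (C * (δ * x)) ≤ Q * (δ * x) := by
    rw [← mul_assoc]; gcongr
  have r4 : (C + 1) * (δ * B) ≤ Q * (δ * B) := by gcongr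
  have r5 : (C + 1) * (C * (x * A)) ≤ Q * (x * A) := by
    rw [← mul_assoc]; gcongr
  have r6 : (C + 1) * (y * δ * A) ≤ Q * (y * δ * A) := by gcongr
  have r7 : (C + 1) * (A * B) ≤ Q * (A * B) := by gcongr
  have r8 : D * (C * (δ * x + δ * Ψ)) ≤ D * (Q * (δ * x + δ * Ψ)) := by gcongr
  have r9 : C * (x * A) ≤ Q * (x * A) := by gcongr
  have r10 : δ * B ≤ Q * (δ * B) := le_mul_of_one_le_left t3 k4
  have r11 : A * B ≤ Q * (A * B) := le_mul_of_one_le_left t5 k4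
  have r12 : y * δ * A ≤ Q * (y * δ * A) := le_mul_of_one_le_left t4 k4
  have e1 : (δ + (δ + A) * (C * x + y * δ + B)) * X + (δ + A) * (C * x + B)
      + (C * x + y * δ + B) * A
      = δ * X + δ * X * (y * δ) + δ * (C * x) * X + δ * B * X + A * (C * x) * X
        + y * δ * A * X + A * B * X + C * (δ * x) + δ * B + 2 * (C * (x * A)) + 2 * (A * B)
        + y * δ * A := by ring
  have hQT : Q * T = Q * (δ * x) + Q * (δ * Ψ) + Q * (δ * B) + Q * (y * δ * A) + (Q * (A * B)
      + Q * (x * A)) := by rw [hT]; ring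
  have q1 : 0 ≤ Q * (δ * x) := by positivity
  have q2 : 0 ≤ Q * (δ * Ψ) := by positivity
  have q3 : 0 ≤ Q * (δ * B) := by positivity
  have q4 : 0 ≤ Q * (y * δ * A) := by positivity
  have q5 : 0 ≤ Q * (A * B) := by positivity
  have q6 : 0 ≤ Q * (x * A) := by positivity
  have r13 : D * (Q * (δ * x + δ * Ψ)) ≤ D * (Q * T) := by
    refine mul_le_mul_of_nonneg_left ?_ hD
    rw [hQT, mul_add]; linarith
  have hDT : 0 ≤ D * (Q * T) := by
    have : 0 ≤ Q * T := by rw [hQT]; linarith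
    positivity
  have e2 : termConst C D * T = 4 * (Q * T) + 4 * (D * (Q * T)) := by unfold termConst; ring
  rw [e1, e2, hQT]
  rw [hQT] at r13 hDT
  linarith

variable {M e s E U₀ : ℝ} {d : CharData} (h0 : 0 < |e|) (h1 : |e| < M) (hs : 1 < s) (hE : 0 < E)
  (h : IsEventHorizonData M e s E U₀ d) {W : Weight} {U v t : ℝ} {ψ a b ψ' a' b' : ℝ × ℝ × ℝ}

lemma jS_near (hδ : 0 ≤ dB M e U v) (hψ : ‖ψ‖ ≤ 1) (hψ' : ‖ψ'‖ ≤ 1)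
    (hd : Within W.Ψ W.A W.Bv t U v (ψ - ψ') (a - a') (b - b')) :
    Jet.Near (dB M e U v) (t * W.Ψ U v) (t * W.A U v) (t * W.Bv U v)
      (jS M e d U v ψ a b) (jS M e d U v ψ' a' b') := by
  obtain ⟨d1, d2, d3⟩ := hd
  have e1 := (abs_fst_le _).trans d1
  have e2 := (abs_snd_snd_le _).trans d1
  have e3 := (abs_fst_le _).trans d2
  have e4 := (abs_snd_fst_le _).trans d2
  have e5 := (abs_fst_le _).trans d3
  have e6 := (abs_snd_fst_le _).trans d3
  simp only [Prod.fst_sub, Prod.snd_sub] at e1 e2 e3 e4 e5 e6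
  refine ⟨?_, ?_, ?_, ?_, ?_, ?_⟩ <;> simp only [jS]
  · rw [add_sub_add_left_eq_sub]; exact e1
  · rw [← mul_sub, abs_mul, abs_of_nonneg hδ]
    have := abs_exp_two_mul_sub_le ((abs_snd_snd_le ψ).trans hψ) ((abs_snd_snd_le ψ').trans hψ')
    calc _ ≤ dB M e U v * (16 * (t * W.Ψ U v)) := by gcongr; linarith
      _ = _ := by ring
  · rw [add_sub_add_left_eq_sub]; exact e3
  · exact e4
  · rw [add_sub_add_left_eq_sub]; exact e5
  · rw [add_sub_add_left_eq_sub]; exact e6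

include h0 h1 hs hE h

lemma jS_near_jB (hδ : 0 ≤ dB M e U v) (hv : 1 ≤ v) (hψ1 : ‖ψ‖ ≤ 1)
    (hd : Within W.Ψ W.A W.Bv 1 U v ψ a b) :
    Jet.Near (dB M e U v) (horizonConst M e E * v ^ (-s) + W.Ψ U v) (W.A U v)
      (horizonConst M e E * v ^ (-s) + W.Bv U v) (jS M e d U v ψ a b) (jB M e U v) := by
  obtain ⟨d1, d2, d3⟩ := hd
  rw [one_mul] at d1 d2 d3
  have e1 := (abs_fst_le _).trans d1
  have e2 := (abs_snd_snd_le _).trans d1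
  have e3 := (abs_fst_le _).trans d2
  have e4 := (abs_snd_fst_le _).trans d2
  have e5 := (abs_fst_le _).trans d3
  have e6 := (abs_snd_fst_le _).trans d3
  have f1 := h.abs_rOut_sub_le h0 h1 hs hE (v := v) hv
  have f2 := h.abs_rOutV_le h0 h1 hs hE (v := v) hv
  have f3 := h.abs_φOutV_le (v := v) hv
  have hvs : 0 ≤ v ^ (-s) := Real.rpow_nonneg (by linarith) _
  have hCE := IsEventHorizonData.E_le_horizonConst h0 h1 hE
  have hC : 0 ≤ horizonConst M e E := hE.le.trans hCE
  have hx : 0 ≤ horizonConst M e E * v ^ (-s) := by positivity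
  have f4 : E * v ^ (-s) ≤ horizonConst M e E * v ^ (-s) := by gcongr
  refine ⟨?_, ?_, ?_, ?_, ?_, ?_⟩ <;> simp only [jS, jB]
  · rw [show d.rOut v + rB M e U v - rPlus M e + ψ.1 - rB M e U v
      = (d.rOut v - rPlus M e) + ψ.1 by ring]
    exact (abs_add_le _ _).trans (add_le_add f1 e1)
  · rw [show dB M e U v * Real.exp (2 * ψ.2.2) - dB M e U v
      = dB M e U v * (Real.exp (2 * ψ.2.2) - Real.exp (2 * 0)) by rw [mul_zero, Real.exp_zero]; ring,
      abs_mul, abs_of_nonneg hδ]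
    have := abs_exp_two_mul_sub_le ((abs_snd_snd_le ψ).trans hψ1) (y := 0) (by simp)
    rw [sub_zero] at this
    calc _ ≤ dB M e U v * (16 * (horizonConst M e E * v ^ (-s) + W.Ψ U v)) := by
          gcongr; linarith
      _ = _ := by ring
  · rw [add_sub_cancel_left]; exact e3
  · rw [sub_zero]; exact e4
  · rw [show d.rOutV v - cc M e * U * dB M e U v / 4 + b.1 - -(cc M e * U * dB M e U v / 4)
      = d.rOutV v + b.1 by ring]
    exact (abs_add_le _ _).trans (add_le_add f2 e5)
  · rw [sub_zero]
    exact (abs_add_le _ _).trans (add_le_add (f3.trans f4) e6)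

lemma jS_bdd {m : ℝ} (hδ : 0 ≤ dB M e U v) (hU : 0 ≤ U) (hv : 1 ≤ v) (hψ1 : ‖ψ‖ ≤ 1)
    (hr : 0 < (jS M e d U v ψ a b).r) (hm : (jS M e d U v ψ a b).r⁻¹ ≤ m)
    (hd : Within W.Ψ W.A W.Bv 1 U v ψ a b) :
    Jet.Bdd m (dB M e U v) (dB M e U v + W.A U v)
      (horizonConst M e E * v ^ (-s) + cc M e * U * dB M e U v + W.Bv U v)
      (jS M e d U v ψ a b) := by
  obtain ⟨d1, d2, d3⟩ := hd
  rw [one_mul] at d1 d2 d3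
  have e3 := (abs_fst_le _).trans d2
  have e4 := (abs_snd_fst_le _).trans d2
  have e5 := (abs_fst_le _).trans d3
  have e6 := (abs_snd_fst_le _).trans d3
  have f2 := h.abs_rOutV_le h0 h1 hs hE (v := v) hv
  have f3 := h.abs_φOutV_le (v := v) hv
  have hc := cc_pos h0 h1
  have hvs : 0 ≤ v ^ (-s) := Real.rpow_nonneg (by linarith) _
  have hCE := IsEventHorizonData.E_le_horizonConst h0 h1 hE
  have f4 : E * v ^ (-s) ≤ horizonConst M e E * v ^ (-s) := by gcongr
  have hD : 0 ≤ cc M e * U * dB M e U v := by positivity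
  refine ⟨hr, hm, ?_, ?_, ?_, ?_, ?_⟩ <;> simp only [jS]
  · rw [abs_mul, abs_of_nonneg hδ, Real.abs_exp]
    have := exp_two_mul_le ((abs_snd_snd_le ψ).trans hψ1)
    calc _ ≤ dB M e U v * 8 := by gcongr
      _ ≤ _ := by linarith
  · rw [abs_le] at e3 ⊢; constructor <;> linarith [e3.1, e3.2]
  · linarith
  · rw [abs_le] at e5 f2 ⊢; constructor <;> linarith [e5.1, e5.2, f2.1, f2.2]
  · rw [abs_le] at e6 f3 ⊢; constructor <;> linarith [e6.1, e6.2, f3.1, f3.2]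

omit hs h in
lemma jB_bdd {m : ℝ} (hU : 0 ≤ U) (hv : 1 ≤ v) (hm : (rMinus M e)⁻¹ ≤ m)
    (hA : 0 ≤ W.A U v) (hB : 0 ≤ W.Bv U v) :
    Jet.Bdd m (dB M e U v) (dB M e U v + W.A U v)
      (horizonConst M e E * v ^ (-s) + cc M e * U * dB M e U v + W.Bv U v) (jB M e U v) := by
  have hc := cc_pos h0 h1
  have hδ := dB_pos h0 h1 hU (v := v)
  have hr := rB_mem h0 h1 hU (v := v)
  have hrm := rMinus_pos h0 h1
  have hvs : 0 ≤ v ^ (-s) := Real.rpow_nonneg (by linarith) _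
  have hCE := IsEventHorizonData.E_le_horizonConst h0 h1 hE
  have hC : 0 ≤ horizonConst M e E := hE.le.trans hCE
  have hx : 0 ≤ horizonConst M e E * v ^ (-s) := by positivity
  have hD : 0 ≤ cc M e * U * dB M e U v := by positivity
  refine ⟨hrm.trans hr.1, (inv_anti₀ hrm hr.1.le).trans hm, ?_, ?_, ?_, ?_, ?_⟩ <;> simp only [jB]
  · rw [abs_of_pos hδ]; linarith
  · rw [abs_neg, abs_of_nonneg (by positivity)]; linarith
  · rw [abs_zero]; linarith
  · rw [abs_neg, abs_of_nonneg (by positivity)]; linarith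
  · rw [abs_zero]; linarith

end Existence

/-! ### Construction of the deviation. -/

section Existence

/-- The derivatives at `v = 1` of the deviation. -/
def aIn (M e U₀ : ℝ) (d : CharData) (U : ℝ) : ℝ × ℝ × ℝ :=
  (-1 + dB M e U 1 / 4, d.φInU U₀ U, -(d.rIn U * d.φInU U₀ U ^ 2 / 2) - lBU M e U 1)

/-- `n` is the mixed derivative of the deviation of the solution from the background, which has
the `U`-derivative `a₀` at `v = 1`. -/
structure IsDeviation (M e U₀ Us : ℝ) (d : CharData) (W : Weight) (a₀ : ℝ → ℝ × ℝ × ℝ)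
    (n : ℝ → ℝ → ℝ × ℝ × ℝ) : Prop where
  cont_a₀ : Continuous a₀
  cont_n : Continuous (Function.uncurry n)
  a₀_eq : ∀ U ∈ Icc 0 Us, a₀ U = aIn M e U₀ d U
  n_eq : ∀ U ∈ Icc 0 Us, ∀ v ∈ Ici (1 : ℝ), n U v =
    (jS M e d U v (primB (primA a₀ n) U v) (primA a₀ n U v) (primB n U v)).rhs e
      - (jB M e U v).rhs e
  within : ∀ U ∈ Icc 0 Us, ∀ v ∈ Ici (1 : ℝ),
    Within W.Ψ W.A W.Bv 1 U v (primB (primA a₀ n) U v) (primA a₀ n U v) (primB n U v)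
  Ψ_le : ∀ U ∈ Icc 0 Us, ∀ v ∈ Ici (1 : ℝ), W.Ψ U v ≤ rMinus M e / 4
  r_pos : ∀ U ∈ Icc 0 Us, ∀ v ∈ Ici (1 : ℝ),
    0 < (jS M e d U v (primB (primA a₀ n) U v) (primA a₀ n U v) (primB n U v)).r

variable {M e s E U₀ : ℝ} {d : CharData} (h0 : 0 < |e|) (h1 : |e| < M)

include h0 h1

lemma exists_aIn_bound (hU₀ : 0 < U₀) (hE : 0 < E) : ∃ K > 0, ∀ d : CharData,
    IsEventHorizonData M e s E U₀ d → ∀ U ∈ Icc 0 U₀, ‖aIn M e U₀ d U‖ ≤ K := by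
  have c1 : ContinuousOn (fun U => dB M e U 1) (Icc 0 U₀) := fun U hU =>
    ((continuousAt_dB h0 h1 hU.1 1).comp (f := fun x : ℝ => (x, (1 : ℝ)))
      (by fun_prop)).continuousWithinAt
  have c2 : ContinuousOn (fun U => lBU M e U 1) (Icc 0 U₀) := fun U hU =>
    ((continuousAt_lBU h0 h1 hU.1 1).comp (f := fun x : ℝ => (x, (1 : ℝ)))
      (by fun_prop)).continuousWithinAt
  obtain ⟨K₁, hK₁⟩ := isCompact_Icc.exists_bound_of_continuousOn c1
  obtain ⟨K₂, hK₂⟩ := isCompact_Icc.exists_bound_of_continuousOn c2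
  have hrp := rPlus_pos h0 h1
  refine ⟨1 + |K₁| + |K₂| + E + rPlus M e * E ^ 2, by positivity, fun d h U hU => ?_⟩
  have k1 := (hK₁ U hU).trans (le_abs_self _)
  have k2 := (hK₂ U hU).trans (le_abs_self _)
  have k3 := h.φ_bound U hU
  have k4 := h.rIn_le h0 h1 hU₀ hU
  have k5 := h.initial.rIn_pos U hU
  rw [Real.norm_eq_abs] at k1 k2
  have hE2 : 0 ≤ rPlus M e * E ^ 2 := by positivity
  have p1 := abs_nonneg K₁
  have p2 := abs_nonneg K₂
  have k6 : |d.rIn U * d.φInU U₀ U ^ 2 / 2| ≤ rPlus M e * E ^ 2 := by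
    rw [abs_of_nonneg (by positivity), ← sq_abs]
    have : d.rIn U * |d.φInU U₀ U| ^ 2 ≤ rPlus M e * E ^ 2 := by
      unfold CharData.φInU; gcongr
    linarith
  refine norm_prod_le_iff.mpr ⟨?_, norm_prod_le_iff.mpr ⟨?_, ?_⟩⟩
  · simp only [aIn, Real.norm_eq_abs]
    rw [abs_le] at k1 ⊢
    constructor <;> linarith
  · simp only [aIn, Real.norm_eq_abs, CharData.φInU]; linarith
  · simp only [aIn, Real.norm_eq_abs]
    rw [abs_le] at k2 k6 ⊢
    constructor <;> linarith

/-- Used for bounded v: there the Reissner–Nordström radius stays close to r₊ when U is small. -/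
lemma rPlus_sub_rB_le {U v : ℝ} (hU : 0 ≤ U) : rPlus M e - rB M e U v
    ≤ cc M e * U * Real.exp (cc M e * v) * (rPlus M e - rMinus M e) ^ qq M e := by
  have hξ := xi_nonneg h0 h1 hU (v := v)
  have hc := cc_pos h0 h1
  have k := rPlus_sub_rho h0 h1 hξ
  have hm := rho_mem h0 h1 hξ
  change rPlus M e - rho M e (xi M e U v) ≤ xi M e U v * _
  rw [k]
  have a3 : 0 < rho M e (xi M e U v) := (rMinus_pos h0 h1).trans hm.1
  have k1 : Real.exp (-(cc M e * rho M e (xi M e U v))) ≤ 1 := by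
    rw [Real.exp_le_one_iff]; have := mul_pos hc a3; linarith
  have k2 : (rho M e (xi M e U v) - rMinus M e) ^ qq M e ≤ (rPlus M e - rMinus M e) ^ qq M e :=
    Real.rpow_le_rpow (sub_pos.mpr hm.1).le (by linarith [hm.2]) (qq_pos h0 h1).le
  have k3 : 0 ≤ (rho M e (xi M e U v) - rMinus M e) ^ qq M e :=
    Real.rpow_nonneg (sub_pos.mpr hm.1).le _
  calc xi M e U v * Real.exp (-(cc M e * rho M e (xi M e U v)))
      * (rho M e (xi M e U v) - rMinus M e) ^ qq M e
      ≤ xi M e U v * 1 * (rPlus M e - rMinus M e) ^ qq M e := by gcongr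
    _ = _ := by ring

lemma continuousOn_jS_rhs (h : IsEventHorizonData M e s E U₀ d) {Us : ℝ}
    {ψ a b : ℝ → ℝ → ℝ × ℝ × ℝ} (hψ : Continuous (Function.uncurry ψ))
    (ha : Continuous (Function.uncurry a)) (hb : Continuous (Function.uncurry b))
    (hr : ∀ U ∈ Icc 0 Us, ∀ v ∈ Ici (1 : ℝ), 0 < (jS M e d U v (ψ U v) (a U v) (b U v)).r) :
    ContinuousOn (fun p : ℝ × ℝ => (jS M e d p.1 p.2 (ψ p.1 p.2) (a p.1 p.2) (b p.1 p.2)).rhs e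
      - (jB M e p.1 p.2).rhs e) (Icc 0 Us ×ˢ Ici 1) := by
  have hψ : Continuous fun p : ℝ × ℝ => ψ p.1 p.2 := hψ
  have ha : Continuous fun p : ℝ × ℝ => a p.1 p.2 := ha
  have hb : Continuous fun p : ℝ × ℝ => b p.1 p.2 := hb
  have cd : ContinuousOn (fun p : ℝ × ℝ => dB M e p.1 p.2) (Icc 0 Us ×ˢ Ici 1) := fun p hp =>
    (continuousAt_dB h0 h1 hp.1.1 p.2).continuousWithinAt
  have cr : ContinuousOn (fun p : ℝ × ℝ => rB M e p.1 p.2) (Icc 0 Us ×ˢ Ici 1) := fun p hp =>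
    (continuousAt_rB h0 h1 hp.1.1 p.2).continuousWithinAt
  have cs : ContinuousOn (fun p : ℝ × ℝ => p.2) (Icc 0 Us ×ˢ Ici (1 : ℝ)) :=
    continuous_snd.continuousOn
  have ms : MapsTo (fun p : ℝ × ℝ => p.2) (Icc 0 Us ×ˢ Ici (1 : ℝ)) (Ici 1) := fun p hp => hp.2
  have co : ContinuousOn (fun p : ℝ × ℝ => d.rOut p.2) (Icc 0 Us ×ˢ Ici 1) :=
    h.initial.rOut_reg.continuousOn.comp cs ms
  have cov : ContinuousOn (fun p : ℝ × ℝ => d.rOutV p.2) (Icc 0 Us ×ˢ Ici 1) :=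
    h.continuousOn_rOutV.comp cs ms
  have cfv : ContinuousOn (fun p : ℝ × ℝ => d.φOutV p.2) (Icc 0 Us ×ˢ Ici 1) :=
    h.continuousOn_φOutV.comp cs ms
  have cD : ContinuousOn (fun p : ℝ × ℝ => cc M e * p.1 * dB M e p.1 p.2 / 4)
      (Icc 0 Us ×ˢ Ici 1) :=
    (((by fun_prop : Continuous fun p : ℝ × ℝ => cc M e * p.1).continuousOn).mul cd).div_const 4
  refine ContinuousOn.sub ?_ ?_
  · refine continuousOn_rhs e ?_ ?_ ?_ ?_ ?_ ?_ fun p hp => (hr _ hp.1 _ hp.2).ne' <;>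
      simp only [jS]
    · exact cd.mul (by fun_prop : Continuous fun p : ℝ × ℝ =>
        Real.exp (2 * (ψ p.1 p.2).2.2)).continuousOn
    · exact ((co.add cr).sub continuousOn_const).add (continuous_fst.comp hψ).continuousOn
    · exact (cd.div_const 4).neg.add (continuous_fst.comp ha).continuousOn
    · exact (cov.sub cD).add (continuous_fst.comp hb).continuousOn
    · exact (continuous_fst.comp (continuous_snd.comp ha)).continuousOn
    · exact cfv.add (continuous_fst.comp (continuous_snd.comp hb)).continuousOn
  · refine continuousOn_rhs e ?_ ?_ ?_ ?_ ?_ ?_ fun p hp => ?_ <;> simp only [jB]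
    · exact cd
    · exact cr
    · exact (cd.div_const 4).neg
    · exact cD.neg
    · exact continuousOn_const
    · exact continuousOn_const
    · exact (rB_pos h0 h1 hp.1.1).ne'

/-- The order of the quantifiers is the point: v₀, a, l precede U₀ because for v ≥ V₀ the constant
of the nonlinearity relies on r ≥ r₋/2 only, whereas L, B and Us also serve v < V₀, where r is
bounded below through U₀. None of them depends on the data d. -/
lemma exists_deviation (hs : 1 < s) (hE : 0 < E) : ∃ v₀ a l : ℝ, ∀ U₀ > 0, ∃ L B Us : ℝ,
    0 < Us ∧ Us ≤ U₀ ∧ cc M e * Us ≤ Real.exp (-cc M e) ∧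
    (∀ U ∈ Icc 0 Us, ∀ v ∈ Ici (1 : ℝ), (⟨cc M e, s, v₀, a, l, L, B⟩ : Weight).Point U v) ∧
    ∀ d : CharData, IsEventHorizonData M e s E U₀ d → ∃ a₀ n,
      IsDeviation M e U₀ Us d ⟨cc M e, s, v₀, a, l, L, B⟩ a₀ n := by
  have hc := cc_pos h0 h1
  have hrm := rMinus_pos h0 h1
  have hM : 0 < M := h0.trans h1
  have hd := sub_pos.mpr (rMinus_lt_rPlus h1)
  obtain ⟨C, hC⟩ : ∃ x, x = horizonConst M e E := ⟨_, rfl⟩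
  have hC1 : 1 ≤ C := by
    have := rPlus_pos h0 h1
    have : 0 ≤ rPlus M e * E ^ 2 / cc M e := by positivity
    rw [hC]; unfold horizonConst; linarith
  obtain ⟨C_D, hC_D, hdB⟩ := exists_dB_le h0 h1 (s := s) (by linarith)
  obtain ⟨D, hD⟩ : ∃ x, x = 8 * M / rMinus M e := ⟨_, rfl⟩
  have hD0 : 0 < D := by rw [hD]; positivity
  obtain ⟨T, hT⟩ : ∃ x, x = termConst C D := ⟨_, rfl⟩
  have hT0 : 0 < T := by rw [hT]; unfold termConst; positivity
  have hlip : ∀ m, 0 < m → 0 < Jet.lipConst e m := fun m hm => by unfold Jet.lipConst; positivity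
  -- Bound on 1/r for v ≥ V₀, where the horizon radius and ψ cost at most r₋/4 each and leave r ≥
  -- r₋/2. Its counterpart m₁ for v < V₀ corresponds to r ≥ U₀/2.
  obtain ⟨m₀, hm₀⟩ : ∃ x, x = 1 + 2 / rMinus M e := ⟨_, rfl⟩
  have hm₀1 : 1 ≤ m₀ := by rw [hm₀]; have : 0 < 2 / rMinus M e := by positivity
                           linarith
  obtain ⟨V₀, hV₀1, hV₀⟩ : ∃ V₀, 1 ≤ V₀ ∧ ∀ v ≥ V₀, C * v ^ (-s) ≤ rMinus M e / 4 := by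
    have k := ((tendsto_rpow_neg_atTop (by linarith : 0 < s)).const_mul C).eventually_le_const
      (u := rMinus M e / 4) (by rw [mul_zero]; positivity)
    obtain ⟨V, hV⟩ := eventually_atTop.mp k
    exact ⟨max 1 V, le_max_left _ _, fun v hv => hV v ((le_max_right _ _).trans hv)⟩
  -- The factor 2 in the constant is what gives the Lipschitz constant 1/2.
  obtain ⟨v₀, a, l, hW⟩ := Weight.exists_weight hc hs hC_D
    (mul_pos (mul_pos two_pos (hlip m₀ (by linarith))) hT0)
  refine ⟨v₀, a, l, fun U₀ hU₀ => ?_⟩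
  obtain ⟨m₁, hm₁⟩ : ∃ x, x = m₀ + 2 / U₀ := ⟨_, rfl⟩
  have hm₀₁ : m₀ ≤ m₁ := by rw [hm₁]; have : 0 < 2 / U₀ := by positivity
                            linarith
  obtain ⟨Ka, hKa, haIn⟩ := exists_aIn_bound (s := s) h0 h1 hU₀ hE
  obtain ⟨η, hη⟩ : ∃ x, x = min 1 (min (rMinus M e / 4) (U₀ / 4)) := ⟨_, rfl⟩
  have hη0 : 0 < η := by rw [hη]; positivity
  have hη1 : η ≤ 1 := by rw [hη]; exact min_le_left _ _
  have hη2 : η ≤ rMinus M e / 4 := by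
    rw [hη]; exact (min_le_right _ _).trans (min_le_left _ _)
  have hη3 : η ≤ U₀ / 4 := by rw [hη]; exact (min_le_right _ _).trans (min_le_right _ _)
  obtain ⟨q, hq⟩ : ∃ x, x = cc M e * Real.exp (cc M e * V₀) * (rPlus M e - rMinus M e) ^ qq M e :=
    ⟨_, rfl⟩
  have hq0 : 0 < q := by rw [hq]; positivity
  -- Of the upper bounds imposed on Us, the second means u ≤ −1, and the third keeps r_RN within
  -- U₀/4 of r₊ for v ≤ V₀.
  obtain ⟨L, B, Us, hgood, hUs, hUs', hpt⟩ := hW (2 * Jet.lipConst e m₁ * T) V₀ Ka η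
    (min U₀ (min (Real.exp (-cc M e) / cc M e) (U₀ / 4 / q)))
    (mul_pos (mul_pos two_pos (hlip m₁ (by linarith))) hT0) hKa hη0 (by positivity)
  have hUs1 : Us ≤ U₀ := hUs'.trans (min_le_left _ _)
  have hUs2 : Us ≤ Real.exp (-cc M e) / cc M e :=
    hUs'.trans ((min_le_right _ _).trans (min_le_left _ _))
  have hUs3 : Us ≤ U₀ / 4 / q := hUs'.trans ((min_le_right _ _).trans (min_le_right _ _))
  obtain ⟨W, hWdef⟩ : ∃ W : Weight, W = ⟨cc M e, s, v₀, a, l, L, B⟩ := ⟨_, rfl⟩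
  have hWc : W.c = cc M e := by rw [hWdef]
  have hWs : W.s = s := by rw [hWdef]
  refine ⟨L, B, Us, hUs, hUs1, by rw [mul_comm]; exact (le_div_iff₀ hc).mp hUs2,
    fun U hU v hv => (hpt U v hU.1 hU.2 hv).1, fun d h => ?_⟩
  rw [← hWdef] at hpt ⊢
  have hpoint : ∀ U ∈ Icc 0 Us, ∀ v ∈ Ici (1 : ℝ), W.Point U v :=
    fun U hU v hv => (hpt U v hU.1 hU.2 hv).1
  -- the bound from below for `r`
  have hr : ∀ U ∈ Icc 0 Us, ∀ v ∈ Ici (1 : ℝ), ∃ m, 1 ≤ m ∧ m₀ ≤ m ∧ m ≤ m₁ ∧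
      (V₀ ≤ v → m ≤ m₀) ∧ ∀ ψ a b : ℝ × ℝ × ℝ, Within W.Ψ W.A W.Bv 1 U v ψ a b →
        0 < (jS M e d U v ψ a b).r ∧ (jS M e d U v ψ a b).r⁻¹ ≤ m := by
    intro U hU v hv
    obtain ⟨-, hΨ, -, -⟩ := hpt U v hU.1 hU.2 hv
    have hrB := rB_mem h0 h1 hU.1 (v := v)
    rcases le_or_gt V₀ v with hvV | hvV
    · refine ⟨m₀, hm₀1, le_rfl, hm₀₁, fun _ => le_rfl, fun ψ a b hw => ?_⟩
      have k1 := (abs_le.mp ((abs_fst_le _).trans hw.1)).1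
      have k2 := h.rPlus_sub_rOut_le h0 h1 hs hE hv
      rw [← hC] at k2
      have k3 := hV₀ v hvV
      have k4 : rMinus M e / 2 ≤ (jS M e d U v ψ a b).r := by
        simp only [jS]; linarith [hrB.1]
      refine ⟨by linarith, (inv_anti₀ (by linarith) k4).trans ?_⟩
      rw [inv_div, hm₀]; linarith
    · refine ⟨m₁, hm₀1.trans hm₀₁, hm₀₁, le_rfl, fun hh => absurd hh hvV.not_ge, fun ψ a b hw => ?_⟩
      have k1 := (abs_le.mp ((abs_fst_le _).trans hw.1)).1
      have k2 := h.le_rOut h0 h1 hU₀ hv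
      have k3 := rPlus_sub_rB_le h0 h1 hU.1 (v := v)
      have k5 : cc M e * U * Real.exp (cc M e * v) * (rPlus M e - rMinus M e) ^ qq M e
          ≤ U₀ / 4 := by
        have : cc M e * U * Real.exp (cc M e * v) * (rPlus M e - rMinus M e) ^ qq M e
            ≤ cc M e * (U₀ / 4 / q) * Real.exp (cc M e * V₀)
              * (rPlus M e - rMinus M e) ^ qq M e := by
          have := hU.2.trans hUs3
          gcongr
        refine this.trans (le_of_eq ?_)
        rw [show cc M e * (U₀ / 4 / q) * Real.exp (cc M e * V₀)
              * (rPlus M e - rMinus M e) ^ qq M e = U₀ / 4 / q * q by rw [hq]; ring]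
        exact div_mul_cancel₀ _ hq0.ne'
      have k4 : U₀ / 2 ≤ (jS M e d U v ψ a b).r := by
        simp only [jS]; linarith
      refine ⟨by linarith, (inv_anti₀ (by linarith) k4).trans ?_⟩
      rw [inv_div, hm₁]; linarith
  -- the weighted bound
  have hbound : ∀ U ∈ Icc 0 Us, ∀ v ∈ Ici (1 : ℝ), ∀ m, 1 ≤ m → m ≤ m₁ → (V₀ ≤ v → m ≤ m₀) →
      2 * Jet.lipConst e m * ((dB M e U v + (dB M e U v + W.A U v)
        * (C * v ^ (-s) + cc M e * U * dB M e U v + W.Bv U v)) * (C * v ^ (-s) + W.Ψ U v)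
        + (dB M e U v + W.A U v) * (C * v ^ (-s) + W.Bv U v)
        + (C * v ^ (-s) + cc M e * U * dB M e U v + W.Bv U v) * W.A U v) ≤ W.w U v := by
    intro U hU v hv m hm1 hmm hmv
    obtain ⟨hp, hΨ, -, -, hK⟩ := hpt U v hU.1 hU.2 hv
    have hδ := dB_pos h0 h1 hU.1 (v := v)
    have hlm := hlip m (by linarith)
    have mono : ∀ m', m ≤ m' → 2 * Jet.lipConst e m * T ≤ 2 * Jet.lipConst e m' * T := by
      intro m' hmm'
      unfold Jet.lipConst
      gcongr
    have hvs := hp.vs_pos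
    have hvs1 := hp.vs_le_one
    rw [hWs] at hvs hvs1
    have hterms := main_terms_le (y := cc M e * U) hC1 hδ.le hvs.le hvs1
      (mul_nonneg hc.le hU.1) ((cU_dB_le h0 h1 hU.1 (v := v)).trans_eq hD.symm)
      hp.A_pos.le hp.Ψ_nonneg (hΨ.trans hη1) hp.Bv_nonneg
    have key := hK (dB M e U v) (2 * Jet.lipConst e m * T) hδ.le (hdB W hWc hWs U v hU.1)
      (by positivity) (mono m₁ hmm) (fun hh => mono m₀ (hmv hh))
    refine le_trans ?_ key
    rw [mul_assoc (2 * _) T]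
    refine mul_le_mul_of_nonneg_left ?_ (by positivity)
    unfold Weight.dterms Weight.qterms
    rw [hWc, hWs, hT]
    exact hterms
  have hwithin1 : ∀ U ∈ Icc 0 Us, ∀ v ∈ Ici (1 : ℝ), ∀ ψ a b : ℝ × ℝ × ℝ,
      Within W.Ψ W.A W.Bv 1 U v ψ a b → ‖ψ‖ ≤ 1 := by
    intro U hU v hv ψ a b hw
    obtain ⟨-, hΨ, -, -⟩ := hpt U v hU.1 hU.2 hv
    have := hw.1
    linarith
  -- the initial derivative
  let π : ℝ → ℝ := fun U => max 0 (min U₀ U)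
  have hπ : Continuous π := by fun_prop
  have hπm : ∀ U, π U ∈ Icc 0 U₀ := fun U => by simp [π, hU₀.le]
  have hπe : ∀ U ∈ Icc 0 Us, π U = U := fun U hU => by
    simp only [π]; rw [min_eq_right (hU.2.trans hUs1), max_eq_right hU.1]
  have ca : Continuous fun U => aIn M e U₀ d (π U) := by
    have cφ : Continuous fun U => d.φInU U₀ (π U) :=
      (h.continuousOn_φInU hU₀).comp_continuous hπ hπm
    have cr : Continuous fun U => d.rIn (π U) :=
      h.initial.rIn_reg.continuousOn.comp_continuous hπ hπm
    have cd : Continuous fun U => dB M e (π U) 1 := by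
      rw [continuous_iff_continuousAt]
      exact fun U => (continuousAt_dB h0 h1 (hπm U).1 1).comp (f := fun x : ℝ => (π x, (1 : ℝ)))
        (by fun_prop)
    have cl : Continuous fun U => lBU M e (π U) 1 := by
      rw [continuous_iff_continuousAt]
      exact fun U => (continuousAt_lBU h0 h1 (hπm U).1 1).comp (f := fun x : ℝ => (π x, (1 : ℝ)))
        (by fun_prop)
    unfold aIn
    fun_prop
  have hsol := exists_goursat (w := W.w) (A := W.A) (B := W.Bv) (P := W.Ψ) hUs.le
    (fun U v ψ a b => (jS M e d U v ψ a b).rhs e - (jB M e U v).rhs e) ca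
    (Weight.continuousOn_w hpoint) (fun U hU v hv => (hpoint U hU v hv).w_pos)
    (Weight.continuousOn_A hpoint) ?_
    (fun U hU v hv => Weight.integral_w_left_le hpoint hU hv)
    (fun U hU v hv => Weight.integral_A_left_le hpoint hU hv) ?_ ?_ ?_
  · obtain ⟨n, hn, hsol⟩ := hsol
    refine ⟨fun U => aIn M e U₀ d (π U), n, ca, hn, fun U hU => by simp only [hπe U hU],
      fun U hU v hv => (hsol U hU v hv).1, fun U hU v hv => (hsol U hU v hv).2,
      fun U hU v hv => (hpt U v hU.1 hU.2 hv).2.1.trans hη2, fun U hU v hv => ?_⟩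
    obtain ⟨m, -, -, -, -, hm⟩ := hr U hU v hv
    exact (hm _ _ _ (hsol U hU v hv).2).1
  · intro U hU v hv
    -- The integral of w is at most A(U, v) − A(U, 1), and A(U, 1) ≥ Ka pays for the initial
    -- derivative.
    have k1 := Weight.integral_w_right_le hpoint hU hv
    obtain ⟨-, -, -, k2, -⟩ := hpt U 1 hU.1 hU.2 le_rfl
    have k3 := haIn d h (π U) (hπm U)
    linarith
  · refine fun ψ a b hψ ha hb hw => continuousOn_jS_rhs h0 h1 h hψ ha hb fun U hU v hv => ?_
    obtain ⟨m, -, -, -, -, hm⟩ := hr U hU v hv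
    exact (hm _ _ _ (hw U hU v hv)).1
  · intro U hU v hv ψ a b hw
    obtain ⟨m, hm1, hm2, hm3, hm4, hm⟩ := hr U hU v hv
    have hp := hpoint U hU v hv
    have hδ := (dB_pos h0 h1 hU.1 (v := v)).le
    have hψ1 := hwithin1 U hU v hv _ _ _ hw
    have k := Jet.norm_rhs_sub_le e hm1 hδ
      (jS_bdd h0 h1 hs hE h hδ hU.1 hv hψ1 (hm _ _ _ hw).1 (hm _ _ _ hw).2 hw)
      (jB_bdd h0 h1 hE hU.1 hv (le_trans (by
        rw [hm₀, inv_eq_one_div]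
        have : 1 / rMinus M e ≤ 2 / rMinus M e := by gcongr; norm_num
        linarith) hm2) hp.A_pos.le hp.Bv_nonneg)
      (jS_near_jB h0 h1 hs hE h hδ hv hψ1 hw)
    refine k.trans ?_
    rw [← hC]
    have k2 := hbound U hU v hv m hm1 hm3 hm4
    have k3 := hp.w_pos
    rw [mul_assoc 2] at k2
    linarith
  · intro U hU v hv ψ a b ψ' a' b' t ht hw hw' hd
    obtain ⟨m, hm1, hm2, hm3, hm4, hm⟩ := hr U hU v hv
    have hp := hpoint U hU v hv
    have hδ := (dB_pos h0 h1 hU.1 (v := v)).le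
    have hψ1 := hwithin1 U hU v hv _ _ _ hw
    have hψ1' := hwithin1 U hU v hv _ _ _ hw'
    have k := Jet.norm_rhs_sub_le e hm1 hδ
      (jS_bdd h0 h1 hs hE h hδ hU.1 hv hψ1 (hm _ _ _ hw).1 (hm _ _ _ hw).2 hw)
      (jS_bdd h0 h1 hs hE h hδ hU.1 hv hψ1' (hm _ _ _ hw').1 (hm _ _ _ hw').2 hw')
      (jS_near hδ hψ1 hψ1' hd)
    simp only [sub_sub_sub_cancel_right]
    refine k.trans ?_
    have k2 := hbound U hU v hv m hm1 hm3 hm4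
    rw [← hC]
    have hvs := hp.vs_pos
    rw [hWs] at hvs
    have hA := hp.A_pos
    have hB := hp.Bv_nonneg
    have hΨ := hp.Ψ_nonneg
    have hU0 := hU.1
    have hl := hlip m (by linarith)
    have hCx : 0 ≤ C * v ^ (-s) := by positivity
    have hβ : 0 ≤ C * v ^ (-s) + cc M e * U * dB M e U v + W.Bv U v := by positivity
    generalize C * v ^ (-s) + cc M e * U * dB M e U v + W.Bv U v = β at *
    generalize C * v ^ (-s) = x at *
    generalize dB M e U v = δ at *
    -- Ψ and Bv are enlarged to x + Ψ and x + Bv, so that the inequality used for the size of the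
    -- nonlinearity also gives its Lipschitz bound.
    calc _ = t / 2 * (2 * Jet.lipConst e m * ((δ + (δ + W.A U v) * β) * W.Ψ U v
          + (δ + W.A U v) * W.Bv U v + β * W.A U v)) := by ring
      _ ≤ t / 2 * (2 * Jet.lipConst e m * ((δ + (δ + W.A U v) * β) * (x + W.Ψ U v)
          + (δ + W.A U v) * (x + W.Bv U v) + β * W.A U v)) := by
        gcongr <;> linarith
      _ ≤ _ := by gcongr

end Existence

/-! ### Regularity and the Raychaudhuri equations -/

section Mixed

/-- A convex set of reals onto which there is a continuous retraction of `ℝ`. -/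
structure IsInterval (I : Set ℝ) : Prop where
  convex : Convex ℝ I
  uniqueDiff : UniqueDiffOn ℝ I
  retract : ∃ ρ : ℝ → ℝ, Continuous ρ ∧ (∀ x, ρ x ∈ I) ∧ ∀ x ∈ I, ρ x = x

lemma isInterval_Icc {a b : ℝ} (h : a < b) : IsInterval (Icc a b) :=
  ⟨convex_Icc _ _, uniqueDiffOn_Icc h, fun x => max a (min b x), by fun_prop,
    fun x => by simp [h.le], fun x hx => by
      change max a (min b x) = x; rw [min_eq_right hx.2, max_eq_right hx.1]⟩

lemma isInterval_Ici (a : ℝ) : IsInterval (Ici a) :=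
  ⟨convex_Ici _, uniqueDiffOn_Ici a, fun x => max a x, by fun_prop,
    fun x => by simp, fun x hx => max_eq_right hx⟩

lemma eq_of_hasDerivWithinAt_zero {I : Set ℝ} (hI : Convex ℝ I) {f : ℝ → ℝ}
    (h : ∀ x ∈ I, HasDerivWithinAt f 0 I x) {x y : ℝ} (hx : x ∈ I) (hy : y ∈ I) : f x = f y := by
  have := hI.norm_image_sub_le_of_norm_hasDerivWithin_le (C := 0) h (fun x _ => by simp) hx hy
  rw [zero_mul] at this
  exact (sub_eq_zero.mp (norm_le_zero_iff.mp this)).symm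

/-- If `∂_u∂_v f = q` is continuous, then `∂_v∂_u f` exists and is equal to it. -/
lemma exists_partial_of_mixed {I J : Set ℝ} (hI : IsInterval I) (hJ : IsInterval J) {u₀ v₀ : ℝ}
    (hu₀ : u₀ ∈ I) (hv₀ : v₀ ∈ J) {f p q : ℝ → ℝ → ℝ} {f₁ : ℝ → ℝ}
    (hf : ∀ u ∈ I, ∀ v ∈ J, HasDerivWithinAt (fun y => f u y) (p u v) J v)
    (hp : ∀ u ∈ I, ∀ v ∈ J, HasDerivWithinAt (fun x => p x v) (q u v) I u)
    (hq : ContinuousOn (fun z : ℝ × ℝ => q z.1 z.2) (I ×ˢ J))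
    (h1 : ∀ u ∈ I, HasDerivWithinAt (fun x => f x v₀) (f₁ u) I u) (h1c : ContinuousOn f₁ I) :
    ∃ a : ℝ → ℝ → ℝ, ContinuousOn (fun z : ℝ × ℝ => a z.1 z.2) (I ×ˢ J) ∧
      (∀ u ∈ I, a u v₀ = f₁ u) ∧
      (∀ u ∈ I, ∀ v ∈ J, HasDerivWithinAt (fun x => f x v) (a u v) I u) ∧
      ∀ u ∈ I, ∀ v ∈ J, HasDerivWithinAt (fun y => a u y) (q u v) J v := by
  obtain ⟨ρ, hρ, hρm, hρe⟩ := hI.retract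
  obtain ⟨σ, hσ, hσm, hσe⟩ := hJ.retract
  obtain ⟨Q, hQ⟩ : ∃ Q : ℝ → ℝ → ℝ, Q = fun u v => q (ρ u) (σ v) := ⟨_, rfl⟩
  have hQc : Continuous (Function.uncurry Q) := by
    rw [hQ]
    exact hq.comp_continuous (f := fun z : ℝ × ℝ => (ρ z.1, σ z.2)) (by fun_prop)
      fun z => ⟨hρm _, hσm _⟩
  have hQe : ∀ u ∈ I, ∀ v ∈ J, Q u v = q u v := by
    intro u hu v hv; rw [hQ]; simp only [hρe u hu, hσe v hv]
  have dv : ∀ u v, HasDerivAt (fun y => ∫ x in u₀..u, ∫ t in v₀..y, Q x t)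
      (∫ x in u₀..u, Q x v) v := by
    intro u v
    simp only [integral_integral_comm hQc]
    exact hasDerivAt_integral (continuous_right (continuous_integral_fst hQc u₀) u) v₀ v
  have du : ∀ u v, HasDerivAt (fun x => ∫ x in u₀..x, ∫ t in v₀..v, Q x t)
      (∫ t in v₀..v, Q u t) u := fun u v =>
    hasDerivAt_integral (continuous_left (continuous_integral_snd hQc v₀) v) u₀ u
  have hpu : ∀ u ∈ I, ∀ v ∈ J, p u v - ∫ x in u₀..u, Q x v = p u₀ v := by
    intro u hu v hv
    have := eq_of_hasDerivWithinAt_zero hI.convex (f := fun u => p u v - ∫ x in u₀..u, Q x v)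
      (fun x hx => ((hp x hx v hv).sub (hasDerivAt_integral (continuous_left hQc v) u₀
        x).hasDerivWithinAt).congr_deriv (by rw [hQe x hx v hv, sub_self])) hu hu₀
    simpa using this
  -- f minus the double integral of q is a function of u plus a function of v; the u-derivative and
  -- the mixed derivative in the other order are then read off.
  have key : ∀ u ∈ I, ∀ v ∈ J, f u v
      = f u v₀ + (f u₀ v - f u₀ v₀) + ∫ x in u₀..u, ∫ t in v₀..v, Q x t := by
    intro u hu v hv
    have := eq_of_hasDerivWithinAt_zero hJ.convex
      (f := fun y => f u y - (∫ x in u₀..u, ∫ t in v₀..y, Q x t) - f u₀ y)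
      (fun y hy => (((hf u hu y hy).sub (dv u y).hasDerivWithinAt).sub
        (hf u₀ hu₀ y hy)).congr_deriv (by rw [hpu u hu y hy, sub_self])) hv hv₀
    simp only [intervalIntegral.integral_same, intervalIntegral.integral_zero] at this
    linarith
  refine ⟨fun u v => f₁ u + ∫ t in v₀..v, Q u t, ?_, fun u hu => by simp, fun u hu v hv => ?_,
    fun u hu v hv => ?_⟩
  · exact (h1c.comp continuousOn_fst fun z hz => hz.1).add
      (continuous_integral_snd hQc v₀).continuousOn
  · have := ((h1 u hu).add_const (f u₀ v - f u₀ v₀)).add (du u v).hasDerivWithinAt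
    exact this.congr (fun x hx => key x hx v hv) (key u hu v hv)
  · have := (hasDerivAt_integral (continuous_right hQc u) v₀ v).const_add (f₁ u)
    rw [hQe u hu v hv] at this
    exact this.hasDerivWithinAt

end Mixed

/-- A solution of the wave equations, given with its first derivatives, where `l = log Ω`. -/
structure SolvesJet (e : ℝ) (I J : Set ℝ) (r f l ru fu lu rv fv lv : ℝ → ℝ → ℝ)
    (j : ℝ → ℝ → Jet) : Prop where
  j_eq : ∀ u v, j u v = ⟨Real.exp (2 * l u v), r u v, ru u v, rv u v, fu u v, fv u v⟩
  r_pos : ∀ u ∈ I, ∀ v ∈ J, 0 < r u v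
  r_u : ∀ u ∈ I, ∀ v ∈ J, HasDerivWithinAt (fun x => r x v) (ru u v) I u
  f_u : ∀ u ∈ I, ∀ v ∈ J, HasDerivWithinAt (fun x => f x v) (fu u v) I u
  l_u : ∀ u ∈ I, ∀ v ∈ J, HasDerivWithinAt (fun x => l x v) (lu u v) I u
  r_v : ∀ u ∈ I, ∀ v ∈ J, HasDerivWithinAt (fun y => r u y) (rv u v) J v
  f_v : ∀ u ∈ I, ∀ v ∈ J, HasDerivWithinAt (fun y => f u y) (fv u v) J v
  l_v : ∀ u ∈ I, ∀ v ∈ J, HasDerivWithinAt (fun y => l u y) (lv u v) J v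
  cont_ru : ContinuousOn (fun z : ℝ × ℝ => ru z.1 z.2) (I ×ˢ J)
  cont_fu : ContinuousOn (fun z : ℝ × ℝ => fu z.1 z.2) (I ×ˢ J)
  cont_lu : ContinuousOn (fun z : ℝ × ℝ => lu z.1 z.2) (I ×ˢ J)
  cont_rv : ContinuousOn (fun z : ℝ × ℝ => rv z.1 z.2) (I ×ˢ J)
  cont_fv : ContinuousOn (fun z : ℝ × ℝ => fv z.1 z.2) (I ×ˢ J)
  cont_lv : ContinuousOn (fun z : ℝ × ℝ => lv z.1 z.2) (I ×ˢ J)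
  ru_v : ∀ u ∈ I, ∀ v ∈ J, HasDerivWithinAt (fun y => ru u y) ((j u v).rhs₁ e) J v
  fu_v : ∀ u ∈ I, ∀ v ∈ J, HasDerivWithinAt (fun y => fu u y) ((j u v).rhs₂) J v
  lu_v : ∀ u ∈ I, ∀ v ∈ J, HasDerivWithinAt (fun y => lu u y) ((j u v).rhs₃ e) J v
  rv_u : ∀ u ∈ I, ∀ v ∈ J, HasDerivWithinAt (fun x => rv x v) ((j u v).rhs₁ e) I u
  fv_u : ∀ u ∈ I, ∀ v ∈ J, HasDerivWithinAt (fun x => fv x v) ((j u v).rhs₂) I u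
  lv_u : ∀ u ∈ I, ∀ v ∈ J, HasDerivWithinAt (fun x => lv x v) ((j u v).rhs₃ e) I u

namespace SolvesJet

variable {e : ℝ} {I J : Set ℝ} {r f l ru fu lu rv fv lv : ℝ → ℝ → ℝ} {j : ℝ → ℝ → Jet}

lemma _root_.ContinuousOn.swap_prod {g : ℝ × ℝ → ℝ} (h : ContinuousOn g (I ×ˢ J)) :
    ContinuousOn (fun z : ℝ × ℝ => g z.swap) (J ×ˢ I) :=
  h.comp continuous_swap.continuousOn fun _ hz => ⟨hz.2, hz.1⟩

/-- The system is invariant under the exchange of the null coordinates, so every statement about ∂_u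
has a counterpart for ∂_v. -/
lemma swap (h : SolvesJet e I J r f l ru fu lu rv fv lv j) :
    SolvesJet e J I (fun a b => r b a) (fun a b => f b a) (fun a b => l b a)
      (fun a b => rv b a) (fun a b => fv b a) (fun a b => lv b a)
      (fun a b => ru b a) (fun a b => fu b a) (fun a b => lu b a)
      (fun a b => ⟨(j b a).o, (j b a).r, (j b a).rv, (j b a).ru, (j b a).fv, (j b a).fu⟩) where
  j_eq u v := by rw [h.j_eq]
  r_pos u hu v hv := h.r_pos v hv u hu
  r_u u hu v hv := h.r_v v hv u hu
  f_u u hu v hv := h.f_v v hv u hu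
  l_u u hu v hv := h.l_v v hv u hu
  r_v u hu v hv := h.r_u v hv u hu
  f_v u hu v hv := h.f_u v hv u hu
  l_v u hu v hv := h.l_u v hv u hu
  cont_ru := h.cont_rv.swap_prod
  cont_fu := h.cont_fv.swap_prod
  cont_lu := h.cont_lv.swap_prod
  cont_rv := h.cont_ru.swap_prod
  cont_fv := h.cont_fu.swap_prod
  cont_lv := h.cont_lu.swap_prod
  ru_v u hu v hv := (h.rv_u v hv u hu).congr_deriv (by simp only [Jet.rhs₁]; ring)
  fu_v u hu v hv := (h.fv_u v hv u hu).congr_deriv (by simp only [Jet.rhs₂]; ring)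
  lu_v u hu v hv := (h.lv_u v hv u hu).congr_deriv (by simp only [Jet.rhs₃]; ring)
  rv_u u hu v hv := (h.ru_v v hv u hu).congr_deriv (by simp only [Jet.rhs₁]; ring)
  fv_u u hu v hv := (h.fu_v v hv u hu).congr_deriv (by simp only [Jet.rhs₂]; ring)
  lv_u u hu v hv := (h.lu_v v hv u hu).congr_deriv (by simp only [Jet.rhs₃]; ring)

variable (hI : IsInterval I) (hJ : IsInterval J) (h : SolvesJet e I J r f l ru fu lu rv fv lv j)

include hI hJ h

lemma cont_r : ContinuousOn (fun z : ℝ × ℝ => r z.1 z.2) (I ×ˢ J) :=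
  continuousOn_of_partials hI.convex hJ.convex h.r_u h.r_v h.cont_ru h.cont_rv

lemma cont_l : ContinuousOn (fun z : ℝ × ℝ => l z.1 z.2) (I ×ˢ J) :=
  continuousOn_of_partials hI.convex hJ.convex h.l_u h.l_v h.cont_lu h.cont_lv

/-- The second derivative `∂_u² r`, and the Raychaudhuri equation. -/
lemma exists_ruu {u₀ v₀ : ℝ} (hu₀ : u₀ ∈ I) (hv₀ : v₀ ∈ J) {g : ℝ → ℝ}
    (hg : ∀ u ∈ I, HasDerivWithinAt (fun x => ru x v₀) (g u) I u) (hgc : ContinuousOn g I)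
    (hray : ∀ u ∈ I, g u - 2 * ru u v₀ * lu u v₀ + r u v₀ * fu u v₀ ^ 2 = 0) :
    ∃ ruu : ℝ → ℝ → ℝ, ContinuousOn (fun z : ℝ × ℝ => ruu z.1 z.2) (I ×ˢ J) ∧
      (∀ u ∈ I, ∀ v ∈ J, HasDerivWithinAt (fun x => ru x v) (ruu u v) I u) ∧
      ∀ u ∈ I, ∀ v ∈ J, ruu u v - 2 * ru u v * lu u v + r u v * fu u v ^ 2 = 0 := by
  have hr := h.cont_r hI hJ
  have hl := h.cont_l hI hJ
  have hr0 : ∀ z ∈ I ×ˢ J, r z.1 z.2 ≠ 0 := fun z hz => (h.r_pos _ hz.1 _ hz.2).ne'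
  obtain ⟨q, hq⟩ : ∃ q : ℝ → ℝ → ℝ, q = fun u v =>
      Real.exp (2 * l u v) * (2 * lu u v * (-(1 / 4) + e ^ 2 / (4 * r u v ^ 2))
        - e ^ 2 / (2 * r u v ^ 3) * ru u v) := ⟨_, rfl⟩
  -- ∂_v(r ∂_u r) contains no derivative of r or φ and is therefore differentiable in u, although
  -- ∂_u²r is not yet known to exist. Exchanging the derivatives then produces ∂_u(r ∂_u r), and
  -- with it ∂_u²r.
  have hH : ∀ u ∈ I, ∀ v ∈ J, HasDerivWithinAt (fun y => r u y * ru u y)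
      (Real.exp (2 * l u v) * (-(1 / 4) + e ^ 2 / (4 * r u v ^ 2))) J v := by
    intro u hu v hv
    have := (h.r_pos u hu v hv).ne'
    refine ((h.r_v u hu v hv).mul (h.ru_v u hu v hv)).congr_deriv ?_
    rw [h.j_eq]
    simp only [Jet.rhs₁]
    field_simp
    ring
  have hHu : ∀ u ∈ I, ∀ v ∈ J, HasDerivWithinAt (fun x => Real.exp (2 * l x v)
      * (-(1 / 4) + e ^ 2 / (4 * r x v ^ 2))) (q u v) I u := by
    intro u hu v hv
    have h0 := (h.r_pos u hu v hv).ne'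
    have k1 := ((h.l_u u hu v hv).const_mul 2).exp
    have k2 := ((((h.r_u u hu v hv).pow 2).const_mul 4).inv
      (mul_ne_zero four_ne_zero (pow_ne_zero 2 h0))).const_mul (e ^ 2)
    refine (k1.mul (k2.const_add (-(1 / 4)))).congr_deriv ?_
    rw [hq]
    simp only [Pi.inv_apply, Pi.pow_apply]
    push_cast
    field_simp
    ring
  have hqc : ContinuousOn (fun z : ℝ × ℝ => q z.1 z.2) (I ×ˢ J) := by
    rw [hq]
    refine ((hl.const_mul 2).rexp).mul (((h.cont_lu.const_mul 2).mul
      (continuousOn_const.add (continuousOn_const.div ((hr.pow 2).const_mul 4) fun z hz => ?_))).sub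
      ((continuousOn_const.div ((hr.pow 3).const_mul 2) fun z hz => ?_).mul h.cont_ru))
    · exact mul_ne_zero four_ne_zero (pow_ne_zero 2 (hr0 z hz))
    · exact mul_ne_zero two_ne_zero (pow_ne_zero 3 (hr0 z hz))
  have cs : ContinuousOn (fun x => (x, v₀)) I := by fun_prop
  have ms : MapsTo (fun x => (x, v₀)) I (I ×ˢ J) := fun x hx => ⟨hx, hv₀⟩
  obtain ⟨a, hac, ha1, hau, hav⟩ := exists_partial_of_mixed hI hJ hu₀ hv₀ hH hHu hqc
    (f₁ := fun u => ru u v₀ * ru u v₀ + r u v₀ * g u)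
    (fun u hu => (h.r_u u hu v₀ hv₀).mul (hg u hu))
    ((((h.cont_ru.comp cs ms).mul (h.cont_ru.comp cs ms))).add ((hr.comp cs ms).mul hgc))
  -- The left side is r times the defect of the Raychaudhuri equation. Its v-derivative vanishes by
  -- the wave equations, and it is zero at v₀.
  have hΘ : ∀ u ∈ I, ∀ v ∈ J, a u v - ru u v ^ 2 - 2 * (r u v * ru u v) * lu u v
      + (r u v * fu u v) ^ 2 = 0 := by
    intro u hu v hv
    have := eq_of_hasDerivWithinAt_zero hJ.convex (f := fun y => a u y - ru u y ^ 2
      - 2 * (r u y * ru u y) * lu u y + (r u y * fu u y) ^ 2) (fun y hy => ?_) hv hv₀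
    · rw [this, ha1 u hu]
      linear_combination r u v₀ * hray u hu
    · have h0 := (h.r_pos u hu y hy).ne'
      refine ((((hav u hu y hy).sub ((h.ru_v u hu y hy).pow 2)).sub
        (((hH u hu y hy).const_mul 2).mul (h.lu_v u hu y hy))).add
        (((h.r_v u hu y hy).mul (h.fu_v u hu y hy)).pow 2)).congr_deriv ?_
      rw [h.j_eq, hq]
      simp only [Pi.mul_apply, Jet.rhs₁, Jet.rhs₂, Jet.rhs₃]
      push_cast
      field_simp
      ring
  refine ⟨fun u v => (a u v - ru u v ^ 2) / r u v,
    (hac.sub (h.cont_ru.pow 2)).div hr hr0, fun u hu v hv => ?_, fun u hu v hv => ?_⟩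
  · have h0 := (h.r_pos u hu v hv).ne'
    have k := (hau u hu v hv).div (h.r_u u hu v hv) h0
    refine (k.congr (fun x hx => ?_) ?_).congr_deriv ?_
    · have := (h.r_pos x hx v hv).ne'
      simp only [Pi.div_apply]; field_simp
    · simp only [Pi.div_apply]; field_simp
    · field_simp
  · have h0 := (h.r_pos u hu v hv).ne'
    have k := hΘ u hu v hv
    field_simp
    linear_combination k

lemma contDiffOn_ru {ruu : ℝ → ℝ → ℝ} (hc : ContinuousOn (fun z : ℝ × ℝ => ruu z.1 z.2) (I ×ˢ J))
    (hd : ∀ u ∈ I, ∀ v ∈ J, HasDerivWithinAt (fun x => ru x v) (ruu u v) I u) :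
    ContDiffOn ℝ 1 (fun z : ℝ × ℝ => ru z.1 z.2) (I ×ˢ J) := by
  have hr := h.cont_r hI hJ
  have hl := h.cont_l hI hJ
  have cR : ContinuousOn (fun z : ℝ × ℝ => (j z.1 z.2).rhs e) (I ×ˢ J) := by
    refine continuousOn_rhs e ?_ ?_ ?_ ?_ ?_ ?_ ?_ <;> simp only [h.j_eq]
    · exact (hl.const_mul 2).rexp
    · exact hr
    · exact h.cont_ru
    · exact h.cont_rv
    · exact h.cont_fu
    · exact h.cont_fv
    · exact fun z hz => (h.r_pos _ hz.1 _ hz.2).ne'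
  have cR₁ : ContinuousOn (fun z : ℝ × ℝ => (j z.1 z.2).rhs₁ e) (I ×ˢ J) :=
    continuous_fst.comp_continuousOn cR
  have := contDiffOn_succ_of_partials hI.convex hJ.convex 0 hd h.ru_v
    (by simpa using hc) (by simpa using cR₁)
  simpa using this

end SolvesJet

/-! ### From the deviation to a solution of the full system. -/

section Solution

namespace SolvesJet

variable {e : ℝ} {I J : Set ℝ} {r f l ru fu lu rv fv lv : ℝ → ℝ → ℝ} {j : ℝ → ℝ → Jet}
  (hI : IsInterval I) (hJ : IsInterval J) (h : SolvesJet e I J r f l ru fu lu rv fv lv j)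

include hI hJ h

lemma solvesWave (hru : ContDiffOn ℝ 1 (fun z : ℝ × ℝ => ru z.1 z.2) (I ×ˢ J))
    (hrv : ContDiffOn ℝ 1 (fun z : ℝ × ℝ => rv z.1 z.2) (I ×ˢ J)) :
    SolvesWave e I J (I ×ˢ J) ⟨r, f, fun u v => Real.exp (l u v)⟩ := by
  have eru : ∀ u ∈ I, ∀ v ∈ J, pu I r u v = ru u v := fun u hu v hv =>
    (h.r_u u hu v hv).derivWithin (hI.uniqueDiff u hu)
  have efu : ∀ u ∈ I, ∀ v ∈ J, pu I f u v = fu u v := fun u hu v hv =>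
    (h.f_u u hu v hv).derivWithin (hI.uniqueDiff u hu)
  have erv : ∀ u ∈ I, ∀ v ∈ J, pv J r u v = rv u v := fun u hu v hv =>
    (h.r_v u hu v hv).derivWithin (hJ.uniqueDiff v hv)
  have efv : ∀ u ∈ I, ∀ v ∈ J, pv J f u v = fv u v := fun u hu v hv =>
    (h.f_v u hu v hv).derivWithin (hJ.uniqueDiff v hv)
  have elv : ∀ u ∈ I, ∀ v ∈ J, pv J (fun a b => Real.log (Real.exp (l a b))) u v = lv u v := by
    intro u hu v hv
    simp only [Real.log_exp]
    exact (h.l_v u hu v hv).derivWithin (hJ.uniqueDiff v hv)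
  have eo : ∀ u v, Real.exp (l u v) ^ 2 = Real.exp (2 * l u v) := fun u v => by
    rw [← Real.exp_nat_mul]; push_cast; rfl
  have c1 : ∀ {g gu gv : ℝ → ℝ → ℝ},
      (∀ u ∈ I, ∀ v ∈ J, HasDerivWithinAt (fun x => g x v) (gu u v) I u) →
      (∀ u ∈ I, ∀ v ∈ J, HasDerivWithinAt (fun y => g u y) (gv u v) J v) →
      ContinuousOn (fun z : ℝ × ℝ => gu z.1 z.2) (I ×ˢ J) →
      ContinuousOn (fun z : ℝ × ℝ => gv z.1 z.2) (I ×ˢ J) →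
      ContDiffOn ℝ 1 (fun z : ℝ × ℝ => g z.1 z.2) (I ×ˢ J) := by
    intro g gu gv hu hv cu cv
    have := contDiffOn_succ_of_partials hI.convex hJ.convex 0 hu hv (by simpa using cu)
      (by simpa using cv)
    simpa using this
  refine ⟨?_, c1 h.f_u h.f_v h.cont_fu h.cont_fv,
    (c1 h.l_u h.l_v h.cont_lu h.cont_lv).exp, fun u v hz => h.r_pos u hz.1 v hz.2,
    fun u v _ => Real.exp_pos _, ?_, ?_, ?_⟩
  · have := contDiffOn_succ_of_partials hI.convex hJ.convex 1 h.r_u h.r_v (by exact_mod_cast hru)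
      (by exact_mod_cast hrv)
    exact this.of_le (by norm_num)
  · rintro u v ⟨hu, hv⟩
    have k := (h.rv_u u hu v hv).congr (fun x hx => erv x hx v hv) (erv u hu v hv)
    refine k.congr_deriv ?_
    simp only [h.j_eq, Jet.rhs₁, eru u hu v hv, erv u hu v hv, eo]
  · rintro u v ⟨hu, hv⟩
    have k := (h.fv_u u hu v hv).congr (fun x hx => efv x hx v hv) (efv u hu v hv)
    refine k.congr_deriv ?_
    simp only [h.j_eq, Jet.rhs₂, eru u hu v hv, erv u hu v hv, efu u hu v hv, efv u hu v hv]
  · rintro u v ⟨hu, hv⟩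
    have k := (h.lv_u u hu v hv).congr (fun x hx => elv x hx v hv) (elv u hu v hv)
    refine k.congr_deriv ?_
    simp only [h.j_eq, Jet.rhs₃, eru u hu v hv, erv u hu v hv, efu u hu v hv, efv u hu v hv, eo]

omit hJ in
lemma raychaudhuri_u {ruu : ℝ → ℝ → ℝ}
    (hd : ∀ u ∈ I, ∀ v ∈ J, HasDerivWithinAt (fun x => ru x v) (ruu u v) I u)
    (hray : ∀ u ∈ I, ∀ v ∈ J, ruu u v - 2 * ru u v * lu u v + r u v * fu u v ^ 2 = 0) :
    ∀ u ∈ I, ∀ v ∈ J, HasDerivWithinAt (fun x => pu I r x v / Real.exp (l x v) ^ 2)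
      (-(r u v * pu I f u v ^ 2 / Real.exp (l u v) ^ 2)) I u := by
  intro u hu v hv
  have eru : ∀ u ∈ I, pu I r u v = ru u v := fun u hu =>
    (h.r_u u hu v hv).derivWithin (hI.uniqueDiff u hu)
  have efu : pu I f u v = fu u v := (h.f_u u hu v hv).derivWithin (hI.uniqueDiff u hu)
  have hp := Real.exp_pos (l u v)
  have k := (hd u hu v hv).div ((h.l_u u hu v hv).exp.pow 2) (pow_ne_zero 2 hp.ne')
  refine (k.congr (fun x hx => ?_) ?_).congr_deriv ?_
  · rw [eru x hx]; rfl
  · rw [eru u hu]; rfl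
  · rw [efu]
    simp only [Pi.pow_apply]
    push_cast
    field_simp
    linear_combination (hray u hu v hv)

lemma solvesRaychaudhuri {ruu rvv : ℝ → ℝ → ℝ}
    (hdu : ∀ u ∈ I, ∀ v ∈ J, HasDerivWithinAt (fun x => ru x v) (ruu u v) I u)
    (hu : ∀ u ∈ I, ∀ v ∈ J, ruu u v - 2 * ru u v * lu u v + r u v * fu u v ^ 2 = 0)
    (hdv : ∀ u ∈ I, ∀ v ∈ J, HasDerivWithinAt (fun y => rv u y) (rvv u v) J v)
    (hv : ∀ u ∈ I, ∀ v ∈ J, rvv u v - 2 * rv u v * lv u v + r u v * fv u v ^ 2 = 0) :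
    SolvesRaychaudhuri I J (I ×ˢ J) ⟨r, f, fun u v => Real.exp (l u v)⟩ where
  v_eq u v hz := (h.swap).raychaudhuri_u hJ (ruu := fun a b => rvv b a)
    (fun a ha b hb => hdv b hb a ha) (fun a ha b hb => hv b hb a ha) v hz.2 u hz.1
  u_eq u v hz := h.raychaudhuri_u hI hdu hu u hz.1 v hz.2

end SolvesJet

lemma hasDerivAt_components {f : ℝ → ℝ × ℝ × ℝ} {f' : ℝ × ℝ × ℝ} {x : ℝ} (h : HasDerivAt f f' x) :
    HasDerivAt (fun x => (f x).1) f'.1 x ∧ HasDerivAt (fun x => (f x).2.1) f'.2.1 x ∧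
      HasDerivAt (fun x => (f x).2.2) f'.2.2 x := by
  have k2 : HasDerivAt (fun x => (f x).2) f'.2 x :=
    (ContinuousLinearMap.snd ℝ ℝ (ℝ × ℝ)).hasFDerivAt.comp_hasDerivAt x h
  exact ⟨(ContinuousLinearMap.fst ℝ ℝ (ℝ × ℝ)).hasFDerivAt.comp_hasDerivAt x h,
    (ContinuousLinearMap.fst ℝ ℝ ℝ).hasFDerivAt.comp_hasDerivAt x k2,
    (ContinuousLinearMap.snd ℝ ℝ ℝ).hasFDerivAt.comp_hasDerivAt x k2⟩

/-- The jet of a solution with the deviation `ψ`. -/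
def jet (M e : ℝ) (d : CharData) (ψ a b : ℝ → ℝ → ℝ × ℝ × ℝ) (u v : ℝ) : Jet :=
  ⟨Real.exp (2 * (lB M e u v + (ψ u v).2.2)), d.rOut v + rB M e u v - rPlus M e + (ψ u v).1,
    -(dB M e u v / 4) + (a u v).1, d.rOutV v - cc M e * u * dB M e u v / 4 + (b u v).1,
    (a u v).2.1, d.φOutV v + (b u v).2.1⟩

/-- The solution with the deviation `ψ`. -/
def solution (M e : ℝ) (d : CharData) (ψ : ℝ → ℝ → ℝ × ℝ × ℝ) : Fields where
  r u v := d.rOut v + rB M e u v - rPlus M e + (ψ u v).1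
  φ u v := d.φOut v + (ψ u v).2.1
  Ω u v := Real.exp (lB M e u v + (ψ u v).2.2)

variable {M e s E U₀ Us : ℝ} {d : CharData} {W : Weight} {a₀ : ℝ → ℝ × ℝ × ℝ}
  {n : ℝ → ℝ → ℝ × ℝ × ℝ} (h0 : 0 < |e|) (h1 : |e| < M)

include h0 h1

lemma jB_rhs₁ {U v : ℝ} (hU : 0 ≤ U) : (jB M e U v).rhs₁ e
    = -(2 * dB M e U v * (M / rB M e U v ^ 2 - e ^ 2 / rB M e U v ^ 3) / 4) := by
  have hr := (rB_pos h0 h1 hU (v := v)).ne'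
  simp only [jB, Jet.rhs₁]
  rw [← fRN_rB h0 h1 hU]
  unfold fRN
  field_simp
  ring

lemma exp_two_lB {U v : ℝ} (hU : 0 ≤ U) : Real.exp (2 * lB M e U v) = dB M e U v := by
  unfold lB
  rw [mul_div_cancel₀ _ two_ne_zero, Real.exp_log (dB_pos h0 h1 hU)]

lemma jS_eq_jet {ψ a b : ℝ → ℝ → ℝ × ℝ × ℝ} {U v : ℝ} (hU : 0 ≤ U) :
    jS M e d U v (ψ U v) (a U v) (b U v) = jet M e d ψ a b U v := by
  unfold jS jet
  rw [mul_add, Real.exp_add, exp_two_lB h0 h1 hU]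

/-- The horizon data depend on v alone, so the mixed derivatives of the background are those of
Reissner–Nordström, rhs(`jB`). Adding n = rhs(`jS`) − rhs(`jB`) leaves exactly the right-hand sides
at the solution. -/
lemma IsDeviation.solvesJet (h : IsEventHorizonData M e s E U₀ d)
    (D : IsDeviation M e U₀ Us d W a₀ n) :
    SolvesJet e (Icc 0 Us) (Ici 1) (solution M e d (primB (primA a₀ n))).r
      (solution M e d (primB (primA a₀ n))).φ
      (fun u v => lB M e u v + (primB (primA a₀ n) u v).2.2)
      (fun u v => -(dB M e u v / 4) + (primA a₀ n u v).1) (fun u v => (primA a₀ n u v).2.1)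
      (fun u v => lBU M e u v + (primA a₀ n u v).2.2)
      (fun u v => d.rOutV v - cc M e * u * dB M e u v / 4 + (primB n u v).1)
      (fun u v => d.φOutV v + (primB n u v).2.1)
      (fun u v => M / rB M e u v ^ 2 - e ^ 2 / rB M e u v ^ 3 + (primB n u v).2.2)
      (jet M e d (primB (primA a₀ n)) (primA a₀ n) (primB n)) := by
  have ca := continuous_primA D.cont_a₀ D.cont_n
  have cb := continuous_primB D.cont_n
  have ca' : Continuous fun p : ℝ × ℝ => primA a₀ n p.1 p.2 := ca
  have cb' : Continuous fun p : ℝ × ℝ => primB n p.1 p.2 := cb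
  have cd : ContinuousOn (fun p : ℝ × ℝ => dB M e p.1 p.2) (Icc 0 Us ×ˢ Ici 1) := fun p hp =>
    (continuousAt_dB h0 h1 hp.1.1 p.2).continuousWithinAt
  have cr : ContinuousOn (fun p : ℝ × ℝ => rB M e p.1 p.2) (Icc 0 Us ×ˢ Ici 1) := fun p hp =>
    (continuousAt_rB h0 h1 hp.1.1 p.2).continuousWithinAt
  have clu : ContinuousOn (fun p : ℝ × ℝ => lBU M e p.1 p.2) (Icc 0 Us ×ˢ Ici 1) := fun p hp =>
    (continuousAt_lBU h0 h1 hp.1.1 p.2).continuousWithinAt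
  have cs : ContinuousOn (fun p : ℝ × ℝ => p.2) (Icc 0 Us ×ˢ Ici (1 : ℝ)) :=
    continuous_snd.continuousOn
  have ms : MapsTo (fun p : ℝ × ℝ => p.2) (Icc 0 Us ×ˢ Ici (1 : ℝ)) (Ici 1) := fun p hp => hp.2
  have hψu : ∀ u v, HasDerivAt (fun x => primB (primA a₀ n) x v) (primA a₀ n u v) u :=
    fun u v => hasDerivAt_primB ca u v
  have hψv : ∀ u v, HasDerivAt (fun y => primB (primA a₀ n) u y) (primB n u v) v :=
    fun u v => hasDerivAt_primB_primA D.cont_a₀ D.cont_n u v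
  have hav : ∀ u v, HasDerivAt (fun y => primA a₀ n u y) (n u v) v :=
    fun u v => hasDerivAt_primA D.cont_n u v
  have hbu : ∀ u v, HasDerivAt (fun x => primB n x v) (n u v) u :=
    fun u v => hasDerivAt_primB D.cont_n u v
  have hn : ∀ u ∈ Icc 0 Us, ∀ v ∈ Ici (1 : ℝ), n u v
      = (jet M e d (primB (primA a₀ n)) (primA a₀ n) (primB n) u v).rhs e - (jB M e u v).rhs e :=
    fun u hu v hv => by rw [D.n_eq u hu v hv, jS_eq_jet h0 h1 hu.1]
  have hn1 : ∀ u ∈ Icc 0 Us, ∀ v ∈ Ici (1 : ℝ), (n u v).1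
      = (jet M e d (primB (primA a₀ n)) (primA a₀ n) (primB n) u v).rhs₁ e
        - (jB M e u v).rhs₁ e := fun u hu v hv => by rw [hn u hu v hv]; rfl
  have hn2 : ∀ u ∈ Icc 0 Us, ∀ v ∈ Ici (1 : ℝ), (n u v).2.1
      = (jet M e d (primB (primA a₀ n)) (primA a₀ n) (primB n) u v).rhs₂ := fun u hu v hv => by
    rw [hn u hu v hv]
    simp only [Jet.rhs, Prod.fst_sub, Prod.snd_sub]
    simp [jB, Jet.rhs₂]
  have hn3 : ∀ u ∈ Icc 0 Us, ∀ v ∈ Ici (1 : ℝ), (n u v).2.2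
      = (jet M e d (primB (primA a₀ n)) (primA a₀ n) (primB n) u v).rhs₃ e
        - (jB M e u v).rhs₃ e := fun u hu v hv => by rw [hn u hu v hv]; rfl
  have hsub : Icc 0 Us ⊆ Ici (0 : ℝ) := fun x hx => hx.1
  refine ⟨fun u v => rfl, fun u hu v hv => ?_, ?_, ?_, ?_, ?_, ?_, ?_, ?_, ?_, ?_, ?_, ?_, ?_,
    ?_, ?_, ?_, ?_, ?_, ?_⟩
  · exact D.r_pos u hu v hv
  · intro u hu v hv
    exact (((hasDerivAt_rB_U h0 h1 hu.1).const_add _).sub_const _ |>.add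
      (hasDerivAt_components (hψu u v)).1).hasDerivWithinAt
  · intro u hu v hv
    exact ((hasDerivAt_components (hψu u v)).2.1.const_add _).hasDerivWithinAt
  · intro u hu v hv
    exact ((hasDerivAt_lB_U h0 h1 hu.1).add
      (hasDerivAt_components (hψu u v)).2.2).hasDerivWithinAt
  · intro u hu v hv
    refine ((((h.hasDerivWithinAt_rOut hv).add
      (hasDerivAt_rB_v h0 h1 hu.1).hasDerivWithinAt).sub_const _).add
      (hasDerivAt_components (hψv u v)).1.hasDerivWithinAt).congr_deriv (by ring)
  · intro u hu v hv
    exact (h.hasDerivWithinAt_φOut hv).add (hasDerivAt_components (hψv u v)).2.1.hasDerivWithinAt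
  · intro u hu v hv
    exact ((hasDerivAt_lB_v h0 h1 hu.1).add
      (hasDerivAt_components (hψv u v)).2.2).hasDerivWithinAt
  · exact (cd.div_const 4).neg.add (continuous_fst.comp ca').continuousOn
  · exact (continuous_fst.comp (continuous_snd.comp ca')).continuousOn
  · exact clu.add (continuous_snd.comp (continuous_snd.comp ca')).continuousOn
  · exact ((h.continuousOn_rOutV.comp cs ms).sub
      ((((by fun_prop : Continuous fun p : ℝ × ℝ => cc M e * p.1).continuousOn).mul
        cd).div_const 4)).add (continuous_fst.comp cb').continuousOn
  · exact (h.continuousOn_φOutV.comp cs ms).add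
      (continuous_fst.comp (continuous_snd.comp cb')).continuousOn
  · exact ((continuousOn_const.div (cr.pow 2) fun p hp =>
      pow_ne_zero 2 (rB_pos h0 h1 hp.1.1).ne').sub (continuousOn_const.div (cr.pow 3) fun p hp =>
      pow_ne_zero 3 (rB_pos h0 h1 hp.1.1).ne')).add
      (continuous_snd.comp (continuous_snd.comp cb')).continuousOn
  · intro u hu v hv
    refine (((hasDerivAt_dB_v h0 h1 hu.1).div_const 4).neg.add
      (hasDerivAt_components (hav u v)).1).hasDerivWithinAt.congr_deriv ?_
    rw [hn1 u hu v hv, jB_rhs₁ h0 h1 hu.1]; ring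
  · intro u hu v hv
    exact (hasDerivAt_components (hav u v)).2.1.hasDerivWithinAt.congr_deriv (hn2 u hu v hv)
  · intro u hu v hv
    refine ((hasDerivAt_lBU_v h0 h1 hu.1).add
      (hasDerivAt_components (hav u v)).2.2).hasDerivWithinAt.congr_deriv ?_
    rw [hn3 u hu v hv]; ring
  · intro u hu v hv
    have k := (((hasDerivWithinAt_rBv_U h0 h1 hu.1 (v := v)).mono hsub).const_add (d.rOutV v)).add
      (hasDerivAt_components (hbu u v)).1.hasDerivWithinAt
    refine (k.congr (fun x hx => ?_) ?_).congr_deriv ?_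
    · simp only [Pi.add_apply]; ring
    · simp only [Pi.add_apply]; ring
    · rw [hn1 u hu v hv]; ring
  · intro u hu v hv
    exact ((hasDerivAt_components (hbu u v)).2.1.const_add _).hasDerivWithinAt.congr_deriv
      (hn2 u hu v hv)
  · intro u hu v hv
    refine ((hasDerivAt_lBv_U h0 h1 hu.1).add
      (hasDerivAt_components (hbu u v)).2.2).hasDerivWithinAt.congr_deriv ?_
    rw [hn3 u hu v hv]; ring

lemma IsDeviation.out_data (h : IsEventHorizonData M e s E U₀ d) (a₀ : ℝ → ℝ × ℝ × ℝ)
    (n : ℝ → ℝ → ℝ × ℝ × ℝ) {v : ℝ} (hv : v ∈ Ici (1 : ℝ)) :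
    (solution M e d (primB (primA a₀ n))).r 0 v = d.rOut v ∧
      (solution M e d (primB (primA a₀ n))).φ 0 v = d.φOut v ∧
      (solution M e d (primB (primA a₀ n))).Ω 0 v = d.ΩOut v := by
  have hψ0 : primB (primA a₀ n) 0 v = 0 := by simp [primB]
  simp only [solution, hψ0, rB_horizon, Prod.fst_zero, Prod.snd_zero, add_zero, true_and]
  refine ⟨by ring, ?_⟩
  have k := h.ΩOut_sq h0 h1 hv
  rw [← exp_two_lB h0 h1 le_rfl, two_mul, Real.exp_add, ← sq] at k
  exact ((sq_eq_sq₀ (h.initial.ΩOut_pos v hv).le (Real.exp_pos _).le).mp k).symm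

/-- `aIn` is the U-derivative of the data minus that of the background, so the solution and the data
have equal U-derivatives on v = 1 and agree at U = 0. -/
lemma IsDeviation.in_data (hU₀ : 0 < U₀) (hUs : 0 < Us) (hUs' : Us ≤ U₀)
    (h : IsEventHorizonData M e s E U₀ d) (D : IsDeviation M e U₀ Us d W a₀ n) :
    ∀ U ∈ Icc 0 Us, (solution M e d (primB (primA a₀ n))).r U 1 = d.rIn U ∧
      (solution M e d (primB (primA a₀ n))).φ U 1 = d.φIn U ∧
      (solution M e d (primB (primA a₀ n))).Ω U 1 = d.ΩIn U := by
  have hS := D.solvesJet h0 h1 h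
  have h0I : (0 : ℝ) ∈ Icc 0 Us := left_mem_Icc.mpr hUs.le
  have h1J : (1 : ℝ) ∈ Ici (1 : ℝ) := self_mem_Ici
  have hsub : Icc 0 Us ⊆ Icc 0 U₀ := Icc_subset_Icc_right hUs'
  obtain ⟨o1, o2, o3⟩ := IsDeviation.out_data h0 h1 h a₀ n h1J
  have ha1 : ∀ U ∈ Icc 0 Us, primA a₀ n U 1 = aIn M e U₀ d U := fun U hU => by
    simp [primA, D.a₀_eq U hU]
  have key : ∀ {f g f' g' : ℝ → ℝ}, (∀ U ∈ Icc 0 Us, HasDerivWithinAt f (f' U) (Icc 0 Us) U) →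
      (∀ U ∈ Icc 0 U₀, HasDerivWithinAt g (g' U) (Icc 0 U₀) U) → (∀ U ∈ Icc 0 Us, f' U = g' U) →
      f 0 = g 0 → ∀ U ∈ Icc 0 Us, f U = g U := by
    intro f g f' g' hf hg hfg h0 U hU
    have := eq_of_hasDerivWithinAt_zero (convex_Icc 0 Us) (f := fun x => f x - g x)
      (fun x hx => ((hf x hx).sub ((hg x (hsub hx)).mono hsub)).congr_deriv
        (by rw [hfg x hx, sub_self])) hU h0I
    rw [h0, sub_self] at this
    linarith
  intro U hU
  refine ⟨?_, ?_, ?_⟩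
  · refine key (fun U hU => hS.r_u U hU 1 h1J) (fun U hU => h.hasDerivWithinAt_rIn hU) ?_
      (o1.trans h.initial.r_match) U hU
    intro U hU
    rw [ha1 U hU]; simp only [aIn]; ring
  · refine key (fun U hU => hS.f_u U hU 1 h1J) (fun U hU => h.hasDerivWithinAt_φIn hU) ?_
      (o2.trans h.initial.φ_match) U hU
    intro U hU
    rw [ha1 U hU]; simp only [aIn]
  · have := key (fun U hU => hS.l_u U hU 1 h1J)
      (fun U hU => h.hasDerivWithinAt_log_ΩIn hU₀ hU) (fun U hU => by
        rw [ha1 U hU]; simp only [aIn]; ring) (by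
        rw [← h.initial.Ω_match, ← o3]; simp only [solution, Real.log_exp]) U hU
    simp only [solution]
    rw [this, Real.exp_log (h.initial.ΩIn_pos U (hsub hU))]

lemma IsDeviation.solves (hU₀ : 0 < U₀) (hUs : 0 < Us) (hUs' : Us ≤ U₀)
    (h : IsEventHorizonData M e s E U₀ d) (D : IsDeviation M e U₀ Us d W a₀ n) :
    SolvesWave e (Icc 0 Us) (Ici 1) (Icc 0 Us ×ˢ Ici 1)
        (solution M e d (primB (primA a₀ n))) ∧
      SolvesRaychaudhuri (Icc 0 Us) (Ici 1) (Icc 0 Us ×ˢ Ici 1)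
        (solution M e d (primB (primA a₀ n))) := by
  have hI := isInterval_Icc hUs
  have hJ := isInterval_Ici 1
  have hS := D.solvesJet h0 h1 h
  have h0I : (0 : ℝ) ∈ Icc 0 Us := left_mem_Icc.mpr hUs.le
  have h1J : (1 : ℝ) ∈ Ici (1 : ℝ) := self_mem_Ici
  have hsub : Icc 0 Us ⊆ Icc 0 U₀ := Icc_subset_Icc_right hUs'
  have ha1 : ∀ U ∈ Icc 0 Us, primA a₀ n U 1 = aIn M e U₀ d U := fun U hU => by
    simp [primA, D.a₀_eq U hU]
  have hru1 : ∀ U ∈ Icc 0 Us, -(dB M e U 1 / 4) + (primA a₀ n U 1).1 = -1 := fun U hU => by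
    rw [ha1 U hU]; simp only [aIn]; ring
  -- On v = 1, ∂_U r = −1 and ∂_U²r = 0, and the third component of `aIn` encodes the constraint.
  obtain ⟨ruu, hruuc, hruu, hrayu⟩ := hS.exists_ruu hI hJ h0I h1J (g := fun _ => 0)
    (fun U hU => (hasDerivWithinAt_const U _ (-1 : ℝ)).congr (fun x hx => hru1 x hx) (hru1 U hU))
    continuousOn_const (fun U hU => by
      rw [hru1 U hU, ha1 U hU]
      rw [(D.in_data h0 h1 hU₀ hUs hUs' h U hU).1]
      simp only [aIn]
      ring)
  have hb0 : ∀ v, primB n 0 v = 0 := fun v => by simp [primB]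
  have hψ0 : ∀ v, primB (primA a₀ n) 0 v = 0 := fun v => by simp [primB]
  have hrv0 : ∀ v, d.rOutV v - cc M e * 0 * dB M e 0 v / 4 + (primB n 0 v).1 = d.rOutV v :=
    fun v => by rw [hb0]; simp
  have hrOutV : ContDiffOn ℝ 1 d.rOutV (Ici 1) :=
    h.initial.rOut_reg.derivWithin (uniqueDiffOn_Ici 1) (by norm_num)
  have hdV : ∀ v ∈ Ici (1 : ℝ), HasDerivWithinAt d.rOutV (derivWithin d.rOutV (Ici 1) v)
      (Ici 1) v := fun v hv => (hrOutV.differentiableOn (by norm_num) v hv).hasDerivWithinAt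
  -- On U = 0 the constraint on the data is differentiated out with the known derivative of Ω_𝓗²;
  -- the coordinates are exchanged to reuse the same lemma.
  obtain ⟨rvv, hrvvc, hrvv, hrayv⟩ := hS.swap.exists_ruu hJ hI h1J h0I
    (g := derivWithin d.rOutV (Ici 1))
    (fun v hv => (hdV v hv).congr (fun y _ => hrv0 y) (hrv0 v))
    (hrOutV.continuousOn_derivWithin (uniqueDiffOn_Ici 1) (by norm_num)) (fun v hv => by
      have hd := (dB_pos h0 h1 (le_refl (0 : ℝ)) (v := v)).ne'
      have k1 := h.hasDerivWithinAt_quot h0 h1 hv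
      have k2 := (hdV v hv).div (hasDerivAt_dB_v h0 h1 (le_refl (0 : ℝ)) (v := v)).hasDerivWithinAt
        hd
      have k := (k1.derivWithin (uniqueDiffOn_Ici 1 v hv)).symm.trans
        (k2.derivWithin (uniqueDiffOn_Ici 1 v hv))
      rw [hrv0, hb0]
      have e1 : (solution M e d (primB (primA a₀ n))).r 0 v = d.rOut v := by
        simp only [solution]; rw [hψ0, rB_horizon]; simp
      rw [e1]
      simp only [Prod.fst_zero, Prod.snd_zero, add_zero]
      generalize M / rB M e 0 v ^ 2 - e ^ 2 / rB M e 0 v ^ 3 = L at *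
      field_simp at k
      linear_combination -k)
  refine ⟨hS.solvesWave hI hJ (hS.contDiffOn_ru hI hJ hruuc hruu) ?_,
    hS.solvesRaychaudhuri hI hJ hruu hrayu (fun u hu v hv => hrvv v hv u hu)
      (fun u hu v hv => hrayv v hv u hu)⟩
  have k := hS.swap.contDiffOn_ru hJ hI hrvvc hrvv
  exact k.comp (contDiff_snd.prodMk contDiff_fst).contDiffOn fun z hz => ⟨hz.2, hz.1⟩

end Solution

/-! ### Uniqueness -/

section Uniqueness

lemma abs_le_of_abs_deriv_le {g g' : ℝ → ℝ} {a b C μ : ℝ} (hμ : 0 < μ) (hC : 0 ≤ C)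
    (hd : ∀ x ∈ Icc a b, HasDerivWithinAt g (g' x) (Icc a b) x) (h0 : g a = 0)
    (hg : ∀ x ∈ Icc a b, |g' x| ≤ C * Real.exp (μ * x)) {x : ℝ} (hx : x ∈ Icc a b) :
    |g x| ≤ C / μ * Real.exp (μ * x) := by
  have hE : ∀ x, HasDerivAt (fun x => C / μ * Real.exp (μ * x)) (C * Real.exp (μ * x)) x := by
    intro x
    have : HasDerivAt (fun x => μ * x) μ x :=
      ((hasDerivAt_id x).const_mul μ).congr_deriv (by ring)
    refine (this.exp.const_mul (C / μ)).congr_deriv ?_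
    field_simp
  have ha : a ∈ Icc a b := left_mem_Icc.mpr (hx.1.trans hx.2)
  have m1 : MonotoneOn (fun x => C / μ * Real.exp (μ * x) - g x) (Icc a b) := by
    refine monotoneOn_of_hasDerivWithinAt_nonneg (convex_Icc _ _)
      (fun y hy => ((hE y).hasDerivWithinAt.sub (hd y hy)).continuousWithinAt)
      (fun y hy => ((hE y).hasDerivWithinAt.sub (hd y (interior_subset hy))).mono
        interior_subset) fun y hy => ?_
    have := (abs_le.mp (hg y (interior_subset hy))).2
    linarith
  have m2 : MonotoneOn (fun x => C / μ * Real.exp (μ * x) + g x) (Icc a b) := by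
    refine monotoneOn_of_hasDerivWithinAt_nonneg (convex_Icc _ _)
      (fun y hy => ((hE y).hasDerivWithinAt.add (hd y hy)).continuousWithinAt)
      (fun y hy => ((hE y).hasDerivWithinAt.add (hd y (interior_subset hy))).mono
        interior_subset) fun y hy => ?_
    have := (abs_le.mp (hg y (interior_subset hy))).1
    linarith
  have k1 := m1 ha hx hx.1
  have k2 := m2 ha hx hx.1
  simp only [h0] at k1 k2
  have : 0 ≤ C / μ * Real.exp (μ * a) := by positivity
  rw [abs_le]
  constructor <;> linarith

lemma abs_exp_two_mul_sub_le_of_le {x y E : ℝ} (hx : Real.exp (2 * x) ≤ E)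
    (hy : Real.exp (2 * y) ≤ E) : |Real.exp (2 * x) - Real.exp (2 * y)| ≤ 2 * E * |x - y| := by
  have key : ∀ a b : ℝ, Real.exp (2 * a) ≤ E → b ≤ a →
      Real.exp (2 * a) - Real.exp (2 * b) ≤ 2 * E * (a - b) := by
    intro a b ha hab
    have h1 := Real.add_one_le_exp (2 * b - 2 * a)
    have h3 : Real.exp (2 * b) = Real.exp (2 * a) * Real.exp (2 * b - 2 * a) := by
      rw [← Real.exp_add]; ring_nf
    have h4 := Real.exp_pos (2 * a)
    have h5 : Real.exp (2 * a) * (2 * b - 2 * a + 1) ≤ Real.exp (2 * b) := by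
      rw [h3]; gcongr
    have h6 : Real.exp (2 * a) * (2 * (a - b)) ≤ E * (2 * (a - b)) :=
      mul_le_mul_of_nonneg_right ha (by linarith)
    linarith
  rcases le_total y x with h | h
  · have : Real.exp (2 * y) ≤ Real.exp (2 * x) := by gcongr
    rw [abs_of_nonneg (by linarith), abs_of_nonneg (by linarith)]
    exact key x y hx h
  · have : Real.exp (2 * x) ≤ Real.exp (2 * y) := by gcongr
    rw [abs_sub_comm, abs_sub_comm x, abs_of_nonneg (by linarith), abs_of_nonneg (by linarith)]
    exact key y x hy h

namespace SolvesJet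

variable {e : ℝ} {r f l ru fu lu rv fv lv r' f' l' ru' fu' lu' rv' fv' lv' : ℝ → ℝ → ℝ}
  {j j' : ℝ → ℝ → Jet}

lemma exists_bdd {A B : ℝ} (hA : 0 < A) (hB : 1 < B)
    (h : SolvesJet e (Icc 0 A) (Icc 1 B) r f l ru fu lu rv fv lv j) :
    ∃ K, ∀ u ∈ Icc 0 A, ∀ v ∈ Icc 1 B, Real.exp (2 * l u v) ≤ K ∧ (r u v)⁻¹ ≤ K ∧ |ru u v| ≤ K
      ∧ |fu u v| ≤ K ∧ |rv u v| ≤ K ∧ |fv u v| ≤ K := by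
  have hI := isInterval_Icc hA
  have hJ := isInterval_Icc hB
  have hc : IsCompact (Icc 0 A ×ˢ Icc 1 B) := isCompact_Icc.prod isCompact_Icc
  obtain ⟨k1, hk1⟩ := hc.exists_bound_of_continuousOn ((h.cont_l hI hJ).const_mul 2).rexp
  obtain ⟨k2, hk2⟩ := hc.exists_bound_of_continuousOn ((h.cont_r hI hJ).inv₀ fun z hz =>
    (h.r_pos _ hz.1 _ hz.2).ne')
  obtain ⟨k3, hk3⟩ := hc.exists_bound_of_continuousOn h.cont_ru
  obtain ⟨k4, hk4⟩ := hc.exists_bound_of_continuousOn h.cont_fu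
  obtain ⟨k5, hk5⟩ := hc.exists_bound_of_continuousOn h.cont_rv
  obtain ⟨k6, hk6⟩ := hc.exists_bound_of_continuousOn h.cont_fv
  refine ⟨|k1| + |k2| + |k3| + |k4| + |k5| + |k6|, fun u hu v hv => ?_⟩
  have m1 := (le_abs_self _).trans ((hk1 (u, v) ⟨hu, hv⟩).trans (le_abs_self _))
  have m2 := (le_abs_self _).trans ((hk2 (u, v) ⟨hu, hv⟩).trans (le_abs_self _))
  have m3 := (hk3 (u, v) ⟨hu, hv⟩).trans (le_abs_self _)
  have m4 := (hk4 (u, v) ⟨hu, hv⟩).trans (le_abs_self _)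
  have m5 := (hk5 (u, v) ⟨hu, hv⟩).trans (le_abs_self _)
  have m6 := (hk6 (u, v) ⟨hu, hv⟩).trans (le_abs_self _)
  simp only [Real.norm_eq_abs] at m3 m4 m5 m6
  change (r u v)⁻¹ ≤ |k2| at m2
  have p1 := abs_nonneg k1
  have p2 := abs_nonneg k2
  have p3 := abs_nonneg k3
  have p4 := abs_nonneg k4
  have p5 := abs_nonneg k5
  have p6 := abs_nonneg k6
  refine ⟨?_, ?_, ?_, ?_, ?_, ?_⟩ <;> linarith

/-- A solution on a compact rectangle is determined by its values on the two initial sides. -/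
lemma eq_of_eq_initial {A B : ℝ} (hA : 0 < A) (hB : 1 < B)
    (h : SolvesJet e (Icc 0 A) (Icc 1 B) r f l ru fu lu rv fv lv j)
    (h' : SolvesJet e (Icc 0 A) (Icc 1 B) r' f' l' ru' fu' lu' rv' fv' lv' j')
    (hin : ∀ u ∈ Icc 0 A, r u 1 = r' u 1 ∧ f u 1 = f' u 1 ∧ l u 1 = l' u 1)
    (hout : ∀ v ∈ Icc 1 B, r 0 v = r' 0 v ∧ f 0 v = f' 0 v ∧ l 0 v = l' 0 v) :
    ∀ u ∈ Icc 0 A, ∀ v ∈ Icc 1 B, r u v = r' u v ∧ f u v = f' u v ∧ l u v = l' u v := by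
  have hI := isInterval_Icc hA
  have hJ := isInterval_Icc hB
  have h0I : (0 : ℝ) ∈ Icc 0 A := left_mem_Icc.mpr hA.le
  have h1J : (1 : ℝ) ∈ Icc 1 B := left_mem_Icc.mpr hB.le
  obtain ⟨k, hk⟩ := h.exists_bdd hA hB
  obtain ⟨k', hk'⟩ := h'.exists_bdd hA hB
  obtain ⟨K, hK⟩ : ∃ K, K = max 1 (max k k') := ⟨_, rfl⟩
  have hK1 : 1 ≤ K := by rw [hK]; exact le_max_left _ _
  have hkK : k ≤ K := by rw [hK]; exact (le_max_left _ _).trans (le_max_right _ _)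
  have hkK' : k' ≤ K := by rw [hK]; exact (le_max_right _ _).trans (le_max_right _ _)
  obtain ⟨w, hw⟩ : ∃ w : ℝ × ℝ → ℝ, w = fun z => |r z.1 z.2 - r' z.1 z.2| + |f z.1 z.2 - f' z.1 z.2|
    + |l z.1 z.2 - l' z.1 z.2| + (|ru z.1 z.2 - ru' z.1 z.2| + |fu z.1 z.2 - fu' z.1 z.2|
    + |lu z.1 z.2 - lu' z.1 z.2|) + (|rv z.1 z.2 - rv' z.1 z.2| + |fv z.1 z.2 - fv' z.1 z.2|
    + |lv z.1 z.2 - lv' z.1 z.2|) := ⟨_, rfl⟩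
  have hf : ContinuousOn (fun z : ℝ × ℝ => f z.1 z.2) (Icc 0 A ×ˢ Icc 1 B) :=
    continuousOn_of_partials hI.convex hJ.convex h.f_u h.f_v h.cont_fu h.cont_fv
  have hf' : ContinuousOn (fun z : ℝ × ℝ => f' z.1 z.2) (Icc 0 A ×ˢ Icc 1 B) :=
    continuousOn_of_partials hI.convex hJ.convex h'.f_u h'.f_v h'.cont_fu h'.cont_fv
  have hwc : ContinuousOn w (Icc 0 A ×ˢ Icc 1 B) := by
    rw [hw]
    exact ((((h.cont_r hI hJ).sub (h'.cont_r hI hJ)).abs.add (hf.sub hf').abs).add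
      ((h.cont_l hI hJ).sub (h'.cont_l hI hJ)).abs).add
      (((h.cont_ru.sub h'.cont_ru).abs.add (h.cont_fu.sub h'.cont_fu).abs).add
        (h.cont_lu.sub h'.cont_lu).abs) |>.add
      (((h.cont_rv.sub h'.cont_rv).abs.add (h.cont_fv.sub h'.cont_fv).abs).add
        (h.cont_lv.sub h'.cont_lv).abs)
  -- the Lipschitz bound
  obtain ⟨Λ, hΛ⟩ : ∃ Λ, Λ = Jet.lipConst e K * (K + K * K + K + K) := ⟨_, rfl⟩
  have hΛ0 : 0 ≤ Λ := by rw [hΛ]; unfold Jet.lipConst; positivity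
  have hL : ∀ u ∈ Icc 0 A, ∀ v ∈ Icc 1 B, ‖(j u v).rhs e - (j' u v).rhs e‖ ≤ Λ * w (u, v) := by
    intro u hu v hv
    obtain ⟨b1, b2, b3, b4, b5, b6⟩ := hk u hu v hv
    obtain ⟨c1, c2, c3, c4, c5, c6⟩ := hk' u hu v hv
    have n1 := abs_nonneg (r u v - r' u v)
    have n2 := abs_nonneg (f u v - f' u v)
    have n3 := abs_nonneg (l u v - l' u v)
    have n4 := abs_nonneg (ru u v - ru' u v)
    have n5 := abs_nonneg (fu u v - fu' u v)
    have n6 := abs_nonneg (lu u v - lu' u v)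
    have n7 := abs_nonneg (rv u v - rv' u v)
    have n8 := abs_nonneg (fv u v - fv' u v)
    have n9 := abs_nonneg (lv u v - lv' u v)
    have hwe : w (u, v) = |r u v - r' u v| + |f u v - f' u v|
      + |l u v - l' u v| + (|ru u v - ru' u v| + |fu u v - fu' u v|
      + |lu u v - lu' u v|) + (|rv u v - rv' u v| + |fv u v - fv' u v|
      + |lv u v - lv' u v|) := by rw [hw]
    have hw0 : 0 ≤ w (u, v) := by rw [hwe]; positivity
    have B1 : Jet.Bdd K K K K (j u v) := by
      rw [h.j_eq]
      refine ⟨h.r_pos u hu v hv, ?_, ?_, ?_, ?_, ?_, ?_⟩ <;> simp only [Real.abs_exp] <;> linarith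
    have B2 : Jet.Bdd K K K K (j' u v) := by
      rw [h'.j_eq]
      refine ⟨h'.r_pos u hu v hv, ?_, ?_, ?_, ?_, ?_, ?_⟩ <;> simp only [Real.abs_exp] <;> linarith
    have N : Jet.Near K (w (u, v)) (w (u, v)) (w (u, v)) (j u v) (j' u v) := by
      rw [h.j_eq, h'.j_eq]
      refine ⟨?_, ?_, ?_, ?_, ?_, ?_⟩ <;> simp only
      · linarith
      · have := abs_exp_two_mul_sub_le_of_le (b1.trans hkK) (c1.trans hkK')
        have h2 : 2 * K * |l u v - l' u v| ≤ 2 * K * w (u, v) := by gcongr; linarith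
        have h3 : 0 ≤ K * w (u, v) := by positivity
        linarith
      · linarith
      · linarith
      · linarith
      · linarith
    refine (Jet.norm_rhs_sub_le e hK1 (by linarith) B1 B2 N).trans (le_of_eq ?_)
    rw [hΛ]; ring
  -- Each integration in the norm weighted by e^{-μ(u+v)} gains 1/μ. The six first derivatives
  -- contribute Λ each, the three unknowns 1 each, so that the total factor (6Λ + 3)/μ is 1/2.
  obtain ⟨μ, hμ⟩ : ∃ μ, μ = 2 * (6 * Λ + 3) := ⟨_, rfl⟩
  have hμ0 : 0 < μ := by rw [hμ]; positivity
  have hc : IsCompact (Icc 0 A ×ˢ Icc 1 B) := isCompact_Icc.prod isCompact_Icc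
  -- The weighted difference attains its maximum S on the compact rectangle; the estimates below
  -- give S ≤ S/2, hence S = 0.
  obtain ⟨z₀, hz₀, hmax⟩ := hc.exists_isMaxOn ⟨(0, 1), h0I, h1J⟩
    (f := fun z => Real.exp (-(μ * z.1) - μ * z.2) * w z)
    ((by fun_prop : Continuous fun z : ℝ × ℝ => Real.exp (-(μ * z.1) - μ * z.2)).continuousOn.mul hwc)
  obtain ⟨S, hS⟩ : ∃ S, S = Real.exp (-(μ * z₀.1) - μ * z₀.2) * w z₀ := ⟨_, rfl⟩
  have hw0 : ∀ z, 0 ≤ w z := fun z => by rw [hw]; positivity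
  have hS0 : 0 ≤ S := by rw [hS]; have := hw0 z₀; positivity
  have hwS : ∀ u ∈ Icc 0 A, ∀ v ∈ Icc 1 B,
      w (u, v) ≤ S * (Real.exp (μ * u) * Real.exp (μ * v)) := by
    intro u hu v hv
    have k : Real.exp (-(μ * u) - μ * v) * w (u, v) ≤ S := hS ▸ hmax (a := (u, v)) ⟨hu, hv⟩
    have e1 : Real.exp (μ * u) * Real.exp (μ * v) * Real.exp (-(μ * u) - μ * v) = 1 := by
      rw [← Real.exp_add, ← Real.exp_add, Real.exp_eq_one_iff]; ring
    calc w (u, v) = Real.exp (μ * u) * Real.exp (μ * v)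
          * (Real.exp (-(μ * u) - μ * v) * w (u, v)) := by rw [← mul_assoc, e1, one_mul]
      _ ≤ Real.exp (μ * u) * Real.exp (μ * v) * S := by gcongr
      _ = _ := by ring
  have hLS : ∀ u ∈ Icc 0 A, ∀ v ∈ Icc 1 B, ‖(j u v).rhs e - (j' u v).rhs e‖
      ≤ Λ * S * (Real.exp (μ * u) * Real.exp (μ * v)) := fun u hu v hv =>
    (hL u hu v hv).trans (by rw [mul_assoc]; gcongr; exact hwS u hu v hv)
  -- integration in the direction of `v` and of `u`
  have intv : ∀ {g g' : ℝ → ℝ → ℝ} {C : ℝ}, 0 ≤ C →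
      (∀ u ∈ Icc 0 A, ∀ v ∈ Icc 1 B, HasDerivWithinAt (fun y => g u y) (g' u v) (Icc 1 B) v) →
      (∀ u ∈ Icc 0 A, g u 1 = 0) →
      (∀ u ∈ Icc 0 A, ∀ v ∈ Icc 1 B, |g' u v| ≤ C * (Real.exp (μ * u) * Real.exp (μ * v))) →
      ∀ u ∈ Icc 0 A, ∀ v ∈ Icc 1 B, |g u v| ≤ C / μ * (Real.exp (μ * u) * Real.exp (μ * v)) := by
    intro g g' C hC hd hg0 hg u hu v hv
    have := abs_le_of_abs_deriv_le hμ0 (C := C * Real.exp (μ * u)) (by positivity)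
      (fun y hy => hd u hu y hy) (hg0 u hu) (fun y hy => (hg u hu y hy).trans_eq (by ring)) hv
    refine this.trans_eq (by ring)
  have intu : ∀ {g g' : ℝ → ℝ → ℝ} {C : ℝ}, 0 ≤ C →
      (∀ u ∈ Icc 0 A, ∀ v ∈ Icc 1 B, HasDerivWithinAt (fun x => g x v) (g' u v) (Icc 0 A) u) →
      (∀ v ∈ Icc 1 B, g 0 v = 0) →
      (∀ u ∈ Icc 0 A, ∀ v ∈ Icc 1 B, |g' u v| ≤ C * (Real.exp (μ * u) * Real.exp (μ * v))) →
      ∀ u ∈ Icc 0 A, ∀ v ∈ Icc 1 B, |g u v| ≤ C / μ * (Real.exp (μ * u) * Real.exp (μ * v)) := by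
    intro g g' C hC hd hg0 hg u hu v hv
    have := abs_le_of_abs_deriv_le hμ0 (C := C * Real.exp (μ * v)) (by positivity)
      (fun x hx => hd x hx v hv) (hg0 v hv) (fun x hx => (hg x hx v hv).trans_eq (by ring)) hu
    refine this.trans_eq (by ring)
  have eqd : ∀ {I : Set ℝ} {g g' : ℝ → ℝ} {a b x : ℝ}, UniqueDiffWithinAt ℝ I x → x ∈ I →
      HasDerivWithinAt g a I x → HasDerivWithinAt g' b I x → (∀ x ∈ I, g x = g' x) → a - b = 0 := by
    intro I g g' a b x hu hx hg hg' he
    rw [← hg.derivWithin hu, ← hg'.derivWithin hu, derivWithin_congr he (he x hx), sub_self]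
  have hΛS : 0 ≤ Λ * S := by positivity
  have a1 := intv hΛS (fun u hu v hv => (h.ru_v u hu v hv).sub (h'.ru_v u hu v hv))
    (fun u hu => eqd (hI.uniqueDiff u hu) hu (h.r_u u hu 1 h1J) (h'.r_u u hu 1 h1J)
      fun x hx => (hin x hx).1)
    fun u hu v hv => (abs_fst_le _).trans (hLS u hu v hv)
  have a2 := intv hΛS (fun u hu v hv => (h.fu_v u hu v hv).sub (h'.fu_v u hu v hv))
    (fun u hu => eqd (hI.uniqueDiff u hu) hu (h.f_u u hu 1 h1J) (h'.f_u u hu 1 h1J)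
      fun x hx => (hin x hx).2.1)
    fun u hu v hv => (abs_snd_fst_le _).trans (hLS u hu v hv)
  have a3 := intv hΛS (fun u hu v hv => (h.lu_v u hu v hv).sub (h'.lu_v u hu v hv))
    (fun u hu => eqd (hI.uniqueDiff u hu) hu (h.l_u u hu 1 h1J) (h'.l_u u hu 1 h1J)
      fun x hx => (hin x hx).2.2)
    fun u hu v hv => (abs_snd_snd_le _).trans (hLS u hu v hv)
  have b1 := intu hΛS (fun u hu v hv => (h.rv_u u hu v hv).sub (h'.rv_u u hu v hv))
    (fun v hv => eqd (hJ.uniqueDiff v hv) hv (h.r_v 0 h0I v hv) (h'.r_v 0 h0I v hv)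
      fun y hy => (hout y hy).1)
    fun u hu v hv => (abs_fst_le _).trans (hLS u hu v hv)
  have b2 := intu hΛS (fun u hu v hv => (h.fv_u u hu v hv).sub (h'.fv_u u hu v hv))
    (fun v hv => eqd (hJ.uniqueDiff v hv) hv (h.f_v 0 h0I v hv) (h'.f_v 0 h0I v hv)
      fun y hy => (hout y hy).2.1)
    fun u hu v hv => (abs_snd_fst_le _).trans (hLS u hu v hv)
  have b3 := intu hΛS (fun u hu v hv => (h.lv_u u hu v hv).sub (h'.lv_u u hu v hv))
    (fun v hv => eqd (hJ.uniqueDiff v hv) hv (h.l_v 0 h0I v hv) (h'.l_v 0 h0I v hv)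
      fun y hy => (hout y hy).2.2)
    fun u hu v hv => (abs_snd_snd_le _).trans (hLS u hu v hv)
  have le_w : ∀ u v, |ru u v - ru' u v| ≤ w (u, v) ∧ |fu u v - fu' u v| ≤ w (u, v) ∧
      |lu u v - lu' u v| ≤ w (u, v) := by
    intro u v
    rw [hw]
    have n1 := abs_nonneg (r u v - r' u v)
    have n2 := abs_nonneg (f u v - f' u v)
    have n3 := abs_nonneg (l u v - l' u v)
    have n4 := abs_nonneg (ru u v - ru' u v)
    have n5 := abs_nonneg (fu u v - fu' u v)
    have n6 := abs_nonneg (lu u v - lu' u v)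
    have n7 := abs_nonneg (rv u v - rv' u v)
    have n8 := abs_nonneg (fv u v - fv' u v)
    have n9 := abs_nonneg (lv u v - lv' u v)
    simp only
    refine ⟨?_, ?_, ?_⟩ <;> linarith
  have p1 := intu hS0 (fun u hu v hv => (h.r_u u hu v hv).sub (h'.r_u u hu v hv))
    (fun v hv => sub_eq_zero.mpr (hout v hv).1)
    fun u hu v hv => (le_w u v).1.trans (hwS u hu v hv)
  have p2 := intu hS0 (fun u hu v hv => (h.f_u u hu v hv).sub (h'.f_u u hu v hv))
    (fun v hv => sub_eq_zero.mpr (hout v hv).2.1)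
    fun u hu v hv => (le_w u v).2.1.trans (hwS u hu v hv)
  have p3 := intu hS0 (fun u hu v hv => (h.l_u u hu v hv).sub (h'.l_u u hu v hv))
    (fun v hv => sub_eq_zero.mpr (hout v hv).2.2)
    fun u hu v hv => (le_w u v).2.2.trans (hwS u hu v hv)
  simp only [Pi.sub_apply] at a1 a2 a3 b1 b2 b3 p1 p2 p3
  have hhalf : ∀ u ∈ Icc 0 A, ∀ v ∈ Icc 1 B,
      w (u, v) ≤ S / 2 * (Real.exp (μ * u) * Real.exp (μ * v)) := by
    intro u hu v hv
    have e1 : S / 2 = 6 * (Λ * S / μ) + 3 * (S / μ) := by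
      rw [hμ]; field_simp
    rw [e1, hw]
    simp only
    have := a1 u hu v hv
    have := a2 u hu v hv
    have := a3 u hu v hv
    have := b1 u hu v hv
    have := b2 u hu v hv
    have := b3 u hu v hv
    have := p1 u hu v hv
    have := p2 u hu v hv
    have := p3 u hu v hv
    linarith
  have hS00 : S = 0 := by
    have k := hhalf z₀.1 hz₀.1 z₀.2 hz₀.2
    have e1 : Real.exp (-(μ * z₀.1) - μ * z₀.2) * (Real.exp (μ * z₀.1) * Real.exp (μ * z₀.2))
        = 1 := by
      rw [← Real.exp_add, ← Real.exp_add, Real.exp_eq_one_iff]; ring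
    have k2 : S ≤ S / 2 := by
      calc S = Real.exp (-(μ * z₀.1) - μ * z₀.2) * w z₀ := hS
        _ ≤ Real.exp (-(μ * z₀.1) - μ * z₀.2)
            * (S / 2 * (Real.exp (μ * z₀.1) * Real.exp (μ * z₀.2))) := by gcongr
        _ = S / 2 * (Real.exp (-(μ * z₀.1) - μ * z₀.2)
            * (Real.exp (μ * z₀.1) * Real.exp (μ * z₀.2))) := by ring
        _ = S / 2 := by rw [e1, mul_one]
    linarith
  intro u hu v hv
  have q1 := p1 u hu v hv
  have q2 := p2 u hu v hv
  have q3 := p3 u hu v hv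
  rw [hS00, zero_div, zero_mul] at q1 q2 q3
  exact ⟨sub_eq_zero.mp (abs_nonpos_iff.mp q1), sub_eq_zero.mp (abs_nonpos_iff.mp q2),
    sub_eq_zero.mp (abs_nonpos_iff.mp q3)⟩

end SolvesJet

end Uniqueness

/-! ### Maximality -/

section Maximality


/-- The domain is relatively open, so near the point its slice coincides with I and the one-sided
derivative in I is the total derivative applied to (1, 0). -/
lemma hasDerivWithinAt_pu {I J : Set ℝ} {O : Set (ℝ × ℝ)} (hI : UniqueDiffOn ℝ I)
    (hO : IsOpen O) {f : ℝ → ℝ → ℝ}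
    (hf : DifferentiableOn ℝ (fun p : ℝ × ℝ => f p.1 p.2) (O ∩ I ×ˢ J)) {u v : ℝ}
    (hp : (u, v) ∈ O ∩ I ×ˢ J) :
    HasDerivWithinAt (fun x => f x v) (pu I f u v) I u ∧
      pu I f u v = fderivWithin ℝ (fun p : ℝ × ℝ => f p.1 p.2) (O ∩ I ×ˢ J) (u, v) (1, 0) := by
  have h1 := (hf (u, v) hp).hasFDerivWithinAt
  have h2 : HasDerivWithinAt (fun x : ℝ => (x, v)) ((1 : ℝ), (0 : ℝ))
      ({x | (x, v) ∈ O} ∩ I) u :=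
    ((hasDerivAt_id u).prodMk (hasDerivAt_const u v)).hasDerivWithinAt
  have hm : MapsTo (fun x : ℝ => (x, v)) ({x | (x, v) ∈ O} ∩ I) (O ∩ I ×ˢ J) :=
    fun x hx => ⟨hx.1, hx.2, hp.2.2⟩
  have h3 := h1.comp_hasDerivWithinAt u h2 hm
  have hO' : {x | (x, v) ∈ O} ∈ 𝓝 u :=
    (hO.preimage (by fun_prop : Continuous fun x : ℝ => (x, v))).mem_nhds hp.1
  have h4 : HasDerivWithinAt (fun x => f x v)
      (fderivWithin ℝ (fun p : ℝ × ℝ => f p.1 p.2) (O ∩ I ×ˢ J) (u, v) (1, 0)) I u := by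
    refine h3.mono_of_mem_nhdsWithin ?_
    exact inter_mem (mem_nhdsWithin_of_mem_nhds hO') self_mem_nhdsWithin
  have h5 := h4.derivWithin (hI u hp.2.1)
  exact ⟨by rw [pu, h5]; exact h4, h5⟩

lemma hasDerivWithinAt_pv {I J : Set ℝ} {O : Set (ℝ × ℝ)} (hJ : UniqueDiffOn ℝ J)
    (hO : IsOpen O) {f : ℝ → ℝ → ℝ}
    (hf : DifferentiableOn ℝ (fun p : ℝ × ℝ => f p.1 p.2) (O ∩ I ×ˢ J)) {u v : ℝ}
    (hp : (u, v) ∈ O ∩ I ×ˢ J) :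
    HasDerivWithinAt (fun y => f u y) (pv J f u v) J v ∧
      pv J f u v = fderivWithin ℝ (fun p : ℝ × ℝ => f p.1 p.2) (O ∩ I ×ˢ J) (u, v) (0, 1) := by
  have h1 := (hf (u, v) hp).hasFDerivWithinAt
  have h2 : HasDerivWithinAt (fun y : ℝ => (u, y)) ((0 : ℝ), (1 : ℝ))
      ({y | (u, y) ∈ O} ∩ J) v :=
    ((hasDerivAt_const v u).prodMk (hasDerivAt_id v)).hasDerivWithinAt
  have hm : MapsTo (fun y : ℝ => (u, y)) ({y | (u, y) ∈ O} ∩ J) (O ∩ I ×ˢ J) :=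
    fun y hy => ⟨hy.1, hp.2.1, hy.2⟩
  have h3 := h1.comp_hasDerivWithinAt v h2 hm
  have hO' : {y | (u, y) ∈ O} ∈ 𝓝 v :=
    (hO.preimage (by fun_prop : Continuous fun y : ℝ => (u, y))).mem_nhds hp.1
  have h4 : HasDerivWithinAt (fun y => f u y)
      (fderivWithin ℝ (fun p : ℝ × ℝ => f p.1 p.2) (O ∩ I ×ˢ J) (u, v) (0, 1)) J v := by
    refine h3.mono_of_mem_nhdsWithin ?_
    exact inter_mem (mem_nhdsWithin_of_mem_nhds hO') self_mem_nhdsWithin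
  have h5 := h4.derivWithin (hJ v hp.2.2)
  exact ⟨by rw [pv, h5]; exact h4, h5⟩

lemma continuousOn_pu_pv {I J : Set ℝ} {O : Set (ℝ × ℝ)} (hI : UniqueDiffOn ℝ I)
    (hJ : UniqueDiffOn ℝ J) (hO : IsOpen O) {f : ℝ → ℝ → ℝ}
    (hf : ContDiffOn ℝ 1 (fun p : ℝ × ℝ => f p.1 p.2) (O ∩ I ×ˢ J)) :
    ContinuousOn (fun p : ℝ × ℝ => pu I f p.1 p.2) (O ∩ I ×ˢ J) ∧
      ContinuousOn (fun p : ℝ × ℝ => pv J f p.1 p.2) (O ∩ I ×ˢ J) := by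
  have hu : UniqueDiffOn ℝ (O ∩ I ×ˢ J) := by
    rw [inter_comm]; exact (hI.prod hJ).inter hO
  have hd := hf.differentiableOn (by norm_num)
  have hc := hf.continuousOn_fderivWithin hu le_rfl
  exact ⟨(hc.clm_apply continuousOn_const).congr fun p hp => (hasDerivWithinAt_pu hI hO hd hp).2,
    (hc.clm_apply continuousOn_const).congr fun p hp => (hasDerivWithinAt_pv hJ hO hd hp).2⟩

/-- A solution, restricted to a compact rectangle. -/
lemma SolvesWave.solvesJet {e : ℝ} {I J : Set ℝ} {O : Set (ℝ × ℝ)} {S : Fields} {A B : ℝ}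
    (hI : UniqueDiffOn ℝ I) (hJ : UniqueDiffOn ℝ J) (hO : IsOpen O)
    (h : SolvesWave e I J (O ∩ I ×ˢ J) S) (hA : 0 < A) (hB : 1 < B)
    (hsub : Icc 0 A ×ˢ Icc 1 B ⊆ O ∩ I ×ˢ J) :
    SolvesJet e (Icc 0 A) (Icc 1 B) S.r S.φ (fun u v => Real.log (S.Ω u v))
      (pu I S.r) (pu I S.φ) (pu I fun u v => Real.log (S.Ω u v))
      (pv J S.r) (pv J S.φ) (pv J fun u v => Real.log (S.Ω u v))
      (fun u v => ⟨Real.exp (2 * Real.log (S.Ω u v)), S.r u v, pu I S.r u v, pv J S.r u v,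
        pu I S.φ u v, pv J S.φ u v⟩) := by
  have hIA := isInterval_Icc hA
  have hJB := isInterval_Icc hB
  have h0I : (0 : ℝ) ∈ Icc 0 A := left_mem_Icc.mpr hA.le
  have h1J : (1 : ℝ) ∈ Icc 1 B := left_mem_Icc.mpr hB.le
  have sI : Icc 0 A ⊆ I := fun x hx => by
    have := @hsub (x, (1 : ℝ)) ⟨hx, h1J⟩
    exact this.2.1
  have sJ : Icc 1 B ⊆ J := fun y hy => by
    have := @hsub ((0 : ℝ), y) ⟨h0I, hy⟩
    exact this.2.2
  have rC : ContDiffOn ℝ 1 (fun p : ℝ × ℝ => S.r p.1 p.2) (O ∩ I ×ˢ J) :=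
    h.r_reg.of_le (by norm_num)
  have lC : ContDiffOn ℝ 1 (fun p : ℝ × ℝ => Real.log (S.Ω p.1 p.2)) (O ∩ I ×ˢ J) :=
    h.Ω_reg.log fun p hp => (h.Ω_pos p.1 p.2 hp).ne'
  have rd := rC.differentiableOn (by norm_num)
  have fd := h.φ_reg.differentiableOn (by norm_num)
  have ld := lC.differentiableOn (by norm_num)
  obtain ⟨cru, crv⟩ := continuousOn_pu_pv hI hJ hO rC
  obtain ⟨cfu, cfv⟩ := continuousOn_pu_pv hI hJ hO h.φ_reg
  obtain ⟨clu, clv⟩ := continuousOn_pu_pv (f := fun u v => Real.log (S.Ω u v)) hI hJ hO lC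
  have mem : ∀ {u v}, u ∈ Icc 0 A → v ∈ Icc 1 B → (u, v) ∈ O ∩ I ×ˢ J :=
    fun hu hv => hsub ⟨hu, hv⟩
  have r_u : ∀ u ∈ Icc 0 A, ∀ v ∈ Icc 1 B,
      HasDerivWithinAt (fun x => S.r x v) (pu I S.r u v) (Icc 0 A) u := fun u hu v hv =>
    (hasDerivWithinAt_pu hI hO rd (mem hu hv)).1.mono sI
  have f_u : ∀ u ∈ Icc 0 A, ∀ v ∈ Icc 1 B,
      HasDerivWithinAt (fun x => S.φ x v) (pu I S.φ u v) (Icc 0 A) u := fun u hu v hv =>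
    (hasDerivWithinAt_pu hI hO fd (mem hu hv)).1.mono sI
  have l_u : ∀ u ∈ Icc 0 A, ∀ v ∈ Icc 1 B, HasDerivWithinAt (fun x => Real.log (S.Ω x v))
      (pu I (fun u v => Real.log (S.Ω u v)) u v) (Icc 0 A) u := fun u hu v hv =>
    (hasDerivWithinAt_pu (f := fun u v => Real.log (S.Ω u v)) hI hO ld (mem hu hv)).1.mono sI
  have r_v : ∀ u ∈ Icc 0 A, ∀ v ∈ Icc 1 B,
      HasDerivWithinAt (fun y => S.r u y) (pv J S.r u v) (Icc 1 B) v := fun u hu v hv =>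
    (hasDerivWithinAt_pv hJ hO rd (mem hu hv)).1.mono sJ
  have f_v : ∀ u ∈ Icc 0 A, ∀ v ∈ Icc 1 B,
      HasDerivWithinAt (fun y => S.φ u y) (pv J S.φ u v) (Icc 1 B) v := fun u hu v hv =>
    (hasDerivWithinAt_pv hJ hO fd (mem hu hv)).1.mono sJ
  have l_v : ∀ u ∈ Icc 0 A, ∀ v ∈ Icc 1 B, HasDerivWithinAt (fun y => Real.log (S.Ω u y))
      (pv J (fun u v => Real.log (S.Ω u v)) u v) (Icc 1 B) v := fun u hu v hv =>
    (hasDerivWithinAt_pv (f := fun u v => Real.log (S.Ω u v)) hJ hO ld (mem hu hv)).1.mono sJ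
  obtain ⟨j, hj⟩ : ∃ j : ℝ → ℝ → Jet, j = fun u v => ⟨Real.exp (2 * Real.log (S.Ω u v)), S.r u v,
    pu I S.r u v, pv J S.r u v, pu I S.φ u v, pv J S.φ u v⟩ := ⟨_, rfl⟩
  have eo : ∀ {u v}, u ∈ Icc 0 A → v ∈ Icc 1 B →
      Real.exp (2 * Real.log (S.Ω u v)) = S.Ω u v ^ 2 := fun hu hv => by
    rw [two_mul, Real.exp_add, Real.exp_log (h.Ω_pos _ _ (mem hu hv)), sq]
  have rv_u : ∀ u ∈ Icc 0 A, ∀ v ∈ Icc 1 B,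
      HasDerivWithinAt (fun x => pv J S.r x v) ((j u v).rhs₁ e) (Icc 0 A) u := fun u hu v hv =>
    ((h.r_eq u v (mem hu hv)).mono sI).congr_deriv (by simp only [hj, Jet.rhs₁, eo hu hv])
  have fv_u : ∀ u ∈ Icc 0 A, ∀ v ∈ Icc 1 B,
      HasDerivWithinAt (fun x => pv J S.φ x v) ((j u v).rhs₂) (Icc 0 A) u := fun u hu v hv =>
    ((h.φ_eq u v (mem hu hv)).mono sI).congr_deriv (by simp only [hj, Jet.rhs₂])
  have lv_u : ∀ u ∈ Icc 0 A, ∀ v ∈ Icc 1 B, HasDerivWithinAt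
      (fun x => pv J (fun u v => Real.log (S.Ω u v)) x v) ((j u v).rhs₃ e) (Icc 0 A) u :=
    fun u hu v hv => ((h.Ω_eq u v (mem hu hv)).mono sI).congr_deriv
      (by simp only [hj, Jet.rhs₃, eo hu hv])
  have cR : ContinuousOn (fun z : ℝ × ℝ => (j z.1 z.2).rhs e) (Icc 0 A ×ˢ Icc 1 B) := by
    refine continuousOn_rhs e ?_ ?_ ?_ ?_ ?_ ?_ ?_ <;> simp only [hj]
    · exact ((lC.continuousOn.mono hsub).const_mul 2).rexp
    · exact rC.continuousOn.mono hsub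
    · exact cru.mono hsub
    · exact crv.mono hsub
    · exact cfu.mono hsub
    · exact cfv.mono hsub
    · exact fun z hz => (h.r_pos _ _ (hsub hz)).ne'
  have cR₁ : ContinuousOn (fun z : ℝ × ℝ => (j z.1 z.2).rhs₁ e) (Icc 0 A ×ˢ Icc 1 B) :=
    continuous_fst.comp_continuousOn cR
  have cR₂ : ContinuousOn (fun z : ℝ × ℝ => (j z.1 z.2).rhs₂) (Icc 0 A ×ˢ Icc 1 B) :=
    continuous_fst.comp_continuousOn (continuous_snd.comp_continuousOn cR)
  have cR₃ : ContinuousOn (fun z : ℝ × ℝ => (j z.1 z.2).rhs₃ e) (Icc 0 A ×ˢ Icc 1 B) :=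
    continuous_snd.comp_continuousOn (continuous_snd.comp_continuousOn cR)
  -- A solution of the wave equations comes with ∂_u∂_v only; the opposite order is recovered from
  -- the continuity of the right-hand side.
  have mixed : ∀ {f fu fv q : ℝ → ℝ → ℝ},
      (∀ u ∈ Icc 0 A, ∀ v ∈ Icc 1 B, HasDerivWithinAt (fun x => f x v) (fu u v) (Icc 0 A) u) →
      (∀ u ∈ Icc 0 A, ∀ v ∈ Icc 1 B, HasDerivWithinAt (fun y => f u y) (fv u v) (Icc 1 B) v) →
      (∀ u ∈ Icc 0 A, ∀ v ∈ Icc 1 B, HasDerivWithinAt (fun x => fv x v) (q u v) (Icc 0 A) u) →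
      ContinuousOn (fun z : ℝ × ℝ => fu z.1 z.2) (Icc 0 A ×ˢ Icc 1 B) →
      ContinuousOn (fun z : ℝ × ℝ => q z.1 z.2) (Icc 0 A ×ˢ Icc 1 B) →
      ∀ u ∈ Icc 0 A, ∀ v ∈ Icc 1 B, HasDerivWithinAt (fun y => fu u y) (q u v) (Icc 1 B) v := by
    intro f fu fv q hfu hfv hq cfu cq u hu v hv
    obtain ⟨a, -, -, ha, hav⟩ := exists_partial_of_mixed hIA hJB h0I h1J hfv hq cq
      (f₁ := fun u => fu u 1) (fun u hu => hfu u hu 1 h1J)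
      (cfu.comp (by fun_prop : Continuous fun x : ℝ => (x, (1 : ℝ))).continuousOn
        fun x hx => ⟨hx, h1J⟩)
    have e1 : ∀ y ∈ Icc 1 B, fu u y = a u y := fun y hy => by
      rw [← (hfu u hu y hy).derivWithin (hIA.uniqueDiff u hu),
        (ha u hu y hy).derivWithin (hIA.uniqueDiff u hu)]
    exact (hav u hu v hv).congr e1 (e1 v hv)
  rw [← hj]
  exact ⟨fun u v => by rw [hj], fun u hu v hv => h.r_pos u v (mem hu hv), r_u, f_u, l_u, r_v, f_v,
    l_v, cru.mono hsub, cfu.mono hsub, clu.mono hsub, crv.mono hsub, cfv.mono hsub, clv.mono hsub,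
    mixed r_u r_v rv_u (cru.mono hsub) cR₁, mixed f_u f_v fv_u (cfu.mono hsub) cR₂,
    mixed l_u l_v lv_u (clu.mono hsub) cR₃, rv_u, fv_u, lv_u⟩

/-- A development that is defined on the whole quadrant is maximal. -/
lemma IsDevelopment.isMaximal {e Us : ℝ} {d : CharData} {S : Fields} (hUs : 0 < Us)
    (h : IsDevelopment e d (Icc 0 Us) (Ici 1) 0 1 (Icc 0 Us ×ˢ Ici 1) S) :
    IsMaximalDevelopment e d (Icc 0 Us) (Ici 1) 0 1 (Icc 0 Us ×ˢ Ici 1) S := by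
  refine ⟨h, fun D' S' h' => ⟨h'.subset, fun u v huv => ?_⟩⟩
  have hI := (isInterval_Icc hUs).uniqueDiff
  have hJ := (isInterval_Ici 1).uniqueDiff
  obtain ⟨hu, hv⟩ := h'.subset huv
  rcases hu.1.eq_or_lt with hu0 | hu0
  · subst hu0
    obtain ⟨a1, a2, a3⟩ := h.out_data v hv
    obtain ⟨b1, b2, b3⟩ := h'.out_data v hv
    exact ⟨b1.trans a1.symm, b2.trans a2.symm, b3.trans a3.symm⟩
  rcases (mem_Ici.mp hv).eq_or_lt with hv0 | hv0
  · subst hv0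
    obtain ⟨a1, a2, a3⟩ := h.in_data u hu
    obtain ⟨b1, b2, b3⟩ := h'.in_data u hu
    exact ⟨b1.trans a1.symm, b2.trans a2.symm, b3.trans a3.symm⟩
  obtain ⟨O, hO, hD⟩ := h'.rel_open
  -- Off the initial curves, the causal past of (u, v) is a nondegenerate rectangle contained in
  -- both domains, on whose initial sides both solutions have the same data.
  have hQ : Icc 0 u ×ˢ Icc 1 v ⊆ Icc 0 Us ×ˢ Ici 1 := fun z hz =>
    ⟨⟨hz.1.1, hz.1.2.trans hu.2⟩, hz.2.1⟩
  have j1 := SolvesWave.solvesJet (O := univ) hI hJ isOpen_univ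
    (by rw [univ_inter]; exact h.solves) hu0 hv0 (by rw [univ_inter]; exact hQ)
  have j2 := SolvesWave.solvesJet hI hJ hO (by rw [← hD]; exact h'.solves) hu0 hv0
    (by rw [← hD]; exact h'.past u v huv)
  obtain ⟨e1, e2, e3⟩ := SolvesJet.eq_of_eq_initial hu0 hv0 j2 j1 (fun x hx => by
      have hx' : x ∈ Icc 0 Us := ⟨hx.1, hx.2.trans hu.2⟩
      obtain ⟨a1, a2, a3⟩ := h.in_data x hx'
      obtain ⟨b1, b2, b3⟩ := h'.in_data x hx'
      exact ⟨b1.trans a1.symm, b2.trans a2.symm, by rw [a3, b3]⟩) (fun y hy => by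
      obtain ⟨a1, a2, a3⟩ := h.out_data y hy.1
      obtain ⟨b1, b2, b3⟩ := h'.out_data y hy.1
      exact ⟨b1.trans a1.symm, b2.trans a2.symm, by rw [a3, b3]⟩) u (right_mem_Icc.mpr hu0.le) v
      (right_mem_Icc.mpr hv0.le)
  exact ⟨e1, e2, Real.log_injOn_pos (h'.solves.Ω_pos u v huv) (h.solves.Ω_pos u v ⟨hu, hv⟩) e3⟩

variable {M e s E U₀ Us : ℝ} {d : CharData} {W : Weight} {a₀ : ℝ → ℝ × ℝ × ℝ}
  {n : ℝ → ℝ → ℝ × ℝ × ℝ}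

lemma IsDeviation.isMaximalDevelopment (h0 : 0 < |e|) (h1 : |e| < M) (hU₀ : 0 < U₀) (hUs : 0 < Us)
    (hUs' : Us ≤ U₀) (h : IsEventHorizonData M e s E U₀ d)
    (D : IsDeviation M e U₀ Us d W a₀ n) :
    IsMaximalDevelopment e d (Icc 0 Us) (Ici 1) 0 1 (Icc 0 Us ×ˢ Ici 1)
      (solution M e d (primB (primA a₀ n))) := by
  refine IsDevelopment.isMaximal hUs ⟨Subset.rfl, ⟨univ, isOpen_univ, by rw [univ_inter]⟩,
    fun v hv => ⟨left_mem_Icc.mpr hUs.le, hv⟩, fun U hU => ⟨hU, self_mem_Ici⟩,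
    fun u v huv z hz => ⟨⟨hz.1.1, hz.1.2.trans huv.1.2⟩, hz.2.1⟩,
    (D.solves h0 h1 hU₀ hUs hUs' h).1, fun v hv => IsDeviation.out_data h0 h1 h a₀ n hv,
    D.in_data h0 h1 hU₀ hUs hUs' h⟩

end Maximality

/-! ### Extension to the Cauchy horizon -/

section Limits

variable {V : Type*} [NormedAddCommGroup V] [CompleteSpace V]

/-- A family of functions of `v` that is uniformly Cauchy at infinity has joint limits there. -/
lemma exists_tendsto_prod_atTop {f : ℝ → ℝ → V} {s : Set ℝ} {G : ℝ → ℝ}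
    (hf : ∀ v, 1 ≤ v → ContinuousOn (fun u => f u v) s) (hG : Tendsto G atTop (𝓝 0))
    (h : ∀ u ∈ s, ∀ v, 1 ≤ v → ∀ v', v ≤ v' → ‖f u v' - f u v‖ ≤ G v) {u : ℝ} (hu : u ∈ s) :
    ∃ L, Tendsto (fun p : ℝ × ℝ => f p.1 p.2) (𝓝[s] u ×ˢ atTop) (𝓝 L) := by
  have key : ∀ ε > 0, ∃ N, 1 ≤ N ∧ G N < ε := fun ε hε => by
    obtain ⟨N, h2, h1⟩ := ((hG.eventually_lt_const hε).and (eventually_ge_atTop 1)).exists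
    exact ⟨N, h1, h2⟩
  have hc : CauchySeq fun v => f u v := by
    rw [Metric.cauchySeq_iff']
    intro ε hε
    obtain ⟨N, hN, hNε⟩ := key ε hε
    exact ⟨N, fun v hv => by rw [dist_eq_norm]; exact (h u hu N hN v hv).trans_lt hNε⟩
  obtain ⟨L, hL⟩ := cauchySeq_tendsto_of_complete hc
  refine ⟨L, Metric.tendsto_nhds.mpr fun ε hε => ?_⟩
  obtain ⟨N, hN, hNε⟩ := key (ε / 3) (by positivity)
  have k1 : ‖L - f u N‖ ≤ G N := le_of_tendsto (hL.sub_const _).norm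
    ((eventually_ge_atTop N).mono fun v hv => h u hu N hN v hv)
  have k2 := Metric.tendsto_nhds.mp (hf N hN u hu) (ε / 3) (by positivity)
  filter_upwards [(k2.and self_mem_nhdsWithin).prod_mk (eventually_ge_atTop N)] with p hp
  obtain ⟨⟨a1, a2⟩, a3⟩ := hp
  have k3 := h p.1 a2 N hN p.2 a3
  rw [dist_eq_norm] at a1 ⊢
  calc ‖f p.1 p.2 - L‖ = ‖(f p.1 p.2 - f p.1 N) + (f p.1 N - f u N) - (L - f u N)‖ := by
        congr 1; abel
    _ ≤ ‖f p.1 p.2 - f p.1 N‖ + ‖f p.1 N - f u N‖ + ‖L - f u N‖ :=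
        (norm_sub_le _ _).trans (by gcongr; exact norm_add_le _ _)
    _ < ε := by linarith

-- The tail of the integral of y^{-s} is v^{1−s}/(s−1); with s > 1 it tends to zero, which is what
-- lets the fields converge at the Cauchy horizon.
omit [CompleteSpace V] in
lemma norm_sub_le_of_deriv_le_rpow [NormedSpace ℝ V] {f f' : ℝ → V} {K s v v' : ℝ} (hs : 1 < s)
    (hv : 1 ≤ v) (hvv : v ≤ v') (hK : 0 ≤ K) (hf : ∀ y, HasDerivAt f (f' y) y)
    (hb : ∀ y, 1 ≤ y → ‖f' y‖ ≤ K * y ^ (-s)) :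
    ‖f v' - f v‖ ≤ K / (s - 1) * v ^ (1 - s) := by
  have hs' : 0 < s - 1 := by linarith
  have k := image_norm_le_of_norm_deriv_right_le_deriv_boundary' (a := v) (b := v')
    (f := fun y => f y - f v) (f' := f')
    (B := fun y => K / (s - 1) * (v ^ (1 - s) - y ^ (1 - s))) (B' := fun y => K * y ^ (-s))
    (fun y _ => ((hf y).sub_const _).continuousAt.continuousWithinAt)
    (fun y _ => ((hf y).sub_const _).hasDerivWithinAt) (by simp) ?_ ?_
    (fun y hy => hb y (hv.trans hy.1)) (right_mem_Icc.mpr hvv)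
  · refine k.trans (mul_le_mul_of_nonneg_left ?_ (by positivity))
    have : 0 ≤ v' ^ (1 - s) := Real.rpow_nonneg (by linarith) _
    linarith
  · intro y hy
    have hy' : y ≠ 0 := by have := hy.1; intro h; linarith
    exact ((continuousAt_const.sub (Real.continuousAt_rpow_const _ _ (Or.inl hy'))).const_mul
      _).continuousWithinAt
  · intro y hy
    have hy' : y ≠ 0 := by have := hy.1; intro h; linarith
    refine (((Real.hasDerivAt_rpow_const (Or.inl hy')).const_sub _).const_mul
      _).hasDerivWithinAt.congr_deriv ?_
    rw [show 1 - s - 1 = -s by ring]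
    field_simp
    ring

end Limits

section Extension

variable {M e : ℝ} (h0 : 0 < |e|) (h1 : |e| < M)

include h0 h1

lemma Vcoord_strictMono : StrictMono (Vcoord M e) := by
  refine strictMono_of_deriv_pos fun v => ?_
  rw [((Vcoord_spec h0 h1).1 v).deriv]
  exact Real.exp_pos _

lemma Vcoord_lt_one (v : ℝ) : Vcoord M e v < 1 := by
  have hk := kappaMinus_pos h0 h1
  have : 0 < Real.exp (-2 * kappaMinus M e * v) / (2 * kappaMinus M e) := by positivity
  unfold Vcoord; linarith

/-- The inverse of `Vcoord`. -/
lemma exists_Vcoord_inv : ∃ g : ℝ → ℝ, (∀ v, g (Vcoord M e v) = v) ∧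
    (∀ x < 1, Vcoord M e (g x) = x) ∧ ContinuousOn g (Iio 1) ∧ Tendsto g (𝓝[<] 1) atTop := by
  have hk := kappaMinus_pos h0 h1
  refine ⟨fun x => Real.log (2 * kappaMinus M e * (1 - x)) / (-2 * kappaMinus M e),
    fun v => ?_, fun x hx => ?_, ?_, ?_⟩
  · have : 2 * kappaMinus M e * (1 - Vcoord M e v) = Real.exp (-2 * kappaMinus M e * v) := by
      unfold Vcoord; field_simp; ring
    simp only [this, Real.log_exp]
    field_simp
  · have : 0 < 1 - x := by linarith
    unfold Vcoord
    rw [mul_div_cancel₀ _ (mul_ne_zero (by norm_num) hk.ne'), Real.exp_log (by positivity)]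
    field_simp
    ring
  · refine ContinuousOn.div_const (ContinuousOn.log (by fun_prop) fun x hx => ?_) _
    have : 0 < 1 - x := sub_pos.mpr hx
    positivity
  · have k : Tendsto (fun x : ℝ => 2 * kappaMinus M e * (1 - x)) (𝓝[<] 1) (𝓝[>] 0) := by
      refine tendsto_nhdsWithin_iff.mpr ⟨?_, ?_⟩
      · have : Tendsto (fun x : ℝ => 2 * kappaMinus M e * (1 - x)) (𝓝 1)
            (𝓝 (2 * kappaMinus M e * (1 - 1))) := Continuous.tendsto (by fun_prop) _
        rw [sub_self, mul_zero] at this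
        exact this.mono_left nhdsWithin_le_nhds
      · filter_upwards [self_mem_nhdsWithin] with x hx
        have : 0 < 1 - x := sub_pos.mpr hx
        simp only [mem_Ioi]
        positivity
    refine ((Real.tendsto_log_nhdsGT_zero.comp k).const_mul_atBot_of_neg
      (inv_lt_zero.mpr (by linarith : -2 * kappaMinus M e < 0))).congr fun x => ?_
    rw [div_eq_inv_mul]; rfl

/-- V → 1 corresponds to v → ∞. The limits are assumed jointly in (u, v), which is precisely what
makes the extension by limits continuous on the closure. -/
lemma exists_isContExtension {us : ℝ} {f : ℝ → ℝ → ℝ} {L : ℝ → ℝ}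
    (hf : ContinuousOn (fun p : ℝ × ℝ => f p.1 p.2) (Iic us ×ˢ Ici 1))
    (hL : ∀ u ≤ us, Tendsto (fun p : ℝ × ℝ => f p.1 p.2) (𝓝[Iic us] u ×ˢ atTop) (𝓝 (L u))) :
    ∃ F, IsContExtension M e us f F ∧ ∀ u ≤ us, F u 1 = L u := by
  obtain ⟨g, hg1, hg2, hg3, hg4⟩ := exists_Vcoord_inv h0 h1
  have hm := Vcoord_strictMono h0 h1
  obtain ⟨A, hA⟩ : ∃ A, A = Iic us ×ˢ Ico (Vcoord M e 1) 1 := ⟨_, rfl⟩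
  have hV1 := Vcoord_lt_one h0 h1 1
  have hclos : closure A = Iic us ×ˢ Icc (Vcoord M e 1) 1 := by
    rw [hA, closure_prod_eq, closure_Ico hV1.ne, isClosed_Iic.closure_eq]
  have hg_ge : ∀ x, Vcoord M e 1 ≤ x → x < 1 → 1 ≤ g x := fun x hx hx1 =>
    hm.le_iff_le.mp (by rwa [hg2 x hx1])
  have hc : ContinuousOn (fun p : ℝ × ℝ => f p.1 (g p.2)) A := by
    refine hf.comp (f := fun p : ℝ × ℝ => (p.1, g p.2))
      (continuousOn_fst.prodMk (hg3.comp continuousOn_snd fun p hp => ?_)) fun p hp => ?_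
    · rw [hA] at hp; exact hp.2.2
    · rw [hA] at hp; exact ⟨hp.1, hg_ge _ hp.2.1 hp.2.2⟩
  have hlim : ∀ u ≤ us, Tendsto (fun p : ℝ × ℝ => f p.1 (g p.2)) (𝓝[A] (u, 1)) (𝓝 (L u)) := by
    intro u hu
    refine (hL u hu).comp (f := fun p : ℝ × ℝ => (p.1, g p.2)) ?_
    rw [hA, nhdsWithin_prod_eq]
    exact tendsto_fst.prodMk ((hg4.mono_left (nhdsWithin_mono _ fun x hx => hx.2)).comp tendsto_snd)
  refine ⟨fun u x => extendFrom A (fun p : ℝ × ℝ => f p.1 (g p.2)) (u, x), ⟨?_, ?_⟩, ?_⟩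
  · refine continuousOn_extendFrom hclos.ge fun p hp => ?_
    rcases hp.2.2.eq_or_lt with h | h
    · refine ⟨L p.1, ?_⟩
      have := hlim p.1 hp.1
      rwa [← h] at this
    · exact ⟨_, hc p (by rw [hA]; exact ⟨hp.1, hp.2.1, h⟩)⟩
  · intro u hu v hv
    have hp : (u, Vcoord M e v) ∈ A := by
      rw [hA]; exact ⟨hu, hm.monotone hv, Vcoord_lt_one h0 h1 v⟩
    have := extendFrom_eq (subset_closure hp) (hc _ hp)
    simp only [hg1] at this
    exact this
  · intro u hu
    exact extendFrom_eq (by rw [hclos]; exact ⟨hu, hV1.le, le_rfl⟩) (hlim u hu)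

lemma tendsto_rRN : Tendsto (fun x => rRN M e x 0) atTop (𝓝 (rMinus M e)) := by
  refine tendsto_order.mpr ⟨fun a ha => .of_forall fun x => ha.trans (rRN_mem h0 h1 x).1,
    fun a ha => ?_⟩
  obtain ⟨r, hr1, hr2⟩ := exists_between (lt_min ha (rMinus_lt_rPlus h1))
  filter_upwards [eventually_ge_atTop (rStar M e r)] with x hx
  have k := rRN_antitone h0 h1 hx
  simp only [rRN_surj h0 h1 ⟨hr1, hr2.trans_le (min_le_right _ _)⟩] at k
  exact k.trans_lt (hr2.trans_le (min_le_left _ _))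

lemma cc_div_qq : cc M e / qq M e = 2 * kappaMinus M e := by
  have := (kappaPlus_pos h0 h1).ne'
  have := (kappaMinus_pos h0 h1).ne'
  unfold cc qq
  field_simp

/-- The relation r*(r) = x exponentiated again, now solved for the factor that vanishes at the
Cauchy horizon. -/
lemma rRN_sub_rMinus (x : ℝ) : rRN M e x 0 - rMinus M e
    = Real.exp (2 * kappaMinus M e * (rRN M e x 0 - x))
      * (rPlus M e - rRN M e x 0) ^ (1 / qq M e) := by
  have hr := rRN_mem h0 h1 x
  have k1 := sub_pos.mpr hr.1
  have k2 := sub_pos.mpr hr.2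
  have k := rStar_rRN h0 h1 x
  rw [rStar_eq h0 h1] at k
  have hc := cc_pos h0 h1
  have hq := qq_pos h0 h1
  rw [Real.rpow_def_of_pos k2, ← Real.exp_add, ← cc_div_qq h0 h1]
  conv_lhs => rw [← Real.exp_log k1]
  congr 1
  generalize Real.log (rRN M e x 0 - rMinus M e) = y at *
  generalize Real.log (rPlus M e - rRN M e x 0) = z at *
  field_simp at k ⊢
  linarith

/-- The Reissner–Nordström metric coefficient extends to the Cauchy horizon. -/
lemma exists_tendsto_exp_mul_OmegaRN : ∃ L > 0,
    Tendsto (fun x => Real.exp (kappaMinus M e * x) * OmegaRN M e 0 x) atTop (𝓝 L) := by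
  have hq := qq_pos h0 h1
  have hm := rMinus_pos h0 h1
  have hd := sub_pos.mpr (rMinus_lt_rPlus h1)
  -- In Ω_RN² the factor r − r₋ carries e^{-2κ₋x}. After cancellation with e^{2κ₋x} a function of r
  -- remains that is continuous and positive at r₋.
  obtain ⟨F, hF⟩ : ∃ F : ℝ → ℝ, F = fun r => √(4 * (rPlus M e - r)
    * (Real.exp (2 * kappaMinus M e * r) * (rPlus M e - r) ^ (1 / qq M e)) / r ^ 2) := ⟨_, rfl⟩
  have hFc : ContinuousAt F (rMinus M e) := by
    rw [hF]
    refine (ContinuousAt.div ?_ (by fun_prop) (by positivity)).sqrt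
    refine ContinuousAt.mul (by fun_prop) (ContinuousAt.mul (by fun_prop) ?_)
    exact ContinuousAt.rpow_const (by fun_prop) (Or.inl hd.ne')
  refine ⟨F (rMinus M e), ?_, (hFc.tendsto.comp (tendsto_rRN h0 h1)).congr fun x => ?_⟩
  · rw [hF]; positivity
  · have hr := rRN_mem h0 h1 x
    have hr0 := hm.trans hr.1
    have k2 := sub_pos.mpr hr.2
    simp only [Function.comp]
    rw [hF]
    have e1 : OmegaRN M e 0 x = √(4 * fRN M e (rRN M e x 0)) := by
      unfold OmegaRN fRN
      rw [rRN_add 0 x, zero_add]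
      congr 1
      ring
    have e2 : Real.exp (kappaMinus M e * x) = √(Real.exp (2 * kappaMinus M e * x)) := by
      rw [← Real.exp_half]; congr 1; ring
    rw [e1, e2, ← Real.sqrt_mul (Real.exp_pos _).le, fRN_eq h1 hr0.ne', rRN_sub_rMinus h0 h1,
      mul_sub, sub_eq_add_neg (2 * kappaMinus M e * rRN M e x 0), Real.exp_add, Real.exp_neg]
    field_simp

variable {s E U₀ Us : ℝ} {d : CharData} {W : Weight} {a₀ : ℝ → ℝ × ℝ × ℝ}
  {n : ℝ → ℝ → ℝ × ℝ × ℝ}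

lemma Ucoord_strictMono : StrictMono (Ucoord M e) := by
  refine strictMono_of_deriv_pos fun v => ?_
  rw [((Ucoord_spec h0 h1).1 v).deriv]
  exact Real.exp_pos _

lemma Ucoord_mem (hUs : 0 < Us) {u : ℝ} (hu : u ≤ ucoord M e Us) : Ucoord M e u ∈ Icc 0 Us :=
  ⟨(Ucoord_pos h0 h1 u).le, by
    rw [← Ucoord_ucoord h0 h1 hUs]; exact (Ucoord_strictMono h0 h1).monotone hu⟩

omit h0 h1 in
lemma Weight.Point.Bv_le_exp {U v : ℝ} (h : W.Point U v) :
    W.Bv U v ≤ Real.exp W.l * v ^ (-W.s) := by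
  refine h.Bv_le.trans ?_
  rw [mul_comm (Real.exp _)]
  have := h.good.ey_ge h.hU (v := v)
  exact mul_le_mul h.vs_le (h.good.ey_le h.hU) (by linarith) h.vs_pos.le

/-- The deviation of the solution has a limit at the Cauchy horizon. -/
lemma IsDeviation.exists_tendsto (hs : 1 < s) (hUs : 0 < Us) (hW : W.s = s)
    (hp : ∀ U ∈ Icc 0 Us, ∀ v ∈ Ici (1 : ℝ), W.Point U v)
    (D : IsDeviation M e U₀ Us d W a₀ n) {u : ℝ} (hu : u ≤ ucoord M e Us) :
    ∃ L : ℝ × ℝ × ℝ, |L.1| ≤ rMinus M e / 4 ∧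
      Tendsto (fun p : ℝ × ℝ => primB (primA a₀ n) (Ucoord M e p.1) p.2)
        (𝓝[Iic (ucoord M e Us)] u ×ˢ atTop) (𝓝 L) := by
  have hs' : 0 < s - 1 := by linarith
  have : (𝓝[Iic (ucoord M e Us)] u).NeBot :=
    mem_closure_iff_nhdsWithin_neBot.mp (subset_closure hu)
  have hlim := exists_tendsto_prod_atTop
    (f := fun u v => primB (primA a₀ n) (Ucoord M e u) v) (s := Iic (ucoord M e Us))
    (G := fun v => Real.exp W.l / (s - 1) * v ^ (1 - s)) (fun v _ => Continuous.continuousOn ?_)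
    ?_ (fun u hu v hv v' hvv => ?_) hu
  · obtain ⟨L, hL⟩ := hlim
    refine ⟨L, le_of_tendsto ((continuous_fst.tendsto L).comp hL).abs ?_, hL⟩
    have hev : ∀ᶠ x in 𝓝[Iic (ucoord M e Us)] u, x ∈ Iic (ucoord M e Us) := self_mem_nhdsWithin
    filter_upwards [hev.prod_mk (eventually_ge_atTop (1 : ℝ))] with p hp
    exact (abs_fst_le _).trans ((D.within _ (Ucoord_mem h0 h1 hUs hp.1) _ hp.2).1.trans
      ((one_mul _).trans_le (D.Ψ_le _ (Ucoord_mem h0 h1 hUs hp.1) _ hp.2)))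
  · have cU : Continuous (Ucoord M e) := continuous_iff_continuousAt.mpr fun u =>
      ((Ucoord_spec h0 h1).1 u).continuousAt
    exact (continuous_primB (continuous_primA D.cont_a₀ D.cont_n)).comp
      (cU.prodMk continuous_const)
  · have := (tendsto_rpow_neg_atTop hs').const_mul (Real.exp W.l / (s - 1))
    rwa [mul_zero, neg_sub] at this
  · refine norm_sub_le_of_deriv_le_rpow hs hv hvv (Real.exp_pos _).le
      (fun y => hasDerivAt_primB_primA D.cont_a₀ D.cont_n _ y) fun y hy => ?_
    have hU := Ucoord_mem h0 h1 hUs hu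
    have := (hp _ hU y hy).Bv_le_exp
    rw [hW] at this
    exact (D.within _ hU y hy).2.2.trans ((one_mul _).trans_le this)

/-- The factor e^{κ₋v} is split into e^{-κ₋u} and e^{κ₋(u+v)}, so that the Reissner–Nordström part
depends on u + v alone; the last factor is an exponential, hence positive in the limit. -/
lemma OmegaCH_solution (ψ : ℝ → ℝ → ℝ × ℝ × ℝ) (u v : ℝ) :
    OmegaCH M e ((solution M e d ψ).toUV M e).Ω u v = Real.exp (-(kappaMinus M e * u))
      * (Real.exp (kappaMinus M e * (u + v)) * OmegaRN M e 0 (u + v))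
      * Real.exp (ψ (Ucoord M e u) v).2.2 := by
  have e1 : OmegaRN M e 0 (u + v) = OmegaRN M e u v := by
    unfold OmegaRN; rw [rRN_add u v, rRN_add 0, zero_add]
  rw [e1, ← Real.exp_log (OmegaRN_pos h0 h1 u v), log_OmegaRN h0 h1]
  simp only [OmegaCH, Fields.toUV, solution, ← Real.exp_add]
  congr 1
  ring

lemma IsDeviation.extendsToCauchyHorizon (hs : 1 < s) (hU₀ : 0 < U₀) (hUs : 0 < Us)
    (hUs' : Us ≤ U₀) (hW : W.s = s) (hp : ∀ U ∈ Icc 0 Us, ∀ v ∈ Ici (1 : ℝ), W.Point U v)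
    (h : IsEventHorizonData M e s E U₀ d) (D : IsDeviation M e U₀ Us d W a₀ n) :
    ExtendsToCauchyHorizon M e (ucoord M e Us)
      ((solution M e d (primB (primA a₀ n))).toUV M e) := by
  have hm := rMinus_pos h0 h1
  have sol := (D.solves h0 h1 hU₀ hUs hUs' h).1
  have cU : Continuous (Ucoord M e) := continuous_iff_continuousAt.mpr fun u =>
    ((Ucoord_spec h0 h1).1 u).continuousAt
  have cp : ContinuousOn (fun p : ℝ × ℝ => (Ucoord M e p.1, p.2))
      (Iic (ucoord M e Us) ×ˢ Ici 1) := by fun_prop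
  have mp : MapsTo (fun p : ℝ × ℝ => (Ucoord M e p.1, p.2)) (Iic (ucoord M e Us) ×ˢ Ici 1)
      (Icc 0 Us ×ˢ Ici 1) := fun p hp => ⟨Ucoord_mem h0 h1 hUs hp.1, hp.2⟩
  have lim : ∀ u, u ≤ ucoord M e Us → ∃ L : ℝ × ℝ × ℝ, |L.1| ≤ rMinus M e / 4 ∧
      Tendsto (fun p : ℝ × ℝ => primB (primA a₀ n) (Ucoord M e p.1) p.2)
        (𝓝[Iic (ucoord M e Us)] u ×ˢ atTop) (𝓝 L) := fun u hu =>
    D.exists_tendsto h0 h1 hs hUs hW hp hu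
  choose! L hL1 hL2 using lim
  obtain ⟨K, hK, hKlim⟩ := exists_tendsto_exp_mul_OmegaRN h0 h1
  have sum : ∀ u, Tendsto (fun p : ℝ × ℝ => p.1 + p.2) (𝓝[Iic (ucoord M e Us)] u ×ˢ atTop)
      atTop := fun u => ((tendsto_nhdsWithin_of_tendsto_nhds tendsto_id).comp tendsto_fst).add_atTop
        tendsto_snd
  have hrX := exists_isContExtension h0 h1 (us := ucoord M e Us)
    (f := ((solution M e d (primB (primA a₀ n))).toUV M e).r)
    (L := fun u => rPlus M e + rMinus M e - rPlus M e + (L u).1)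
    (sol.r_reg.continuousOn.comp cp mp) (fun u hu => ?_)
  · obtain ⟨rX, hr, hr1⟩ := hrX
    have hφX := exists_isContExtension h0 h1 (us := ucoord M e Us)
      (f := ((solution M e d (primB (primA a₀ n))).toUV M e).φ)
      (L := fun u => 0 + (L u).2.1)
      (sol.φ_reg.continuousOn.comp cp mp) (fun u hu => ?_)
    · obtain ⟨φX, hφ, -⟩ := hφX
      have hΩX := exists_isContExtension h0 h1 (us := ucoord M e Us)
        (f := OmegaCH M e ((solution M e d (primB (primA a₀ n))).toUV M e).Ω)
        (L := fun u => Real.exp (-(kappaMinus M e * u)) * K * Real.exp (L u).2.2)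
        ?_ (fun u hu => ?_)
      · obtain ⟨ΩX, hΩ, hΩ1⟩ := hΩX
        refine ⟨rX, φX, ΩX, hr, hφ, hΩ, fun u hu => ⟨?_, ?_⟩⟩
        · rw [hr1 u hu]
          -- The limit of r is r₋ plus the first component of the limit of ψ, which is at most r₋/4
          -- in modulus.
          linarith [(abs_le.mp (hL1 u hu)).1]
        · rw [hΩ1 u hu]
          positivity
      · exact (by fun_prop : Continuous fun p : ℝ × ℝ =>
          Real.exp (kappaMinus M e * p.2)).continuousOn.mul
          ((by fun_prop : Continuous fun p : ℝ × ℝ => Real.exp (kappaPlus M e * p.1)).continuousOn.mul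
            (sol.Ω_reg.continuousOn.comp cp mp))
      · simp only [OmegaCH_solution h0 h1]
        refine Tendsto.mul (Tendsto.mul ?_ (hKlim.comp (sum u))) ?_
        · have : Tendsto (fun x => Real.exp (-(kappaMinus M e * x))) (𝓝[Iic (ucoord M e Us)] u)
              (𝓝 (Real.exp (-(kappaMinus M e * u)))) :=
            ((by fun_prop : Continuous fun x => Real.exp (-(kappaMinus M e * x))).tendsto u).mono_left
              nhdsWithin_le_nhds
          exact this.comp tendsto_fst
        · exact ((Real.continuous_exp.comp (continuous_snd.comp continuous_snd)).tendsto
            (L u)).comp (hL2 u hu)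
    · refine Tendsto.add ?_ (((continuous_fst.comp continuous_snd).tendsto (L u)).comp (hL2 u hu))
      have : Tendsto d.φOut atTop (𝓝 0) := by
        refine squeeze_zero_norm' ((eventually_ge_atTop 1).mono fun v hv => h.abs_φOut_le hv) ?_
        have := (tendsto_rpow_neg_atTop (by linarith : 0 < s)).const_mul E
        rwa [mul_zero] at this
      exact this.comp tendsto_snd
  · refine Tendsto.add (Tendsto.sub_const (Tendsto.add ?_ ?_) _)
      ((continuous_fst.tendsto (L u)).comp (hL2 u hu))
    · exact (show Tendsto d.rOut atTop (𝓝 (rPlus M e)) from h.r_lim).comp tendsto_snd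
    · refine ((tendsto_rRN h0 h1).comp (sum u)).congr fun p => ?_
      rw [rB_Ucoord h0 h1, rRN_add p.1 p.2]
      rfl

end Extension

/-! ### Estimates in the `(u, v)` coordinates -/

section Estimates

variable {M e s E U₀ Us : ℝ} {d : CharData} {W : Weight} {a₀ : ℝ → ℝ × ℝ × ℝ}
  {n : ℝ → ℝ → ℝ × ℝ × ℝ} (h0 : 0 < |e|) (h1 : |e| < M)

include h0 h1

lemma rDiff_solution (ψ : ℝ → ℝ → ℝ × ℝ × ℝ) (u v : ℝ) :
    rDiff M e ((solution M e d ψ).toUV M e) u v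
      = d.rOut v - rPlus M e + (ψ (Ucoord M e u) v).1 := by
  simp only [rDiff, Fields.toUV, solution, rB_Ucoord h0 h1]
  ring

lemma logOmegaDiff_solution (ψ : ℝ → ℝ → ℝ × ℝ × ℝ) (u v : ℝ) :
    logOmegaDiff M e ((solution M e d ψ).toUV M e) u v = (ψ (Ucoord M e u) v).2.2 := by
  simp only [logOmegaDiff, Fields.toUV, solution, log_OmegaRN h0 h1]
  rw [Real.log_mul (Real.exp_pos _).ne' (Real.exp_pos _).ne', Real.log_exp, Real.log_exp]
  ring

/-- cU = e^{cu} ≤ e^{-c} means u ≤ −1. -/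
lemma neg_of_le_ucoord (hUs : 0 < Us) (hcU : cc M e * Us ≤ Real.exp (-cc M e)) {u : ℝ}
    (hu : u ≤ ucoord M e Us) : u < 0 := by
  have hc := cc_pos h0 h1
  have k := (Ucoord_mem h0 h1 hUs hu).2
  have k2 : Real.exp (cc M e * u) ≤ Real.exp (-cc M e) := by
    rw [← cc_mul_Ucoord h0 h1]
    exact (by gcongr : cc M e * Ucoord M e u ≤ cc M e * Us).trans hcU
  have := Real.exp_le_exp.mp k2
  nlinarith

lemma IsDeviation.pv_eq (h : IsEventHorizonData M e s E U₀ d)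
    (D : IsDeviation M e U₀ Us d W a₀ n) (u : ℝ) {v : ℝ} (hv : v ∈ Ici (1 : ℝ)) :
    pv (Ici 1) ((solution M e d (primB (primA a₀ n))).toUV M e).φ u v
      = d.φOutV v + (primB n (Ucoord M e u) v).2.1 ∧
    pv (Ici 1) (rDiff M e ((solution M e d (primB (primA a₀ n))).toUV M e)) u v
      = d.rOutV v + (primB n (Ucoord M e u) v).1 ∧
    pv (Ici 1) (logOmegaDiff M e ((solution M e d (primB (primA a₀ n))).toUV M e)) u v
      = (primB n (Ucoord M e u) v).2.2 := by
  obtain ⟨k1, k2, k3⟩ := hasDerivAt_components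
    (hasDerivAt_primB_primA D.cont_a₀ D.cont_n (Ucoord M e u) v)
  have hu := (isInterval_Ici 1).uniqueDiff v hv
  refine ⟨?_, ?_, ?_⟩
  · exact ((h.hasDerivWithinAt_φOut hv).add k2.hasDerivWithinAt).derivWithin hu
  · simp only [pv, rDiff_solution h0 h1]
    exact (((h.hasDerivWithinAt_rOut hv).sub_const _).add k1.hasDerivWithinAt).derivWithin hu
  · simp only [pv, logOmegaDiff_solution h0 h1]
    exact k3.hasDerivWithinAt.derivWithin hu

/-- The horizon data drop out of ∂_u, and only ψ is differentiated, with dU/du = e^{cu}. -/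
lemma IsDeviation.pu_eq (D : IsDeviation M e U₀ Us d W a₀ n) (u v : ℝ) :
    pu univ ((solution M e d (primB (primA a₀ n))).toUV M e).φ u v
      = Real.exp (cc M e * u) * (primA a₀ n (Ucoord M e u) v).2.1 ∧
    pu univ (rDiff M e ((solution M e d (primB (primA a₀ n))).toUV M e)) u v
      = Real.exp (cc M e * u) * (primA a₀ n (Ucoord M e u) v).1 ∧
    pu univ (logOmegaDiff M e ((solution M e d (primB (primA a₀ n))).toUV M e)) u v
      = Real.exp (cc M e * u) * (primA a₀ n (Ucoord M e u) v).2.2 := by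
  have k : HasDerivAt (fun x => primB (primA a₀ n) (Ucoord M e x) v)
      (Real.exp (cc M e * u) • primA a₀ n (Ucoord M e u) v) u :=
    HasDerivAt.scomp u (hasDerivAt_primB (continuous_primA D.cont_a₀ D.cont_n) (Ucoord M e u) v)
      ((Ucoord_spec h0 h1).1 u)
  obtain ⟨k1, k2, k3⟩ := hasDerivAt_components k
  refine ⟨?_, ?_, ?_⟩
  · simp only [pu, derivWithin_univ]
    exact (k2.const_add _).deriv
  · simp only [pu, derivWithin_univ, rDiff_solution h0 h1]
    exact (k1.const_add _).deriv
  · simp only [pu, derivWithin_univ, logOmegaDiff_solution h0 h1]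
    exact k3.deriv

/-- The constant in the estimates of the fields and their derivatives along `∂_v`. -/
def fieldConst (M e s E a l : ℝ) : ℝ :=
  2 * horizonConst M e E + 3 * |a| * Real.exp l * (1 + 1 / cc M e + 1 / (s - 1))
    + 3 * Real.exp l

lemma fieldConst_pos (hs : 1 < s) (hE : 0 < E) (a l : ℝ) : 0 < fieldConst M e s E a l := by
  have hH : 0 < horizonConst M e E := hE.trans_le (IsEventHorizonData.E_le_horizonConst h0 h1 hE)
  have := cc_pos h0 h1
  have : 0 < s - 1 := by linarith
  unfold fieldConst
  positivity

lemma IsDeviation.abs_fields_le (hs : 1 < s) (hE : 0 < E) (hUs : 0 < Us)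
    (hcU : cc M e * Us ≤ Real.exp (-cc M e)) (hWc : W.c = cc M e) (hWs : W.s = s)
    (hp : ∀ U ∈ Icc 0 Us, ∀ v ∈ Ici (1 : ℝ), W.Point U v)
    (h : IsEventHorizonData M e s E U₀ d) (D : IsDeviation M e U₀ Us d W a₀ n) {u v : ℝ}
    (hu : u ≤ ucoord M e Us) (hv : v ∈ Ici (1 : ℝ)) :
    |((solution M e d (primB (primA a₀ n))).toUV M e).φ u v|
        + |rDiff M e ((solution M e d (primB (primA a₀ n))).toUV M e) u v|
        + |logOmegaDiff M e ((solution M e d (primB (primA a₀ n))).toUV M e) u v|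
      ≤ fieldConst M e s E W.a W.l * (v ^ (-s) + |u| ^ (-s + 1)) := by
  have hU := Ucoord_mem h0 h1 hUs hu
  have hpt := hp _ hU v hv
  have hu0 := neg_of_le_ucoord h0 h1 hUs hcU hu
  have hψ := (D.within _ hU v hv).1
  rw [one_mul] at hψ
  have a1 := (abs_fst_le _).trans hψ
  have a2 := (abs_snd_fst_le _).trans hψ
  have a3 := (abs_snd_snd_le _).trans hψ
  have b1 := h.abs_φOut_le hv
  have b2 := h.abs_rOut_sub_le h0 h1 hs hE hv
  have hEH := IsEventHorizonData.E_le_horizonConst h0 h1 hE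
  have hvs := hpt.vs_pos
  have hΨ := hpt.Ψ_le
  have ha := hpt.good.a_pos
  have hP : W.P (Ucoord M e u) v
      ≤ (1 + 1 / cc M e + 1 / (s - 1)) * (v ^ (-s) + |u| ^ (-s + 1)) := by
    have e1 : Ucoord M e u = Real.exp (W.c * u) / W.c := by rw [hWc, Ucoord_eq]
    rw [e1] at hpt
    have := hpt.P_uv_le hu0
    rwa [← e1, hWc, hWs] at this
  rw [hWs] at hvs
  have hus : 0 ≤ |u| ^ (-s + 1) := by positivity
  have hH := hE.trans_le hEH
  have k1 : W.Ψ (Ucoord M e u) v ≤ W.a * Real.exp W.l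
      * ((1 + 1 / cc M e + 1 / (s - 1)) * (v ^ (-s) + |u| ^ (-s + 1))) := hΨ.trans (by gcongr)
  have k2 : E * v ^ (-s) ≤ horizonConst M e E * (v ^ (-s) + |u| ^ (-s + 1)) := by
    gcongr; linarith
  have k3 : horizonConst M e E * v ^ (-s)
      ≤ horizonConst M e E * (v ^ (-s) + |u| ^ (-s + 1)) := by gcongr; linarith
  have k4 : 0 ≤ 3 * Real.exp W.l * (v ^ (-s) + |u| ^ (-s + 1)) := by positivity
  rw [rDiff_solution h0 h1, logOmegaDiff_solution h0 h1]
  have c1 : |((solution M e d (primB (primA a₀ n))).toUV M e).φ u v| ≤ _ :=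
    abs_add_le (d.φOut v) (primB (primA a₀ n) (Ucoord M e u) v).2.1
  have c2 := abs_add_le (d.rOut v - rPlus M e) (primB (primA a₀ n) (Ucoord M e u) v).1
  unfold fieldConst
  rw [abs_of_pos ha]
  generalize v ^ (-s) + |u| ^ (-s + 1) = X at *
  linarith

lemma IsDeviation.abs_pv_le (hs : 1 < s) (hE : 0 < E) (hUs : 0 < Us) (hWs : W.s = s)
    (hp : ∀ U ∈ Icc 0 Us, ∀ v ∈ Ici (1 : ℝ), W.Point U v)
    (h : IsEventHorizonData M e s E U₀ d) (D : IsDeviation M e U₀ Us d W a₀ n) {u v : ℝ}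
    (hu : u ≤ ucoord M e Us) (hv : v ∈ Ici (1 : ℝ)) :
    |pv (Ici 1) ((solution M e d (primB (primA a₀ n))).toUV M e).φ u v|
        + |pv (Ici 1) (rDiff M e ((solution M e d (primB (primA a₀ n))).toUV M e)) u v|
        + |pv (Ici 1) (logOmegaDiff M e ((solution M e d (primB (primA a₀ n))).toUV M e)) u v|
      ≤ fieldConst M e s E W.a W.l * v ^ (-s) := by
  have hU := Ucoord_mem h0 h1 hUs hu
  have hpt := hp _ hU v hv
  obtain ⟨e1, e2, e3⟩ := D.pv_eq h0 h1 h u hv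
  rw [e1, e2, e3]
  have hb := (D.within _ hU v hv).2.2
  rw [one_mul] at hb
  have a1 := (abs_fst_le _).trans hb
  have a2 := (abs_snd_fst_le _).trans hb
  have a3 := (abs_snd_snd_le _).trans hb
  have b1 := h.abs_φOutV_le hv
  have b2 := h.abs_rOutV_le h0 h1 hs hE hv
  have hEH := IsEventHorizonData.E_le_horizonConst h0 h1 hE
  have hvs := hpt.vs_pos
  have hB := hpt.Bv_le_exp
  rw [hWs] at hvs hB
  have k2 : E * v ^ (-s) ≤ horizonConst M e E * v ^ (-s) := by gcongr
  have k4 : 0 ≤ 3 * |W.a| * Real.exp W.l * (1 + 1 / cc M e + 1 / (s - 1)) * v ^ (-s) := by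
    have := cc_pos h0 h1
    have : 0 < s - 1 := by linarith
    positivity
  have c1 := abs_add_le (d.φOutV v) (primB n (Ucoord M e u) v).2.1
  have c2 := abs_add_le (d.rOutV v) (primB n (Ucoord M e u) v).1
  unfold fieldConst
  linarith

/-- The constant in the estimates of the derivatives along `∂_u`, in the two regions. -/
lemma exists_abs_pu_le (hs : 1 < s) (W : Weight) (hWc : W.c = cc M e) (hWs : W.s = s)
    (hUs : 0 < Us) (hcU : cc M e * Us ≤ Real.exp (-cc M e))
    (hp : ∀ U ∈ Icc 0 Us, ∀ v ∈ Ici (1 : ℝ), W.Point U v) (A : ℝ) :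
    ∃ K > 0, ∀ d a₀ n, IsDeviation M e U₀ Us d W a₀ n → ∀ u v, u ≤ ucoord M e Us →
      v ∈ Ici (1 : ℝ) →
      (u + v ≤ A → |pu univ ((solution M e d (primB (primA a₀ n))).toUV M e).φ u v|
        + |pu univ (rDiff M e ((solution M e d (primB (primA a₀ n))).toUV M e)) u v|
        + |pu univ (logOmegaDiff M e ((solution M e d (primB (primA a₀ n))).toUV M e)) u v|
          ≤ K * OmegaRN M e u v ^ 2 * v ^ (-s)) ∧
      (A ≤ u + v → |pu univ ((solution M e d (primB (primA a₀ n))).toUV M e).φ u v|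
        + |pu univ (rDiff M e ((solution M e d (primB (primA a₀ n))).toUV M e)) u v|
        + |pu univ (logOmegaDiff M e ((solution M e d (primB (primA a₀ n))).toUV M e)) u v|
          ≤ K * |u| ^ (-s)) := by
  have hc := cc_pos h0 h1
  obtain ⟨m, hm, hmΩ⟩ := exists_le_OmegaRN_sq h0 h1 A
  have hgood := (hp 0 (left_mem_Icc.mpr hUs.le) 1 self_mem_Ici).good
  have ha := hgood.a_pos
  have hB := hgood.B_pos
  have hs0 : 0 < s := by linarith
  -- K₁ and K₂ belong to the regions u + v ≤ A and u + v ≥ A. They contain B, and through it U₀.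
  obtain ⟨K₁, hK₁⟩ : ∃ x, x = (1 + Real.log (1 + Real.exp (cc M e * A)) / cc M e) ^ s
    + cc M e * W.B * (s / cc M e) ^ s := ⟨_, rfl⟩
  obtain ⟨K₂, hK₂⟩ : ∃ x, x = (1 + Real.log (1 + Real.exp (-(cc M e * A))) / cc M e) ^ s
    + cc M e * W.B * (s / cc M e) ^ s := ⟨_, rfl⟩
  have hlog : ∀ x, 0 ≤ Real.log (1 + Real.exp x) := fun x =>
    Real.log_nonneg (by linarith [Real.exp_pos x])
  have hK₁0 : 0 < K₁ := by
    have := hlog (cc M e * A)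
    rw [hK₁]; positivity
  have hK₂0 : 0 < K₂ := by
    have := hlog (-(cc M e * A))
    rw [hK₂]; positivity
  refine ⟨3 * (W.a * Real.exp W.l) * (K₁ / m + K₂), by positivity,
    fun d a₀ n D u v hu hv => ?_⟩
  have hU := Ucoord_mem h0 h1 hUs hu
  have hpt := hp _ hU v hv
  have hu0 := neg_of_le_ucoord h0 h1 hUs hcU hu
  have hA := (D.within _ hU v hv).2.1
  rw [one_mul] at hA
  have hx := Real.exp_pos (cc M e * u)
  have main : |pu univ ((solution M e d (primB (primA a₀ n))).toUV M e).φ u v|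
        + |pu univ (rDiff M e ((solution M e d (primB (primA a₀ n))).toUV M e)) u v|
        + |pu univ (logOmegaDiff M e ((solution M e d (primB (primA a₀ n))).toUV M e)) u v|
      ≤ 3 * (W.a * Real.exp W.l)
        * (Real.exp (cc M e * u) * W.p (Ucoord M e u) v) := by
    obtain ⟨e1, e2, e3⟩ := D.pu_eq h0 h1 u v
    rw [e1, e2, e3, abs_mul, abs_mul, abs_mul, abs_of_pos hx]
    have b := hA.trans hpt.A_le
    have a1 := mul_le_mul_of_nonneg_left ((abs_fst_le _).trans b) hx.le
    have a2 := mul_le_mul_of_nonneg_left ((abs_snd_fst_le _).trans b) hx.le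
    have a3 := mul_le_mul_of_nonneg_left ((abs_snd_snd_le _).trans b) hx.le
    linarith
  have hvs := hpt.vs_pos
  rw [hWs] at hvs
  have e1 : Ucoord M e u = Real.exp (W.c * u) / W.c := by rw [hWc, Ucoord_eq]
  rw [e1] at hpt
  have hus : 0 < |u| ^ (-s) := Real.rpow_pos_of_pos (abs_pos.mpr hu0.ne) _
  have hl := Real.exp_pos W.l
  refine ⟨fun huv => main.trans ?_, fun huv => main.trans ?_⟩
  · have k := hpt.cU_p_le_of_le huv
    rw [← e1, hWc, hWs, ← hK₁] at k
    have k2 : Real.exp (cc M e * (u + v)) ≤ OmegaRN M e u v ^ 2 / m := by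
      rw [le_div_iff₀ hm, mul_comm]; exact hmΩ u v huv
    have hΩ := OmegaRN_pos h0 h1 u v
    rw [mul_assoc (3 * _), mul_assoc (3 * _)]
    refine mul_le_mul_of_nonneg_left ?_ (by positivity)
    calc _ ≤ K₁ * (Real.exp (cc M e * (u + v)) * v ^ (-s)) := k
      _ ≤ K₁ * (OmegaRN M e u v ^ 2 / m * v ^ (-s)) := by gcongr
      _ = K₁ / m * (OmegaRN M e u v ^ 2 * v ^ (-s)) := by ring
      _ ≤ (K₁ / m + K₂) * (OmegaRN M e u v ^ 2 * v ^ (-s)) := by gcongr; linarith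
      _ = _ := by ring
  · have k := hpt.cU_p_le_of_ge huv hu0
    rw [← e1, hWc, hWs, ← hK₂] at k
    rw [mul_assoc (3 * _)]
    refine mul_le_mul_of_nonneg_left (k.trans ?_) (by positivity)
    have : 0 < K₁ / m := by positivity
    gcongr
    linarith

end Estimates

end EMSF

end

theorem theorem5p1 (M e s E : ℝ) (he : 0 < |e|) (heM : |e| < M) (hs : 1 < s) (hE : 0 < E) :
    ∃ C > 0, ∀ U₀ > 0, ∃ (C' : ℝ → ℝ) (Us : ℝ), (∀ A, 0 < C' A) ∧ 0 < Us ∧ Us ≤ U₀ ∧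
      ∀ d : EMSF.CharData, EMSF.IsEventHorizonData M e s E U₀ d →
        ∃ S T : EMSF.Fields, T = S.toUV M e ∧
          EMSF.IsMaximalDevelopment e d (Set.Icc 0 Us) (Set.Ici 1) 0 1
            (Set.Icc 0 Us ×ˢ Set.Ici 1) S ∧
          EMSF.SolvesRaychaudhuri (Set.Icc 0 Us) (Set.Ici 1) (Set.Icc 0 Us ×ˢ Set.Ici 1) S ∧
          EMSF.ExtendsToCauchyHorizon M e (EMSF.ucoord M e Us) T ∧
          ∀ u v : ℝ, u < EMSF.ucoord M e Us → 1 ≤ v →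
            (|T.φ u v| + |EMSF.rDiff M e T u v| + |EMSF.logOmegaDiff M e T u v|
              ≤ C * (v ^ (-s) + |u| ^ (-s + 1))) ∧
            (|EMSF.pv (Set.Ici 1) T.φ u v| + |EMSF.pv (Set.Ici 1) (EMSF.rDiff M e T) u v|
                + |EMSF.pv (Set.Ici 1) (EMSF.logOmegaDiff M e T) u v|
              ≤ C * v ^ (-s)) ∧
            ∀ A : ℝ,
              (u + v ≤ A →
                |EMSF.pu Set.univ T.φ u v| + |EMSF.pu Set.univ (EMSF.rDiff M e T) u v|
                    + |EMSF.pu Set.univ (EMSF.logOmegaDiff M e T) u v|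
                  ≤ C' A * EMSF.OmegaRN M e u v ^ 2 * v ^ (-s)) ∧
              (A ≤ u + v →
                |EMSF.pu Set.univ T.φ u v| + |EMSF.pu Set.univ (EMSF.rDiff M e T) u v|
                    + |EMSF.pu Set.univ (EMSF.logOmegaDiff M e T) u v|
                  ≤ C' A * |u| ^ (-s)) := by

  -- a and l are available before U₀ is given, and the first constant involves no other weight
  -- parameter; this makes it independent of U₀.
  obtain ⟨v₀, a, l, hdev⟩ := EMSF.exists_deviation he heM hs hE
  refine ⟨EMSF.fieldConst M e s E a l, EMSF.fieldConst_pos he heM hs hE a l, fun U₀ hU₀ => ?_⟩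
  obtain ⟨L, B, Us, hUs, hUs', hcU, hp, hd⟩ := hdev U₀ hU₀
  -- Us is already fixed, so the estimates for all A hold on one and the same region.
  choose C' hC' hpu using fun A =>
    EMSF.exists_abs_pu_le (U₀ := U₀) he heM hs _ rfl rfl hUs hcU hp A
  refine ⟨C', Us, hC', hUs, hUs', fun d h => ?_⟩
  obtain ⟨a₀, n, D⟩ := hd d h
  refine ⟨_, _, rfl, D.isMaximalDevelopment he heM hU₀ hUs hUs' h,
    (D.solves he heM hU₀ hUs hUs' h).2,
    D.extendsToCauchyHorizon he heM hs hU₀ hUs hUs' rfl hp h, fun u v hu hv => ⟨?_, ?_, ?_⟩⟩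
  · exact D.abs_fields_le he heM hs hE hUs hcU rfl rfl hp h hu.le hv
  · exact D.abs_pv_le he heM hs hE hUs rfl hp h hu.le hv
  · exact fun A => hpu A d a₀ n D u v hu.le hv
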